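/- Let $\alpha,\beta,\gamma,n\in\mathbb C$, put $\kappa=\alpha+\beta+\gamma+2n+1$, and assume $\alpha,\beta,\gamma,\kappa\neq0$. Let $B=\mathbb C\setminus\{0,1\}$ with coordinate $t$, and $$(a_0,a_1,a_2,a_3,a_4)=(-\gamma,\ \kappa,\ -n-\alpha,\ -\beta,\ \alpha),$$ so that $a_0+a_1+2a_2+a_3+a_4=1$. When a point $(x,y)=(a,b)$ is blown up, $(u,v)$ and $(U,V)$ denote the charts with blow up map $(x,y)=(a+uv,b+v)=(a+V,b+UV)$; they carry the index of the point. All constructions are families over $t\in B$; $d_t$ is the exterior derivative on the fibres, $d$ that on the total space. **The systems.** The KNY form of Painlevé VI (with its denominators cleared) is $$f'=\frac{2(f-1)(f-t)g-(a_0-1)f(f-1)-a_3f(f-t)-a_4(f-1)(f-t)}{t(t-1)},\qquad g'=-\frac{f^2(g+a_2)(g+a_1+a_2)-tg(g-a_4)}{t(t-1)f}.\tag{K}$$ The system in the first parametrisation is $$\tilde x'=\tilde y,\qquad \tilde y'=\frac{\phi(\tilde x,\tilde y;t)}{2(t-1)^2t^2\tilde x(\kappa-\tilde x)(\kappa+(t-1)\tilde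 x)},\tag{S1}$$ $$\begin{aligned}\phi=&-(t-1)\tilde x^4\big(6\kappa^2-\beta^2+4n(t^2-6t)(\kappa-n)+t^2(\alpha+\beta+1)(\alpha+\beta+2\gamma+1)\\&\quad-t(2\alpha(\kappa-2n)+2\beta(\gamma+1)+2\gamma+5(\kappa-2n)^2)\big)\\ &-\tilde x^2\big(\kappa^2(-\kappa^2+6\beta^2+4nt(\kappa-n)+t^2(\beta^2-\alpha^2+1)+t(2\alpha(\kappa-2n)-5\beta^2+2\beta(\gamma+1)+2\gamma))\\&\quad+3t^2(t-1)^3\tilde y^2+2\kappa t(t^3-5t^2+6t-2)\tilde y\big)\\ &+2(t-1)\tilde x^3\big((t-1)^2t\tilde y-2\kappa(\beta^2-\kappa^2+2nt(\beta+\gamma+n)+\beta\gamma t+(\kappa-1)(\alpha+1)t)\big)\\ &-2\kappa\tilde x\big(-(t-2)(t-1)^2t^2\tilde y^2+\kappa t(2t^2-3t+1)\tilde y+\beta^2\kappa^2(t-2)\big)\\ &-\kappa^2(\beta^2\kappa^2-(t-1)^2t^2\tilde y^2)-(t-1)^3\tilde x^6+2\kappa(t-2)(t-1)^2\tilde x^5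 .\end{aligned}$$ The system in the second parametrisation is $$\xi_0'=\frac{\upsilon_0\big(((t-1)\xi_0+\kappa)(\xi_0-\beta)-t\xi_0(\alpha+1)\big)+2}{(t-1)t\upsilon_0},\qquad \upsilon_0'=-\frac{\eta(\xi_0,\upsilon_0;t)}{(t-1)t\,\xi_0(\kappa-\xi_0)(\kappa+(t-1)\xi_0)},\tag{S2}$$ $$\begin{aligned}\eta(x,v;t)=&\ \kappa^2-ntv^2x^2(\gamma+n)(\kappa+(t-1)x)^2+2\kappa(t-2)x-3(t-1)x^2\\ &+v\Big(x\big(x\big((t-1)x(-2(\kappa+\beta)+t(2\alpha+2\beta+1)-(t-1)x)-\kappa(5\beta+\kappa+t(\alpha(t-2)+\beta(t-6)-1))\big)-2\beta\kappa^2(t-2)\big)-\beta\kappa^3\Big).\end{aligned}$$ **The spaces.** * $E^{\rm KNY}$: in $\mathbb P^1\times\mathbb P^1$ with affine coordinates $(f,g)$, $F=1/f$, $G=1/g$, blow up $b_1:(F,g)=(0,-a_2)$, $b_2:(F,g)=(0,-a_1-a_2)$, $b_3:(f,G)=(t,0)$, $b_5:(f,g)=(0,0)$, $b_6:(f,g)=(0,a_4)$,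 $b_7:(f,G)=(1,0)$, then $b_4:(u_3,v_3)=(ta_0,0)$ and $b_8:(u_7,v_7)=(a_3,0)$, and remove the proper transforms of $\{f=0\}$, $\{f=\infty\}$, $\{g=\infty\}$ and of the exceptional lines over $b_3$ and $b_7$. * $E_1$ (first parametrisation): in $\mathbb P^1\times\mathbb P^1$ with affine coordinates $(\tilde x,\tilde y)$ blow up $p_{1,2}=\big(0,\mp\tfrac{\beta\kappa}{t(t-1)}\big)$, $p_{3,4}=\big(\tfrac{\kappa}{1-t},\tfrac{(1\mp\alpha)\kappa}{(t-1)^2}\big)$, $p_{5,6}=\big(\kappa,\mp\tfrac{\gamma\kappa}{t-1}\big)$, $p_7:(1/\tilde x,1/\tilde y)=(0,0)$, then $p_8:(U_7,V_7)=(0,0)$, then $p_{9,10}:(u_8,v_8)=(\mp t,0)$, and remove the proper transforms of $\{\tilde x=0\}$, $\{\tilde x=\kappa\}$, $\{\tilde x=\frac{\kappa}{1-t}\}$, $\{\tilde x=\infty\}$, $\{\tilde y=\infty\}$ and of the exceptional lines over $p_7$ and $p_8$. * $E_2$ (second parametrisation): in the Hirzebruch surface $\mathbb F_1$ with charts $(\xi_0,\upsilon_0)$,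 $(\xi_1,\upsilon_1)=(\frac1{\xi_0},\xi_0\upsilon_0)$, $(\xi_2,\upsilon_2)=(\frac1{\xi_0},\frac1{\xi_0\upsilon_0})$, $(\xi_3,\upsilon_3)=(\xi_0,\frac1{\upsilon_0})$ blow up the points with $(\xi_3,\upsilon_3)$ equal to $(0,0)$, $(0,\kappa\beta)$, $(\kappa,-\kappa tn)$, $(\kappa,-\kappa t(\gamma+n))$, $(\frac{\kappa}{1-t},0)$, $(\frac{\kappa}{1-t},\frac{\kappa t\alpha}{1-t})$ and $\pi_7:(\xi_1,\upsilon_1)=(0,0)$, then $\pi_8:(u_7,v_7)=(1-t,0)$, and remove the proper transforms of $\{\xi_0=0\}$, $\{\xi_0=\kappa\}$, $\{\xi_0=\frac{\kappa}{1-t}\}$, of the section $\{\upsilon_0=0\}\cup\{\upsilon_1=0\}$ and of the exceptional line over $\pi_7$. **Definitions.** A *symplectic atlas* of such a space $E\to B$, with a holomorphic symplectic form $\omega_t$ on its fibres, is an atlas of holomorphic charts $(x_i,y_i;t)$ on open sets $U_i$ covering $E$, with $\omega_t=d_tx_i\wedge d_ty_i$ on $U_i$. A *global Hamiltonian structure*,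 with respect to this atlas, of a system on $E$ (a holomorphic vector field with $t$-component $1$) consists of holomorphic functions $H_i$ on the $U_i$ such that the system is $x_i'=\partial H_i/\partial y_i$, $y_i'=-\partial H_i/\partial x_i$ on $U_i$, and such that the forms $dx_i\wedge dy_i+dH_i\wedge dt$ on the $U_i$ are the restrictions of one holomorphic two-form $\Omega$ on $E$. **Statement.** 1. (Takano's atlas.) $E^{\rm KNY}$ has open subsets $U_0,\dots,U_5$ with coordinates $(x_i,y_i;t):U_i\to\mathbb C^2\times B$, each a biholomorphism onto $\mathbb C^2\times B$, given on $(f,g)$ with $f\ne0$ (and $g\neq0$ if $i\ge3$) by $$\begin{aligned}&(x_0,y_0)=\big(f,\tfrac gf\big),\quad (x_1,y_1)=\big(f(g+a_2),\tfrac1f\big),\quad (x_2,y_2)=\big(f(g+a_1+a_2),\tfrac1f\big),\\ &(x_3,y_3)=\Big(\tfrac{g(a_0f+tg-fg)}{f^2},\tfrac fg\Big),\quad (x_4,y_4)=\Big(\tfrac{g(a_4-g)}f,\tfrac fg\Big),\quad (x_5,y_5)=\Big(\tfrac{g(g+a_3f-fg)}{f^2},\tfrac fg\Big).\end{aligned}$$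 They are a symplectic atlas for a symplectic form $\omega_t^{\rm KNY}$ that equals $\frac{d_tf\wedge d_tg}{f}$ in the chart $(f,g)$. System (K) extends to $E^{\rm KNY}$ and has, with respect to this atlas, a global Hamiltonian structure $(H_i)$, with two-form $\Omega^{\rm KNY}$ and $$H_0=\frac{x_0(x_0-1)(x_0-t)y_0^2+a_2(a_1+a_2)x_0+\big((a_1+2a_2)x_0^2+t(a_3+a_4)x_0-(a_1+2a_2+a_3)x_0-ta_4\big)y_0}{t(t-1)}.$$ 2. (First parametrisation.) The map $$f=\frac{\kappa+(t-1)\tilde x}{\kappa},\qquad g=\frac{(t-1)(\alpha-\beta-\gamma-1)\tilde x^2-\kappa(1-\alpha+2\beta+\gamma+(\alpha-\beta-1)t)\tilde x+\kappa(\beta\kappa+(t-1)t\tilde y)}{2(t-1)(\tilde x-\kappa)\tilde x}$$ extends to an isomorphism $\Phi_1:E_1\to E^{\rm KNY}$ over $B$. The coordinates $x_i\circ\Phi_1,\ y_i\circ\Phi_1$ $(i=0,\dots,5)$ are a symplectic atlas of $E_1$ for $\omega_t=\Phi_1^*\omega_t^{\rm KNY}$, which equals $\dfrac{-\frac12\kappa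 t(t-1)\,d_t\tilde x\wedge d_t\tilde y}{\tilde x(\tilde x-\kappa)((1-t)\tilde x-\kappa)}$ in the chart $(\tilde x,\tilde y)$. System (S1) extends to $E_1$, corresponds to (K) under $\Phi_1$, and has, with respect to this atlas, the global Hamiltonian structure given by the same $H_i$ (as functions of the pulled back coordinates and $t$), with two-form $\Phi_1^*\Omega^{\rm KNY}$. 3. (Second parametrisation.) The map $$f=\frac{(t-1)\xi_0+\kappa}{\kappa},\qquad g=\frac{\kappa+\xi_0\upsilon_0\big((\alpha+n)((t-1)\xi_0+\kappa)-\alpha t\kappa\big)}{(t-1)\xi_0(\xi_0-\kappa)\upsilon_0}$$ extends to an isomorphism $\Phi_2:E_2\to E^{\rm KNY}$ over $B$. The coordinates $x_i\circ\Phi_2,\ y_i\circ\Phi_2$ are a symplectic atlas of $E_2$ for $\omega_t=\Phi_2^*\omega_t^{\rm KNY}$, which equals $\dfrac{\kappa\,d_t\xi_0\wedge d_t\upsilon_0}{\xi_0(\xi_0-\kappa)((1-t)\xi_0-\kappa)\upsilon_0^2}$ in the chart $(\xi_0,\upsilon_0)$. System (S2) extends to $E_2$, corresponds to (K) under $\Phi_2$,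 and has, with respect to this atlas, the global Hamiltonian structure given by the same $H_i$, with two-form $\Phi_2^*\Omega^{\rm KNY}$. -/

import Mathlib

open Set Filter Topology

noncomputable section

namespace PVI

/-! ## Families of complex surfaces over a `t`-domain, described by coordinate patches -/

/-- Coordinates `(x, y, t)`. -/
abbrev C3 := ℂ × ℂ × ℂ

/-- The independent variable space `B = ℂ ∖ {0, 1}`. -/
def B : Set ℂ := {t | t ≠ 0 ∧ t ≠ 1}

/-- A coordinate patch of `X`, given by its parametrisation: the point with coordinates `w` is
`par w`, for `w ∈ dom`. Values of `par` off `dom` are irrelevant. -/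
structure Patch (X : Type) where
  dom : Set C3
  par : C3 → X

/-- A family of surfaces over the `t`-line, with total space `carrier`, projection `base`, and a
given collection of coordinate patches. -/
structure Space where
  Pt : Type
  carrier : Set Pt
  base : Pt → ℂ
  Ix : Type
  chart : Ix → Patch Pt

/-- Near `w`, the map `Φ` is given by the holomorphic map `g` in the coordinates of the patches
`P` (source) and `Q` (target). For `Φ = id` this says that `g` is the change of coordinates. -/
def IsTransition {X Y : Type} (P : Patch X) (Q : Patch Y) (Φ : X → Y) (g : C3 → C3) (w : C3) :
    Prop :=
  AnalyticAt ℂ g w ∧ ∀ᶠ w' in 𝓝 w, w' ∈ P.dom ∧ g w' ∈ Q.dom ∧ Q.par (g w') = Φ (P.par w')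

/-- `Φ` is holomorphic in the coordinates of `P` and `Q`, wherever both see it. -/
def IsHolomorphicBetween {X Y : Type} (P : Patch X) (Q : Patch Y) (Φ : X → Y) : Prop :=
  ∀ w ∈ P.dom, ∀ z ∈ Q.dom, Φ (P.par w) = Q.par z → ∃ g, g w = z ∧ IsTransition P Q Φ g w

/-- `P` is a holomorphic coordinate chart `(x, y; t)` of `S`, compatible with all the given
coordinate patches of `S`. -/
structure Space.IsHolomorphicPatch (S : Space) (P : Patch S.Pt) : Prop where
  isOpen : IsOpen P.dom
  mapsTo : MapsTo P.par P.dom S.carrier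
  injOn : InjOn P.par P.dom
  base : ∀ w ∈ P.dom, S.base (P.par w) = w.2.2
  toChart : ∀ k, IsHolomorphicBetween P (S.chart k) id
  ofChart : ∀ k, IsHolomorphicBetween (S.chart k) P id

/-- `Φ` is an isomorphism of families over the `t`-line, with inverse `Ψ`. -/
structure IsBiholomorphism (S T : Space) (Φ : S.Pt → T.Pt) (Ψ : T.Pt → S.Pt) : Prop where
  mapsTo : MapsTo Φ S.carrier T.carrier
  mapsTo_symm : MapsTo Ψ T.carrier S.carrier
  left_inv : LeftInvOn Ψ Φ S.carrier
  right_inv : RightInvOn Ψ Φ T.carrier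
  base : ∀ p ∈ S.carrier, T.base (Φ p) = S.base p
  holomorphic : ∀ k l, IsHolomorphicBetween (S.chart k) (T.chart l) Φ
  holomorphic_symm : ∀ k l, IsHolomorphicBetween (T.chart k) (S.chart l) Ψ

/-- The patch of `X` whose coordinate functions are those of the patch `P` of `Y`, pulled back
under an isomorphism `X → Y` with inverse `Ψ`. -/
def Patch.pullback {X Y : Type} (P : Patch Y) (Ψ : Y → X) : Patch X := ⟨P.dom, Ψ ∘ P.par⟩

/-! ## Relative area forms, two-forms and systems of differential equations -/

/-- The Jacobian determinant in `(x, y)`, at constant `t`. -/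
def relJac (g : C3 → C3) (w : C3) : ℂ :=
  (fderiv ℂ g w (1, 0, 0)).1 * (fderiv ℂ g w (0, 1, 0)).2.1
    - (fderiv ℂ g w (0, 1, 0)).1 * (fderiv ℂ g w (1, 0, 0)).2.1

/-- The bilinear forms on `ℂ³`. -/
abbrev Bil := C3 →L[ℂ] C3 →L[ℂ] ℂ

/-- `F d_t x ∧ d_t y` on `P` is the pullback under `Φ` of `G d_t x ∧ d_t y` on `Q`, where `d_t`
is the exterior derivative on the fibres. -/
def IsAreaPullback {X Y : Type} (P : Patch X) (Q : Patch Y) (Φ : X → Y) (F G : C3 → ℂ) : Prop :=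
  ∀ w g, IsTransition P Q Φ g w → F w = G (g w) * relJac g w

/-- The two-form `F` on `P` is the pullback under `Φ` of the two-form `G` on `Q`. -/
def IsFormPullback {X Y : Type} (P : Patch X) (Q : Patch Y) (Φ : X → Y) (F G : C3 → Bil) : Prop :=
  ∀ w g, IsTransition P Q Φ g w →
    F w = (G (g w)).bilinearComp (fderiv ℂ g w) (fderiv ℂ g w)

/-- `Φ` carries the vector field `V` on `P` to the vector field `W` on `Q`. -/
def IsRelatedField {X Y : Type} (P : Patch X) (Q : Patch Y) (Φ : X → Y) (V W : C3 → C3) : Prop :=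
  ∀ w g, IsTransition P Q Φ g w → W (g w) = fderiv ℂ g w (V w)

/-- `ω_t`, written as `ω k d_t x ∧ d_t y` in the chart `k`, is a holomorphic symplectic form on
the fibres of `S`. -/
structure Space.IsSymplecticForm (S : Space) (ω : S.Ix → C3 → ℂ) : Prop where
  analytic : ∀ k, AnalyticOnNhd ℂ (ω k) (S.chart k).dom
  nondegenerate : ∀ k, ∀ z ∈ (S.chart k).dom, ω k z ≠ 0
  compatible : ∀ k l, IsAreaPullback (S.chart k) (S.chart l) id (ω k) (ω l)

/-- `Ω`, written as `Ω k` in the chart `k`, is a holomorphic two-form on the total space `S`. -/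
structure Space.IsTwoForm (S : Space) (Ω : S.Ix → C3 → Bil) : Prop where
  analytic : ∀ k, AnalyticOnNhd ℂ (Ω k) (S.chart k).dom
  alternating : ∀ k, ∀ z ∈ (S.chart k).dom, ∀ u, Ω k z u u = 0
  compatible : ∀ k l, IsFormPullback (S.chart k) (S.chart l) id (Ω k) (Ω l)

/-- `V`, written as `V k` in the chart `k`, is a holomorphic non-autonomous system of
differential equations on `S`: a vector field on the total space with `t`-component `1`. -/
structure Space.IsSystem (S : Space) (V : S.Ix → C3 → C3) : Prop where
  analytic : ∀ k, AnalyticOnNhd ℂ (V k) (S.chart k).dom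
  time : ∀ k, ∀ z ∈ (S.chart k).dom, (V k z).2.2 = 1
  compatible : ∀ k l, IsRelatedField (S.chart k) (S.chart l) id (V k) (V l)

/-- The wedge product of two linear forms. -/
def wedge (l m : C3 →L[ℂ] ℂ) : Bil := l.smulRight m - m.smulRight l

def dx : C3 →L[ℂ] ℂ := ContinuousLinearMap.fst ℂ ℂ (ℂ × ℂ)
def dy : C3 →L[ℂ] ℂ := (ContinuousLinearMap.fst ℂ ℂ ℂ).comp (ContinuousLinearMap.snd ℂ ℂ (ℂ × ℂ))
def dt : C3 →L[ℂ] ℂ := (ContinuousLinearMap.snd ℂ ℂ ℂ).comp (ContinuousLinearMap.snd ℂ ℂ (ℂ × ℂ))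

/-- The two-form `dx ∧ dy + dH ∧ dt`. -/
def hamForm (H : C3 → ℂ) (w : C3) : Bil := wedge dx dy + wedge (fderiv ℂ H w) dt

/-- The system `x' = ∂H/∂y`, `y' = -∂H/∂x`. -/
def hamSystem (H : C3 → ℂ) (w : C3) : C3 :=
  (fderiv ℂ H w (0, 1, 0), -fderiv ℂ H w (1, 0, 0), 1)

/-- The patches `P i`, with coordinates `(x_i, y_i; t)`, are a symplectic atlas of `S` for the
symplectic form `ω_t`: they are charts, cover `S`, and `ω_t = d_t x_i ∧ d_t y_i` in each. -/
structure Space.IsSymplecticAtlas (S : Space) {ι : Type} (P : ι → Patch S.Pt)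
    (ω : S.Ix → C3 → ℂ) : Prop where
  symplectic : S.IsSymplecticForm ω
  isPatch : ∀ i, S.IsHolomorphicPatch (P i)
  cover : S.carrier ⊆ ⋃ i, (P i).par '' (P i).dom
  darboux : ∀ i k, IsAreaPullback (P i) (S.chart k) id (fun _ => 1) (ω k)

/-- The Hamiltonians `H i`, one on each patch of the atlas `P`, are a global Hamiltonian structure
of the system `V` on `S`: they define one two-form `Ω` on `S`, equal to
`dx_i ∧ dy_i + dH_i ∧ dt` in each patch, and the system is the Hamiltonian system of `H i` in
each patch. -/
structure Space.IsGlobalHamiltonianStructure (S : Space) {ι : Type} (P : ι → Patch S.Pt)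
    (V : S.Ix → C3 → C3) (H : ι → C3 → ℂ) (Ω : S.Ix → C3 → Bil) : Prop where
  system : S.IsSystem V
  twoForm : S.IsTwoForm Ω
  analytic : ∀ i, AnalyticOnNhd ℂ (H i) (P i).dom
  form_eq : ∀ i k, IsFormPullback (P i) (S.chart k) id (hamForm (H i)) (Ω k)
  hamiltonian : ∀ i k, IsRelatedField (P i) (S.chart k) id (hamSystem (H i)) (V k)

/-! ## Blow ups -/

/-- The point `1/x` of the Riemann sphere. -/
def recip (x : ℂ) : OnePoint ℂ := if x = 0 then OnePoint.infty else ((x⁻¹ : ℂ) : OnePoint ℂ)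

section BlowUp

variable (S : Space) {J : Type} (k : J → S.Ix) (a b : J → ℂ → ℂ)

/-- The `j`-th centre, in the fibre over `t`: the point `(x, y) = (a j t, b j t)` of chart `k j`. -/
def Space.center (j : J) (t : ℂ) : S.Pt := (S.chart (k j)).par (a j t, b j t, t)

/-- The simultaneous blow up of the fibres at finitely many distinct points, depending on `t`.
The centre `j` over `t` is replaced by an exceptional line, the set of points `Sum.inr (j, t, u)`
with `u = (x - a) / (y - b) ∈ ℂ ∪ {∞}`. It is covered by the charts `(u, v)` and `(U, V)`, with
blow up map `(x, y) = (a + u v, b + v) = (a + V, b + U V)`, which are numbered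
`Sum.inr (j, false)` and `Sum.inr (j, true)`. -/
def Space.blowUp : Space where
  Pt := S.Pt ⊕ (J × ℂ × OnePoint ℂ)
  carrier := {q | (∃ p ∈ S.carrier, (∀ j, ∀ t ∈ B, p ≠ S.center k a b j t) ∧ q = Sum.inl p) ∨
    ∃ j, ∃ t ∈ B, ∃ u, q = Sum.inr (j, t, u)}
  base := Sum.elim S.base fun e => e.2.1
  Ix := S.Ix ⊕ (J × Bool)
  chart
    | Sum.inl i =>
      { dom := {z | z ∈ (S.chart i).dom ∧ ∀ j, (S.chart i).par z ≠ S.center k a b j z.2.2}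
        par := fun z => Sum.inl ((S.chart i).par z) }
    | Sum.inr (j, false) =>
      { dom := {z | z.2.2 ∈ B ∧
          (a j z.2.2 + z.1 * z.2.1, b j z.2.2 + z.2.1, z.2.2) ∈ (S.chart (k j)).dom ∧
          (z.2.1 ≠ 0 → ∀ i, (S.chart (k j)).par
            (a j z.2.2 + z.1 * z.2.1, b j z.2.2 + z.2.1, z.2.2) ≠ S.center k a b i z.2.2)}
        par := fun z =>
          if z.2.1 = 0 then Sum.inr (j, z.2.2, (z.1 : OnePoint ℂ))
          else Sum.inl ((S.chart (k j)).par
            (a j z.2.2 + z.1 * z.2.1, b j z.2.2 + z.2.1, z.2.2)) }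
    | Sum.inr (j, true) =>
      { dom := {z | z.2.2 ∈ B ∧
          (a j z.2.2 + z.2.1, b j z.2.2 + z.1 * z.2.1, z.2.2) ∈ (S.chart (k j)).dom ∧
          (z.2.1 ≠ 0 → ∀ i, (S.chart (k j)).par
            (a j z.2.2 + z.2.1, b j z.2.2 + z.1 * z.2.1, z.2.2) ≠ S.center k a b i z.2.2)}
        par := fun z =>
          if z.2.1 = 0 then Sum.inr (j, z.2.2, recip z.1)
          else Sum.inl ((S.chart (k j)).par
            (a j z.2.2 + z.2.1, b j z.2.2 + z.1 * z.2.1, z.2.2)) }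

/-- The exceptional line over the `j`-th centre. -/
def Space.exceptional (j : J) : Set (S.blowUp k a b).Pt :=
  {q | ∃ t ∈ B, ∃ u, q = Sum.inr (j, t, u)}

/-- The proper transform of a closed curve `C`: away from the exceptional lines it is `C`, and a
point of an exceptional line belongs to it if it is a limit, in some chart, of points of `C` away
from the centres. -/
def Space.properTransform (C : Set S.Pt) : Set (S.blowUp k a b).Pt :=
  {q | q ∈ (S.blowUp k a b).carrier ∧ ((∃ p ∈ C, q = Sum.inl p) ∨
    ((∃ e, q = Sum.inr e) ∧ ∃ i, ∃ z ∈ ((S.blowUp k a b).chart i).dom,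
      ((S.blowUp k a b).chart i).par z = q ∧
      z ∈ closure {w | w ∈ ((S.blowUp k a b).chart i).dom ∧
        ∃ p ∈ C, ((S.blowUp k a b).chart i).par w = Sum.inl p}))}

end BlowUp

/-- The open subspace `S ∖ D`. -/
def Space.remove (S : Space) (D : Set S.Pt) : Space where
  Pt := S.Pt
  carrier := S.carrier \ D
  base := S.base
  Ix := S.Ix
  chart i := ⟨{z | z ∈ (S.chart i).dom ∧ (S.chart i).par z ∉ D}, (S.chart i).par⟩

/-! ## The compactifications `ℙ¹ × ℙ¹` and `𝔽₁` -/

/-- The two affine coordinates of the Riemann sphere: `x ↦ x` and `x ↦ 1/x`. -/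
def sphereChart (s : Bool) (x : ℂ) : OnePoint ℂ := if s then recip x else (x : OnePoint ℂ)

/-- The trivial bundle `ℙ¹ × ℙ¹ × B`, with its four standard affine charts: `(s, s')` is the chart
with coordinate `x` or `1/x` (`s = false` or `true`) and `y` or `1/y` (`s' = false` or `true`). -/
def P1P1 : Space where
  Pt := OnePoint ℂ × OnePoint ℂ × ℂ
  carrier := {p | p.2.2 ∈ B}
  base p := p.2.2
  Ix := Bool × Bool
  chart s := ⟨{z | z.2.2 ∈ B}, fun z => (sphereChart s.1 z.1, sphereChart s.2 z.2.1, z.2.2)⟩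

/-- The trivial bundle `𝔽₁ × B`. The point `(ξ, υ, t)` has `ξ ∈ ℂ ∪ {∞}` the coordinate on the
base of `𝔽₁ → ℙ¹`, and `υ ∈ ℂ ∪ {∞}` is the fibre coordinate `υ₀` if `ξ ≠ ∞` and
`υ₁ = ξ₀ υ₀` if `ξ = ∞`. The four charts are
`(ξ₁, υ₁) = (1/ξ₀, ξ₀ υ₀)`, `(ξ₂, υ₂) = (1/ξ₀, 1/(ξ₀ υ₀))`, `(ξ₃, υ₃) = (ξ₀, 1/υ₀)`
and `(ξ₀, υ₀)`. -/
def F1 : Space where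
  Pt := OnePoint ℂ × OnePoint ℂ × ℂ
  carrier := {p | p.2.2 ∈ B}
  base p := p.2.2
  Ix := Fin 4
  chart i := ⟨{z | z.2.2 ∈ B}, fun z =>
    (![((z.1 : ℂ) : OnePoint ℂ), recip z.1, recip z.1, ((z.1 : ℂ) : OnePoint ℂ)] i,
     ![((z.2.1 : ℂ) : OnePoint ℂ),
       if z.1 = 0 then ((z.2.1 : ℂ) : OnePoint ℂ) else ((z.1 * z.2.1 : ℂ) : OnePoint ℂ),
       if z.1 = 0 then recip z.2.1 else recip (z.2.1 / z.1),
       recip z.2.1] i,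
     z.2.2)⟩

/-- The curve on which the first coordinate (the base coordinate, for `𝔽₁`) is `c t`. -/
def firstCoord (c : ℂ → OnePoint ℂ) : Set (OnePoint ℂ × OnePoint ℂ × ℂ) :=
  {p | p.2.2 ∈ B ∧ p.1 = c p.2.2}

/-- The curve on which the second coordinate (the fibre coordinate, for `𝔽₁`) is `c`. -/
def secondCoord (c : OnePoint ℂ) : Set (OnePoint ℂ × OnePoint ℂ × ℂ) :=
  {p | p.2.2 ∈ B ∧ p.2.1 = c}

/-! ## The space `E^KNY` -/

section KNY

variable (a : Fin 5 → ℂ)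

/-- `ℙ¹ × ℙ¹` blown up at `b₁, b₂, b₃, b₅, b₆, b₇`, in this order. -/
def knyX₁ : Space :=
  P1P1.blowUp (J := Fin 6)
    ![(true, false), (true, false), (false, true), (false, false), (false, false), (false, true)]
    (fun j t => ![0, 0, t, 0, 0, 1] j)
    (fun j _ => ![-a 2, -a 1 - a 2, 0, 0, a 4, 0] j)

def knyChart₁ (j : Fin 6) (s : Bool) : (knyX₁ a).Ix := Sum.inr (j, s)

/-- `X^KNY`: the blow up of `knyX₁` at `b₄ : (u₃, v₃) = (t a₀, 0)` and
`b₈ : (u₇, v₇) = (a₃, 0)`. -/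
def knyX : Space :=
  (knyX₁ a).blowUp (J := Fin 2) ![knyChart₁ a 2 false, knyChart₁ a 5 false]
    (fun j t => ![t * a 0, a 3] j) (fun _ _ => 0)

/-- The proper transform, under the second step, of a curve in `knyX₁`. -/
def knyProper (C : Set (knyX₁ a).Pt) : Set (knyX a).Pt :=
  (knyX₁ a).properTransform _ _ _ C

/-- The proper transform, under the first step, of a curve in `ℙ¹ × ℙ¹`. -/
def knyProper₁ (C : Set (OnePoint ℂ × OnePoint ℂ × ℂ)) : Set (knyX₁ a).Pt :=
  P1P1.properTransform _ _ _ C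

/-- The exceptional line of the first step over the `j`-th of `b₁, b₂, b₃, b₅, b₆, b₇`. -/
def knyExceptional₁ (j : Fin 6) : Set (knyX₁ a).Pt := P1P1.exceptional _ _ _ j

/-- `D^KNY = D₀ ∪ D₁ ∪ D₂ ∪ D₃ ∪ D₄`: the proper transforms of the exceptional line over `b₃`,
of `{f = ∞}`, of `{g = ∞}`, of the exceptional line over `b₇`, and of `{f = 0}`. -/
def knyD : Set (knyX a).Pt :=
  knyProper a (knyExceptional₁ a 2) ∪
  knyProper a (knyProper₁ a (firstCoord fun _ => OnePoint.infty)) ∪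
  knyProper a (knyProper₁ a (secondCoord OnePoint.infty)) ∪
  knyProper a (knyExceptional₁ a 5) ∪
  knyProper a (knyProper₁ a (firstCoord fun _ => ((0 : ℂ) : OnePoint ℂ)))

/-- `E^KNY = X^KNY ∖ D^KNY`. -/
def knyE : Space := (knyX a).remove (knyD a)

/-- The affine chart `(f, g)` of `E^KNY`. -/
def knyAff : (knyE a).Ix :=
  (Sum.inl (Sum.inl (false, false) : (knyX₁ a).Ix) : (knyX₁ a).Ix ⊕ (Fin 2 × Bool))

/-- The Kajiwara--Noumi--Yamada system, at `z = (f, g, t)` with `f ≠ 0`. -/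
def knySystem (z : C3) : C3 :=
  ((2 * (z.1 - 1) * (z.1 - z.2.2) * z.2.1 - (a 0 - 1) * z.1 * (z.1 - 1)
      - a 3 * z.1 * (z.1 - z.2.2) - a 4 * (z.1 - 1) * (z.1 - z.2.2)) / (z.2.2 * (z.2.2 - 1)),
   -(z.1 ^ 2 * (z.2.1 + a 2) * (z.2.1 + a 1 + a 2) - z.2.2 * z.2.1 * (z.2.1 - a 4))
      / (z.2.2 * (z.2.2 - 1) * z.1),
   1)

/-- Takano's coordinates `(x_i, y_i; t)` as functions of `z = (f, g, t)`. -/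
def takano (i : Fin 6) (z : C3) : C3 :=
  let f := z.1
  let g := z.2.1
  let t := z.2.2
  (![f,
     f * (g + a 2),
     f * (g + a 1 + a 2),
     g * (a 0 * f + t * g - f * g) / f ^ 2,
     g * (a 4 - g) / f,
     g * (g + a 3 * f - f * g) / f ^ 2] i,
   ![g / f, 1 / f, 1 / f, f / g, f / g, f / g] i,
   t)

/-- The Hamiltonian `H₀` of the Kajiwara--Noumi--Yamada system in the coordinates `(x₀, y₀; t)`. -/
def knyH₀ (w : C3) : ℂ :=
  let x := w.1
  let y := w.2.1
  let t := w.2.2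
  (x * (x - 1) * (x - t) * y ^ 2 + a 2 * (a 1 + a 2) * x) / (t * (t - 1))
    + (x ^ 2 * (a 1 + 2 * a 2) + x * t * (a 3 + a 4) - x * (a 1 + 2 * a 2 + a 3) - t * a 4) * y
      / (t * (t - 1))

end KNY

/-! ## The parameters -/

/-- The complex parameters `α, β, γ, n`. -/
structure Params where
  α : ℂ
  β : ℂ
  γ : ℂ
  n : ℂ

def Params.κ (p : Params) : ℂ := p.α + p.β + p.γ + 2 * p.n + 1

/-- The identification of parameters
`(a₀, a₁, a₂, a₃, a₄) = (-γ, κ, -n - α, -β, α)`. -/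
def Params.a (p : Params) : Fin 5 → ℂ := ![-p.γ, p.κ, -p.n - p.α, -p.β, p.α]

/-! ## The first parametrisation -/

section First

variable (p : Params)

/-- The polynomial `φ(x̃, ỹ; t)`. -/
def phi (α β γ n κ x y t : ℂ) : ℂ :=
  -(t - 1) * x ^ 4 * (6 * κ ^ 2 - β ^ 2 + 4 * n * (t ^ 2 - 6 * t) * (κ - n)
      + t ^ 2 * (α + β + 1) * (α + β + 2 * γ + 1)
      - t * (2 * α * (κ - 2 * n) + 2 * β * (γ + 1) + 2 * γ + 5 * (κ - 2 * n) ^ 2))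
  - x ^ 2 * (κ ^ 2 * (-κ ^ 2 + 6 * β ^ 2 + 4 * n * t * (κ - n) + t ^ 2 * (β ^ 2 - α ^ 2 + 1)
        + t * (2 * α * (κ - 2 * n) - 5 * β ^ 2 + 2 * β * (γ + 1) + 2 * γ))
      + 3 * t ^ 2 * (t - 1) ^ 3 * y ^ 2 + 2 * κ * t * (t ^ 3 - 5 * t ^ 2 + 6 * t - 2) * y)
  + 2 * (t - 1) * x ^ 3 * ((t - 1) ^ 2 * t * y
      - 2 * κ * (β ^ 2 - κ ^ 2 + 2 * n * t * (β + γ + n) + β * γ * t + (κ - 1) * (α + 1) * t))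
  - 2 * κ * x * (-((t - 2) * (t - 1) ^ 2 * t ^ 2 * y ^ 2) + κ * t * (2 * t ^ 2 - 3 * t + 1) * y
      + β ^ 2 * κ ^ 2 * (t - 2))
  - κ ^ 2 * (β ^ 2 * κ ^ 2 - (t - 1) ^ 2 * t ^ 2 * y ^ 2) - (t - 1) ^ 3 * x ^ 6
  + 2 * κ * (t - 2) * (t - 1) ^ 2 * x ^ 5

/-- The system in the first parametrisation, at `z = (x̃, ỹ, t)`. -/
def system₁ (z : C3) : C3 :=
  (z.2.1,
   phi p.α p.β p.γ p.n p.κ z.1 z.2.1 z.2.2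
      / (2 * (z.2.2 - 1) ^ 2 * z.2.2 ^ 2 * z.1 * (p.κ - z.1) * (p.κ + (z.2.2 - 1) * z.1)),
   1)

/-- The identification `(x̃, ỹ, t) ↦ (f, g, t)`. -/
def ident₁ (z : C3) : C3 :=
  let x := z.1
  let y := z.2.1
  let t := z.2.2
  ((p.κ + (t - 1) * x) / p.κ,
   ((t - 1) * (p.α - p.β - p.γ - 1) * x ^ 2
      - p.κ * (1 - p.α + 2 * p.β + p.γ + (p.α - p.β - 1) * t) * x
      + p.κ * (p.β * p.κ + (t - 1) * t * y)) / (2 * (t - 1) * (x - p.κ) * x),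
   t)

/-- The coefficient of `d_t x̃ ∧ d_t ỹ` in the symplectic form in the first parametrisation. -/
def area₁ (z : C3) : ℂ :=
  -(p.κ * z.2.2 * (z.2.2 - 1) / 2)
    / (z.1 * (z.1 - p.κ) * ((1 - z.2.2) * z.1 - p.κ))

/-- `ℙ¹ × ℙ¹` blown up at `p₁, …, p₇` (numbered from `0` here). -/
def X₁₁ : Space :=
  P1P1.blowUp (J := Fin 7)
    ![(false, false), (false, false), (false, false), (false, false), (false, false),
      (false, false), (true, true)]
    (fun j t => ![0, 0, p.κ / (1 - t), p.κ / (1 - t), p.κ, p.κ, 0] j)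
    (fun j t => ![p.β * p.κ / (t * (1 - t)), p.β * p.κ / (t * (t - 1)),
      (1 - p.α) * p.κ / (t - 1) ^ 2, (1 + p.α) * p.κ / (t - 1) ^ 2,
      p.γ * p.κ / (1 - t), p.γ * p.κ / (t - 1), 0] j)

def chart₁₁ (j : Fin 7) (s : Bool) : (X₁₁ p).Ix := Sum.inr (j, s)

/-- The blow up of `X₁₁` at `p₈ : (U₇, V₇) = (0, 0)`. -/
def X₁₂ : Space :=
  (X₁₁ p).blowUp (J := Unit) (fun _ => chart₁₁ p 6 true) (fun _ _ => 0) (fun _ _ => 0)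

def chart₁₂ (s : Bool) : (X₁₂ p).Ix := Sum.inr ((), s)

/-- The surfaces `S_t`: the blow up of `X₁₂` at `p₉ : (u₈, v₈) = (-t, 0)` and
`p₁₀ : (u₈, v₈) = (t, 0)`. -/
def X₁₃ : Space :=
  (X₁₂ p).blowUp (J := Fin 2) (fun _ => chart₁₂ p false) (fun j t => ![-t, t] j) (fun _ _ => 0)

def proper₁₁ (C : Set (OnePoint ℂ × OnePoint ℂ × ℂ)) : Set (X₁₁ p).Pt :=
  P1P1.properTransform _ _ _ C

def proper₁₂ (C : Set (X₁₁ p).Pt) : Set (X₁₂ p).Pt := (X₁₁ p).properTransform _ _ _ C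

def proper₁₃ (C : Set (X₁₂ p).Pt) : Set (X₁₃ p).Pt := (X₁₂ p).properTransform _ _ _ C

/-- The exceptional line over `p₇`. -/
def exceptional₁₁ : Set (X₁₁ p).Pt := P1P1.exceptional _ _ _ (6 : Fin 7)

/-- The exceptional line over `p₈`. -/
def exceptional₁₂ : Set (X₁₂ p).Pt := (X₁₁ p).exceptional _ _ _ ()

/-- The seven inaccessible curves on `S_t`: the proper transforms of `{x̃ = 0}`,
`{x̃ = κ/(1-t)}`, `{x̃ = κ}`, `{x̃ = ∞}`, `{ỹ = ∞}`, and of the exceptional lines over `p₇` and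
`p₈`. -/
def D₁ : Set (X₁₃ p).Pt :=
  proper₁₃ p (proper₁₂ p (proper₁₁ p (firstCoord fun _ => ((0 : ℂ) : OnePoint ℂ)))) ∪
  proper₁₃ p (proper₁₂ p (proper₁₁ p (firstCoord fun t => ((p.κ / (1 - t) : ℂ) : OnePoint ℂ)))) ∪
  proper₁₃ p (proper₁₂ p (proper₁₁ p (firstCoord fun _ => ((p.κ : ℂ) : OnePoint ℂ)))) ∪
  proper₁₃ p (proper₁₂ p (proper₁₁ p (firstCoord fun _ => OnePoint.infty))) ∪
  proper₁₃ p (proper₁₂ p (proper₁₁ p (secondCoord OnePoint.infty))) ∪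
  proper₁₃ p (proper₁₂ p (exceptional₁₁ p)) ∪
  proper₁₃ p (exceptional₁₂ p)

/-- The space `E` of the first parametrisation. The minimal surface `X_t` arises from `S_t` by
contracting successively the proper transform of `{x̃ = ∞}` and that of the exceptional line over
`p₇`, to a point on the image of the exceptional line over `p₈`. Both contracted curves and the
image point lie in the removed curves, so that `E_t = X_t ∖ D_t` is the complement in `S_t` of the
seven curves. -/
def E₁ : Space := (X₁₃ p).remove (D₁ p)

/-- The affine chart `(x̃, ỹ)` of `E₁`. -/
def aff₁ : (E₁ p).Ix :=
  (Sum.inl (Sum.inl (Sum.inl (false, false) : (X₁₁ p).Ix) : (X₁₂ p).Ix) :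
    (X₁₂ p).Ix ⊕ (Fin 2 × Bool))

end First

/-! ## The second parametrisation -/

section Second

variable (p : Params)

/-- The polynomial `η(ξ₀, υ₀; t)`. -/
def eta (α β γ n κ x v t : ℂ) : ℂ :=
  κ ^ 2 - n * t * v ^ 2 * x ^ 2 * (γ + n) * (κ + (t - 1) * x) ^ 2
  + v * (x * (x * ((t - 1) * x * (-2 * (κ + β) + t * (2 * α + 2 * β + 1) - (t - 1) * x)
        - κ * (5 * β + κ + t * (α * (t - 2) + β * (t - 6) - 1)))
      - 2 * β * κ ^ 2 * (t - 2)) - β * κ ^ 3)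
  + 2 * κ * (t - 2) * x - 3 * (t - 1) * x ^ 2

/-- The system in the second parametrisation, at `z = (ξ₀, υ₀, t)`. -/
def system₂ (z : C3) : C3 :=
  let x := z.1
  let v := z.2.1
  let t := z.2.2
  ((v * (((t - 1) * x + p.κ) * (x - p.β) - t * x * (p.α + 1)) + 2) / ((t - 1) * t * v),
   -eta p.α p.β p.γ p.n p.κ x v t
      / ((t - 1) * t * x * (p.κ - x) * (p.κ + (t - 1) * x)),
   1)

/-- The identification `(ξ₀, υ₀, t) ↦ (f, g, t)`. -/
def ident₂ (z : C3) : C3 :=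
  let x := z.1
  let v := z.2.1
  let t := z.2.2
  (((t - 1) * x + p.κ) / p.κ,
   (p.κ + x * v * ((p.α + p.n) * (x * (t - 1) + p.κ) - p.α * t * p.κ))
      / ((t - 1) * x * (x - p.κ) * v),
   t)

/-- The coefficient of `d_t ξ₀ ∧ d_t υ₀` in the symplectic form in the second parametrisation. -/
def area₂ (z : C3) : ℂ :=
  p.κ / (z.1 * (z.1 - p.κ) * ((1 - z.2.2) * z.1 - p.κ) * z.2.1 ^ 2)

/-- `𝔽₁` blown up at `π₁, …, π₇` (numbered from `0` here), the first six in the chart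
`(ξ₃, υ₃)` and the last one in the chart `(ξ₁, υ₁)`. -/
def X₂₁ : Space :=
  F1.blowUp (J := Fin 7) (![3, 3, 3, 3, 3, 3, 1] : Fin 7 → Fin 4)
    (fun j t => ![0, 0, p.κ, p.κ, p.κ / (1 - t), p.κ / (1 - t), 0] j)
    (fun j t => ![0, p.κ * p.β, -p.κ * t * p.n, -p.κ * t * (p.γ + p.n), 0,
      p.κ * t * p.α / (1 - t), 0] j)

def chart₂₁ (j : Fin 7) (s : Bool) : (X₂₁ p).Ix := Sum.inr (j, s)

/-- The surfaces `X_t`: the blow up of `X₂₁` at `π₈ : (u₇, v₇) = (1 - t, 0)`. -/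
def X₂₂ : Space :=
  (X₂₁ p).blowUp (J := Unit) (fun _ => chart₂₁ p 6 false) (fun _ t => 1 - t) (fun _ _ => 0)

def proper₂₁ (C : Set (OnePoint ℂ × OnePoint ℂ × ℂ)) : Set (X₂₁ p).Pt :=
  F1.properTransform _ _ _ C

def proper₂₂ (C : Set (X₂₁ p).Pt) : Set (X₂₂ p).Pt := (X₂₁ p).properTransform _ _ _ C

/-- The exceptional line over `π₇`. -/
def exceptional₂₁ : Set (X₂₁ p).Pt := F1.exceptional _ _ _ (6 : Fin 7)

/-- The inaccessible divisor `D`: the proper transforms of the fibres `{ξ₀ = 0}`, `{ξ₀ = κ}`,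
`{ξ₀ = κ/(1-t)}`, of the `(-1)`-curve `{υ₀ = 0} ∪ {υ₁ = 0}`, and of the exceptional line over
`π₇`. -/
def D₂ : Set (X₂₂ p).Pt :=
  proper₂₂ p (proper₂₁ p (firstCoord fun _ => ((0 : ℂ) : OnePoint ℂ))) ∪
  proper₂₂ p (proper₂₁ p (firstCoord fun _ => ((p.κ : ℂ) : OnePoint ℂ))) ∪
  proper₂₂ p (proper₂₁ p (firstCoord fun t => ((p.κ / (1 - t) : ℂ) : OnePoint ℂ))) ∪
  proper₂₂ p (proper₂₁ p (secondCoord ((0 : ℂ) : OnePoint ℂ))) ∪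
  proper₂₂ p (exceptional₂₁ p)

/-- The space `E` of the second parametrisation. -/
def E₂ : Space := (X₂₂ p).remove (D₂ p)

/-- The affine chart `(ξ₀, υ₀)` of `E₂`. -/
def aff₂ : (E₂ p).Ix :=
  (Sum.inl (Sum.inl (0 : Fin 4) : (X₂₁ p).Ix) : (X₂₁ p).Ix ⊕ (Unit × Bool))

end Second

/-! ## Transport of the Hamiltonian structure -/

/-- The data on `S` (with distinguished affine chart `k`) are obtained from those on `T` (with
distinguished affine chart `l`) by pullback along an isomorphism `Φ : S → T` over the `t`-line,
given in the affine charts by the formula `ident`. Here `τ` is a collection of patches on `T`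
with Hamiltonians `H`, and `ω`, `Ω`, `V` are the symplectic form on the fibres, the two-form and
the system on `T`. The pulled back patches are a symplectic atlas of `S` for the pulled back
symplectic form, which is `area d_t x ∧ d_t y` in the affine chart. The system `sys`, given in
the affine chart, extends to `S`, corresponds to `V` under `Φ`, and the same Hamiltonians, in the
pulled back coordinates, are a global Hamiltonian structure of it with two-form `Φ^* Ω`. -/
def PullsBackAlong (S T : Space) (k : S.Ix) (l : T.Ix) (ident sys : C3 → C3) (area : C3 → ℂ)
    {ι : Type} (τ : ι → Patch T.Pt) (H : ι → C3 → ℂ) (ω : T.Ix → C3 → ℂ) (Ω : T.Ix → C3 → Bil)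
    (V : T.Ix → C3 → C3) : Prop :=
  ∃ (Φ : S.Pt → T.Pt) (Ψ : T.Pt → S.Pt) (ω' : S.Ix → C3 → ℂ) (Ω' : S.Ix → C3 → Bil)
    (V' : S.Ix → C3 → C3),
    IsBiholomorphism S T Φ Ψ ∧
    (∀ z ∈ (S.chart k).dom, ident z ∈ (T.chart l).dom ∧
      Φ ((S.chart k).par z) = (T.chart l).par (ident z)) ∧
    (∀ i j, IsAreaPullback (S.chart i) (T.chart j) Φ (ω' i) (ω j)) ∧
    (∀ i j, IsFormPullback (S.chart i) (T.chart j) Φ (Ω' i) (Ω j)) ∧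
    (∀ i j, IsRelatedField (S.chart i) (T.chart j) Φ (V' i) (V j)) ∧
    (∀ z ∈ (S.chart k).dom, ω' k z = area z) ∧
    (∀ z ∈ (S.chart k).dom, V' k z = sys z) ∧
    S.IsSymplecticAtlas (fun i => (τ i).pullback Ψ) ω' ∧
    S.IsGlobalHamiltonianStructure (fun i => (τ i).pullback Ψ) V' H Ω'

end PVI

end

/-!
All three spaces are one and the same surface, embedded in three compactifications. Takano's
charts `1, …, 5` meet each other only inside the chart `0`, and each of them exceeds that chart by
the line `y_i = 0`. Gluing the six charts therefore gives an abstract family (`ModelPt`): a copy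
of `ℂ² × B` and five lines, two at `f = ∞` and one each at `f = t`, `f = 0`, `f = 1`.

On this family everything is explicit. In each chart there is a Hamiltonian, polynomial in `x` and
`y` (`modelHam`); on overlaps two of them differ by the correction `lineSlope * y` that
compensates the `t`-dependence of the gluing (`modelHam_fwd`), so that the forms `dx ∧ dy + dH ∧
dt` agree (`hamForm_fwd`, `isFormPullback_modelPatch`). This one two-form determines the rest: its
coefficient at `d_t x ∧ d_t y` is the symplectic form on the fibres, and the system spans its
kernel (`Space.IsHamAtlas` and its consequences `Space.IsHamAtlas.isSymplecticAtlas`,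
`Space.IsHamAtlas.isGlobalHamiltonianStructure`).

It remains to place the family in each of the three compactifications (`Space.IsPlacement`) and to
see that it fills exactly the complement of the removed curves. Away from finitely many fibres of
the coordinate `f` the chart `0` is a chart of the compactification. On such a fibre two points
are blown up; the chart `0` continues onto one exceptional line, and the line `y_i = 0` of another
chart lies on the second one. All three parametrisations have this shape, with different
polynomials in `f`, and `FibreData` with `FibreData.Valid.isLocalPatch_zero` and
`FibreData.Valid.isLocalPatch_line` treats them together; only the lines reached by iterated blow
ups, or lying over `f = ∞`, are computed case by case. A chart-open set that avoids a curve also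
avoids its proper transforms (`Space.IsChartOpen.disjoint_properTransform`), which separates the
glued surface from the removed curves; that nothing else remains is a check of the points of each
exceptional line (`knyX_carrier_subset`, `e1X_carrier_subset`, `e2X_carrier_subset`).

Two families exhausted by the glued surface are isomorphic, and all structures correspond
(`Space.IsPlacement.pullsBackAlong`). That this isomorphism, the system and the area form are
given by the stated formulas is an identity of rational functions in the affine charts
(`isAffineForm_kny`, `isAffineForm_E₁`, `isAffineForm_E₂`), as the affine charts of the three
spaces all lie in the chart `0`. Those of the systems reduce to the polynomial identities
`phiRed_eq` and `etaRed_eq`.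
-/


open Set Filter Topology

noncomputable section

namespace PVI

/-- The projection rules let `fun_prop` see through maps into products. -/
@[fun_prop]
theorem analyticAt_fst_comp {E F G : Type*} [NormedAddCommGroup E] [NormedSpace ℂ E]
    [NormedAddCommGroup F] [NormedSpace ℂ F] [NormedAddCommGroup G] [NormedSpace ℂ G]
    {f : E → F × G} {x : E} (hf : AnalyticAt ℂ f x) : AnalyticAt ℂ (fun x => (f x).1) x :=
  AnalyticAt.comp (g := Prod.fst) analyticAt_fst hf

@[fun_prop]
theorem analyticAt_snd_comp {E F G : Type*} [NormedAddCommGroup E] [NormedSpace ℂ E]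
    [NormedAddCommGroup F] [NormedSpace ℂ F] [NormedAddCommGroup G] [NormedSpace ℂ G]
    {f : E → F × G} {x : E} (hf : AnalyticAt ℂ f x) : AnalyticAt ℂ (fun x => (f x).2) x :=
  AnalyticAt.comp (g := Prod.snd) analyticAt_snd hf

/-! ### Transitions between patches -/

section Transition

variable {X Y Z : Type}

theorem IsTransition.comp {P : Patch X} {Q : Patch Y} {R : Patch Z} {Φ : X → Y} {Ψ : Y → Z}
    {g h : C3 → C3} {w : C3} (hh : IsTransition Q R Ψ h (g w)) (hg : IsTransition P Q Φ g w) :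
    IsTransition P R (Ψ ∘ Φ) (h ∘ g) w := by
  refine ⟨hh.1.comp hg.1, ?_⟩
  filter_upwards [hg.2, hg.1.continuousAt.eventually hh.2] with w' h1 h2
  exact ⟨h1.1, h2.2.1, by rw [Function.comp_apply, h2.2.2, h1.2.2]; rfl⟩

/-- Being a transition only depends on the germs of the patches at the two points. -/
theorem IsTransition.transfer {X' Y' : Type} {P : Patch X} {Q : Patch Y} {P' : Patch X'}
    {Q' : Patch Y'} {Φ : X → Y} {Φ' : X' → Y'} {g : C3 → C3} {w : C3}
    (hg : IsTransition P Q Φ g w) (hP : P'.dom ∈ 𝓝 w) (hQ : Q'.dom ∈ 𝓝 (g w))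
    (h : ∀ w' ∈ P.dom ∩ P'.dom, ∀ z ∈ Q.dom ∩ Q'.dom, Q.par z = Φ (P.par w') →
      Q'.par z = Φ' (P'.par w')) :
    IsTransition P' Q' Φ' g w := by
  refine ⟨hg.1, ?_⟩
  filter_upwards [hg.2, hP, hg.1.continuousAt.eventually hQ] with w' h1 h2 h3
  exact ⟨h2, h3, h _ ⟨h1.1, h2⟩ _ ⟨h1.2.1, h3⟩ h1.2.2⟩

theorem IsTransition.mem {P : Patch X} {Q : Patch Y} {Φ : X → Y} {g : C3 → C3} {w : C3}
    (hg : IsTransition P Q Φ g w) : w ∈ P.dom ∧ g w ∈ Q.dom ∧ Q.par (g w) = Φ (P.par w) :=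
  hg.2.self_of_nhds

theorem IsTransition.eventually {P : Patch X} {Q : Patch Y} {Φ : X → Y} {g : C3 → C3} {w : C3}
    (hg : IsTransition P Q Φ g w) : ∀ᶠ w' in 𝓝 w, IsTransition P Q Φ g w' := by
  filter_upwards [hg.1.eventually_analyticAt, hg.2.eventually_nhds] with w' h1 h2
  exact ⟨h1, h2⟩

/-- Two transitions into an injective patch have the same germ. -/
theorem IsTransition.unique {P : Patch X} {Q : Patch Y} {Φ : X → Y} {g g' : C3 → C3} {w : C3}
    (hQ : InjOn Q.par Q.dom) (hg : IsTransition P Q Φ g w) (hg' : IsTransition P Q Φ g' w) :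
    g =ᶠ[𝓝 w] g' := by
  filter_upwards [hg.2, hg'.2] with w' h1 h2
  exact hQ h1.2.1 h2.2.1 (h1.2.2.trans h2.2.2.symm)

/-- The patches `P` and `Q` overlap at `P.par w = Q.par z`, and the changes of coordinates between
them are holomorphic there, in both directions. -/
def LocEquiv (P Q : Patch X) (w z : C3) : Prop :=
  ∃ g h, g w = z ∧ h z = w ∧ IsTransition P Q id g w ∧ IsTransition Q P id h z

theorem LocEquiv.refl {P : Patch X} {w : C3} (h : P.dom ∈ 𝓝 w) : LocEquiv P P w w := by
  have : IsTransition P P id id w := ⟨analyticAt_id, by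
    filter_upwards [h] with w' h'
    exact ⟨h', h', rfl⟩⟩
  exact ⟨id, id, rfl, rfl, this, this⟩

theorem LocEquiv.symm {P Q : Patch X} {w z : C3} (h : LocEquiv P Q w z) : LocEquiv Q P z w := by
  obtain ⟨g, k, h1, h2, h3, h4⟩ := h
  exact ⟨k, g, h2, h1, h4, h3⟩

theorem LocEquiv.trans {P Q R : Patch X} {w z v : C3} (h : LocEquiv P Q w z)
    (h' : LocEquiv Q R z v) : LocEquiv P R w v := by
  obtain ⟨g, k, rfl, h2, h3, h4⟩ := h
  obtain ⟨g', k', rfl, h2', h3', h4'⟩ := h'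
  refine ⟨g' ∘ g, k ∘ k', rfl, by simp [h2, h2'], h3'.comp h3, ?_⟩
  have := IsTransition.comp (h := k) (g := k') (w := g' (g w)) (by rw [h2']; exact h4) h4'
  exact this

theorem LocEquiv.mem {P Q : Patch X} {w z : C3} (h : LocEquiv P Q w z) :
    w ∈ P.dom ∧ z ∈ Q.dom ∧ P.par w = Q.par z := by
  obtain ⟨g, k, rfl, h2, h3, h4⟩ := h
  exact ⟨h3.mem.1, h3.mem.2.1, h3.mem.2.2.symm⟩

theorem LocEquiv.transfer {P Q : Patch X} {P' Q' : Patch Y} {w z : C3} (h : LocEquiv P Q w z)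
    (hP : P'.dom ∈ 𝓝 w) (hQ : Q'.dom ∈ 𝓝 z)
    (H : ∀ w' ∈ P.dom ∩ P'.dom, ∀ z' ∈ Q.dom ∩ Q'.dom, P.par w' = Q.par z' →
      P'.par w' = Q'.par z') :
    LocEquiv P' Q' w z := by
  obtain ⟨g, k, rfl, h2, h3, h4⟩ := h
  exact ⟨g, k, rfl, h2, h3.transfer hP hQ fun w' hw z hz e => (H w' hw z hz e.symm).symm,
    h4.transfer hQ (by rw [h2]; exact hP) fun w' hw z hz e => H z hz w' hw e⟩

/-- A holomorphic map `g` with holomorphic local inverse `h` at `w`. -/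
structure LocInv (g h : C3 → C3) (w : C3) : Prop where
  analytic : AnalyticAt ℂ g w
  analytic_inv : AnalyticAt ℂ h (g w)
  left : h (g w) = w
  right : ∀ᶠ z in 𝓝 (g w), g (h z) = z

theorem LocEquiv.of_locInv {P Q : Patch X} {g h : C3 → C3} {w : C3} (H : LocInv g h w)
    (hP : P.dom ∈ 𝓝 w) (hQ : Q.dom ∈ 𝓝 (g w)) (hpar : ∀ᶠ w' in 𝓝 w, Q.par (g w') = P.par w') :
    LocEquiv P Q w (g w) := by
  refine ⟨g, h, rfl, H.left, ⟨H.analytic, ?_⟩, H.analytic_inv, ?_⟩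
  · filter_upwards [hpar, hP, H.analytic.continuousAt.eventually hQ] with w' h1 h2 h3
    exact ⟨h2, h3, h1⟩
  · have hc : Tendsto h (𝓝 (g w)) (𝓝 w) := by
      have := H.analytic_inv.continuousAt.tendsto
      rwa [H.left] at this
    filter_upwards [H.right, hQ, hc.eventually hpar, hc.eventually hP] with z h1 h2 h3 h4
    refine ⟨h2, h4, ?_⟩
    rw [← h3, h1]; rfl

theorem LocEquiv.isTransition {P Q : Patch X} {w z : C3} (h : LocEquiv P Q w z) :
    ∃ g, g w = z ∧ IsTransition P Q id g w := by
  obtain ⟨g, k, h1, h2, h3, h4⟩ := h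
  exact ⟨g, h1, h3⟩

end Transition

/-! ### Holomorphic patches of a family -/

/-- All the given coordinate patches of `S` are charts, compatible with each other, and they lie
over `B`. -/
structure Space.IsAtlas (S : Space) : Prop where
  isPatch : ∀ k, S.IsHolomorphicPatch (S.chart k)
  time : ∀ k, ∀ z ∈ (S.chart k).dom, z.2.2 ∈ B

/-- Near `w`, the patch `Q` is compatible with some chart of `S`. -/
def Space.IsLocalPatch (S : Space) (Q : Patch S.Pt) (w : C3) : Prop :=
  ∃ l z, LocEquiv Q (S.chart l) w z

section Patches

variable {S : Space}

theorem Space.IsHolomorphicPatch.locEquiv {P : Patch S.Pt} (h : S.IsHolomorphicPatch P) {k : S.Ix}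
    {w z : C3} (hw : w ∈ P.dom) (hz : z ∈ (S.chart k).dom) (e : P.par w = (S.chart k).par z) :
    LocEquiv P (S.chart k) w z := by
  obtain ⟨g, h1, h2⟩ := h.toChart k w hw z hz e
  obtain ⟨g', h1', h2'⟩ := h.ofChart k z hz w hw e.symm
  exact ⟨g, g', h1, h1', h2, h2'⟩

theorem Space.IsAtlas.locEquiv (hS : S.IsAtlas) {k l : S.Ix} {w z : C3} (hw : w ∈ (S.chart k).dom)
    (hz : z ∈ (S.chart l).dom) (e : (S.chart k).par w = (S.chart l).par z) :
    LocEquiv (S.chart k) (S.chart l) w z :=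
  (hS.isPatch k).locEquiv hw hz e

theorem Space.IsAtlas.isOpen (hS : S.IsAtlas) (k : S.Ix) : IsOpen (S.chart k).dom :=
  (hS.isPatch k).isOpen

theorem Space.IsAtlas.base (hS : S.IsAtlas) {k : S.Ix} {z : C3} (hz : z ∈ (S.chart k).dom) :
    S.base ((S.chart k).par z) = z.2.2 := (hS.isPatch k).base z hz

theorem Space.isAtlas_of_locEquiv (ho : ∀ k, IsOpen (S.chart k).dom)
    (hm : ∀ k, MapsTo (S.chart k).par (S.chart k).dom S.carrier)
    (hi : ∀ k, InjOn (S.chart k).par (S.chart k).dom)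
    (hb : ∀ k, ∀ w ∈ (S.chart k).dom, S.base ((S.chart k).par w) = w.2.2)
    (ht : ∀ k, ∀ z ∈ (S.chart k).dom, z.2.2 ∈ B)
    (h : ∀ k l, ∀ w ∈ (S.chart k).dom, ∀ z ∈ (S.chart l).dom,
      (S.chart k).par w = (S.chart l).par z → LocEquiv (S.chart k) (S.chart l) w z) :
    S.IsAtlas where
  time := ht
  isPatch k :=
    { isOpen := ho k
      mapsTo := hm k
      injOn := hi k
      base := hb k
      toChart := fun l w hw z hz e => (h k l w hw z hz e).isTransition
      ofChart := fun l w hw z hz e => (h l k w hw z hz e).isTransition }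

theorem Space.IsAtlas.isHolomorphicPatch (hS : S.IsAtlas) {Q : Patch S.Pt} (ho : IsOpen Q.dom)
    (hi : InjOn Q.par Q.dom) (hb : ∀ w ∈ Q.dom, S.base (Q.par w) = w.2.2)
    (h : ∀ w ∈ Q.dom, S.IsLocalPatch Q w) : S.IsHolomorphicPatch Q where
  isOpen := ho
  mapsTo w hw := by
    obtain ⟨l, z, e⟩ := h w hw
    rw [e.mem.2.2]
    exact (hS.isPatch l).mapsTo e.mem.2.1
  injOn := hi
  base := hb
  toChart k w hw z hz e := by
    obtain ⟨l, z', e'⟩ := h w hw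
    exact (e'.trans (hS.locEquiv e'.mem.2.1 hz (e'.mem.2.2.symm.trans e))).isTransition
  ofChart k w hw z hz e := by
    obtain ⟨l, z', e'⟩ := h z hz
    exact (e'.trans (hS.locEquiv e'.mem.2.1 hw (e'.mem.2.2.symm.trans e.symm))).symm.isTransition

theorem Space.IsLocalPatch.of_locEquiv {P Q : Patch S.Pt} {w z : C3} (h : LocEquiv P Q w z)
    (hQ : S.IsLocalPatch Q z) : S.IsLocalPatch P w := by
  obtain ⟨l, z', e⟩ := hQ
  exact ⟨l, z', h.trans e⟩

/-- A set is chart-open if it is open in every chart. -/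
def Space.IsChartOpen (S : Space) (U : Set S.Pt) : Prop :=
  ∀ k, IsOpen {z | z ∈ (S.chart k).dom ∧ (S.chart k).par z ∈ U}

theorem Space.IsAtlas.isChartOpen_iUnion (hS : S.IsAtlas) {ι : Type*} {Q : ι → Patch S.Pt}
    (h : ∀ i, ∀ w ∈ (Q i).dom, S.IsLocalPatch (Q i) w) :
    S.IsChartOpen (⋃ i, (Q i).par '' (Q i).dom) := by
  intro k
  rw [isOpen_iff_mem_nhds]
  rintro z ⟨hz, hzU⟩
  obtain ⟨i, w, hw, e⟩ := mem_iUnion.1 hzU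
  obtain ⟨l, z', e'⟩ := h i w hw
  obtain ⟨g, -, hg⟩ := ((hS.locEquiv hz e'.mem.2.1 (e.symm.trans e'.mem.2.2)).trans
    e'.symm).isTransition
  filter_upwards [hg.2] with v hv
  exact ⟨hv.1, mem_iUnion.2 ⟨i, g v, hv.2.1, hv.2.2⟩⟩

end Patches

/-! ### Blow ups of families -/

theorem recip_eq_recip {x y : ℂ} : recip x = recip y ↔ x = y := by
  unfold recip
  split_ifs with h1 h2 h2
  · simp [h1, h2]
  · simp [h1, Ne.symm h2]
  · simp [h1, h2]
  · simp

theorem coe_eq_recip {x y : ℂ} : ((x : ℂ) : OnePoint ℂ) = recip y ↔ x * y = 1 := by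
  unfold recip
  split_ifs with h
  · simp [h]
  · rw [OnePoint.coe_eq_coe]
    exact ⟨fun e => by rw [e]; exact inv_mul_cancel₀ h, fun e => eq_inv_of_mul_eq_one_left e⟩

theorem sphereChart_self {s : Bool} {x y : ℂ} : sphereChart s x = sphereChart s y ↔ x = y := by
  cases s <;> simp [sphereChart, recip_eq_recip]

theorem sphereChart_ne {s s' : Bool} (h : s ≠ s') {x y : ℂ} :
    sphereChart s x = sphereChart s' y ↔ x * y = 1 := by
  cases s <;> cases s' <;> simp_all [sphereChart, coe_eq_recip]
  rw [eq_comm, coe_eq_recip, mul_comm]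

theorem isOpen_B : IsOpen B := by
  have : B = {0}ᶜ ∩ {1}ᶜ := by ext t; simp [B]
  rw [this]
  exact isOpen_compl_singleton.inter isOpen_compl_singleton

/-- The blow down map of the chart `(u, v)` (for `s = false`) or `(U, V)` (for `s = true`). -/
def blowDown (a b : ℂ → ℂ) (s : Bool) (z : C3) : C3 :=
  (a z.2.2 + (if s then z.2.1 else z.1 * z.2.1), b z.2.2 + (if s then z.1 * z.2.1 else z.2.1),
    z.2.2)

/-- The inverse of the blow down map, away from the exceptional line. -/
def blowDownInv (a b : ℂ → ℂ) (s : Bool) (z : C3) : C3 :=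
  (if s then (z.2.1 - b z.2.2) / (z.1 - a z.2.2) else (z.1 - a z.2.2) / (z.2.1 - b z.2.2),
    if s then z.1 - a z.2.2 else z.2.1 - b z.2.2, z.2.2)

theorem analyticAt_blowDown {a b : ℂ → ℂ} {s : Bool} {z : C3} (ha : AnalyticAt ℂ a z.2.2)
    (hb : AnalyticAt ℂ b z.2.2) : AnalyticAt ℂ (blowDown a b s) z := by
  unfold blowDown
  cases s <;> simp only [if_true, Bool.false_eq_true, if_false] <;> fun_prop

theorem locInv_blowDown {a b : ℂ → ℂ} {s : Bool} {z : C3} (ha : AnalyticAt ℂ a z.2.2)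
    (hb : AnalyticAt ℂ b z.2.2) (hz : z.2.1 ≠ 0) :
    LocInv (blowDown a b s) (blowDownInv a b s) z := by
  obtain ⟨u, v, t⟩ := z
  simp only at ha hb hz
  cases s
  · have h0 : (blowDown a b false (u, v, t)).2.1 - b (blowDown a b false (u, v, t)).2.2 ≠ 0 := by
      simp [blowDown, hz]
    have hc : ContinuousAt (fun w : C3 => w.2.1 - b w.2.2) (blowDown a b false (u, v, t)) := by
      have := hb.continuousAt
      fun_prop (disch := assumption)
    refine ⟨analyticAt_blowDown ha hb, ?_, ?_, ?_⟩
    · unfold blowDownInv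
      simp only [Bool.false_eq_true, if_false]
      fun_prop (disch := assumption)
    · simp [blowDown, blowDownInv, hz]
    · filter_upwards [hc.eventually_ne h0] with w hw
      simp [blowDown, blowDownInv, div_mul_cancel₀ _ hw]
  · have h0 : (blowDown a b true (u, v, t)).1 - a (blowDown a b true (u, v, t)).2.2 ≠ 0 := by
      simp [blowDown, hz]
    have hc : ContinuousAt (fun w : C3 => w.1 - a w.2.2) (blowDown a b true (u, v, t)) := by
      have := ha.continuousAt
      fun_prop (disch := assumption)
    refine ⟨analyticAt_blowDown ha hb, ?_, ?_, ?_⟩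
    · unfold blowDownInv
      simp only [if_true]
      fun_prop (disch := assumption)
    · simp [blowDown, blowDownInv, hz]
    · filter_upwards [hc.eventually_ne h0] with w hw
      simp [blowDown, blowDownInv, div_mul_cancel₀ _ hw]

theorem blowDown_injOn_ne {a b : ℂ → ℂ} {s : Bool} {z z' : C3} (hz : z.2.1 ≠ 0)
    (h : blowDown a b s z = blowDown a b s z') : z = z' := by
  obtain ⟨u, v, t⟩ := z
  obtain ⟨u', v', t'⟩ := z'
  cases s <;> simp only [blowDown, if_true, Bool.false_eq_true, if_false, Prod.mk.injEq] at h <;>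
    obtain ⟨h1, h2, rfl⟩ := h
  · obtain rfl := add_left_cancel h2
    obtain rfl := mul_right_cancel₀ hz (add_left_cancel h1)
    rfl
  · obtain rfl := add_left_cancel h1
    obtain rfl := mul_right_cancel₀ hz (add_left_cancel h2)
    rfl

theorem blowDown_eq_center {a b : ℂ → ℂ} {s : Bool} {z : C3} :
    blowDown a b s z = (a z.2.2, b z.2.2, z.2.2) ↔ z.2.1 = 0 := by
  cases s <;> simp only [blowDown, if_true, Bool.false_eq_true, if_false, Prod.mk.injEq] <;>
    constructor <;> intro h <;> simp_all

section BlowUp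

variable {S : Space} {J : Type} {k : J → S.Ix} {a b : J → ℂ → ℂ}

/-- The centres of a blow up are distinct points of their charts which depend holomorphically on
`t`, and each of them is closed in the total space. -/
structure Space.Admissible (S : Space) {J : Type} (k : J → S.Ix) (a b : J → ℂ → ℂ) : Prop where
  analytic_fst : ∀ j, ∀ t ∈ B, AnalyticAt ℂ (a j) t
  analytic_snd : ∀ j, ∀ t ∈ B, AnalyticAt ℂ (b j) t
  mem : ∀ j, ∀ t ∈ B, (a j t, b j t, t) ∈ (S.chart (k j)).dom
  distinct : ∀ i j, ∀ t ∈ B, S.center k a b i t = S.center k a b j t → i = j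
  closed : ∀ j i, IsOpen {z | z ∈ (S.chart i).dom ∧ (S.chart i).par z ≠ S.center k a b j z.2.2}

/-- The point of the blow up that corresponds to a point `p` which is not a centre. -/
def offPt (k : J → S.Ix) (a b : J → ℂ → ℂ) (p : S.Pt) : (S.blowUp k a b).Pt := Sum.inl p

/-- The point `u` of the `j`-th exceptional line over `t`. -/
def excPt (k : J → S.Ix) (a b : J → ℂ → ℂ) (j : J) (t : ℂ) (u : OnePoint ℂ) :
    (S.blowUp k a b).Pt := Sum.inr (j, t, u)

/-- The index of the chart `i` of `S` as a chart of the blow up. -/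
def offIx (k : J → S.Ix) (a b : J → ℂ → ℂ) (i : S.Ix) : (S.blowUp k a b).Ix := Sum.inl i

/-- The index of the chart `(u, v)` or `(U, V)` at the `j`-th centre. -/
def excIx (k : J → S.Ix) (a b : J → ℂ → ℂ) (j : J) (s : Bool) : (S.blowUp k a b).Ix :=
  Sum.inr (j, s)

theorem offPt_inj {p q : S.Pt} : offPt k a b p = offPt k a b q ↔ p = q := Sum.inl_injective.eq_iff

theorem excPt_inj {j j' : J} {t t' : ℂ} {u u' : OnePoint ℂ} :
    excPt k a b j t u = excPt k a b j' t' u' ↔ j = j' ∧ t = t' ∧ u = u' :=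
  Sum.inr_injective.eq_iff.trans (by rw [Prod.mk.injEq, Prod.mk.injEq])

theorem offPt_ne_excPt {p : S.Pt} {j : J} {t : ℂ} {u : OnePoint ℂ} :
    offPt k a b p ≠ excPt k a b j t u := Sum.inl_ne_inr

theorem blowUp_pt_cases (q : (S.blowUp k a b).Pt) :
    (∃ p, q = offPt k a b p) ∨ ∃ j t u, q = excPt k a b j t u := by
  rcases q with p | ⟨j, t, u⟩
  · exact Or.inl ⟨p, rfl⟩
  · exact Or.inr ⟨j, t, u, rfl⟩

theorem blowUp_ix_cases (c : (S.blowUp k a b).Ix) :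
    (∃ i, c = offIx k a b i) ∨ ∃ j s, c = excIx k a b j s := by
  rcases c with i | ⟨j, s⟩
  · exact Or.inl ⟨i, rfl⟩
  · exact Or.inr ⟨j, s, rfl⟩

theorem offPt_mem_carrier {p : S.Pt} : offPt k a b p ∈ (S.blowUp k a b).carrier ↔
    p ∈ S.carrier ∧ ∀ j, ∀ t ∈ B, p ≠ S.center k a b j t := by
  constructor
  · rintro (⟨p', h1, h2, h3⟩ | ⟨j, t, -, u, h⟩)
    · rw [Sum.inl_injective h3]
      exact ⟨h1, h2⟩
    · exact absurd h offPt_ne_excPt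
  · exact fun h => Or.inl ⟨p, h.1, h.2, rfl⟩

theorem excPt_mem_carrier {j : J} {t : ℂ} {u : OnePoint ℂ} :
    excPt k a b j t u ∈ (S.blowUp k a b).carrier ↔ t ∈ B := by
  constructor
  · rintro (⟨p', h1, h2, h3⟩ | ⟨j, t, h, u, e⟩)
    · exact absurd h3.symm offPt_ne_excPt
    · rwa [(excPt_inj.1 e).2.1]
  · exact fun h => Or.inr ⟨j, t, h, u, rfl⟩

theorem blowUp_base_offPt {p : S.Pt} : (S.blowUp k a b).base (offPt k a b p) = S.base p := rfl

theorem blowUp_base_excPt {j : J} {t : ℂ} {u : OnePoint ℂ} :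
    (S.blowUp k a b).base (excPt k a b j t u) = t := rfl

theorem blowUp_dom_off (i : S.Ix) : ((S.blowUp k a b).chart (offIx k a b i)).dom =
    {z | z ∈ (S.chart i).dom ∧ ∀ j, (S.chart i).par z ≠ S.center k a b j z.2.2} := rfl

theorem blowUp_dom_exc (j : J) (s : Bool) : ((S.blowUp k a b).chart (excIx k a b j s)).dom =
    {z | z.2.2 ∈ B ∧ blowDown (a j) (b j) s z ∈ (S.chart (k j)).dom ∧
      (z.2.1 ≠ 0 → ∀ i, (S.chart (k j)).par (blowDown (a j) (b j) s z) ≠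
        S.center k a b i z.2.2)} := by
  cases s <;> rfl

theorem blowUp_par_exc_zero {j : J} {s : Bool} {z : C3} (hz : z.2.1 = 0) :
    ((S.blowUp k a b).chart (excIx k a b j s)).par z =
      excPt k a b j z.2.2 (sphereChart s z.1) := by
  cases s <;> exact if_pos hz

theorem blowUp_par_exc_ne {j : J} {s : Bool} {z : C3} (hz : z.2.1 ≠ 0) :
    ((S.blowUp k a b).chart (excIx k a b j s)).par z =
      offPt k a b ((S.chart (k j)).par (blowDown (a j) (b j) s z)) := by
  cases s <;> exact if_neg hz

theorem Space.Admissible.mem_dom_exceptional (h : S.Admissible k a b) {j : J} {s : Bool} {u t : ℂ}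
    (ht : t ∈ B) : (u, 0, t) ∈ ((S.blowUp k a b).chart (excIx k a b j s)).dom := by
  rw [blowUp_dom_exc]
  refine ⟨ht, ?_, fun h => absurd rfl h⟩
  have : blowDown (a j) (b j) s (u, 0, t) = (a j t, b j t, t) := blowDown_eq_center.2 rfl
  rw [this]
  exact h.mem j t ht

theorem Space.Admissible.base_center (h : S.Admissible k a b) (hS : S.IsAtlas) {j : J} {t : ℂ}
    (ht : t ∈ B) : S.base (S.center k a b j t) = t := hS.base (h.mem j t ht)

variable [Finite J]

theorem Space.IsAtlas.isOpen_avoid (hS : S.IsAtlas) (h : S.Admissible k a b) (i : S.Ix)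
    (p : J → Prop) : IsOpen {z | z ∈ (S.chart i).dom ∧
      ∀ j, p j → (S.chart i).par z ≠ S.center k a b j z.2.2} := by
  have : {z | z ∈ (S.chart i).dom ∧ ∀ j, p j → (S.chart i).par z ≠ S.center k a b j z.2.2} =
      (S.chart i).dom ∩ ⋂ j : {j // p j}, {z | z ∈ (S.chart i).dom ∧
        (S.chart i).par z ≠ S.center k a b j z.2.2} := by
    ext z
    simp only [mem_ofPred_eq, mem_inter_iff, mem_iInter, Subtype.forall]
    exact ⟨fun ⟨h1, h2⟩ => ⟨h1, fun j hj => ⟨h1, h2 j hj⟩⟩,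
      fun ⟨h1, h2⟩ => ⟨h1, fun j hj => (h2 j hj).2⟩⟩
  rw [this]
  exact (hS.isOpen i).inter (isOpen_iInter_of_finite fun j => h.closed j i)

theorem Space.IsAtlas.isOpen_blowUp_exc (hS : S.IsAtlas) (h : S.Admissible k a b) (j : J)
    (s : Bool) : IsOpen ((S.blowUp k a b).chart (excIx k a b j s)).dom := by
  rw [blowUp_dom_exc, isOpen_iff_mem_nhds]
  rintro z ⟨ht, hz, hv⟩
  have hc : ContinuousAt (blowDown (a j) (b j) s) z :=
    (analyticAt_blowDown (h.analytic_fst j _ ht) (h.analytic_snd j _ ht)).continuousAt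
  have hB : ∀ᶠ w : C3 in 𝓝 z, w.2.2 ∈ B :=
    (continuous_snd.comp continuous_snd).continuousAt.eventually (isOpen_B.mem_nhds ht)
  by_cases hv0 : z.2.1 = 0
  · have e : blowDown (a j) (b j) s z = (a j z.2.2, b j z.2.2, z.2.2) := blowDown_eq_center.2 hv0
    have := hc.eventually ((hS.isOpen_avoid h (k j) (fun i => i ≠ j)).mem_nhds
      ⟨hz, fun i hi hij => hi (h.distinct _ _ _ ht (by rw [e] at hij; exact hij.symm))⟩)
    filter_upwards [hB, this] with w h1 h2
    refine ⟨h1, h2.1, fun hw i hi => ?_⟩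
    by_cases hij : i = j
    · subst hij
      exact hw (blowDown_eq_center.1 ((hS.isPatch _).injOn h2.1 (h.mem _ _ h1) hi))
    · exact h2.2 i hij hi
  · have := hc.eventually ((hS.isOpen_avoid h (k j) (fun _ => True)).mem_nhds
      ⟨hz, fun i _ => hv hv0 i⟩)
    filter_upwards [hB, this] with w h1 h2
    exact ⟨h1, h2.1, fun _ i => h2.2 i trivial⟩

theorem Space.IsAtlas.isOpen_blowUp (hS : S.IsAtlas) (h : S.Admissible k a b)
    (c : (S.blowUp k a b).Ix) : IsOpen ((S.blowUp k a b).chart c).dom := by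
  rcases blowUp_ix_cases c with ⟨i, rfl⟩ | ⟨j, s, rfl⟩
  · have := hS.isOpen_avoid h i (fun _ => True)
    simpa [blowUp_dom_off] using this
  · exact hS.isOpen_blowUp_exc h j s

/-- Off the exceptional line, the charts of a blow up are those of the original family, composed
with the blow down map. -/
theorem Space.IsAtlas.locEquiv_blowDown (hS : S.IsAtlas) (h : S.Admissible k a b) {j : J}
    {s : Bool} {z : C3} (hz : z ∈ ((S.blowUp k a b).chart (excIx k a b j s)).dom)
    (hv : z.2.1 ≠ 0) :
    LocEquiv ((S.blowUp k a b).chart (excIx k a b j s)) ((S.blowUp k a b).chart (offIx k a b (k j)))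
      z (blowDown (a j) (b j) s z) := by
  have hz' := hz
  rw [blowUp_dom_exc] at hz'
  refine LocEquiv.of_locInv (locInv_blowDown (h.analytic_fst j _ hz'.1) (h.analytic_snd j _ hz'.1)
    hv) ((hS.isOpen_blowUp h _).mem_nhds hz) ((hS.isOpen_blowUp h _).mem_nhds
      ⟨hz'.2.1, hz'.2.2 hv⟩) ?_
  have : ∀ᶠ w : C3 in 𝓝 z, w.2.1 ≠ 0 :=
    (continuous_fst.comp continuous_snd).continuousAt.eventually_ne hv
  filter_upwards [this] with w hw
  rw [blowUp_par_exc_ne hw]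
  rfl

theorem Space.IsAtlas.locEquiv_off (hS : S.IsAtlas) (h : S.Admissible k a b) {i i' : S.Ix}
    {z z' : C3} (hz : z ∈ ((S.blowUp k a b).chart (offIx k a b i)).dom)
    (hz' : z' ∈ ((S.blowUp k a b).chart (offIx k a b i')).dom)
    (e : (S.chart i).par z = (S.chart i').par z') :
    LocEquiv ((S.blowUp k a b).chart (offIx k a b i)) ((S.blowUp k a b).chart (offIx k a b i'))
      z z' :=
  (hS.locEquiv hz.1 hz'.1 e).transfer ((hS.isOpen_blowUp h _).mem_nhds hz)
    ((hS.isOpen_blowUp h _).mem_nhds hz') fun _ _ _ _ e => congrArg (offPt k a b) e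

theorem Space.IsAtlas.exists_locEquiv_off (hS : S.IsAtlas) (h : S.Admissible k a b)
    {c : (S.blowUp k a b).Ix} {z : C3} (hz : z ∈ ((S.blowUp k a b).chart c).dom) {p : S.Pt}
    (e : ((S.blowUp k a b).chart c).par z = offPt k a b p) :
    ∃ i z', LocEquiv ((S.blowUp k a b).chart c) ((S.blowUp k a b).chart (offIx k a b i)) z z' ∧
      (S.chart i).par z' = p := by
  rcases blowUp_ix_cases c with ⟨i, rfl⟩ | ⟨j, s, rfl⟩
  · exact ⟨i, z, LocEquiv.refl ((hS.isOpen_blowUp h _).mem_nhds hz), offPt_inj.1 e⟩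
  · by_cases hv : z.2.1 = 0
    · rw [blowUp_par_exc_zero hv] at e
      exact absurd e.symm offPt_ne_excPt
    · rw [blowUp_par_exc_ne hv] at e
      exact ⟨k j, _, hS.locEquiv_blowDown h hz hv, offPt_inj.1 e⟩

theorem locInv_flip {u t : ℂ} (hu : u ≠ 0) : LocInv (fun w : C3 => (w.1⁻¹, w.1 * w.2.1, w.2.2))
    (fun w : C3 => (w.1⁻¹, w.1 * w.2.1, w.2.2)) (u, 0, t) := by
  refine ⟨?_, ?_, by simp, ?_⟩
  · fun_prop (disch := assumption)
  · have : u⁻¹ ≠ 0 := inv_ne_zero hu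
    fun_prop (disch := assumption)
  · have : ∀ᶠ w : C3 in 𝓝 (u⁻¹, u * 0, t), w.1 ≠ 0 :=
      continuous_fst.continuousAt.eventually_ne (inv_ne_zero hu)
    filter_upwards [this] with w hw
    simp [inv_mul_cancel_left₀ hw]

omit [Finite J] in
theorem blowDown_flip {a b : ℂ → ℂ} {s s' : Bool} (hs : s ≠ s') {w : C3} (hw : w.1 ≠ 0) :
    blowDown a b s' (w.1⁻¹, w.1 * w.2.1, w.2.2) = blowDown a b s w := by
  cases s <;> cases s' <;> simp_all [blowDown]

theorem Space.IsAtlas.locEquiv_exc (hS : S.IsAtlas) (h : S.Admissible k a b) {j : J}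
    {s s' : Bool} {t u u' : ℂ} (ht : t ∈ B) (e : sphereChart s u = sphereChart s' u') :
    LocEquiv ((S.blowUp k a b).chart (excIx k a b j s)) ((S.blowUp k a b).chart (excIx k a b j s'))
      (u, 0, t) (u', 0, t) := by
  have ho := fun (s : Bool) (u : ℂ) => (hS.isOpen_blowUp h _).mem_nhds
    (h.mem_dom_exceptional (j := j) (s := s) (u := u) ht)
  by_cases hs : s = s'
  · subst hs
    rw [sphereChart_self.1 e]
    exact LocEquiv.refl (ho _ _)
  · have hu := (sphereChart_ne hs).1 e
    have hu0 : u ≠ 0 := left_ne_zero_of_mul_eq_one hu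
    obtain rfl : u' = u⁻¹ := eq_inv_of_mul_eq_one_right hu
    have hg : (u⁻¹, (0 : ℂ), t) = (fun w : C3 => (w.1⁻¹, w.1 * w.2.1, w.2.2)) (u, 0, t) := by
      simp
    have ho' := ho s' u⁻¹
    rw [hg] at ho' ⊢
    refine LocEquiv.of_locInv (locInv_flip hu0) (ho _ _) ho' ?_
    have : ∀ᶠ w : C3 in 𝓝 (u, 0, t), w.1 ≠ 0 := continuous_fst.continuousAt.eventually_ne hu0
    filter_upwards [this] with w hw
    by_cases hv : w.2.1 = 0
    · rw [blowUp_par_exc_zero hv, blowUp_par_exc_zero (by simp [hv]),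
        (sphereChart_ne hs).2 (mul_inv_cancel₀ hw)]
    · rw [blowUp_par_exc_ne hv, blowUp_par_exc_ne (by simp [hv, hw]), blowDown_flip hs hw]

/-- The blow up of a family at admissible centres is again a family of complex surfaces: its
charts are compatible with each other. -/
theorem Space.IsAtlas.blowUp (hS : S.IsAtlas) (h : S.Admissible k a b) :
    (S.blowUp k a b).IsAtlas := by
  refine Space.isAtlas_of_locEquiv (hS.isOpen_blowUp h) ?_ ?_ ?_ ?_ ?_
  · intro c z hz
    have key : ∀ p ∈ S.carrier, S.base p = z.2.2 → (∀ j, p ≠ S.center k a b j z.2.2) →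
        offPt k a b p ∈ (S.blowUp k a b).carrier := by
      refine fun p hp hb hc => offPt_mem_carrier.2 ⟨hp, fun j t ht e => hc j ?_⟩
      rw [e, h.base_center hS ht] at hb
      rw [← hb, e]
    rcases blowUp_ix_cases c with ⟨i, rfl⟩ | ⟨j, s, rfl⟩
    · exact key _ ((hS.isPatch i).mapsTo hz.1) (hS.base hz.1) hz.2
    · rw [blowUp_dom_exc] at hz
      by_cases hv : z.2.1 = 0
      · rw [blowUp_par_exc_zero hv]
        exact excPt_mem_carrier.2 hz.1
      · rw [blowUp_par_exc_ne hv]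
        exact key _ ((hS.isPatch _).mapsTo hz.2.1) (hS.base hz.2.1) (hz.2.2 hv)
  · intro c z hz z' hz' e
    rcases blowUp_ix_cases c with ⟨i, rfl⟩ | ⟨j, s, rfl⟩
    · exact (hS.isPatch i).injOn hz.1 hz'.1 (offPt_inj.1 e)
    · rw [blowUp_dom_exc] at hz hz'
      by_cases hv : z.2.1 = 0 <;> by_cases hv' : z'.2.1 = 0
      · rw [blowUp_par_exc_zero hv, blowUp_par_exc_zero hv', excPt_inj, sphereChart_self] at e
        exact Prod.ext e.2.2 (Prod.ext (hv.trans hv'.symm) e.2.1)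
      · rw [blowUp_par_exc_zero hv, blowUp_par_exc_ne hv'] at e
        exact absurd e.symm offPt_ne_excPt
      · rw [blowUp_par_exc_ne hv, blowUp_par_exc_zero hv'] at e
        exact absurd e offPt_ne_excPt
      · rw [blowUp_par_exc_ne hv, blowUp_par_exc_ne hv'] at e
        exact blowDown_injOn_ne hv ((hS.isPatch _).injOn hz.2.1 hz'.2.1 (offPt_inj.1 e))
  · intro c z hz
    rcases blowUp_ix_cases c with ⟨i, rfl⟩ | ⟨j, s, rfl⟩
    · exact hS.base hz.1
    · rw [blowUp_dom_exc] at hz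
      by_cases hv : z.2.1 = 0
      · rw [blowUp_par_exc_zero hv, blowUp_base_excPt]
      · rw [blowUp_par_exc_ne hv, blowUp_base_offPt]
        exact hS.base hz.2.1
  · intro c z hz
    rcases blowUp_ix_cases c with ⟨i, rfl⟩ | ⟨j, s, rfl⟩
    · exact hS.time _ _ hz.1
    · rw [blowUp_dom_exc] at hz
      exact hz.1
  · intro c c' z hz z' hz' e
    rcases blowUp_pt_cases (((S.blowUp k a b).chart c).par z) with ⟨p, hp⟩ | ⟨j, t, u, hp⟩
    · obtain ⟨i, y, h1, h2⟩ := hS.exists_locEquiv_off h hz hp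
      obtain ⟨i', y', h1', h2'⟩ := hS.exists_locEquiv_off h hz' (e.symm.trans hp)
      exact (h1.trans (hS.locEquiv_off h h1.mem.2.1 h1'.mem.2.1 (h2.trans h2'.symm))).trans h1'.symm
    · have key : ∀ c z, z ∈ ((S.blowUp k a b).chart c).dom →
          ((S.blowUp k a b).chart c).par z = excPt k a b j t u →
          ∃ s u', c = excIx k a b j s ∧ z = (u', 0, t) ∧ sphereChart s u' = u ∧ t ∈ B := by
        intro c z hz e
        rcases blowUp_ix_cases c with ⟨i, rfl⟩ | ⟨j', s, rfl⟩
        · exact absurd e offPt_ne_excPt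
        · by_cases hv : z.2.1 = 0
          · rw [blowUp_par_exc_zero hv, excPt_inj] at e
            rw [blowUp_dom_exc] at hz
            obtain ⟨rfl, rfl, e⟩ := e
            exact ⟨s, z.1, rfl, Prod.ext rfl (Prod.ext hv rfl), e, hz.1⟩
          · rw [blowUp_par_exc_ne hv] at e
            exact absurd e offPt_ne_excPt
      obtain ⟨s, v, rfl, rfl, h1, ht⟩ := key c z hz hp
      obtain ⟨s', v', rfl, rfl, h2, -⟩ := key c' z' hz' (e.symm.trans hp)
      exact hS.locEquiv_exc h ht (h1.trans h2.symm)

/-- A patch that avoids the centres stays a patch of the blow up. -/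
theorem Space.IsLocalPatch.blowUp (hS : S.IsAtlas) (h : S.Admissible k a b) {Q : Patch S.Pt}
    {Q' : Patch (S.blowUp k a b).Pt} {w : C3} (hQ : S.IsLocalPatch Q w)
    (hd : Q'.dom ∈ 𝓝 w) (hpar : ∀ v, Q'.par v = offPt k a b (Q.par v))
    (hw : ∀ j, ∀ t ∈ B, Q.par w ≠ S.center k a b j t) :
    (S.blowUp k a b).IsLocalPatch Q' w := by
  obtain ⟨l, z, e⟩ := hQ
  refine ⟨offIx k a b l, z, e.transfer hd ((hS.isOpen_blowUp h _).mem_nhds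
    ⟨e.mem.2.1, fun j hj => hw j _ (hS.time _ _ e.mem.2.1) (e.mem.2.2.trans hj)⟩) ?_⟩
  intro w' _ z' _ e
  rw [hpar, e]; rfl

omit [Finite J] in
/-- A chart-open set of the blow up which avoids a curve away from the exceptional lines avoids
its proper transform. -/
theorem Space.IsChartOpen.disjoint_properTransform {U : Set (S.blowUp k a b).Pt}
    (hU : (S.blowUp k a b).IsChartOpen U) {C : Set S.Pt} (h : ∀ p ∈ C, offPt k a b p ∉ U)
    {q : (S.blowUp k a b).Pt} (hq : q ∈ S.properTransform k a b C) : q ∉ U := by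
  intro hqU
  rcases hq.2 with ⟨p, hp, rfl⟩ | ⟨-, i, z, hz, rfl, hcl⟩
  · exact h p hp hqU
  · obtain ⟨w, hw, -, p, hp, e⟩ := mem_closure_iff.1 hcl _ (hU i) ⟨hz, hqU⟩
    refine h p hp ?_
    have := hw.2
    rw [e] at this
    exact this

omit [Finite J] in
/-- The part of a chart-open set away from the exceptional lines is chart-open before the
blow up. -/
theorem Space.IsChartOpen.of_blowUp {U : Set (S.blowUp k a b).Pt} (hS : S.IsAtlas)
    (hU : (S.blowUp k a b).IsChartOpen U) (hc : U ⊆ (S.blowUp k a b).carrier) :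
    S.IsChartOpen {p | offPt k a b p ∈ U} := by
  intro i
  convert hU (offIx k a b i) using 1
  ext z
  exact ⟨fun hz => ⟨⟨hz.1, fun j hj => (offPt_mem_carrier.1 (hc hz.2)).2 j _ (hS.time _ _ hz.1) hj⟩,
    hz.2⟩, fun hz => ⟨hz.1.1, hz.2⟩⟩

omit [Finite J] in
theorem offPt_mem_properTransform {C : Set S.Pt} {p : S.Pt} (hp : p ∈ C)
    (h : offPt k a b p ∈ (S.blowUp k a b).carrier) :
    offPt k a b p ∈ S.properTransform k a b C :=
  ⟨h, Or.inl ⟨p, hp, rfl⟩⟩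

/-- The point of an exceptional line in the direction `u = 0` (for `s = false`) or `U = 0` (for
`s = true`) lies on the proper transform of a curve containing the points in that direction. -/
theorem excPt_mem_properTransform (hS : S.IsAtlas) (h : S.Admissible k a b) {C : Set S.Pt} {j : J}
    (s : Bool) {t : ℂ} (ht : t ∈ B)
    (hC : ∀ v : ℂ, v ≠ 0 → blowDown (a j) (b j) s (0, v, t) ∈ (S.chart (k j)).dom →
      (S.chart (k j)).par (blowDown (a j) (b j) s (0, v, t)) ∈ C) :
    excPt k a b j t (sphereChart s 0) ∈ S.properTransform k a b C := by
  have hz := h.mem_dom_exceptional (j := j) (s := s) (u := 0) ht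
  refine ⟨excPt_mem_carrier.2 ht, Or.inr ⟨⟨_, rfl⟩, excIx k a b j s, (0, 0, t), hz,
    blowUp_par_exc_zero rfl, ?_⟩⟩
  have hlim : Tendsto (fun v : ℂ => ((0, v, t) : C3)) (𝓝[≠] 0) (𝓝 (0, 0, t)) := by
    have : Continuous fun v : ℂ => ((0, v, t) : C3) := by fun_prop
    exact (this.tendsto 0).mono_left nhdsWithin_le_nhds
  refine mem_closure_of_tendsto hlim ?_
  filter_upwards [hlim.eventually ((hS.isOpen_blowUp h _).mem_nhds hz), self_mem_nhdsWithin]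
    with v h1 h2
  have h2 : v ≠ 0 := h2
  refine ⟨h1, _, ?_, blowUp_par_exc_ne h2⟩
  rw [blowUp_dom_exc] at h1
  exact hC v h2 h1.2.1

/-- Sections of exceptional lines are closed. -/
theorem isOpen_ne_excPt (hS : S.IsAtlas) (h : S.Admissible k a b) (j : J) (s : Bool)
    {c : ℂ → ℂ} (hc : ContinuousOn c B) (i : (S.blowUp k a b).Ix) :
    IsOpen {z | z ∈ ((S.blowUp k a b).chart i).dom ∧
      ((S.blowUp k a b).chart i).par z ≠ excPt k a b j z.2.2 (sphereChart s (c z.2.2))} := by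
  have ho := hS.isOpen_blowUp h i
  rcases blowUp_ix_cases i with ⟨i, rfl⟩ | ⟨j', s', rfl⟩
  · convert ho using 1
    ext z
    exact ⟨fun hz => hz.1, fun hz => ⟨hz, offPt_ne_excPt⟩⟩
  by_cases hj : j' = j
  · subst hj
    have hcc : ContinuousOn (fun z : C3 => c z.2.2)
        ((S.blowUp k a b).chart (excIx k a b j' s')).dom := by
      refine hc.comp (by fun_prop) fun z hz => ?_
      rw [blowUp_dom_exc] at hz
      exact hz.1
    have key : ∀ F : C3 → ℂ, ContinuousOn F ((S.blowUp k a b).chart (excIx k a b j' s')).dom →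
        (∀ z : C3, sphereChart s' z.1 = sphereChart s (c z.2.2) ↔ F z = 0) →
        IsOpen {z | z ∈ ((S.blowUp k a b).chart (excIx k a b j' s')).dom ∧
        ((S.blowUp k a b).chart (excIx k a b j' s')).par z ≠
          excPt k a b j' z.2.2 (sphereChart s (c z.2.2))} := by
      intro F hF hiff
      have h1 := hF.isOpen_inter_preimage ho (isOpen_compl_singleton (x := (0 : ℂ)))
      have h2 := (show ContinuousOn (fun z : C3 => z.2.1) _ by fun_prop).isOpen_inter_preimage ho
        (isOpen_compl_singleton (x := (0 : ℂ)))
      convert h1.union h2 using 1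
      ext z
      rw [mem_union, mem_inter_iff, mem_inter_iff, ← and_or_left]
      refine and_congr_right fun _ => ?_
      by_cases hv : z.2.1 = 0
      · rw [blowUp_par_exc_zero hv]
        simp [hv, hiff, excPt_inj]
      · rw [blowUp_par_exc_ne hv]
        simp [hv, offPt_ne_excPt]
    by_cases hs : s' = s
    · subst hs
      exact key (fun z => z.1 - c z.2.2) ((by fun_prop : ContinuousOn (fun z : C3 => z.1) _).sub hcc)
        fun z => by rw [sphereChart_self, sub_eq_zero]
    · exact key (fun z => z.1 * c z.2.2 - 1)
        (((by fun_prop : ContinuousOn (fun z : C3 => z.1) _).mul hcc).sub continuousOn_const)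
        fun z => by rw [sphereChart_ne hs, sub_eq_zero]
  · convert ho using 1
    ext z
    refine ⟨fun hz => hz.1, fun hz => ⟨hz, ?_⟩⟩
    by_cases hv : z.2.1 = 0
    · rw [blowUp_par_exc_zero hv, Ne, excPt_inj]
      exact fun h => hj h.1
    · rw [blowUp_par_exc_ne hv]
      exact offPt_ne_excPt

omit [Finite J] in
theorem center_excIx {I : Type} {j : I → J} {s : I → Bool} {c : I → ℂ → ℂ} (i : I) (t : ℂ) :
    (S.blowUp k a b).center (fun i => excIx k a b (j i) (s i)) c (fun _ _ => 0) i t =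
      excPt k a b (j i) t (sphereChart (s i) (c i t)) := by
  rw [Space.center, blowUp_par_exc_zero rfl]

/-- Admissible centres on the exceptional lines of a blow up: the points `u = c i t` of the charts
`(j i, s i)`. -/
theorem Space.Admissible.exceptional (hS : S.IsAtlas) (h : S.Admissible k a b) {I : Type}
    {j : I → J} {s : I → Bool} {c : I → ℂ → ℂ} (hc : ∀ i, ∀ t ∈ B, AnalyticAt ℂ (c i) t)
    (hd : ∀ i i', ∀ t ∈ B, j i = j i' → sphereChart (s i) (c i t) = sphereChart (s i') (c i' t) →
      i = i') :
    (S.blowUp k a b).Admissible (fun i => excIx k a b (j i) (s i)) c (fun _ _ => 0) where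
  analytic_fst := hc
  analytic_snd _ _ _ := analyticAt_const
  mem i t ht := h.mem_dom_exceptional ht
  distinct i i' t ht e := by
    rw [center_excIx, center_excIx, excPt_inj] at e
    exact hd i i' t ht e.1 e.2.2
  closed i l := by
    have := isOpen_ne_excPt hS h (j i) (s i)
      (fun t ht => (hc i t ht).continuousAt.continuousWithinAt) l
    convert this using 4
    rw [center_excIx]

end BlowUp

/-! ### Open subfamilies -/

theorem Space.IsAtlas.remove {S : Space} (hS : S.IsAtlas) {U D : Set S.Pt} (hU : S.IsChartOpen U)
    (hUD : ∀ p ∈ D, p ∉ U) (hc : S.carrier ⊆ U ∪ D) : (S.remove D).IsAtlas := by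
  have ho : ∀ k, IsOpen ((S.remove D).chart k).dom := by
    intro k
    convert hU k using 1
    ext z
    exact ⟨fun hz => ⟨hz.1, (hc ((hS.isPatch k).mapsTo hz.1)).resolve_right hz.2⟩,
      fun hz => ⟨hz.1, fun h => hUD _ h hz.2⟩⟩
  refine Space.isAtlas_of_locEquiv ho ?_ ?_ ?_ ?_ ?_
  · exact fun k z hz => ⟨(hS.isPatch k).mapsTo hz.1, hz.2⟩
  · exact fun k z hz z' hz' e => (hS.isPatch k).injOn hz.1 hz'.1 e
  · exact fun k z hz => hS.base hz.1
  · exact fun k z hz => hS.time k z hz.1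
  · exact fun k l z hz z' hz' e => (hS.locEquiv hz.1 hz'.1 e).transfer ((ho k).mem_nhds hz)
      ((ho l).mem_nhds hz') fun _ _ _ _ e => e

theorem Space.IsLocalPatch.remove {S : Space} {D : Set S.Pt} (hD : (S.remove D).IsAtlas)
    {Q : Patch S.Pt} {w : C3} (hQ : S.IsLocalPatch Q w) (hd : Q.dom ∈ 𝓝 w) (hw : Q.par w ∉ D) :
    (S.remove D).IsLocalPatch Q w := by
  obtain ⟨l, z, e⟩ := hQ
  exact ⟨l, z, e.transfer hd ((hD.isOpen l).mem_nhds ⟨e.mem.2.1, e.mem.2.2 ▸ hw⟩)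
    fun _ _ _ _ e => e⟩

/-! ### Two-forms on the total space -/

/-- The coefficient of `d_t x ∧ d_t y`. -/
def areaOf (A : Bil) : ℂ := A (1, 0, 0) (0, 1, 0)

/-- The vector field with `t`-component `1` in the kernel of a two-form. It is defined through a
quotient by `areaOf A`, so that it has this meaning only if `areaOf A ≠ 0`. -/
def fieldOf (A : Bil) : C3 :=
  (A (0, 1, 0) (0, 0, 1) / A (1, 0, 0) (0, 1, 0), -A (1, 0, 0) (0, 0, 1) / A (1, 0, 0) (0, 1, 0), 1)

theorem hamForm_apply (H : C3 → ℂ) (w u v : C3) : hamForm H w u v =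
    u.1 * v.2.1 - u.2.1 * v.1 + (fderiv ℂ H w u * v.2.2 - u.2.2 * fderiv ℂ H w v) := by
  simp [hamForm, wedge, dx, dy, dt]

theorem hamForm_self (H : C3 → ℂ) (w u : C3) : hamForm H w u u = 0 := by
  rw [hamForm_apply]; ring

theorem areaOf_hamForm (H : C3 → ℂ) (w : C3) : areaOf (hamForm H w) = 1 := by
  simp [areaOf, hamForm_apply]

theorem fieldOf_hamForm (H : C3 → ℂ) (w : C3) : fieldOf (hamForm H w) = hamSystem H w := by
  simp [fieldOf, hamForm_apply, hamSystem]

theorem c3_eq (u : C3) : u = u.1 • ((1, 0, 0) : C3) + u.2.1 • ((0, 1, 0) : C3) +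
    u.2.2 • ((0, 0, 1) : C3) := by
  ext <;> simp

theorem clm_apply_eq {E : Type*} [NormedAddCommGroup E] [NormedSpace ℂ E] (L : C3 →L[ℂ] E)
    (u : C3) : L u = u.1 • L (1, 0, 0) + u.2.1 • L (0, 1, 0) + u.2.2 • L (0, 0, 1) := by
  conv_lhs => rw [c3_eq u]
  simp only [map_add, map_smul]

theorem bil_apply_eq {A : Bil} (hA : ∀ u, A u u = 0) (u v : C3) : A u v =
    (u.1 * v.2.1 - u.2.1 * v.1) * A (1, 0, 0) (0, 1, 0) +
    (u.1 * v.2.2 - u.2.2 * v.1) * A (1, 0, 0) (0, 0, 1) +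
    (u.2.1 * v.2.2 - u.2.2 * v.2.1) * A (0, 1, 0) (0, 0, 1) := by
  have hs : ∀ u v, A u v = -A v u := by
    intro u v
    have := hA (u + v)
    simp only [map_add, add_apply, hA] at this
    linear_combination this
  rw [clm_apply_eq A u]
  simp only [add_apply, smul_apply, smul_eq_mul]
  rw [clm_apply_eq (A (1, 0, 0)) v, clm_apply_eq (A (0, 1, 0)) v, clm_apply_eq (A (0, 0, 1)) v,
    hA, hA, hA, hs (0, 1, 0) (1, 0, 0), hs (0, 0, 1) (1, 0, 0), hs (0, 0, 1) (0, 1, 0)]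
  simp only [smul_eq_mul]
  ring

theorem areaOf_bilinearComp {A : Bil} (hA : ∀ u, A u u = 0) {L : C3 →L[ℂ] C3}
    (hL : ∀ v, (L v).2.2 = v.2.2) : areaOf (A.bilinearComp L L) =
    areaOf A * ((L (1, 0, 0)).1 * (L (0, 1, 0)).2.1 - (L (0, 1, 0)).1 * (L (1, 0, 0)).2.1) := by
  simp only [areaOf, ContinuousLinearMap.bilinearComp_apply]
  rw [bil_apply_eq hA, hL, hL]
  ring

/-- The kernel of the pullback of a two-form is mapped to the kernel of the two-form. -/
theorem map_fieldOf_bilinearComp {A : Bil} (hA : ∀ u, A u u = 0) {L : C3 →L[ℂ] C3}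
    (hL : ∀ v, (L v).2.2 = v.2.2) (h : areaOf (A.bilinearComp L L) ≠ 0) :
    fieldOf A = L (fieldOf (A.bilinearComp L L)) := by
  have h' := h
  rw [areaOf_bilinearComp hA hL] at h
  have h0 := left_ne_zero_of_mul h
  have h1 := right_ne_zero_of_mul h
  simp only [areaOf] at h0
  rw [clm_apply_eq L]
  simp only [areaOf, ContinuousLinearMap.bilinearComp_apply] at h'
  simp only [fieldOf, ContinuousLinearMap.bilinearComp_apply]
  rw [bil_apply_eq hA] at h'
  rw [bil_apply_eq hA (L (0, 1, 0)) (L (0, 0, 1)), bil_apply_eq hA (L (1, 0, 0)) (L (0, 0, 1)),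
    bil_apply_eq hA (L (1, 0, 0)) (L (0, 1, 0))]
  simp only [hL, mul_zero, zero_mul, mul_one, sub_zero, add_zero] at h' ⊢
  have hD : (L (1, 0, 0)).1 * (L (0, 1, 0)).2.1 - (L (1, 0, 0)).2.1 * (L (0, 1, 0)).1 ≠ 0 :=
    left_ne_zero_of_mul h'
  generalize A (1, 0, 0) (0, 1, 0) = a at *
  generalize A (1, 0, 0) (0, 0, 1) = b
  generalize A (0, 1, 0) (0, 0, 1) = c
  refine Prod.ext ?_ (Prod.ext ?_ (by simp [hL]))
  all_goals
    simp only [Prod.fst_add, Prod.snd_add, Prod.smul_fst, Prod.smul_snd, smul_eq_mul]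
    clear h1 hL h' h hA
    generalize (L (1, 0, 0)).1 = p at *
    generalize (L (1, 0, 0)).2.1 = q at *
    generalize (L (0, 1, 0)).1 = r at *
    generalize (L (0, 1, 0)).2.1 = s at *
    rw [div_mul_eq_mul_div, div_mul_eq_mul_div, ← add_div, one_mul,
      div_add' _ _ _ (mul_ne_zero hD h0), div_eq_div_iff h0 (mul_ne_zero hD h0)]
    ring

theorem bilinearComp_comp (A : Bil) (L M : C3 →L[ℂ] C3) :
    (A.bilinearComp L L).bilinearComp M M = A.bilinearComp (L.comp M) (L.comp M) := by
  rfl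

theorem analyticAt_clm_apply {E F : Type*} [NormedAddCommGroup E] [NormedSpace ℂ E]
    [NormedAddCommGroup F] [NormedSpace ℂ F] {L : C3 → E →L[ℂ] F} {w : C3}
    (h : AnalyticAt ℂ L w) (u : E) : AnalyticAt ℂ (fun z => L z u) w :=
  ((ContinuousLinearMap.apply ℂ F u).analyticAt _).comp h

theorem analyticAt_smul_const {E : Type*} [NormedAddCommGroup E] [NormedSpace ℂ E] {f : C3 → ℂ}
    {w : C3} (h : AnalyticAt ℂ f w) (v : E) : AnalyticAt ℂ (fun z => f z • v) w :=
  h.smul analyticAt_const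

/-- A family of alternating forms is analytic if its three coefficients are. -/
theorem analyticAt_bil {A : C3 → Bil} {w : C3} (hA : ∀ᶠ z in 𝓝 w, ∀ u, A z u u = 0)
    (h : ∀ u v, AnalyticAt ℂ (fun z => A z u v) w) : AnalyticAt ℂ A w := by
  have hs : ∀ (v : Bil) {f : C3 → ℂ}, AnalyticAt ℂ f w → AnalyticAt ℂ (fun z => f z • v) w :=
    fun v f hf => analyticAt_smul_const hf v
  have h1 : AnalyticAt ℂ (fun z => A z (1, 0, 0) (0, 1, 0) • wedge dx dy +
      A z (1, 0, 0) (0, 0, 1) • wedge dx dt + A z (0, 1, 0) (0, 0, 1) • wedge dy dt) w :=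
    ((hs _ (h _ _)).add (hs _ (h _ _))).add (hs _ (h _ _))
  refine h1.congr ?_
  filter_upwards [hA] with z hz
  refine ContinuousLinearMap.ext fun u => ContinuousLinearMap.ext fun v => ?_
  rw [bil_apply_eq hz u v]
  simp [wedge, dx, dy, dt]
  ring

theorem IsTransition.base_fderiv {S T : Space} {P : Patch S.Pt} {Q : Patch T.Pt} {Φ : S.Pt → T.Pt}
    (hP : ∀ w ∈ P.dom, S.base (P.par w) = w.2.2) (hQ : ∀ w ∈ Q.dom, T.base (Q.par w) = w.2.2)
    (hΦ : ∀ w ∈ P.dom, T.base (Φ (P.par w)) = S.base (P.par w)) {g : C3 → C3} {w : C3}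
    (hg : IsTransition P Q Φ g w) (v : C3) : (fderiv ℂ g w v).2.2 = v.2.2 := by
  have h1 : (fun z => (g z).2.2) =ᶠ[𝓝 w] fun z => z.2.2 := by
    filter_upwards [hg.2] with z hz
    rw [← hQ _ hz.2.1, hz.2.2, hΦ _ hz.1, hP _ hz.1]
  have hd := hg.1.differentiableAt.hasFDerivAt
  have h2 : HasFDerivAt (fun z => (g z).2.2) (dt.comp (fderiv ℂ g w)) w :=
    (dt.hasFDerivAt (x := g w)).comp w hd
  have h3 : HasFDerivAt (fun z : C3 => z.2.2) dt w := dt.hasFDerivAt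
  have := (h2.congr_of_eventuallyEq h1.symm).unique h3
  exact congrArg (fun L : C3 →L[ℂ] ℂ => L v) this

/-! ### Hamiltonian atlases -/

section HamAtlas

variable {S : Space} {ι : Type}

/-- The patches `P i` cover `S`, and the two-forms `dx_i ∧ dy_i + dH_i ∧ dt` agree on overlaps. -/
structure Space.IsHamAtlas (S : Space) {ι : Type} (P : ι → Patch S.Pt) (H : ι → C3 → ℂ) :
    Prop where
  atlas : S.IsAtlas
  isPatch : ∀ i, S.IsHolomorphicPatch (P i)
  cover : S.carrier ⊆ ⋃ i, (P i).par '' (P i).dom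
  analytic : ∀ i, AnalyticOnNhd ℂ (H i) (P i).dom
  compat : ∀ i j, IsFormPullback (P i) (P j) id (hamForm (H i)) (hamForm (H j))

/-- The two-form of the form `dH_i ∧ dt + dx_i ∧ dy_i` in each patch `P i`, in the chart `k`. -/
def Space.hamTwoForm (S : Space) {ι : Type} (P : ι → Patch S.Pt) (H : ι → C3 → ℂ) (k : S.Ix)
    (z : C3) : Bil :=
  open Classical in
  if h : ∃ q : ι × (C3 → C3), IsTransition (S.chart k) (P q.1) id q.2 z then
    (hamForm (H h.choose.1) (h.choose.2 z)).bilinearComp (fderiv ℂ h.choose.2 z)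
      (fderiv ℂ h.choose.2 z)
  else 0

variable {P : ι → Patch S.Pt} {H : ι → C3 → ℂ}

theorem Space.IsHamAtlas.exists_transition (h : S.IsHamAtlas P H) {k : S.Ix} {z : C3}
    (hz : z ∈ (S.chart k).dom) : ∃ i g, IsTransition (S.chart k) (P i) id g z := by
  obtain ⟨i, w, hw, e⟩ := mem_iUnion.1 (h.cover ((h.atlas.isPatch k).mapsTo hz))
  obtain ⟨g, -, hg⟩ := (h.isPatch i).ofChart k z hz w hw e.symm
  exact ⟨i, g, hg⟩

theorem fderiv_comp_of_transition {X Y : Type} {P : Patch X} {Q : Patch Y} {Φ : X → Y}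
    {g h : C3 → C3} {w : C3} (hg : IsTransition P Q Φ g w) (hh : AnalyticAt ℂ h (g w)) :
    fderiv ℂ (h ∘ g) w = (fderiv ℂ h (g w)).comp (fderiv ℂ g w) :=
  fderiv_comp w hh.differentiableAt hg.1.differentiableAt

theorem Space.IsHamAtlas.hamTwoForm_eq (h : S.IsHamAtlas P H) {k : S.Ix} {i : ι} {g : C3 → C3}
    {z : C3} (hg : IsTransition (S.chart k) (P i) id g z) :
    S.hamTwoForm P H k z =
      (hamForm (H i) (g z)).bilinearComp (fderiv ℂ g z) (fderiv ℂ g z) := by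
  have hex : ∃ q : ι × (C3 → C3), IsTransition (S.chart k) (P q.1) id q.2 z := ⟨(i, g), hg⟩
  rw [Space.hamTwoForm, dif_pos hex]
  have hg' := hex.choose_spec
  generalize hex.choose = q at hg'
  obtain ⟨j, g'⟩ := q
  simp only at hg' ⊢
  obtain ⟨r, hr, hrt⟩ := (((h.isPatch j).locEquiv hg'.mem.2.1 hg'.mem.1 hg'.mem.2.2).trans
    ((h.isPatch i).locEquiv hg.mem.2.1 hg.mem.1 hg.mem.2.2).symm).isTransition
  have hc := hrt.comp hg'
  have he : r ∘ g' =ᶠ[𝓝 z] g := IsTransition.unique (h.isPatch i).injOn hc hg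
  rw [h.compat j i _ _ hrt, bilinearComp_comp, ← fderiv_comp_of_transition hg' hrt.1,
    he.fderiv_eq, hr]

theorem analyticAt_pullback_hamForm {H : C3 → ℂ} {g : C3 → C3} {w : C3}
    (hH : AnalyticAt ℂ H (g w)) (hg : AnalyticAt ℂ g w) :
    AnalyticAt ℂ (fun z => (hamForm H (g z)).bilinearComp (fderiv ℂ g z) (fderiv ℂ g z)) w := by
  refine analyticAt_bil (Eventually.of_forall fun z u => hamForm_self _ _ _) fun u v => ?_
  simp only [ContinuousLinearMap.bilinearComp_apply, hamForm_apply]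
  have h1 : ∀ u, AnalyticAt ℂ (fun z => fderiv ℂ g z u) w := analyticAt_clm_apply hg.fderiv
  have h2 : ∀ u, AnalyticAt ℂ (fun z => fderiv ℂ H (g z) (fderiv ℂ g z u)) w := by
    intro u
    have h3 : AnalyticAt ℂ (fun z => fderiv ℂ (H ∘ g) z u) w :=
      analyticAt_clm_apply (hH.comp hg).fderiv u
    refine h3.congr ?_
    filter_upwards [hg.eventually_analyticAt, hg.continuousAt.eventually hH.eventually_analyticAt]
      with z hz hz'
    rw [fderiv_comp z hz'.differentiableAt hz.differentiableAt]
    rfl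
  have h1u := h1 u
  have h1v := h1 v
  have h2u := h2 u
  have h2v := h2 v
  fun_prop

theorem Space.IsHamAtlas.form_eq (h : S.IsHamAtlas P H) (i : ι) (k : S.Ix) :
    IsFormPullback (P i) (S.chart k) id (hamForm (H i)) (S.hamTwoForm P H k) := by
  intro w g hg
  obtain ⟨j, r, hr⟩ := h.exists_transition hg.mem.2.1
  rw [h.hamTwoForm_eq hr, bilinearComp_comp, ← fderiv_comp_of_transition hg hr.1]
  have hc := h.compat i j w (r ∘ g) (hr.comp hg)
  exact hc

theorem Space.IsHamAtlas.alternating (h : S.IsHamAtlas P H) (k : S.Ix) {z : C3}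
    (hz : z ∈ (S.chart k).dom) (u : C3) : S.hamTwoForm P H k z u u = 0 := by
  obtain ⟨j, r, hr⟩ := h.exists_transition hz
  rw [h.hamTwoForm_eq hr, ContinuousLinearMap.bilinearComp_apply, hamForm_self]

theorem Space.IsHamAtlas.analyticAt (h : S.IsHamAtlas P H) (k : S.Ix) {z : C3}
    (hz : z ∈ (S.chart k).dom) : AnalyticAt ℂ (S.hamTwoForm P H k) z := by
  obtain ⟨j, r, hr⟩ := h.exists_transition hz
  refine (analyticAt_pullback_hamForm (h.analytic j _ hr.mem.2.1) hr.1).congr ?_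
  filter_upwards [hr.eventually] with z' hz'
  exact (h.hamTwoForm_eq hz').symm

theorem Space.IsHamAtlas.twoForm (h : S.IsHamAtlas P H) : S.IsTwoForm (S.hamTwoForm P H) where
  analytic k _ hz := h.analyticAt k hz
  alternating k _ hz u := h.alternating k hz u
  compatible k l w g hg := by
    obtain ⟨j, r, hr⟩ := h.exists_transition hg.mem.2.1
    have hc := h.hamTwoForm_eq (hr.comp hg)
    rw [h.hamTwoForm_eq hr, bilinearComp_comp, ← fderiv_comp_of_transition hg hr.1]
    exact hc

theorem Space.IsHamAtlas.base_fderiv (h : S.IsHamAtlas P H) (i : ι) (k : S.Ix) {g : C3 → C3}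
    {w : C3} (hg : IsTransition (P i) (S.chart k) id g w) (v : C3) :
    (fderiv ℂ g w v).2.2 = v.2.2 :=
  hg.base_fderiv (S := S) (T := S) (h.isPatch i).base (h.atlas.isPatch k).base (fun _ _ => rfl) v

theorem Space.IsHamAtlas.areaOf_ne_zero (h : S.IsHamAtlas P H) (k : S.Ix) {z : C3}
    (hz : z ∈ (S.chart k).dom) : areaOf (S.hamTwoForm P H k z) ≠ 0 := by
  obtain ⟨i, w, hw, e⟩ := mem_iUnion.1 (h.cover ((h.atlas.isPatch k).mapsTo hz))
  obtain ⟨g, rfl, hg⟩ := (h.isPatch i).toChart k w hw z hz e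
  have h1 := congrArg areaOf (h.form_eq i k w g hg)
  rw [areaOf_hamForm, areaOf_bilinearComp (h.alternating k hz) (h.base_fderiv i k hg)] at h1
  exact left_ne_zero_of_mul (h1 ▸ one_ne_zero)

/-- Area forms and kernels are compatible with a pullback of two-forms. -/
theorem areaOf_fieldOf_of_form {A A' : Bil} {g : C3 → C3} {w : C3} (hA : ∀ u, A u u = 0)
    (hL : ∀ v, (fderiv ℂ g w v).2.2 = v.2.2) (h0 : areaOf A' ≠ 0)
    (h : A' = A.bilinearComp (fderiv ℂ g w) (fderiv ℂ g w)) :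
    areaOf A' = areaOf A * relJac g w ∧ fieldOf A = fderiv ℂ g w (fieldOf A') := by
  subst h
  exact ⟨areaOf_bilinearComp hA hL, map_fieldOf_bilinearComp hA hL h0⟩

theorem Space.IsHamAtlas.darboux (h : S.IsHamAtlas P H) (i : ι) (k : S.Ix) {g : C3 → C3} {w : C3}
    (hg : IsTransition (P i) (S.chart k) id g w) :
    1 = areaOf (S.hamTwoForm P H k (g w)) * relJac g w ∧
      fieldOf (S.hamTwoForm P H k (g w)) = fderiv ℂ g w (hamSystem (H i) w) := by
  have := areaOf_fieldOf_of_form (h.alternating k hg.mem.2.1) (h.base_fderiv i k hg)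
    (by rw [areaOf_hamForm]; exact one_ne_zero) (h.form_eq i k w g hg)
  rwa [areaOf_hamForm, fieldOf_hamForm] at this

theorem Space.IsHamAtlas.compatible (h : S.IsHamAtlas P H) (k l : S.Ix) {g : C3 → C3} {w : C3}
    (hg : IsTransition (S.chart k) (S.chart l) id g w) :
    areaOf (S.hamTwoForm P H k w) = areaOf (S.hamTwoForm P H l (g w)) * relJac g w ∧
      fieldOf (S.hamTwoForm P H l (g w)) = fderiv ℂ g w (fieldOf (S.hamTwoForm P H k w)) :=
  areaOf_fieldOf_of_form (h.alternating l hg.mem.2.1)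
    (hg.base_fderiv (S := S) (T := S) (h.atlas.isPatch k).base (h.atlas.isPatch l).base
      fun _ _ => rfl) (h.areaOf_ne_zero k hg.mem.1) (h.twoForm.compatible k l w g hg)

theorem Space.IsHamAtlas.isSymplecticAtlas (h : S.IsHamAtlas P H) :
    S.IsSymplecticAtlas P fun k z => areaOf (S.hamTwoForm P H k z) where
  symplectic :=
    { analytic := fun k z hz => by
        have := h.analyticAt k hz
        simp only [areaOf]
        exact analyticAt_clm_apply (analyticAt_clm_apply this _) _
      nondegenerate := fun k z hz => h.areaOf_ne_zero k hz
      compatible := fun k l w g hg => (h.compatible k l hg).1 }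
  isPatch := h.isPatch
  cover := h.cover
  darboux i k w g hg := (h.darboux i k hg).1

theorem Space.IsHamAtlas.isGlobalHamiltonianStructure (h : S.IsHamAtlas P H) :
    S.IsGlobalHamiltonianStructure P (fun k z => fieldOf (S.hamTwoForm P H k z)) H
      (S.hamTwoForm P H) where
  system :=
    { analytic := fun k z hz => by
        have h1 : ∀ u v : C3, AnalyticAt ℂ (fun z => S.hamTwoForm P H k z u v) z := fun u v =>
          analyticAt_clm_apply (analyticAt_clm_apply (h.analyticAt k hz) u) v
        have h0 := h.areaOf_ne_zero k hz
        simp only [areaOf] at h0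
        simp only [fieldOf]
        exact ((h1 _ _).div (h1 _ _) h0).prod (((h1 _ _).neg.div (h1 _ _) h0).prod
          analyticAt_const)
      time := fun k z hz => rfl
      compatible := fun k l w g hg => (h.compatible k l hg).2 }
  twoForm := h.twoForm
  analytic := h.analytic
  form_eq := h.form_eq
  hamiltonian i k w g hg := (h.darboux i k hg).2

/-- Families with Hamiltonian atlases that correspond to each other under an isomorphism: the
two-forms, area forms and systems correspond to each other as well. -/
theorem Space.IsHamAtlas.pullback {T : Space} {Q : ι → Patch T.Pt} {Φ : S.Pt → T.Pt}
    {Ψ : T.Pt → S.Pt} (h : S.IsHamAtlas (fun i => (Q i).pullback Ψ) H) (hT : T.IsHamAtlas Q H)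
    (hΦ : IsBiholomorphism S T Φ Ψ) (k : S.Ix) (l : T.Ix) {g : C3 → C3} {w : C3}
    (hg : IsTransition (S.chart k) (T.chart l) Φ g w) :
    S.hamTwoForm (fun i => (Q i).pullback Ψ) H k w = (T.hamTwoForm Q H l (g w)).bilinearComp
        (fderiv ℂ g w) (fderiv ℂ g w) ∧
      areaOf (S.hamTwoForm (fun i => (Q i).pullback Ψ) H k w) =
        areaOf (T.hamTwoForm Q H l (g w)) * relJac g w ∧
      fieldOf (T.hamTwoForm Q H l (g w)) =
        fderiv ℂ g w (fieldOf (S.hamTwoForm (fun i => (Q i).pullback Ψ) H k w)) := by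
  have key : S.hamTwoForm (fun i => (Q i).pullback Ψ) H k w =
      (T.hamTwoForm Q H l (g w)).bilinearComp (fderiv ℂ g w) (fderiv ℂ g w) := by
    obtain ⟨j, r, hr⟩ := hT.exists_transition hg.mem.2.1
    have hr' : IsTransition (S.chart k) ((Q j).pullback Ψ) id (r ∘ g) w := by
      refine ⟨hr.1.comp hg.1, ?_⟩
      filter_upwards [hg.2, hg.1.continuousAt.eventually hr.2] with v h1 h2
      refine ⟨h1.1, h2.2.1, ?_⟩
      change Ψ ((Q j).par (r (g v))) = _
      rw [h2.2.2, id, h1.2.2]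
      exact hΦ.left_inv ((h.atlas.isPatch k).mapsTo h1.1)
    rw [hT.hamTwoForm_eq hr, bilinearComp_comp, ← fderiv_comp_of_transition hg hr.1]
    have hc := h.hamTwoForm_eq hr'
    exact hc
  exact ⟨key, areaOf_fieldOf_of_form (hT.alternating l hg.mem.2.1)
    (hg.base_fderiv (h.atlas.isPatch k).base (hT.atlas.isPatch l).base
      fun v hv => hΦ.base _ ((h.atlas.isPatch k).mapsTo hv)) (h.areaOf_ne_zero k hg.mem.1) key⟩

end HamAtlas

/-! ### The gluing of Takano's charts -/

/-- The five lines `y_i = 0` in Takano's charts `1, …, 5` : two of them over `f = ∞`, and three over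
`f = t`, `f = 0` and `f = 1`. -/
abbrev Line := Fin 2 ⊕ Fin 3

/-- The points of the abstract surface glued from Takano's charts: the points `(x₀, y₀, t)` of the
chart `0`, and the points `(x_i, 0, t)` of the lines in the other charts. -/
abbrev ModelPt := C3 ⊕ (Line × ℂ × ℂ)

/-- The `t`-coordinate of a point of the abstract surface. -/
def modelTime : ModelPt → ℂ := Sum.elim (fun w => w.2.2) (fun q => q.2.2)

/-- The points over `B`. -/
def modelCarrier : Set ModelPt := {m | modelTime m ∈ B}

/-- The domain `ℂ² × B`. -/
def fullDom : Set C3 := {w | w.2.2 ∈ B}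

theorem isOpen_fullDom : IsOpen fullDom :=
  isOpen_B.preimage (continuous_snd.comp continuous_snd)

theorem fullDom_mem_nhds {w : C3} (h : w.2.2 ∈ B) : fullDom ∈ 𝓝 w := isOpen_fullDom.mem_nhds h

/-- The value `0`, `1` or `t` of `f` on one of the last three lines, as an affine function of `t`:
the constant term. -/
def fibreConst : Fin 3 → ℂ := ![0, 0, 1]

/-- The derivative with respect to `t` of the value of `f` on one of the last three lines. -/
def fibreSlope : Fin 3 → ℂ := ![1, 0, 0]

/-- The value `t`, `0` or `1` of `f` on one of the last three lines. -/
def fibre (i : Fin 3) (t : ℂ) : ℂ := fibreConst i + fibreSlope i * t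

section Model

variable (a : Fin 5 → ℂ)

/-- The negative of the value of `g` at the two points on `f = ∞`. -/
def infParam : Fin 2 → ℂ := ![a 2, a 1 + a 2]

/-- The parameters of the last three lines. -/
def finParam : Fin 3 → ℂ := ![a 0, a 4, a 3]

/-- The change of coordinates from Takano's chart `0` to another one. -/
def fwd : Line → C3 → C3
  | Sum.inl i, w => (w.1 * (w.1 * w.2.1 + infParam a i), w.1⁻¹, w.2.2)
  | Sum.inr i, w => ((finParam a i - (w.1 - fibre i w.2.2) * w.2.1) * w.2.1, w.2.1⁻¹, w.2.2)

/-- The change of coordinates from one of Takano's charts to the chart `0`. -/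
def back : Line → C3 → C3
  | Sum.inl i, w => (w.2.1⁻¹, w.2.1 * (w.1 * w.2.1 - infParam a i), w.2.2)
  | Sum.inr i, w => (fibre i w.2.2 + w.2.1 * (finParam a i - w.1 * w.2.1), w.2.1⁻¹, w.2.2)

/-- The coordinate which is inverted in the change of coordinates. -/
def pivot : Line → C3 → ℂ
  | Sum.inl _, w => w.1
  | Sum.inr _, w => w.2.1

variable {a}

theorem fwd_time (l : Line) (w : C3) : (fwd a l w).2.2 = w.2.2 := by rcases l with i | i <;> rfl

theorem back_time (l : Line) (w : C3) : (back a l w).2.2 = w.2.2 := by rcases l with i | i <;> rfl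

theorem fwd_snd (l : Line) (w : C3) : (fwd a l w).2.1 = (pivot l w)⁻¹ := by
  rcases l with i | i <;> rfl

theorem pivot_back (l : Line) (w : C3) : pivot l (back a l w) = w.2.1⁻¹ := by
  rcases l with i | i <;> rfl

theorem back_fwd {l : Line} {w : C3} (h : pivot l w ≠ 0) : back a l (fwd a l w) = w := by
  obtain ⟨x, y, t⟩ := w
  rcases l with i | i <;> simp only [pivot] at h <;> simp only [back, fwd, Prod.mk.injEq, inv_inv,
    true_and, and_true]
  · field_simp
    ring
  · field_simp
    ring

theorem fwd_back {l : Line} {w : C3} (h : w.2.1 ≠ 0) : fwd a l (back a l w) = w := by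
  obtain ⟨x, y, t⟩ := w
  rcases l with i | i <;> simp only at h <;> simp only [back, fwd, Prod.mk.injEq, inv_inv,
    and_true]
  · field_simp
    ring
  · field_simp
    ring

theorem analyticAt_fwd {l : Line} {w : C3} (h : pivot l w ≠ 0) : AnalyticAt ℂ (fwd a l) w := by
  rcases l with i | i <;> simp only [pivot] at h <;> unfold fwd <;> simp only [fibre] <;>
    fun_prop (disch := assumption)

theorem analyticAt_back {l : Line} {w : C3} (h : w.2.1 ≠ 0) : AnalyticAt ℂ (back a l) w := by
  rcases l with i | i <;> unfold back <;> simp only [fibre] <;> fun_prop (disch := assumption)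

theorem eventually_pivot_ne {l : Line} {w : C3} (h : pivot l w ≠ 0) :
    ∀ᶠ z in 𝓝 w, pivot l z ≠ 0 := by
  rcases l with i | i
  · exact continuous_fst.continuousAt.eventually_ne h
  · exact (continuous_fst.comp continuous_snd).continuousAt.eventually_ne h

theorem eventually_snd_ne {w : C3} (h : w.2.1 ≠ 0) : ∀ᶠ z : C3 in 𝓝 w, z.2.1 ≠ 0 :=
  (continuous_fst.comp continuous_snd).continuousAt.eventually_ne h

variable (a)

/-- Takano's charts, as patches of the abstract surface. The chart `0` is `none`. -/
def modelPatch : Option Line → Patch ModelPt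
  | none => ⟨fullDom, Sum.inl⟩
  | some l => ⟨fullDom, open Classical in
      fun w => if w.2.1 = 0 then Sum.inr (l, w.1, w.2.2) else Sum.inl (back a l w)⟩

variable {a}

theorem modelPatch_dom (i : Option Line) : (modelPatch a i).dom = fullDom := by cases i <;> rfl

theorem modelPatch_zero {l : Line} {w : C3} (h : w.2.1 = 0) :
    (modelPatch a (some l)).par w = Sum.inr (l, w.1, w.2.2) := if_pos h

theorem modelPatch_ne {l : Line} {w : C3} (h : w.2.1 ≠ 0) :
    (modelPatch a (some l)).par w = Sum.inl (back a l w) := if_neg h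

theorem modelTime_modelPatch (i : Option Line) (w : C3) :
    modelTime ((modelPatch a i).par w) = w.2.2 := by
  rcases i with _ | l
  · rfl
  · by_cases h : w.2.1 = 0
    · rw [modelPatch_zero h]; rfl
    · rw [modelPatch_ne h]; exact back_time l w

theorem modelPatch_mem (i : Option Line) {w : C3} (h : w ∈ fullDom) :
    (modelPatch a i).par w ∈ modelCarrier := by
  rw [modelCarrier, mem_ofPred_eq, modelTime_modelPatch]; exact h

theorem modelPatch_injective (i : Option Line) : Function.Injective (modelPatch a i).par := by
  intro w z e
  rcases i with _ | l
  · exact Sum.inl_injective e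
  · by_cases h : w.2.1 = 0 <;> by_cases h' : z.2.1 = 0
    · rw [modelPatch_zero h, modelPatch_zero h', Sum.inr.injEq, Prod.mk.injEq, Prod.mk.injEq] at e
      exact Prod.ext e.2.1 (Prod.ext (h.trans h'.symm) e.2.2)
    · rw [modelPatch_zero h, modelPatch_ne h'] at e; cases e
    · rw [modelPatch_ne h, modelPatch_zero h'] at e; cases e
    · rw [modelPatch_ne h, modelPatch_ne h', Sum.inl.injEq] at e
      rw [← fwd_back (a := a) (l := l) h, e, fwd_back h']

theorem modelPatch_cover {m : ModelPt} (hm : m ∈ modelCarrier) :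
    ∃ i, ∃ w ∈ fullDom, (modelPatch a i).par w = m := by
  rcases m with w | ⟨l, x, t⟩
  · exact ⟨none, w, hm, rfl⟩
  · exact ⟨some l, (x, 0, t), hm, modelPatch_zero rfl⟩

variable (a)

/-- The Hamiltonians in Takano's charts: `knyH₀` in the new coordinates, minus `lineSlope l * y₀`,
written in a form without poles on the line `y_i = 0`. -/
def modelHam : Option Line → C3 → ℂ
  | none, w => knyH₀ a w
  | some (Sum.inl i), w =>
    let g := w.1 * w.2.1 - infParam a i
    (w.1 ^ 2 * w.2.1 + (a 1 + 2 * a 2 - 2 * infParam a i) * w.1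
      + (w.2.2 * w.2.1 - 1 - w.2.2) * g ^ 2
      + (w.2.2 * (a 3 + a 4) - (a 1 + 2 * a 2) - a 3 - w.2.2 * a 4 * w.2.1) * g)
      / (w.2.2 * (w.2.2 - 1))
  | some (Sum.inr i), w =>
    let c := fibre i w.2.2
    let h := finParam a i - w.1 * w.2.1
    let f := c + w.2.1 * h
    (-(3 * c ^ 2 - 2 * (1 + w.2.2) * c + w.2.2) * w.1 + h ^ 2 * (f + 2 * c - 1 - w.2.2)
      + h * ((a 1 + 2 * a 2) * (f + c) + w.2.2 * (a 3 + a 4) - (a 1 + 2 * a 2) - a 3)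
      + a 2 * (a 1 + a 2) * f) / (w.2.2 * (w.2.2 - 1))

/-- The `t`-dependence of the change of coordinates. -/
def lineSlope : Line → ℂ
  | Sum.inl _ => 0
  | Sum.inr i => fibreSlope i

variable {a}

theorem analyticAt_modelHam (i : Option Line) {w : C3} (hw : w ∈ fullDom) :
    AnalyticAt ℂ (modelHam a i) w := by
  have h : w.2.2 * (w.2.2 - 1) ≠ 0 := mul_ne_zero hw.1 (sub_ne_zero.2 hw.2)
  rcases i with _ | i | i
  · have h : w.2.2 * (w.2.2 - 1) ≠ 0 := h
    unfold modelHam knyH₀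
    fun_prop (disch := assumption)
  · unfold modelHam
    fun_prop (disch := assumption)
  · unfold modelHam
    simp only [fibre]
    fun_prop (disch := assumption)

/-- Takano's Hamiltonians agree up to a correction which makes up for the `t`-dependence of the
change of coordinates. -/
theorem modelHam_fwd (ha : a 0 + a 1 + 2 * a 2 + a 3 + a 4 = 1) (l : Line) {w : C3}
    (hw : w ∈ fullDom) (h : pivot l w ≠ 0) :
    modelHam a (some l) (fwd a l w) = modelHam a none w - lineSlope l * w.2.1 := by
  obtain ⟨x, y, t⟩ := w
  have h0 : t ≠ 0 := hw.1
  have h1 : t - 1 ≠ 0 := sub_ne_zero.2 hw.2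
  rcases l with i | i
  · simp only [pivot] at h
    fin_cases i <;>
    · simp [modelHam, knyH₀, fwd, infParam, lineSlope]
      field_simp
      ring
  · simp only [pivot] at h
    fin_cases i
    · obtain ha : a 0 = 1 - a 1 - 2 * a 2 - a 3 - a 4 := by linear_combination ha
      simp [modelHam, knyH₀, fwd, finParam, lineSlope, fibre, fibreConst, fibreSlope, ha]
      field_simp
      ring
    · simp [modelHam, knyH₀, fwd, finParam, lineSlope, fibre, fibreConst, fibreSlope]
      field_simp
      ring
    · simp [modelHam, knyH₀, fwd, finParam, lineSlope, fibre, fibreConst, fibreSlope]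
      field_simp
      ring

theorem hasFDerivAt_fst (w : C3) : HasFDerivAt (fun z : C3 => z.1) dx w := dx.hasFDerivAt

theorem hasFDerivAt_snd (w : C3) : HasFDerivAt (fun z : C3 => z.2.1) dy w := dy.hasFDerivAt

theorem hasFDerivAt_time (w : C3) : HasFDerivAt (fun z : C3 => z.2.2) dt w := dt.hasFDerivAt

/-- The change of coordinates preserves `dx ∧ dy` up to a multiple of `dy ∧ dt`, and preserves `t`.
-/
theorem fderiv_fwd {l : Line} {w : C3} (h : pivot l w ≠ 0) (u v : C3) :
    (fderiv ℂ (fwd a l) w u).1 * (fderiv ℂ (fwd a l) w v).2.1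
      - (fderiv ℂ (fwd a l) w u).2.1 * (fderiv ℂ (fwd a l) w v).1 =
    u.1 * v.2.1 - u.2.1 * v.1 + lineSlope l * (u.2.1 * v.2.2 - u.2.2 * v.2.1) ∧
    (fderiv ℂ (fwd a l) w u).2.2 = u.2.2 := by
  have hx := hasFDerivAt_fst w
  have hy := hasFDerivAt_snd w
  have ht := hasFDerivAt_time w
  rcases l with i | i
  · simp only [pivot] at h
    have h1 : HasFDerivAt (fwd a (Sum.inl i)) _ w :=
      (hx.mul ((hx.mul hy).add_const (infParam a i))).prodMk
        (((hasDerivAt_inv h).comp_hasFDerivAt w hx).prodMk ht)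
    rw [h1.fderiv]
    simp [dx, dy, dt, lineSlope]
    field_simp
    ring
  · simp only [pivot] at h
    have h1 : HasFDerivAt (fwd a (Sum.inr i)) _ w :=
      ((((hx.sub ((ht.const_mul (fibreSlope i)).const_add (fibreConst i))).mul hy).const_sub
        (finParam a i)).mul hy).prodMk (((hasDerivAt_inv h).comp_hasFDerivAt w hy).prodMk ht)
    rw [h1.fderiv]
    simp [dx, dy, dt, lineSlope]
    field_simp
    ring

/-- The correction `-lineSlope l * y` of the Hamiltonian cancels the `dy ∧ dt` term by which the
change of coordinates fails to preserve `dx ∧ dy`. -/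
theorem hamForm_fwd (ha : a 0 + a 1 + 2 * a 2 + a 3 + a 4 = 1) (l : Line) {w : C3}
    (hw : w ∈ fullDom) (h : pivot l w ≠ 0) :
    hamForm (modelHam a none) w = (hamForm (modelHam a (some l)) (fwd a l w)).bilinearComp
      (fderiv ℂ (fwd a l) w) (fderiv ℂ (fwd a l) w) := by
  have hw' : fwd a l w ∈ fullDom := by rw [fullDom, mem_ofPred_eq, fwd_time]; exact hw
  have hd : ∀ u, fderiv ℂ (modelHam a (some l)) (fwd a l w) (fderiv ℂ (fwd a l) w u) =
      fderiv ℂ (modelHam a none) w u - lineSlope l * u.2.1 := by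
    have h1 : modelHam a (some l) ∘ fwd a l =ᶠ[𝓝 w]
        fun z => modelHam a none z - lineSlope l * z.2.1 := by
      filter_upwards [fullDom_mem_nhds hw, eventually_pivot_ne h] with z hz hz'
      exact modelHam_fwd ha l hz hz'
    have h2 := fderiv_comp w (analyticAt_modelHam (a := a) (some l) hw').differentiableAt
      (analyticAt_fwd (a := a) h).differentiableAt
    have h3 : HasFDerivAt (fun z => modelHam a none z - lineSlope l * z.2.1) _ w :=
      (analyticAt_modelHam none hw).differentiableAt.hasFDerivAt.sub
        ((hasFDerivAt_snd w).const_mul (lineSlope l))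
    rw [h1.fderiv_eq, h3.fderiv] at h2
    intro u
    have := congrArg (fun L : C3 →L[ℂ] ℂ => L u) h2
    simpa [dy] using this.symm
  refine ContinuousLinearMap.ext fun u => ContinuousLinearMap.ext fun v => ?_
  rw [ContinuousLinearMap.bilinearComp_apply, hamForm_apply, hamForm_apply,
    (fderiv_fwd (a := a) h u v).1, (fderiv_fwd (a := a) h u v).2, (fderiv_fwd (a := a) h v u).2,
    hd, hd]
  ring

theorem isTransition_fwd {l : Line} {w : C3} (hw : w ∈ fullDom) (h : pivot l w ≠ 0) :
    IsTransition (modelPatch a none) (modelPatch a (some l)) id (fwd a l) w := by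
  refine ⟨analyticAt_fwd h, ?_⟩
  filter_upwards [fullDom_mem_nhds hw, eventually_pivot_ne h] with z hz hz'
  refine ⟨hz, ?_, ?_⟩
  · rw [modelPatch_dom, fullDom, mem_ofPred_eq, fwd_time]; exact hz
  · rw [modelPatch_ne (by rw [fwd_snd]; exact inv_ne_zero hz'), back_fwd hz']; rfl

theorem isTransition_back {l : Line} {w : C3} (hw : w ∈ fullDom) (h : w.2.1 ≠ 0) :
    IsTransition (modelPatch a (some l)) (modelPatch a none) id (back a l) w := by
  refine ⟨analyticAt_back h, ?_⟩
  filter_upwards [fullDom_mem_nhds hw, eventually_snd_ne h] with z hz hz'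
  refine ⟨hz, ?_, ?_⟩
  · rw [modelPatch_dom, fullDom, mem_ofPred_eq, back_time]; exact hz
  · rw [modelPatch_ne hz']; rfl

theorem hamForm_back (ha : a 0 + a 1 + 2 * a 2 + a 3 + a 4 = 1) (l : Line) {w : C3}
    (hw : w ∈ fullDom) (h : w.2.1 ≠ 0) :
    hamForm (modelHam a (some l)) w = (hamForm (modelHam a none) (back a l w)).bilinearComp
      (fderiv ℂ (back a l) w) (fderiv ℂ (back a l) w) := by
  have hp : pivot l (back a l w) ≠ 0 := by rw [pivot_back]; exact inv_ne_zero h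
  have hw' : back a l w ∈ fullDom := by rw [fullDom, mem_ofPred_eq, back_time]; exact hw
  have h1 : fwd a l ∘ back a l =ᶠ[𝓝 w] id := by
    filter_upwards [eventually_snd_ne h] with z hz using fwd_back hz
  rw [hamForm_fwd ha l hw' hp, bilinearComp_comp, ← fderiv_comp w
    (analyticAt_fwd hp).differentiableAt (analyticAt_back h).differentiableAt, h1.fderiv_eq,
    fderiv_id, fwd_back h]
  rfl

/-- At the point with coordinates `w` and `z` in the patches `i` and `j`, the change of coordinates
is holomorphic and respects the two-forms. -/
def FormRel (a : Fin 5 → ℂ) (i j : Option Line) (w z : C3) : Prop :=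
  ∃ g, g w = z ∧ IsTransition (modelPatch a i) (modelPatch a j) id g w ∧
    hamForm (modelHam a i) w = (hamForm (modelHam a j) z).bilinearComp (fderiv ℂ g w)
      (fderiv ℂ g w)

theorem FormRel.refl (i : Option Line) {w : C3} (hw : w ∈ fullDom) : FormRel a i i w w := by
  refine ⟨id, rfl, ⟨analyticAt_id, ?_⟩, ?_⟩
  · filter_upwards [fullDom_mem_nhds hw] with z hz
    rw [modelPatch_dom]
    exact ⟨hz, hz, rfl⟩
  · rw [fderiv_id]; rfl

theorem FormRel.trans {i j k : Option Line} {w z v : C3} (h : FormRel a i j w z)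
    (h' : FormRel a j k z v) : FormRel a i k w v := by
  obtain ⟨g, rfl, h1, h2⟩ := h
  obtain ⟨g', rfl, h1', h2'⟩ := h'
  refine ⟨g' ∘ g, rfl, h1'.comp h1, ?_⟩
  rw [h2, h2', bilinearComp_comp, ← fderiv_comp_of_transition h1 h1'.1]

theorem FormRel.of_chart_zero (ha : a 0 + a 1 + 2 * a 2 + a 3 + a 4 = 1) (i : Option Line)
    {w v : C3} (hw : w ∈ fullDom) (h : (modelPatch a i).par w = Sum.inl v) :
    FormRel a i none w v ∧ FormRel a none i v w := by
  rcases i with _ | l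
  · obtain rfl := Sum.inl_injective h
    exact ⟨FormRel.refl _ hw, FormRel.refl _ hw⟩
  · by_cases hy : w.2.1 = 0
    · rw [modelPatch_zero hy] at h; cases h
    · rw [modelPatch_ne hy] at h
      obtain rfl := Sum.inl_injective h
      have hp : pivot l (back a l w) ≠ 0 := by rw [pivot_back]; exact inv_ne_zero hy
      have hw' : back a l w ∈ fullDom := by rw [fullDom, mem_ofPred_eq, back_time]; exact hw
      refine ⟨⟨_, rfl, isTransition_back hw hy, hamForm_back ha l hw hy⟩,
        ⟨_, fwd_back hy, isTransition_fwd hw' hp, ?_⟩⟩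
      rw [hamForm_fwd ha l hw' hp, fwd_back hy]

/-- Different charts of Takano's atlas only overlap in the chart `0`. -/
theorem FormRel.of_eq (ha : a 0 + a 1 + 2 * a 2 + a 3 + a 4 = 1) {i j : Option Line} {w z : C3}
    (hw : w ∈ fullDom) (hz : z ∈ fullDom) (h : (modelPatch a i).par w = (modelPatch a j).par z) :
    FormRel a i j w z := by
  rcases hm : (modelPatch a i).par w with v | q
  · exact (FormRel.of_chart_zero ha i hw hm).1.trans
      (FormRel.of_chart_zero ha j hz (h.symm.trans hm)).2
  · have key : ∀ (i : Option Line) (w : C3), (modelPatch a i).par w = Sum.inr q →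
        i = some q.1 := by
      rintro (_ | l) w e
      · cases e
      · by_cases hy : w.2.1 = 0
        · rw [modelPatch_zero hy] at e
          rw [← Sum.inr_injective e]
        · rw [modelPatch_ne hy] at e; cases e
    obtain rfl : i = j := (key i w hm).trans (key j z (h.symm.trans hm)).symm
    obtain rfl := modelPatch_injective i h
    exact FormRel.refl i hw

theorem locEquiv_modelPatch (ha : a 0 + a 1 + 2 * a 2 + a 3 + a 4 = 1) {i j : Option Line}
    {w z : C3} (hw : w ∈ fullDom) (hz : z ∈ fullDom)
    (h : (modelPatch a i).par w = (modelPatch a j).par z) :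
    LocEquiv (modelPatch a i) (modelPatch a j) w z := by
  obtain ⟨g, h1, h2, -⟩ := FormRel.of_eq ha hw hz h
  obtain ⟨g', h1', h2', -⟩ := FormRel.of_eq ha hz hw h.symm
  exact ⟨g, g', h1, h1', h2, h2'⟩

theorem isFormPullback_modelPatch (ha : a 0 + a 1 + 2 * a 2 + a 3 + a 4 = 1) (i j : Option Line) :
    IsFormPullback (modelPatch a i) (modelPatch a j) id (hamForm (modelHam a i))
      (hamForm (modelHam a j)) := by
  intro w g hg
  have hm := hg.mem
  rw [modelPatch_dom, modelPatch_dom] at hm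
  obtain ⟨g', h1, h2, h3⟩ := FormRel.of_eq ha hm.1 hm.2.1 hm.2.2.symm
  rw [h3, (IsTransition.unique (modelPatch_injective j).injOn h2 hg).fderiv_eq]

end Model

/-! ### Families that contain the glued surface -/

section Placement

variable {X Y : Space} {a : Fin 5 → ℂ} {place : ModelPt → X.Pt} {placeY : ModelPt → Y.Pt}

/-- Takano's charts, placed in a family. -/
def placedPatch (a : Fin 5 → ℂ) (place : ModelPt → X.Pt) (i : Option Line) : Patch X.Pt :=
  ⟨fullDom, fun w => place ((modelPatch a i).par w)⟩

/-- The map `place` embeds the abstract surface into `X` as an open subfamily. As all overlaps of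
Takano's charts are in the chart `0`, it is enough to look at that chart and at the five lines. -/
structure Space.IsPlacement (X : Space) (a : Fin 5 → ℂ) (place : ModelPt → X.Pt) : Prop where
  atlas : X.IsAtlas
  injOn : InjOn place modelCarrier
  base : ∀ m ∈ modelCarrier, X.base (place m) = modelTime m
  local_zero : ∀ w ∈ fullDom, X.IsLocalPatch (placedPatch a place none) w
  local_line : ∀ l x, ∀ t ∈ B, X.IsLocalPatch (placedPatch a place (some l)) (x, 0, t)

theorem Space.IsPlacement.isLocalPatch (h : X.IsPlacement a place)
    (ha : a 0 + a 1 + 2 * a 2 + a 3 + a 4 = 1) (i : Option Line) {w : C3} (hw : w ∈ fullDom) :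
    X.IsLocalPatch (placedPatch a place i) w := by
  rcases i with _ | l
  · exact h.local_zero w hw
  · obtain ⟨x, y, t⟩ := w
    by_cases hy : y = 0
    · subst hy
      exact h.local_line l x t hw
    · have hw' : back a l (x, y, t) ∈ fullDom := by
        rw [fullDom, mem_ofPred_eq, back_time]; exact hw
      have h1 : LocEquiv (modelPatch a (some l)) (modelPatch a none) (x, y, t)
          (back a l (x, y, t)) := locEquiv_modelPatch ha hw hw' (modelPatch_ne hy)
      refine Space.IsLocalPatch.of_locEquiv (h1.transfer (Q' := placedPatch a place none)
        (isOpen_fullDom.mem_nhds hw) (isOpen_fullDom.mem_nhds hw') ?_) (h.local_zero _ hw')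
      exact fun _ _ _ _ e => congrArg place e

theorem Space.IsPlacement.isHolomorphicPatch (h : X.IsPlacement a place)
    (ha : a 0 + a 1 + 2 * a 2 + a 3 + a 4 = 1) (i : Option Line) :
    X.IsHolomorphicPatch (placedPatch a place i) := by
  refine h.atlas.isHolomorphicPatch isOpen_fullDom ?_ ?_ fun w hw => h.isLocalPatch ha i hw
  · exact fun w hw z hz e => modelPatch_injective i
      (h.injOn (modelPatch_mem i hw) (modelPatch_mem i hz) e)
  · exact fun w hw => (h.base _ (modelPatch_mem i hw)).trans (modelTime_modelPatch i w)

theorem Space.image_place (place : ModelPt → X.Pt) (a : Fin 5 → ℂ) : place '' modelCarrier =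
    ⋃ i, (placedPatch a place i).par '' (placedPatch a place i).dom := by
  ext p
  constructor
  · rintro ⟨m, hm, rfl⟩
    obtain ⟨i, w, hw, rfl⟩ := modelPatch_cover (a := a) hm
    exact mem_iUnion.2 ⟨i, w, hw, rfl⟩
  · intro hp
    obtain ⟨i, w, hw, rfl⟩ := mem_iUnion.1 hp
    exact ⟨_, modelPatch_mem i hw, rfl⟩

theorem Space.IsPlacement.isChartOpen (h : X.IsPlacement a place)
    (ha : a 0 + a 1 + 2 * a 2 + a 3 + a 4 = 1) : X.IsChartOpen (place '' modelCarrier) := by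
  rw [Space.image_place place a]
  exact h.atlas.isChartOpen_iUnion fun i w hw => h.isLocalPatch ha i hw

theorem Space.IsPlacement.image_subset (h : X.IsPlacement a place)
    (ha : a 0 + a 1 + 2 * a 2 + a 3 + a 4 = 1) : place '' modelCarrier ⊆ X.carrier := by
  rw [Space.image_place place a]
  refine iUnion_subset fun i => ?_
  rintro _ ⟨w, hw, rfl⟩
  exact (h.isHolomorphicPatch ha i).mapsTo hw

theorem Space.IsPlacement.remove (h : X.IsPlacement a place)
    (ha : a 0 + a 1 + 2 * a 2 + a 3 + a 4 = 1) {D : Set X.Pt}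
    (hD : ∀ p ∈ D, p ∉ place '' modelCarrier) (hc : X.carrier ⊆ place '' modelCarrier ∪ D) :
    (X.remove D).IsPlacement a place := by
  have hA := h.atlas.remove (h.isChartOpen ha) hD hc
  refine ⟨hA, h.injOn, h.base, fun w hw => ?_, fun l x t ht => ?_⟩
  · exact (h.local_zero w hw).remove hA (isOpen_fullDom.mem_nhds hw)
      fun hp => hD _ hp ⟨_, modelPatch_mem none hw, rfl⟩
  · exact (h.local_line l x t ht).remove hA (fullDom_mem_nhds ht)
      fun hp => hD _ hp ⟨_, modelPatch_mem (some l) (w := (x, 0, t)) ht, rfl⟩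

/-- Takano's atlas and Hamiltonians on a family which is exhausted by the glued surface. The patches
may be given by other formulas off their domains. -/
theorem Space.IsPlacement.isHamAtlas (h : X.IsPlacement a place)
    (ha : a 0 + a 1 + 2 * a 2 + a 3 + a 4 = 1) (hs : X.carrier ⊆ place '' modelCarrier)
    {ι : Type} {e : ι → Option Line} (he : Function.Surjective e) {P : ι → Patch X.Pt}
    (hP : ∀ i, (P i).dom = fullDom) (hpar : ∀ i, ∀ w ∈ fullDom,
      (P i).par w = place ((modelPatch a (e i)).par w)) :
    X.IsHamAtlas P fun i => modelHam a (e i) := by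
  have hmem : ∀ i, ∀ w ∈ fullDom, (P i).dom ∈ 𝓝 w := fun i w hw => by
    rw [hP]; exact isOpen_fullDom.mem_nhds hw
  refine ⟨h.atlas, fun i => ?_, ?_, fun i w hw => ?_, fun i j w g hg => ?_⟩
  · refine h.atlas.isHolomorphicPatch (by rw [hP]; exact isOpen_fullDom) ?_ ?_ ?_
    · intro w hw z hz e'
      rw [hP] at hw hz
      rw [hpar _ _ hw, hpar _ _ hz] at e'
      exact (h.isHolomorphicPatch ha (e i)).injOn hw hz e'
    · intro w hw
      rw [hP] at hw
      rw [hpar _ _ hw]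
      exact (h.isHolomorphicPatch ha (e i)).base w hw
    · intro w hw
      rw [hP] at hw
      refine Space.IsLocalPatch.of_locEquiv ((LocEquiv.refl (P := placedPatch a place (e i))
        (isOpen_fullDom.mem_nhds hw)).transfer (hmem i w hw) (isOpen_fullDom.mem_nhds hw) ?_)
        (h.isLocalPatch ha (e i) hw)
      intro w' hw' z hz e'
      rw [hpar _ _ hw'.1]
      exact e'
  · refine hs.trans ?_
    rw [Space.image_place place a]
    refine iUnion_subset fun i => ?_
    obtain ⟨i, rfl⟩ := he i
    rintro _ ⟨w, hw, rfl⟩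
    exact mem_iUnion.2 ⟨i, w, by rw [hP]; exact hw, hpar i w hw⟩
  · rw [hP] at hw
    exact analyticAt_modelHam _ hw
  · have hm := hg.mem
    rw [hP, hP] at hm
    refine isFormPullback_modelPatch ha (e i) (e j) w g (hg.transfer ?_ ?_ ?_)
    · rw [modelPatch_dom]; exact isOpen_fullDom.mem_nhds hm.1
    · rw [modelPatch_dom]; exact isOpen_fullDom.mem_nhds hm.2.1
    · intro w' hw' z hz e'
      have h1 := hw'.1
      have h2 := hz.1
      rw [hP] at h1 h2
      rw [id, hpar _ _ h1, hpar _ _ h2] at e'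
      exact h.injOn (modelPatch_mem _ h2) (modelPatch_mem _ h1) e'

/-- The isomorphism between two families that are exhausted by the glued surface. -/
def transport (place : ModelPt → X.Pt) (placeY : ModelPt → Y.Pt) (p : X.Pt) : Y.Pt :=
  placeY (Function.invFunOn place modelCarrier p)

theorem transport_place (hi : InjOn place modelCarrier) {m : ModelPt} (hm : m ∈ modelCarrier) :
    transport place placeY (place m) = placeY m := by
  rw [transport, hi.leftInvOn_invFunOn hm]

theorem Space.IsPlacement.isHolomorphicBetween (hX : X.IsPlacement a place)
    (hY : Y.IsPlacement a placeY) (ha : a 0 + a 1 + 2 * a 2 + a 3 + a 4 = 1)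
    (hXs : X.carrier ⊆ place '' modelCarrier) (k : X.Ix) (l : Y.Ix) :
    IsHolomorphicBetween (X.chart k) (Y.chart l) (transport place placeY) := by
  intro w hw z hz e
  obtain ⟨m, hm, hmw⟩ := hXs ((hX.atlas.isPatch k).mapsTo hw)
  obtain ⟨i, v, hv, rfl⟩ := modelPatch_cover (a := a) hm
  obtain ⟨g, rfl, hg⟩ := (hX.isHolomorphicPatch ha i).ofChart k w hw v hv hmw.symm
  rw [← hmw, transport_place hX.injOn hm] at e
  obtain ⟨g', h1, hg'⟩ := (hY.isHolomorphicPatch ha i).toChart l _ hv z hz e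
  refine ⟨g' ∘ g, h1, hg'.1.comp hg.1, ?_⟩
  filter_upwards [hg.2, hg.1.continuousAt.eventually hg'.2] with w' h2 h3
  refine ⟨h2.1, h3.2.1, h3.2.2.trans ?_⟩
  have h4 : (X.chart k).par w' = place ((modelPatch a i).par (g w')) := h2.2.2.symm
  rw [h4, transport_place hX.injOn (modelPatch_mem i h2.2.1)]
  rfl

theorem Space.IsPlacement.isBiholomorphism (hX : X.IsPlacement a place)
    (hY : Y.IsPlacement a placeY) (ha : a 0 + a 1 + 2 * a 2 + a 3 + a 4 = 1)
    (hXs : X.carrier ⊆ place '' modelCarrier) (hYs : Y.carrier ⊆ placeY '' modelCarrier) :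
    IsBiholomorphism X Y (transport place placeY) (transport placeY place) where
  mapsTo p hp := by
    obtain ⟨m, hm, rfl⟩ := hXs hp
    rw [transport_place hX.injOn hm]
    exact hY.image_subset ha ⟨m, hm, rfl⟩
  mapsTo_symm p hp := by
    obtain ⟨m, hm, rfl⟩ := hYs hp
    rw [transport_place hY.injOn hm]
    exact hX.image_subset ha ⟨m, hm, rfl⟩
  left_inv p hp := by
    obtain ⟨m, hm, rfl⟩ := hXs hp
    rw [transport_place hX.injOn hm, transport_place hY.injOn hm]
  right_inv p hp := by
    obtain ⟨m, hm, rfl⟩ := hYs hp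
    rw [transport_place hY.injOn hm, transport_place hX.injOn hm]
  base p hp := by
    obtain ⟨m, hm, rfl⟩ := hXs hp
    rw [transport_place hX.injOn hm, hX.base m hm, hY.base m hm]
  holomorphic := hX.isHolomorphicBetween hY ha hXs
  holomorphic_symm := hY.isHolomorphicBetween hX ha hYs

/-- In the chart `k`, Takano's chart `0` is given by a change of coordinates `g` which carries the
area form to `area` and the Hamiltonian system to `sys`. -/
def IsAffineForm (X : Space) (a : Fin 5 → ℂ) (place : ModelPt → X.Pt) (k : X.Ix) (sys : C3 → C3)
    (area : C3 → ℂ) : Prop :=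
  ∀ z ∈ (X.chart k).dom, ∃ w ∈ fullDom, ∃ g, g w = z ∧ AnalyticAt ℂ g w ∧
    (∀ᶠ w' in 𝓝 w, (X.chart k).par (g w') = place (Sum.inl w')) ∧ area z * relJac g w = 1 ∧
    fderiv ℂ g w (hamSystem (knyH₀ a) w) = sys z

theorem IsAffineForm.eq {k : X.Ix} {sys : C3 → C3} {area : C3 → ℂ}
    (h : IsAffineForm X a place k sys area) {ι : Type} {e : ι → Option Line} {P : ι → Patch X.Pt}
    (hP : ∀ i, (P i).dom = fullDom) (hpar : ∀ i, ∀ w ∈ fullDom,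
      (P i).par w = place ((modelPatch a (e i)).par w))
    (hX : X.IsHamAtlas P fun i => modelHam a (e i)) {i : ι} (hi : e i = none) {z : C3}
    (hz : z ∈ (X.chart k).dom) :
    areaOf (X.hamTwoForm P (fun i => modelHam a (e i)) k z) = area z ∧
      fieldOf (X.hamTwoForm P (fun i => modelHam a (e i)) k z) = sys z := by
  obtain ⟨w, hw, g, rfl, hg, hp, h1, h2⟩ := h z hz
  have ht : IsTransition (P i) (X.chart k) id g w := by
    refine ⟨hg, ?_⟩
    filter_upwards [hp, isOpen_fullDom.mem_nhds hw,
      hg.continuousAt.eventually ((hX.atlas.isOpen k).mem_nhds hz)] with w' h3 h4 h5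
    refine ⟨by rw [hP]; exact h4, h5, ?_⟩
    rw [h3, id, hpar i w' h4, hi]
    rfl
  obtain ⟨h3, h4⟩ := hX.darboux i k ht
  have h0 : relJac g w ≠ 0 := right_ne_zero_of_mul (h1 ▸ one_ne_zero)
  refine ⟨mul_right_cancel₀ h0 (h3.symm.trans h1.symm), ?_⟩
  rw [h4, ← h2, hi]
  rfl

/-- A family exhausted by the glued surface carries the structure of another such family, pulled
back along the isomorphism between the two. -/
theorem Space.IsPlacement.pullsBackAlong (hX : X.IsPlacement a place)
    (hY : Y.IsPlacement a placeY) (ha : a 0 + a 1 + 2 * a 2 + a 3 + a 4 = 1)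
    (hXs : X.carrier ⊆ place '' modelCarrier) (hYs : Y.carrier ⊆ placeY '' modelCarrier)
    {k : X.Ix} {l : Y.Ix} {ident sys : C3 → C3} {area : C3 → ℂ}
    (hk : IsAffineForm X a place k sys area)
    (hid : ∀ z ∈ (X.chart k).dom, ∃ w ∈ fullDom, place (Sum.inl w) = (X.chart k).par z ∧
      ident z ∈ (Y.chart l).dom ∧ placeY (Sum.inl w) = (Y.chart l).par (ident z))
    {ι : Type} {e : ι → Option Line} (he : Function.Surjective e) :
    PullsBackAlong X Y k l ident sys area (fun i => placedPatch a placeY (e i))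
      (fun i => modelHam a (e i))
      (fun k z => areaOf (Y.hamTwoForm (fun i => placedPatch a placeY (e i))
        (fun i => modelHam a (e i)) k z))
      (Y.hamTwoForm (fun i => placedPatch a placeY (e i)) fun i => modelHam a (e i))
      (fun k z => fieldOf (Y.hamTwoForm (fun i => placedPatch a placeY (e i))
        (fun i => modelHam a (e i)) k z)) := by
  have hYH := hY.isHamAtlas ha hYs he (P := fun i => placedPatch a placeY (e i)) (fun _ => rfl)
    fun _ _ _ => rfl
  have hpar : ∀ i, ∀ w ∈ fullDom,
      ((placedPatch a placeY (e i)).pullback (transport placeY place)).par w =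
        place ((modelPatch a (e i)).par w) :=
    fun i w hw => transport_place hY.injOn (modelPatch_mem _ hw)
  have hXH := hX.isHamAtlas ha hXs he
    (P := fun i => (placedPatch a placeY (e i)).pullback (transport placeY place))
    (fun _ => rfl) hpar
  have hb := hX.isBiholomorphism hY ha hXs hYs
  obtain ⟨i, hi⟩ := he none
  refine ⟨transport place placeY, transport placeY place, _, _, _, hb, ?_, ?_, ?_, ?_, ?_, ?_,
    hXH.isSymplecticAtlas, hXH.isGlobalHamiltonianStructure⟩
  · intro z hz
    obtain ⟨w, hw, h1, h2, h3⟩ := hid z hz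
    refine ⟨h2, ?_⟩
    rw [← h1, ← h3]
    exact transport_place hX.injOn (m := Sum.inl w) hw
  · exact fun i j w g hg => (hXH.pullback hYH hb i j hg).2.1
  · exact fun i j w g hg => (hXH.pullback hYH hb i j hg).1
  · exact fun i j w g hg => (hXH.pullback hYH hb i j hg).2.2
  · exact fun z hz => (hk.eq (fun _ => rfl) hpar hXH hi hz).1
  · exact fun z hz => (hk.eq (fun _ => rfl) hpar hXH hi hz).2

end Placement

/-! ### The compactifications -/

theorem eventually_fst_ne {w : C3} {c : ℂ} (h : w.1 ≠ c) : ∀ᶠ z : C3 in 𝓝 w, z.1 ≠ c :=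
  continuous_fst.continuousAt.eventually_ne h

/-- A section that is cut out by two continuous equations is closed. -/
theorem isOpen_ne_of_iff {S : Space} (hS : S.IsAtlas) {i : S.Ix} {σ : ℂ → S.Pt} (F G : C3 → ℂ)
    (hF : ContinuousOn F fullDom) (hG : ContinuousOn G fullDom)
    (h : ∀ z ∈ (S.chart i).dom, (S.chart i).par z = σ z.2.2 ↔ F z = 0 ∧ G z = 0) :
    IsOpen {z | z ∈ (S.chart i).dom ∧ (S.chart i).par z ≠ σ z.2.2} := by
  have hd : (S.chart i).dom ⊆ fullDom := fun z hz => hS.time i z hz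
  have h1 := (hF.mono hd).isOpen_inter_preimage (hS.isOpen i)
    (isOpen_compl_singleton (x := (0 : ℂ)))
  have h2 := (hG.mono hd).isOpen_inter_preimage (hS.isOpen i)
    (isOpen_compl_singleton (x := (0 : ℂ)))
  convert h1.union h2 using 1
  ext z
  rw [mem_union, mem_inter_iff, mem_inter_iff, ← and_or_left]
  refine and_congr_right fun hz => ?_
  rw [Ne, h z hz, not_and_or]
  rfl

theorem continuousOn_time {c : ℂ → ℂ} (hc : ContinuousOn c B) :
    ContinuousOn (fun z : C3 => c z.2.2) fullDom :=
  hc.comp (by fun_prop) fun _ hz => hz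

/-- The change of coordinates between the affine coordinates `s` and `s'` of the Riemann sphere. -/
def sphereFlip (s s' : Bool) (x : ℂ) : ℂ := if s = s' then x else x⁻¹

theorem sphereFlip_of_eq {s s' : Bool} {x x' : ℂ} (h : sphereChart s x = sphereChart s' x') :
    x' = sphereFlip s s' x ∧ (s = s' ∨ x ≠ 0) := by
  by_cases hs : s = s'
  · subst hs
    rw [sphereChart_self] at h
    simp [sphereFlip, h]
  · have h1 := (sphereChart_ne hs).1 h
    rw [sphereFlip, if_neg hs]
    exact ⟨eq_inv_of_mul_eq_one_right h1, Or.inr (left_ne_zero_of_mul_eq_one h1)⟩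

theorem sphereChart_flip {s s' : Bool} {x : ℂ} (h : s = s' ∨ x ≠ 0) :
    sphereChart s' (sphereFlip s s' x) = sphereChart s x := by
  by_cases hs : s = s'
  · subst hs; simp [sphereFlip]
  · rw [sphereFlip, if_neg hs]
    exact ((sphereChart_ne hs).2 (mul_inv_cancel₀ (h.resolve_left hs))).symm

theorem sphereFlip_flip (s s' : Bool) (x : ℂ) : sphereFlip s' s (sphereFlip s s' x) = x := by
  by_cases hs : s = s'
  · subst hs; simp [sphereFlip]
  · simp [sphereFlip, hs, Ne.symm hs]

theorem sphereFlip_ne {s s' : Bool} {x : ℂ} (h : s = s' ∨ x ≠ 0) :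
    s' = s ∨ sphereFlip s s' x ≠ 0 := by
  by_cases hs : s = s'
  · exact Or.inl hs.symm
  · rw [sphereFlip, if_neg hs]
    exact Or.inr (inv_ne_zero (h.resolve_left hs))

theorem analyticAt_sphereFlip {s s' : Bool} {x : ℂ} (h : s = s' ∨ x ≠ 0) :
    AnalyticAt ℂ (sphereFlip s s') x := by
  unfold sphereFlip
  by_cases hs : s = s'
  · simp only [hs, if_true]
    fun_prop
  · simp only [hs, if_false]
    have := h.resolve_left hs
    fun_prop (disch := assumption)

theorem eventually_sphereFlip {f : C3 → ℂ} {w : C3} (hf : ContinuousAt f w) {s s' : Bool}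
    (h : s = s' ∨ f w ≠ 0) : ∀ᶠ z in 𝓝 w, s = s' ∨ f z ≠ 0 := by
  rcases h with h | h
  · exact Eventually.of_forall fun _ => Or.inl h
  · filter_upwards [hf.eventually_ne h] with z hz using Or.inr hz

/-- The point of `ℙ¹ × ℙ¹ × B` with the given coordinates. -/
def P1P1pt (x y : OnePoint ℂ) (t : ℂ) : P1P1.Pt := (x, y, t)

theorem P1P1pt_inj {x y x' y' : OnePoint ℂ} {t t' : ℂ} :
    P1P1pt x y t = P1P1pt x' y' t' ↔ x = x' ∧ y = y' ∧ t = t' :=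
  Prod.ext_iff.trans (and_congr_right fun _ => Prod.ext_iff)

theorem P1P1_par (s s' : Bool) (z : C3) : (P1P1.chart (s, s')).par z =
    P1P1pt (sphereChart s z.1) (sphereChart s' z.2.1) z.2.2 := rfl

theorem isAtlas_P1P1 : P1P1.IsAtlas := by
  refine Space.isAtlas_of_locEquiv (fun k => isOpen_fullDom) (fun k z hz => hz) ?_
    (fun k z hz => rfl)
    (fun k z hz => hz) ?_
  · rintro ⟨s, r⟩ w - z - e
    rw [P1P1_par, P1P1_par, P1P1pt_inj, sphereChart_self, sphereChart_self] at e
    exact Prod.ext e.1 (Prod.ext e.2.1 e.2.2)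
  · rintro ⟨s, r⟩ ⟨s', r'⟩ w hw ⟨x, y, t⟩ hz e
    rw [P1P1_par, P1P1_par, P1P1pt_inj] at e
    obtain ⟨e1, e2, rfl⟩ := e
    obtain ⟨rfl, h1⟩ := sphereFlip_of_eq e1
    obtain ⟨rfl, h2⟩ := sphereFlip_of_eq e2
    have hL : ∀ {s s' r r' : Bool} {w : C3}, (s = s' ∨ w.1 ≠ 0) → (r = r' ∨ w.2.1 ≠ 0) →
        AnalyticAt ℂ (fun w : C3 => (sphereFlip s s' w.1, sphereFlip r r' w.2.1, w.2.2)) w :=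
      fun {s s' r r' w} h1 h2 => by
        have h3 : AnalyticAt ℂ (fun w : C3 => sphereFlip s s' w.1) w :=
          AnalyticAt.fun_comp (g := sphereFlip s s') (analyticAt_sphereFlip h1) (by fun_prop)
        have h4 : AnalyticAt ℂ (fun w : C3 => sphereFlip r r' w.2.1) w :=
          AnalyticAt.fun_comp (g := sphereFlip r r') (f := fun w : C3 => w.2.1)
            (analyticAt_sphereFlip h2) (by fun_prop)
        exact h3.prod (h4.prod (by fun_prop))
    refine LocEquiv.of_locInv (g := fun w : C3 => (sphereFlip s s' w.1, sphereFlip r r' w.2.1, w.2.2))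
      (h := fun w : C3 => (sphereFlip s' s w.1, sphereFlip r' r w.2.1, w.2.2))
      ⟨hL h1 h2, hL (sphereFlip_ne h1) (sphereFlip_ne h2), ?_, ?_⟩
      (isOpen_fullDom.mem_nhds hw) (isOpen_fullDom.mem_nhds hz) ?_
    · simp [sphereFlip_flip]
    · exact Eventually.of_forall fun z => by simp [sphereFlip_flip]
    · filter_upwards [eventually_sphereFlip (f := fun z => z.1) (by fun_prop) h1,
        eventually_sphereFlip (f := fun z => z.2.1) (by fun_prop) h2] with z h3 h4
      rw [P1P1_par, P1P1_par, sphereChart_flip h3, sphereChart_flip h4]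

theorem isOpen_ne_P1P1 {a b : ℂ → ℂ} (ha : ContinuousOn a B) (hb : ContinuousOn b B)
    (l i : P1P1.Ix) : IsOpen {z | z ∈ (P1P1.chart i).dom ∧
      (P1P1.chart i).par z ≠ (P1P1.chart l).par (a z.2.2, b z.2.2, z.2.2)} := by
  obtain ⟨s, r⟩ := i
  obtain ⟨s', r'⟩ := l
  have ha' := continuousOn_time ha
  have hb' := continuousOn_time hb
  have key : ∀ (f : C3 → ℂ) (c : ℂ → ℂ) (s s' : Bool), Continuous f → ContinuousOn c B →
      ∃ F : C3 → ℂ, ContinuousOn F fullDom ∧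
        ∀ z, sphereChart s (f z) = sphereChart s' (c z.2.2) ↔ F z = 0 := by
    intro f c s s' hf hc
    by_cases hs : s = s'
    · subst hs
      exact ⟨fun z => f z - c z.2.2, hf.continuousOn.sub (continuousOn_time hc),
        fun z => by rw [sphereChart_self, sub_eq_zero]⟩
    · exact ⟨fun z => f z * c z.2.2 - 1,
        (hf.continuousOn.mul (continuousOn_time hc)).sub continuousOn_const,
        fun z => by rw [sphereChart_ne hs, sub_eq_zero]⟩
  obtain ⟨F, hF, hF'⟩ := key (fun z => z.1) a s s' (by fun_prop) ha
  obtain ⟨G, hG, hG'⟩ := key (fun z => z.2.1) b r r' (by fun_prop) hb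
  refine isOpen_ne_of_iff isAtlas_P1P1
    (σ := fun t => (P1P1.chart (s', r')).par (a t, b t, t)) F G hF hG fun z _ => ?_
  rw [P1P1_par, P1P1_par, ← hF', ← hG', P1P1pt_inj]
  simp

/-- The chart of `𝔽₁` with base coordinate `ξ₀` or `1 / ξ₀` (`s = false` or `true`), and with the
fibre coordinate inverted if `r = true`. -/
def F1ix (s r : Bool) : F1.Ix := (match s, r with
  | false, false => 0
  | true, false => 1
  | true, true => 2
  | false, true => 3 : Fin 4)

/-- The fibre coordinate over the other affine chart of the base. -/
def F1twist (r : Bool) (x y : ℂ) : ℂ := if r then y / x else x * y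

theorem F1ix_surj (i : F1.Ix) : ∃ s r, i = F1ix s r := by
  change Fin 4 at i
  fin_cases i
  · exact ⟨false, false, rfl⟩
  · exact ⟨true, false, rfl⟩
  · exact ⟨true, true, rfl⟩
  · exact ⟨false, true, rfl⟩

/-- The point of `𝔽₁ × B` with the given coordinates. -/
def F1pt (x y : OnePoint ℂ) (t : ℂ) : F1.Pt := (x, y, t)

theorem F1pt_inj {x y x' y' : OnePoint ℂ} {t t' : ℂ} :
    F1pt x y t = F1pt x' y' t' ↔ x = x' ∧ y = y' ∧ t = t' :=
  Prod.ext_iff.trans (and_congr_right fun _ => Prod.ext_iff)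

theorem F1_par_false (r : Bool) (z : C3) : (F1.chart (F1ix false r)).par z =
    F1pt (sphereChart false z.1) (sphereChart r z.2.1) z.2.2 := by
  cases r <;> rfl

theorem F1_par_zero (s r : Bool) {z : C3} (hz : z.1 = 0) : (F1.chart (F1ix s r)).par z =
    F1pt (sphereChart s z.1) (sphereChart r z.2.1) z.2.2 := by
  cases s
  · exact F1_par_false r z
  · cases r
    · exact Prod.ext rfl (Prod.ext (if_pos hz) rfl)
    · exact Prod.ext rfl (Prod.ext (if_pos hz) rfl)

theorem F1_par_true (r : Bool) {z : C3} (hz : z.1 ≠ 0) : (F1.chart (F1ix true r)).par z =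
    F1pt (sphereChart true z.1) (sphereChart r (F1twist r z.1 z.2.1)) z.2.2 := by
  cases r
  · exact Prod.ext rfl (Prod.ext (if_neg hz) rfl)
  · exact Prod.ext rfl (Prod.ext (if_neg hz) rfl)

theorem F1_par_fst (s r : Bool) (z : C3) :
    ((F1.chart (F1ix s r)).par z).1 = sphereChart s z.1 := by
  cases s <;> cases r <;> rfl

theorem F1twist_twist {r : Bool} {x y : ℂ} (hx : x ≠ 0) :
    F1twist r x⁻¹ (F1twist r x y) = y := by
  cases r <;> simp [F1twist, hx]

theorem F1twist_inj {r : Bool} {x y y' : ℂ} (hx : x ≠ 0) :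
    F1twist r x y = F1twist r x y' ↔ y = y' := by
  cases r <;> simp [F1twist, hx]

theorem F1twist_mul {r r' : Bool} (hr : r ≠ r') {x y y' : ℂ} (hx : x ≠ 0) :
    F1twist r x y * F1twist r' x y' = y * y' := by
  cases r <;> cases r' <;> simp_all [F1twist]
  · field_simp
  · field_simp

/-- Change of the base coordinate of `𝔽₁`. -/
theorem F1_par_base {s s' : Bool} (hs : s ≠ s') (r : Bool) {z : C3} (hz : z.1 ≠ 0) :
    (F1.chart (F1ix s' r)).par (z.1⁻¹, F1twist r z.1 z.2.1, z.2.2) =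
      (F1.chart (F1ix s r)).par z := by
  have h1 : sphereChart s' z.1⁻¹ = sphereChart s z.1 :=
    ((sphereChart_ne hs).2 (mul_inv_cancel₀ hz)).symm
  cases s <;> cases s'
  · exact absurd rfl hs
  · rw [F1_par_true _ (inv_ne_zero hz), F1_par_false, h1, F1twist_twist hz]
  · rw [F1_par_true _ hz, F1_par_false, h1]
  · exact absurd rfl hs

/-- Points with the same base coordinate have the same fibre. -/
theorem F1_par_fibre {s r r' : Bool} {x y y' t : ℂ} :
    (F1.chart (F1ix s r)).par (x, y, t) = (F1.chart (F1ix s r')).par (x, y', t) ↔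
      sphereChart r y = sphereChart r' y' := by
  by_cases hx : x = 0
  · rw [F1_par_zero _ _ hx, F1_par_zero _ _ hx, F1pt_inj]
    simp
  cases s
  · rw [F1_par_false, F1_par_false, F1pt_inj]
    simp
  · rw [F1_par_true _ hx, F1_par_true _ hx, F1pt_inj]
    simp only [true_and, and_true]
    by_cases hr : r = r'
    · subst hr
      rw [sphereChart_self, sphereChart_self, F1twist_inj hx]
    · rw [sphereChart_ne hr, sphereChart_ne hr, F1twist_mul hr hx]

theorem isAtlas_F1 : F1.IsAtlas := by
  have hfibre : ∀ (s r r' : Bool) (w z : C3), w ∈ fullDom → w.1 = z.1 →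
      (F1.chart (F1ix s r)).par w = (F1.chart (F1ix s r')).par z →
      LocEquiv (F1.chart (F1ix s r)) (F1.chart (F1ix s r')) w z := by
    rintro s r r' ⟨x, y, t⟩ ⟨x', y', t'⟩ hw hx e
    obtain rfl : x = x' := hx
    obtain rfl : t = t' := congrArg (fun p : OnePoint ℂ × OnePoint ℂ × ℂ => p.2.2) e
    obtain ⟨rfl, h⟩ := sphereFlip_of_eq (F1_par_fibre.1 e)
    have hL : ∀ {r r' : Bool} {w : C3}, (r = r' ∨ w.2.1 ≠ 0) →
        AnalyticAt ℂ (fun w : C3 => (w.1, sphereFlip r r' w.2.1, w.2.2)) w :=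
      fun {r r' w} h2 => by
        have h4 : AnalyticAt ℂ (fun w : C3 => sphereFlip r r' w.2.1) w :=
          AnalyticAt.fun_comp (g := sphereFlip r r') (f := fun w : C3 => w.2.1)
            (analyticAt_sphereFlip h2) (by fun_prop)
        exact analyticAt_fst.prod (h4.prod (by fun_prop))
    refine LocEquiv.of_locInv (w := (x, y, t))
      (g := fun w : C3 => (w.1, sphereFlip r r' w.2.1, w.2.2))
      (h := fun w : C3 => (w.1, sphereFlip r' r w.2.1, w.2.2))
      ⟨hL h, hL (sphereFlip_ne h), ?_, ?_⟩
      (isOpen_fullDom.mem_nhds hw) (isOpen_fullDom.mem_nhds hw) ?_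
    · simp [sphereFlip_flip]
    · exact Eventually.of_forall fun z => by simp [sphereFlip_flip]
    · filter_upwards [eventually_sphereFlip (f := fun z => z.2.1) (w := (x, y, t)) (by fun_prop) h]
        with z h4
      exact F1_par_fibre.2 (sphereChart_flip h4)
  have hbase : ∀ (s s' r : Bool) (w : C3), s ≠ s' → w ∈ fullDom → w.1 ≠ 0 →
      LocEquiv (F1.chart (F1ix s r)) (F1.chart (F1ix s' r)) w
        (w.1⁻¹, F1twist r w.1 w.2.1, w.2.2) := by
    intro s s' r w hs hw hx
    have hL : ∀ {w : C3}, w.1 ≠ 0 →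
        AnalyticAt ℂ (fun w : C3 => (w.1⁻¹, F1twist r w.1 w.2.1, w.2.2)) w := by
      intro w hw
      cases r <;> simp only [F1twist, if_true, Bool.false_eq_true, if_false] <;>
        fun_prop (disch := assumption)
    refine LocEquiv.of_locInv (h := fun w : C3 => (w.1⁻¹, F1twist r w.1 w.2.1, w.2.2))
      ⟨hL hx, hL (inv_ne_zero hx), ?_, ?_⟩
      (isOpen_fullDom.mem_nhds hw) (isOpen_fullDom.mem_nhds hw) ?_
    · simp [F1twist_twist hx]
    · filter_upwards [eventually_fst_ne (inv_ne_zero hx)] with z hz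
      simp [F1twist_twist hz]
    · filter_upwards [eventually_fst_ne hx] with z hz
      exact F1_par_base hs r hz
  have hloc : ∀ k l, ∀ w ∈ (F1.chart k).dom, ∀ z ∈ (F1.chart l).dom,
      (F1.chart k).par w = (F1.chart l).par z → LocEquiv (F1.chart k) (F1.chart l) w z := by
    intro k l w hw z hz e
    obtain ⟨s, r, rfl⟩ := F1ix_surj k
    obtain ⟨s', r', rfl⟩ := F1ix_surj l
    have e1 : sphereChart s w.1 = sphereChart s' z.1 := by
      rw [← F1_par_fst s r, e, F1_par_fst]
    by_cases hs : s = s'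
    · subst hs
      exact hfibre s r r' w z hw (sphereChart_self.1 e1) e
    · have h1 := (sphereChart_ne hs).1 e1
      have hx : w.1 ≠ 0 := left_ne_zero_of_mul_eq_one h1
      exact (hbase s s' r w hs hw hx).trans (hfibre s' r r' _ z hw
        (eq_inv_of_mul_eq_one_right h1).symm ((F1_par_base hs r hx).trans e))
  refine Space.isAtlas_of_locEquiv (fun k => isOpen_fullDom) (fun k z hz => hz) ?_
    (fun k z hz => rfl) (fun k z hz => hz) hloc
  · rintro k w hw z hz e
    obtain ⟨s, r, rfl⟩ := F1ix_surj k
    obtain ⟨x, y, t⟩ := w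
    obtain ⟨x', y', t'⟩ := z
    have e1 : sphereChart s x = sphereChart s x' := by
      have := congrArg Prod.fst e
      rwa [F1_par_fst, F1_par_fst] at this
    obtain rfl := sphereChart_self.1 e1
    obtain rfl : t = t' := congrArg (fun p : OnePoint ℂ × OnePoint ℂ × ℂ => p.2.2) e
    rw [sphereChart_self.1 (F1_par_fibre.1 e)]

theorem isOpen_ne_F1 {a b : ℂ → ℂ} (ha : ContinuousOn a B) (hb : ContinuousOn b B)
    (l i : F1.Ix) : IsOpen {z | z ∈ (F1.chart i).dom ∧
      (F1.chart i).par z ≠ (F1.chart l).par (a z.2.2, b z.2.2, z.2.2)} := by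
  obtain ⟨s, r, rfl⟩ := F1ix_surj i
  obtain ⟨s', r', rfl⟩ := F1ix_surj l
  have ha' := continuousOn_time ha
  have hb' := continuousOn_time hb
  have hx : ContinuousOn (fun z : C3 => z.1) fullDom := by fun_prop
  have hy : ContinuousOn (fun z : C3 => z.2.1) fullDom := by fun_prop
  have fst : ∀ z, (F1.chart (F1ix s r)).par z =
      (F1.chart (F1ix s' r')).par (a z.2.2, b z.2.2, z.2.2) →
      sphereChart s z.1 = sphereChart s' (a z.2.2) := by
    intro z e
    have := congrArg Prod.fst e
    rwa [F1_par_fst, F1_par_fst] at this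
  by_cases hs : s = s'
  · subst hs
    have key : ∀ G : C3 → ℂ, ContinuousOn G fullDom →
        (∀ z, sphereChart r z.2.1 = sphereChart r' (b z.2.2) ↔ G z = 0) →
        IsOpen {z | z ∈ (F1.chart (F1ix s r)).dom ∧ (F1.chart (F1ix s r)).par z ≠
          (F1.chart (F1ix s r')).par (a z.2.2, b z.2.2, z.2.2)} := by
      intro G hG h
      refine isOpen_ne_of_iff isAtlas_F1
        (σ := fun t => (F1.chart (F1ix s r')).par (a t, b t, t)) (fun z => z.1 - a z.2.2) G
        (hx.sub ha') hG fun z _ => ⟨fun e => ?_, fun e => ?_⟩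
      · have h1 := sphereChart_self.1 (fst z e)
        refine ⟨sub_eq_zero.2 h1, (h z).1 (F1_par_fibre (s := s) (x := z.1) (t := z.2.2).1 ?_)⟩
        rw [← h1] at e
        exact e
      · have h1 := sub_eq_zero.1 e.1
        have h2 := (F1_par_fibre (s := s) (x := z.1) (t := z.2.2)).2 ((h z).2 e.2)
        rw [← h1]
        exact h2
    by_cases hr : r = r'
    · subst hr
      exact key (fun z => z.2.1 - b z.2.2) (hy.sub hb')
        fun z => by rw [sphereChart_self, sub_eq_zero]
    · exact key (fun z => z.2.1 * b z.2.2 - 1) ((hy.mul hb').sub continuousOn_const)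
        fun z => by rw [sphereChart_ne hr, sub_eq_zero]
  · have key : ∀ G : C3 → ℂ, ContinuousOn G fullDom → (∀ z : C3, z.1 ≠ 0 →
        (sphereChart r (F1twist r z.1 z.2.1) = sphereChart r' (b z.2.2) ↔ G z = 0)) →
        IsOpen {z | z ∈ (F1.chart (F1ix s r)).dom ∧ (F1.chart (F1ix s r)).par z ≠
          (F1.chart (F1ix s' r')).par (a z.2.2, b z.2.2, z.2.2)} := by
      intro G hG h
      refine isOpen_ne_of_iff isAtlas_F1
        (σ := fun t => (F1.chart (F1ix s' r')).par (a t, b t, t)) (fun z => z.1 * a z.2.2 - 1) G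
        ((hx.mul ha').sub continuousOn_const) hG fun z _ => ⟨fun e => ?_, fun e => ?_⟩
      · have h1 := (sphereChart_ne hs).1 (fst z e)
        have h2 : z.1 ≠ 0 := left_ne_zero_of_mul_eq_one h1
        rw [← F1_par_base hs r h2, eq_inv_of_mul_eq_one_right h1] at e
        exact ⟨sub_eq_zero.2 h1, (h z h2).1 (F1_par_fibre.1 e)⟩
      · have h1 := sub_eq_zero.1 e.1
        have h2 : z.1 ≠ 0 := left_ne_zero_of_mul_eq_one h1
        rw [← F1_par_base hs r h2, eq_inv_of_mul_eq_one_right h1]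
        exact F1_par_fibre.2 ((h z h2).2 e.2)
    cases r <;> cases r'
    · exact key (fun z => z.1 * z.2.1 - b z.2.2) ((hx.mul hy).sub hb')
        fun z hz => by rw [sphereChart_self, sub_eq_zero]; simp [F1twist]
    · exact key (fun z => z.1 * z.2.1 * b z.2.2 - 1) (((hx.mul hy).mul hb').sub continuousOn_const)
        fun z hz => by rw [sphereChart_ne (by simp), sub_eq_zero]; simp [F1twist]
    · exact key (fun z => z.2.1 * b z.2.2 - z.1) ((hy.mul hb').sub hx)
        fun z hz => by
          rw [sphereChart_ne (by simp), sub_eq_zero]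
          simp only [F1twist, if_true]
          rw [div_mul_eq_mul_div, div_eq_one_iff_eq hz]
    · exact key (fun z => z.2.1 - b z.2.2 * z.1) (hy.sub (hb'.mul hx))
        fun z hz => by
          rw [sphereChart_self, sub_eq_zero]
          simp only [F1twist, if_true]
          rw [div_eq_iff hz]

/-! ### Blowing up pairs of points on fibres -/

theorem fibre_inj {i j : Fin 3} {t : ℂ} (ht : t ∈ B) (h : fibre i t = fibre j t) : i = j := by
  have h0 := ht.1
  have h1 := ht.2
  fin_cases i <;> fin_cases j <;> simp_all [fibre, fibreConst, fibreSlope, eq_comm]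

theorem analyticAt_time {c : ℂ → ℂ} {w : C3} (hc : AnalyticAt ℂ c w.2.2) :
    AnalyticAt ℂ (fun w : C3 => c w.2.2) w :=
  AnalyticAt.fun_comp (g := c) (f := fun w : C3 => w.2.2) hc (by fun_prop)

/-- A presentation of Takano's chart `0` in a chart `(X, Y)` of a family. It is
`(X, Y) = (shift + scale * f, total f * y₀ + q f)`, where `q` is a quadratic polynomial in `f` and
`total` is a polynomial in `f` that vanishes on the fibres `f = fibre (line i) t`, with quotient
`(r0 i, r1 i, r2 i)`. Two points of such a fibre are blown up: the centre `neg i`, whose exceptional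
line contains the points with this value of `f` in the chart `0`, and the centre `pos i`, whose
exceptional line contains one of the lines at infinity. All coefficients are functions of `t`. -/
structure FibreData (S : Space) (J ι : Type) where
  chart : S.Ix
  line : ι → Fin 3
  neg : ι → J
  pos : ι → J
  shift : ℂ → ℂ
  scale : ℂ → ℂ
  total : ℂ → ℂ → ℂ
  q0 : ℂ → ℂ
  q1 : ℂ → ℂ
  q2 : ℂ → ℂ
  r0 : ι → ℂ → ℂ
  r1 : ι → ℂ → ℂ
  r2 : ι → ℂ → ℂ

namespace FibreData

variable {S : Space} {J ι : Type} (D : FibreData S J ι)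

/-- The value of `f` on the fibre `i`. -/
def c (i : ι) (t : ℂ) : ℂ := fibre (D.line i) t

/-- The quotient of `total` by `f - c`. -/
def R (i : ι) (f t : ℂ) : ℂ := D.r0 i t + D.r1 i t * f + D.r2 i t * f ^ 2

/-- The divided difference of `R` between `f` and `c`. -/
def dR (i : ι) (f t : ℂ) : ℂ := D.r1 i t + D.r2 i t * (f + D.c i t)

/-- The quadratic polynomial `q` in `f`. -/
def q (f t : ℂ) : ℂ := D.q0 t + D.q1 t * f + D.q2 t * f ^ 2

/-- The divided difference of `q` between `f` and `c`. -/
def dq (i : ι) (f t : ℂ) : ℂ := D.q1 t + D.q2 t * (f + D.c i t)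

/-- Takano's chart `0` in the coordinates `(X, Y)`. -/
def gen (w : C3) : C3 :=
  (D.shift w.2.2 + D.scale w.2.2 * w.1, D.total w.1 w.2.2 * w.2.1 + D.q w.1 w.2.2, w.2.2)

/-- The value of `f` in the coordinates `(X, Y)`. -/
def ungenFst (z : C3) : ℂ := (z.1 - D.shift z.2.2) / D.scale z.2.2

/-- The inverse of `gen`, away from the fibres. -/
def ungen (z : C3) : C3 :=
  (D.ungenFst z, (z.2.1 - D.q (D.ungenFst z) z.2.2) / D.total (D.ungenFst z) z.2.2, z.2.2)

/-- Takano's chart `0` at the fibre `i`, in the coordinates `(U, V)` at the centre `neg i`. -/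
def negMap (i : ι) (w : C3) : C3 :=
  ((D.R i w.1 w.2.2 * w.2.1 + D.dq i w.1 w.2.2) / D.scale w.2.2,
    D.scale w.2.2 * (w.1 - D.c i w.2.2), w.2.2)

/-- The inverse of `negMap i`. -/
def negInv (i : ι) (z : C3) : C3 :=
  let f := D.c i z.2.2 + z.2.1 / D.scale z.2.2
  (f, (D.scale z.2.2 * z.1 - D.dq i f z.2.2) / D.R i f z.2.2, z.2.2)

variable (a : Fin 5 → ℂ)

/-- The first coordinate `U` at the centre `pos i`. -/
def posFst (i : ι) (w : C3) : ℂ :=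
  let s := finParam a (D.line i) - w.1 * w.2.1
  let f := D.c i w.2.2 + w.2.1 * s
  (D.dR i f w.2.2 * s - D.R i (D.c i w.2.2) w.2.2 * w.1 / s + D.dq i f w.2.2) / D.scale w.2.2

/-- Takano's chart at the line over the fibre `i`, in the coordinates `(U, V)` at the centre
`pos i`. -/
def posMap (i : ι) (w : C3) : C3 :=
  (D.posFst a i w, D.scale w.2.2 * (w.2.1 * (finParam a (D.line i) - w.1 * w.2.1)), w.2.2)

/-- The quantity `b - x y` in the coordinates `(U, V)` at the centre `pos i`. -/
def posFactor (i : ι) (z : C3) : ℂ :=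
  let f := D.c i z.2.2 + z.2.1 / D.scale z.2.2
  (D.R i (D.c i z.2.2) z.2.2 * finParam a (D.line i) + D.q (D.c i z.2.2) z.2.2 + z.1 * z.2.1
    - D.q f z.2.2) / D.R i f z.2.2

/-- The inverse of `posMap i`. -/
def posInv (i : ι) (z : C3) : C3 :=
  let f := D.c i z.2.2 + z.2.1 / D.scale z.2.2
  let s := D.posFactor a i z
  (s * (D.dR i f z.2.2 * s + D.dq i f z.2.2 - D.scale z.2.2 * z.1) / D.R i (D.c i z.2.2) z.2.2,
    z.2.1 / (D.scale z.2.2 * s), z.2.2)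

/-- The fibre data describe blow ups at admissible centres. -/
structure Valid (k : J → S.Ix) (A A' : J → ℂ → ℂ) : Prop where
  atlas : S.IsAtlas
  admissible : S.Admissible k A A'
  dom : (S.chart D.chart).dom = fullDom
  analytic_shift : ∀ t ∈ B, AnalyticAt ℂ D.shift t
  analytic_scale : ∀ t ∈ B, AnalyticAt ℂ D.scale t
  analytic_q : ∀ t ∈ B, AnalyticAt ℂ D.q0 t ∧ AnalyticAt ℂ D.q1 t ∧ AnalyticAt ℂ D.q2 t
  analytic_r : ∀ i, ∀ t ∈ B, AnalyticAt ℂ (D.r0 i) t ∧ AnalyticAt ℂ (D.r1 i) t ∧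
    AnalyticAt ℂ (D.r2 i) t
  analytic_total : ∀ w ∈ fullDom, AnalyticAt ℂ (fun w : C3 => D.total w.1 w.2.2) w
  scale_ne : ∀ t ∈ B, D.scale t ≠ 0
  param_ne : ∀ i, finParam a (D.line i) ≠ 0
  total_eq : ∀ i f, ∀ t ∈ B, D.total f t = (f - D.c i t) * D.R i f t
  total_ne : ∀ f, ∀ t ∈ B, (∀ i, f ≠ D.c i t) → D.total f t ≠ 0
  R_ne : ∀ i, ∀ t ∈ B, D.R i (D.c i t) t ≠ 0
  line_inj : Function.Injective D.line
  neg_inj : Function.Injective D.neg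
  pos_inj : Function.Injective D.pos
  neg_ne_pos : ∀ i j, D.neg i ≠ D.pos j
  k_neg : ∀ i, k (D.neg i) = D.chart
  k_pos : ∀ i, k (D.pos i) = D.chart
  fst_neg : ∀ i, ∀ t ∈ B, A (D.neg i) t = D.shift t + D.scale t * D.c i t
  fst_pos : ∀ i, ∀ t ∈ B, A (D.pos i) t = D.shift t + D.scale t * D.c i t
  snd_neg : ∀ i, ∀ t ∈ B, A' (D.neg i) t = D.q (D.c i t) t
  snd_pos : ∀ i, ∀ t ∈ B, A' (D.pos i) t =
    D.R i (D.c i t) t * finParam a (D.line i) + D.q (D.c i t) t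
  avoid : ∀ z ∈ fullDom, (∀ i, z.1 ≠ D.shift z.2.2 + D.scale z.2.2 * D.c i z.2.2) →
    ∀ j, (S.chart D.chart).par z ≠ S.center k A A' j z.2.2

variable {a} {k : J → S.Ix} {A A' : J → ℂ → ℂ}

theorem analyticAt_c (i : ι) (t : ℂ) : AnalyticAt ℂ (D.c i) t := by
  unfold c
  simp only [fibre]
  fun_prop

theorem R_eq (i : ι) (f t : ℂ) : D.R i f t = D.R i (D.c i t) t + (f - D.c i t) * D.dR i f t := by
  simp only [R, dR]
  ring

theorem q_eq (i : ι) (f t : ℂ) : D.q f t = D.q (D.c i t) t + (f - D.c i t) * D.dq i f t := by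
  simp only [q, dq]
  ring

variable {D}

namespace Valid

theorem analyticAt_R (h : D.Valid a k A A') (i : ι) {f τ : C3 → ℂ} {w : C3}
    (hf : AnalyticAt ℂ f w) (hτ : AnalyticAt ℂ τ w) (ht : τ w ∈ B) :
    AnalyticAt ℂ (fun w => D.R i (f w) (τ w)) w := by
  obtain ⟨h0, h1, h2⟩ := h.analytic_r i _ ht
  unfold R
  have h0' : AnalyticAt ℂ (fun w => D.r0 i (τ w)) w := h0.fun_comp hτ
  have h1' : AnalyticAt ℂ (fun w => D.r1 i (τ w)) w := h1.fun_comp hτ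
  have h2' : AnalyticAt ℂ (fun w => D.r2 i (τ w)) w := h2.fun_comp hτ
  fun_prop

theorem analyticAt_dR (h : D.Valid a k A A') (i : ι) {f τ : C3 → ℂ} {w : C3}
    (hf : AnalyticAt ℂ f w) (hτ : AnalyticAt ℂ τ w) (ht : τ w ∈ B) :
    AnalyticAt ℂ (fun w => D.dR i (f w) (τ w)) w := by
  obtain ⟨h0, h1, h2⟩ := h.analytic_r i _ ht
  unfold dR
  have h1' : AnalyticAt ℂ (fun w => D.r1 i (τ w)) w := h1.fun_comp hτ
  have h2' : AnalyticAt ℂ (fun w => D.r2 i (τ w)) w := h2.fun_comp hτ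
  have h3' : AnalyticAt ℂ (fun w => D.c i (τ w)) w := (D.analyticAt_c i _).fun_comp hτ
  fun_prop

theorem analyticAt_q (h : D.Valid a k A A') {f τ : C3 → ℂ} {w : C3}
    (hf : AnalyticAt ℂ f w) (hτ : AnalyticAt ℂ τ w) (ht : τ w ∈ B) :
    AnalyticAt ℂ (fun w => D.q (f w) (τ w)) w := by
  obtain ⟨h0, h1, h2⟩ := h.analytic_q _ ht
  unfold q
  have h0' : AnalyticAt ℂ (fun w => D.q0 (τ w)) w := h0.fun_comp hτ
  have h1' : AnalyticAt ℂ (fun w => D.q1 (τ w)) w := h1.fun_comp hτ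
  have h2' : AnalyticAt ℂ (fun w => D.q2 (τ w)) w := h2.fun_comp hτ
  fun_prop

theorem analyticAt_dq (h : D.Valid a k A A') (i : ι) {f τ : C3 → ℂ} {w : C3}
    (hf : AnalyticAt ℂ f w) (hτ : AnalyticAt ℂ τ w) (ht : τ w ∈ B) :
    AnalyticAt ℂ (fun w => D.dq i (f w) (τ w)) w := by
  obtain ⟨h0, h1, h2⟩ := h.analytic_q _ ht
  unfold dq
  have h1' : AnalyticAt ℂ (fun w => D.q1 (τ w)) w := h1.fun_comp hτ
  have h2' : AnalyticAt ℂ (fun w => D.q2 (τ w)) w := h2.fun_comp hτ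
  have h3' : AnalyticAt ℂ (fun w => D.c i (τ w)) w := (D.analyticAt_c i _).fun_comp hτ
  fun_prop

theorem analyticAt_gen (h : D.Valid a k A A') {w : C3} (hw : w ∈ fullDom) :
    AnalyticAt ℂ D.gen w := by
  have h1 := analyticAt_time (h.analytic_shift _ hw)
  have h2 := analyticAt_time (h.analytic_scale _ hw)
  have h3 := h.analytic_total w hw
  have h4 := h.analyticAt_q (f := fun w : C3 => w.1) (τ := fun w : C3 => w.2.2) (w := w)
    (by fun_prop) (by fun_prop) hw
  unfold gen
  fun_prop

theorem ungenFst_gen (h : D.Valid a k A A') {w : C3} (hw : w ∈ fullDom) :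
    D.ungenFst (D.gen w) = w.1 := by
  have := h.scale_ne _ hw
  simp only [ungenFst, gen]
  field_simp
  ring

theorem gen_fst_ne (h : D.Valid a k A A') {w : C3} (hw : w ∈ fullDom)
    (hf : ∀ i, w.1 ≠ D.c i w.2.2) (i : ι) :
    (D.gen w).1 ≠ D.shift w.2.2 + D.scale w.2.2 * D.c i w.2.2 := by
  intro e
  exact hf i (mul_left_cancel₀ (h.scale_ne _ hw) (add_left_cancel e))

theorem ungen_gen (h : D.Valid a k A A') {w : C3} (hw : w ∈ fullDom)
    (hf : ∀ i, w.1 ≠ D.c i w.2.2) : D.ungen (D.gen w) = w := by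
  have h1 := h.total_ne _ _ hw hf
  have h2 := h.ungenFst_gen hw
  refine Prod.ext h2 (Prod.ext ?_ rfl)
  simp only [ungen, h2]
  simp only [gen]
  field_simp
  ring

theorem gen_ungen (h : D.Valid a k A A') {z : C3} (hz : z ∈ fullDom)
    (hf : ∀ i, z.1 ≠ D.shift z.2.2 + D.scale z.2.2 * D.c i z.2.2) :
    (∀ i, (D.ungen z).1 ≠ D.c i z.2.2) ∧ D.gen (D.ungen z) = z := by
  have h1 := h.scale_ne _ hz
  have h2 : ∀ i, (D.ungen z).1 ≠ D.c i z.2.2 := fun i e => hf i (by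
    rw [← e]
    simp only [ungen, ungenFst]
    field_simp
    ring)
  refine ⟨h2, ?_⟩
  have h3 : D.total (D.ungenFst z) z.2.2 ≠ 0 := h.total_ne _ _ hz h2
  simp only [gen, ungen]
  refine Prod.ext ?_ (Prod.ext ?_ rfl)
  · simp only [ungenFst]
    field_simp
    ring
  · simp only
    field_simp
    ring

theorem eventually_ne [Finite ι] {w : C3} (p : ι → Prop)
    (hf : ∀ i, p i → w.1 ≠ D.c i w.2.2) : ∀ᶠ w' : C3 in 𝓝 w, ∀ i, p i → w'.1 ≠ D.c i w'.2.2 := by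
  refine eventually_all.2 fun i => ?_
  by_cases hp : p i
  · have hc : ContinuousAt (fun w : C3 => w.1 - D.c i w.2.2) w :=
      continuous_fst.continuousAt.sub (analyticAt_time (D.analyticAt_c i _)).continuousAt
    filter_upwards [hc.eventually_ne (sub_ne_zero.2 (hf i hp))] with w' h1 _ using sub_ne_zero.1 h1
  · exact Eventually.of_forall fun _ h => absurd h hp

theorem locInv_gen [Finite ι] (h : D.Valid a k A A') {w : C3} (hw : w ∈ fullDom)
    (hf : ∀ i, w.1 ≠ D.c i w.2.2) : LocInv D.gen D.ungen w := by
  have h0 := h.scale_ne _ hw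
  have ha : AnalyticAt ℂ D.ungenFst (D.gen w) := by
    have h1 := analyticAt_time (w := D.gen w) (h.analytic_shift _ hw)
    have h2 := analyticAt_time (w := D.gen w) (h.analytic_scale _ hw)
    have h3 : D.scale (D.gen w).2.2 ≠ 0 := h0
    unfold ungenFst
    fun_prop (disch := assumption)
  have hT : AnalyticAt ℂ (fun z => D.total (D.ungenFst z) z.2.2) (D.gen w) := by
    have h1 : AnalyticAt ℂ (fun z : C3 => ((D.ungenFst z, 0, z.2.2) : C3)) (D.gen w) := by
      fun_prop
    exact AnalyticAt.fun_comp (g := fun w : C3 => D.total w.1 w.2.2)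
      (f := fun z : C3 => ((D.ungenFst z, 0, z.2.2) : C3)) (h.analytic_total _ hw) h1
  have hq := h.analyticAt_q (τ := fun z : C3 => z.2.2) ha (by fun_prop) hw
  have hT0 : D.total (D.ungenFst (D.gen w)) (D.gen w).2.2 ≠ 0 := by
    rw [h.ungenFst_gen hw]
    exact h.total_ne _ _ hw hf
  refine ⟨h.analyticAt_gen hw, ?_, h.ungen_gen hw hf, ?_⟩
  · unfold ungen
    fun_prop (disch := assumption)
  · have h1 := ha.continuousAt.eventually (p := fun x => x = x) (by simp)
    have hc : Tendsto (fun z : C3 => ((D.ungenFst z, 0, z.2.2) : C3)) (𝓝 (D.gen w))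
        (𝓝 (w.1, 0, w.2.2)) := by
      have : ContinuousAt (fun z : C3 => ((D.ungenFst z, 0, z.2.2) : C3)) (D.gen w) := by
        have := ha.continuousAt
        fun_prop
      have h2 := this.tendsto
      rwa [h.ungenFst_gen hw] at h2
    filter_upwards [hc.eventually (eventually_ne (D := D) (w := (w.1, 0, w.2.2)) (fun _ => True)
      fun i _ => hf i), isOpen_fullDom.mem_nhds (show D.gen w ∈ fullDom from hw)] with z h2 h3
    refine (h.gen_ungen h3 fun i e => h2 i trivial ?_).2
    have := h.scale_ne _ h3
    simp only [ungenFst, e]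
    field_simp
    ring

theorem locInv_negMap (h : D.Valid a k A A') (i : ι) {y t : ℂ} (ht : t ∈ B) :
    LocInv (D.negMap i) (D.negInv i) (D.c i t, y, t) := by
  have h0 := h.scale_ne t ht
  have hR := h.R_ne i t ht
  have e : D.negMap i (D.c i t, y, t) =
      ((D.R i (D.c i t) t * y + D.dq i (D.c i t) t) / D.scale t, 0, t) := by
    simp [negMap]
  have hs : AnalyticAt ℂ (fun w : C3 => D.scale w.2.2) (D.c i t, y, t) :=
    analyticAt_time (h.analytic_scale t ht)
  have hs' : AnalyticAt ℂ (fun w : C3 => D.scale w.2.2) (D.negMap i (D.c i t, y, t)) := by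
    rw [e]; exact analyticAt_time (h.analytic_scale t ht)
  have hc' : AnalyticAt ℂ (fun w : C3 => D.c i w.2.2) (D.negMap i (D.c i t, y, t)) :=
    analyticAt_time (D.analyticAt_c i _)
  have hf : AnalyticAt ℂ (fun z : C3 => D.c i z.2.2 + z.2.1 / D.scale z.2.2)
      (D.negMap i (D.c i t, y, t)) := by
    have : D.scale (D.negMap i (D.c i t, y, t)).2.2 ≠ 0 := h0
    fun_prop (disch := assumption)
  have hR' := h.analyticAt_R i (τ := fun z : C3 => z.2.2) hf (by fun_prop) ht
  have hRe : D.R i (D.c i (D.negMap i (D.c i t, y, t)).2.2 + (D.negMap i (D.c i t, y, t)).2.1 /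
      D.scale (D.negMap i (D.c i t, y, t)).2.2) (D.negMap i (D.c i t, y, t)).2.2 ≠ 0 := by
    rw [e]; simpa using hR
  refine ⟨?_, ?_, ?_, ?_⟩
  · have h1 := h.analyticAt_R i (w := (D.c i t, y, t)) (f := fun w : C3 => w.1)
      (τ := fun w : C3 => w.2.2) (by fun_prop) (by fun_prop) ht
    have h2 := h.analyticAt_dq i (w := (D.c i t, y, t)) (f := fun w : C3 => w.1)
      (τ := fun w : C3 => w.2.2) (by fun_prop) (by fun_prop) ht
    have h3 : AnalyticAt ℂ (fun w : C3 => D.c i w.2.2) (D.c i t, y, t) :=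
      analyticAt_time (D.analyticAt_c i _)
    unfold negMap
    fun_prop (disch := assumption)
  · have h2 := h.analyticAt_dq i (τ := fun z : C3 => z.2.2) hf (by fun_prop) ht
    unfold negInv
    dsimp only
    fun_prop (disch := assumption)
  · rw [e]
    simp only [negInv, zero_div, add_zero]
    rw [mul_div_cancel₀ _ h0, add_sub_cancel_right, mul_div_cancel_left₀ _ hR]
  · filter_upwards [hR'.continuousAt.eventually_ne hRe, hs'.continuousAt.eventually_ne
      (show D.scale (D.negMap i (D.c i t, y, t)).2.2 ≠ 0 from h0)] with z h1 h2
    simp only [negMap, negInv]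
    rw [mul_div_cancel₀ _ h1, sub_add_cancel, mul_div_cancel_left₀ _ h2, add_sub_cancel_left,
      mul_div_cancel₀ _ h2]

theorem locInv_posMap (h : D.Valid a k A A') (i : ι) {x t : ℂ} (ht : t ∈ B) :
    LocInv (D.posMap a i) (D.posInv a i) (x, 0, t) := by
  have h0 := h.scale_ne t ht
  have hR := h.R_ne i t ht
  have hb := h.param_ne i
  have e : D.posMap a i (x, 0, t) = (D.posFst a i (x, 0, t), 0, t) := by
    simp [posMap]
  have hs : AnalyticAt ℂ (fun w : C3 => D.scale w.2.2) (x, 0, t) :=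
    analyticAt_time (h.analytic_scale t ht)
  have hc : AnalyticAt ℂ (fun w : C3 => D.c i w.2.2) (x, 0, t) :=
    analyticAt_time (D.analyticAt_c i _)
  have hs' : AnalyticAt ℂ (fun w : C3 => D.scale w.2.2) (D.posMap a i (x, 0, t)) := by
    rw [e]; exact analyticAt_time (h.analytic_scale t ht)
  have hc' : AnalyticAt ℂ (fun w : C3 => D.c i w.2.2) (D.posMap a i (x, 0, t)) :=
    analyticAt_time (D.analyticAt_c i _)
  have h0' : D.scale (D.posMap a i (x, 0, t)).2.2 ≠ 0 := h0
  have hf : AnalyticAt ℂ (fun z : C3 => D.c i z.2.2 + z.2.1 / D.scale z.2.2)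
      (D.posMap a i (x, 0, t)) := by
    fun_prop (disch := assumption)
  have hR' := h.analyticAt_R i (τ := fun z : C3 => z.2.2) hf (by fun_prop) ht
  have hRe : D.R i (D.c i (D.posMap a i (x, 0, t)).2.2 + (D.posMap a i (x, 0, t)).2.1 /
      D.scale (D.posMap a i (x, 0, t)).2.2) (D.posMap a i (x, 0, t)).2.2 ≠ 0 := by
    rw [e]; simpa using hR
  have hRc := h.analyticAt_R i (τ := fun z : C3 => z.2.2) hc' (by fun_prop) ht
  have hRce : D.R i (D.c i (D.posMap a i (x, 0, t)).2.2) (D.posMap a i (x, 0, t)).2.2 ≠ 0 := hR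
  have hq := h.analyticAt_q (τ := fun z : C3 => z.2.2) hf (by fun_prop) ht
  have hqc := h.analyticAt_q (τ := fun z : C3 => z.2.2) hc' (by fun_prop) ht
  have hF : AnalyticAt ℂ (D.posFactor a i) (D.posMap a i (x, 0, t)) := by
    unfold posFactor
    dsimp only
    fun_prop (disch := assumption)
  have hFe : D.posFactor a i (D.posMap a i (x, 0, t)) = finParam a (D.line i) := by
    rw [e]
    simp only [posFactor, zero_div, add_zero, mul_zero]
    field_simp
    ring
  have hF0 : D.posFactor a i (D.posMap a i (x, 0, t)) ≠ 0 := by rwa [hFe]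
  refine ⟨?_, ?_, ?_, ?_⟩
  · have h1 : AnalyticAt ℂ (fun w : C3 => D.c i w.2.2 +
        w.2.1 * (finParam a (D.line i) - w.1 * w.2.1)) (x, 0, t) := by fun_prop
    have h2 := h.analyticAt_dR i (τ := fun w : C3 => w.2.2) h1 (by fun_prop) ht
    have h3 := h.analyticAt_dq i (τ := fun w : C3 => w.2.2) h1 (by fun_prop) ht
    have h4 := h.analyticAt_R i (τ := fun w : C3 => w.2.2) hc (by fun_prop) ht
    have h5 : finParam a (D.line i) - ((x, 0, t) : C3).1 * ((x, 0, t) : C3).2.1 ≠ 0 := by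
      simpa using hb
    have h6 : D.scale ((x, 0, t) : C3).2.2 ≠ 0 := h0
    unfold posMap posFst
    dsimp only at h5 h6 ⊢
    fun_prop (disch := assumption)
  · have h2 := h.analyticAt_dR i (τ := fun z : C3 => z.2.2) hf (by fun_prop) ht
    have h3 := h.analyticAt_dq i (τ := fun z : C3 => z.2.2) hf (by fun_prop) ht
    have h4 : D.scale (D.posMap a i (x, 0, t)).2.2 *
      D.posFactor a i (D.posMap a i (x, 0, t)) ≠ 0 := mul_ne_zero h0' hF0
    unfold posInv
    dsimp only
    fun_prop (disch := assumption)
  · simp only [posInv, hFe]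
    rw [e]
    simp only [zero_div, add_zero, posFst, mul_zero, sub_zero, zero_mul]
    refine Prod.ext ?_ rfl
    simp only
    field_simp
    ring
  · filter_upwards [hR'.continuousAt.eventually_ne hRe, hs'.continuousAt.eventually_ne h0',
      hF.continuousAt.eventually_ne hF0, hRc.continuousAt.eventually_ne hRce] with z h1 h2 h3 h4
    obtain ⟨U, V, t⟩ := z
    simp only at h1 h2 h3 h4
    -- the quantity `b - x y` of the preimage is `posFactor`
    have key : finParam a (D.line i) - (D.posInv a i (U, V, t)).1 * (D.posInv a i (U, V, t)).2.1 =
        D.posFactor a i (U, V, t) := by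
      have h5 : D.posFactor a i (U, V, t) * D.R i (D.c i t + V / D.scale t) t =
          D.R i (D.c i t) t * finParam a (D.line i) + D.q (D.c i t) t + U * V
            - D.q (D.c i t + V / D.scale t) t := by
        rw [posFactor, div_mul_cancel₀ _ h1]
      have h6 := D.R_eq i (D.c i t + V / D.scale t) t
      have h7 := D.q_eq i (D.c i t + V / D.scale t) t
      simp only [posInv]
      generalize D.posFactor a i (U, V, t) = s at *
      rw [h6, h7] at h5
      generalize D.dR i (D.c i t + V / D.scale t) t = ρ at *
      generalize D.dq i (D.c i t + V / D.scale t) t = θ at *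
      generalize D.R i (D.c i t) t = r at *
      rw [add_sub_cancel_left] at h5
      field_simp at h5 ⊢
      linear_combination -h5
    have e2 : (D.posInv a i (U, V, t)).2.1 = V / (D.scale t * D.posFactor a i (U, V, t)) := rfl
    have e3 : (D.posInv a i (U, V, t)).2.2 = t := rfl
    have e4 : D.c i t + V / (D.scale t * D.posFactor a i (U, V, t)) * D.posFactor a i (U, V, t) =
        D.c i t + V / D.scale t := by
      field_simp
    simp only [posMap, posFst, key, e3]
    rw [e2, e4]
    simp only [posInv]
    generalize D.posFactor a i (U, V, t) = s at *
    generalize D.c i t + V / D.scale t = f at *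
    refine Prod.ext ?_ (Prod.ext ?_ rfl)
    · simp only
      generalize D.R i (D.c i t) t = r at *
      field_simp
      ring
    · simp only
      field_simp

end Valid

end FibreData

theorem exists_sphereChart (u : OnePoint ℂ) :
    u = sphereChart false 0 ∨ ∃ U, u = sphereChart true U := by
  induction u with
  | infty => exact Or.inr ⟨0, by simp [sphereChart, recip]⟩
  | coe x =>
    by_cases hx : x = 0
    · exact Or.inl (by rw [hx]; rfl)
    · exact Or.inr ⟨x⁻¹, by simp [sphereChart, recip, hx]⟩

namespace FibreData

variable {S : Space} {J ι : Type} (D : FibreData S J ι) (a : Fin 5 → ℂ) (k : J → S.Ix)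
  (A A' : J → ℂ → ℂ)

open Classical in
/-- The point of the blow up with the given coordinates in Takano's chart `0`. -/
def zeroPt (w : C3) : (S.blowUp k A A').Pt :=
  if h : ∃ i, w.1 = D.c i w.2.2 then
    excPt k A A' (D.neg h.choose) w.2.2 (sphereChart true (D.negMap h.choose w).1)
  else offPt k A A' ((S.chart D.chart).par (D.gen w))

/-- The point of the exceptional line over `pos i` which is the point `(x, 0, t)` in Takano's chart
at the line over the fibre `i`. -/
def linePt (i : ι) (x t : ℂ) : (S.blowUp k A A').Pt :=
  excPt k A A' (D.pos i) t (sphereChart true (D.posFst a i (x, 0, t)))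

/-- Takano's chart `0` as a patch of the blow up. -/
def zeroPatch : Patch (S.blowUp k A A').Pt := ⟨fullDom, D.zeroPt k A A'⟩

open Classical in
/-- Takano's chart at the line over the fibre `i` as a patch of the blow up. -/
def linePatch (i : ι) : Patch (S.blowUp k A A').Pt :=
  ⟨fullDom, fun w => if w.2.1 = 0 then D.linePt a k A A' i w.1 w.2.2
    else D.zeroPt k A A' (back a (Sum.inr (D.line i)) w)⟩

variable {D a k A A'}

namespace Valid

theorem c_inj (h : D.Valid a k A A') {i j : ι} {t : ℂ} (ht : t ∈ B) (e : D.c i t = D.c j t) :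
    i = j := h.line_inj (fibre_inj ht e)

theorem zeroPt_off {w : C3} (hf : ∀ i, w.1 ≠ D.c i w.2.2) :
    D.zeroPt k A A' w = offPt k A A' ((S.chart D.chart).par (D.gen w)) :=
  dif_neg fun ⟨i, hi⟩ => hf i hi

theorem zeroPt_exc (h : D.Valid a k A A') {w : C3} (hw : w ∈ fullDom) {i : ι}
    (hf : w.1 = D.c i w.2.2) : D.zeroPt k A A' w =
      excPt k A A' (D.neg i) w.2.2 (sphereChart true (D.negMap i w).1) := by
  have hex : ∃ i, w.1 = D.c i w.2.2 := ⟨i, hf⟩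
  have e : hex.choose = i := h.c_inj hw (hex.choose_spec.symm.trans hf)
  rw [zeroPt, dif_pos hex, e]

theorem zeroPt_cases (h : D.Valid a k A A') {w : C3} (hw : w ∈ fullDom) :
    ((∀ i, w.1 ≠ D.c i w.2.2) ∧
      D.zeroPt k A A' w = offPt k A A' ((S.chart D.chart).par (D.gen w))) ∨
    ∃ i, w.1 = D.c i w.2.2 ∧ D.zeroPt k A A' w =
      excPt k A A' (D.neg i) w.2.2 (sphereChart true (D.negMap i w).1) := by
  by_cases hex : ∃ i, w.1 = D.c i w.2.2
  · obtain ⟨i, hi⟩ := hex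
    exact Or.inr ⟨i, hi, h.zeroPt_exc hw hi⟩
  · have hf : ∀ i, w.1 ≠ D.c i w.2.2 := fun i hi => hex ⟨i, hi⟩
    exact Or.inl ⟨hf, zeroPt_off hf⟩

theorem gen_avoid (h : D.Valid a k A A') {w : C3} (hw : w ∈ fullDom)
    (hf : ∀ i, w.1 ≠ D.c i w.2.2) (j : J) :
    (S.chart D.chart).par (D.gen w) ≠ S.center k A A' j w.2.2 :=
  h.avoid (D.gen w) hw (h.gen_fst_ne hw hf) j

theorem exc_par_ne {j : J} (hj : k j = D.chart) {z : C3}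
    (hz : z.2.1 ≠ 0) : ((S.blowUp k A A').chart (excIx k A A' j true)).par z =
      offPt k A A' ((S.chart D.chart).par (A j z.2.2 + z.2.1, A' j z.2.2 + z.1 * z.2.1, z.2.2)) := by
  rw [blowUp_par_exc_ne hz, hj]
  simp only [blowDown, if_true]

variable [Finite ι] [Finite J]

/-- Takano's chart `0` is a holomorphic patch of the blow up. -/
theorem isLocalPatch_zero (h : D.Valid a k A A') {w : C3} (hw : w ∈ fullDom) :
    (S.blowUp k A A').IsLocalPatch (D.zeroPatch k A A') w := by
  rcases h.zeroPt_cases hw with ⟨hf, -⟩ | ⟨i, hi, -⟩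
  · refine ⟨offIx k A A' D.chart, D.gen w, LocEquiv.of_locInv (h.locInv_gen hw hf)
      (isOpen_fullDom.mem_nhds hw) (((h.atlas.blowUp h.admissible).isOpen _).mem_nhds
        ⟨by rw [h.dom]; exact hw, h.gen_avoid hw hf⟩) ?_⟩
    filter_upwards [eventually_ne (D := D) (w := w) (fun _ => True) fun i _ => hf i] with w' h1
    exact (zeroPt_off fun i => h1 i trivial).symm
  · obtain ⟨f, y, t⟩ := w
    obtain rfl : f = D.c i t := hi
    have hw : t ∈ B := hw
    have e : D.negMap i (D.c i t, y, t) = ((D.negMap i (D.c i t, y, t)).1, 0, t) :=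
      Prod.ext rfl (Prod.ext (by simp [negMap]) rfl)
    -- on the fibre, the chart `0` is a chart `(U, V)` at the centre `neg i`
    refine ⟨excIx k A A' (D.neg i) true, _, LocEquiv.of_locInv (h.locInv_negMap i hw)
      (fullDom_mem_nhds hw) (((h.atlas.blowUp h.admissible).isOpen _).mem_nhds ?_) ?_⟩
    · rw [e]
      exact h.admissible.mem_dom_exceptional hw
    · filter_upwards [eventually_ne (D := D) (w := (D.c i t, y, t)) (fun j => j ≠ i)
        fun j hj e => hj (h.c_inj hw e).symm, fullDom_mem_nhds (w := (D.c i t, y, t)) hw]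
        with w h1 h2
      by_cases hf : w.1 = D.c i w.2.2
      · rw [blowUp_par_exc_zero (by simp [negMap, hf])]
        exact (h.zeroPt_exc h2 hf).symm
      · have hs := h.scale_ne _ h2
        rw [exc_par_ne (h.k_neg i) (mul_ne_zero hs (sub_ne_zero.2 hf))]
        refine Eq.trans ?_ (zeroPt_off (D := D) (k := k) (A := A) (A' := A') (w := w) ?_).symm
        · have h3 := D.R_eq i w.1 w.2.2
          have h4 := D.q_eq i w.1 w.2.2
          congr 2
          simp only [negMap, gen, h.fst_neg i _ h2, h.snd_neg i _ h2, h.total_eq i _ _ h2]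
          refine Prod.ext ?_ (Prod.ext ?_ rfl)
          · simp only
            ring
          · simp only
            rw [h4]
            generalize D.dq i w.1 w.2.2 = θ
            generalize D.R i w.1 w.2.2 = ρ
            field_simp
            ring
        · intro j
          by_cases hj : j = i
          · rw [hj]; exact hf
          · exact h1 j hj

/-- Takano's chart at the line over the fibre `i` is a holomorphic patch of the blow up. -/
theorem isLocalPatch_line (h : D.Valid a k A A') (i : ι) {x t : ℂ} (ht : t ∈ B) :
    (S.blowUp k A A').IsLocalPatch (D.linePatch a k A A' i) (x, 0, t) := by
  have e : D.posMap a i (x, 0, t) = (D.posFst a i (x, 0, t), 0, t) := by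
    simp [posMap]
  refine ⟨excIx k A A' (D.pos i) true, _, LocEquiv.of_locInv (h.locInv_posMap i ht)
    (fullDom_mem_nhds ht) (((h.atlas.blowUp h.admissible).isOpen _).mem_nhds ?_) ?_⟩
  · rw [e]
    exact h.admissible.mem_dom_exceptional ht
  · have hs : ∀ᶠ w : C3 in 𝓝 (x, 0, t), finParam a (D.line i) - w.1 * w.2.1 ≠ 0 := by
      have hc : Continuous fun w : C3 => finParam a (D.line i) - w.1 * w.2.1 := by fun_prop
      exact hc.continuousAt.eventually_ne (by simpa using h.param_ne i)
    have hF : Tendsto (fun w : C3 => (((back a (Sum.inr (D.line i)) w).1, 0, w.2.2) : C3))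
        (𝓝 (x, 0, t)) (𝓝 (D.c i t, 0, t)) := by
      have hc : Continuous fun w : C3 => (((back a (Sum.inr (D.line i)) w).1, 0, w.2.2) : C3) := by
        simp only [back, fibre]
        fun_prop
      have := hc.tendsto (x, 0, t)
      simpa [back, c] using this
    filter_upwards [hs, hF.eventually (eventually_ne (D := D) (w := (D.c i t, 0, t))
      (fun j => j ≠ i) fun j hj e => hj (h.c_inj ht e).symm),
      fullDom_mem_nhds (w := (x, 0, t)) ht] with w h1 h2 h3
    by_cases hy : w.2.1 = 0
    · rw [blowUp_par_exc_zero (by simp [posMap, hy])]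
      refine Eq.trans ?_ (if_pos hy).symm
      rw [linePt, ← hy]
      rfl
    · have hscale := h.scale_ne _ h3
      rw [exc_par_ne (h.k_pos i) (mul_ne_zero hscale (mul_ne_zero hy h1))]
      refine Eq.trans (Eq.trans ?_ (zeroPt_off (D := D) (k := k) (A := A) (A' := A')
        (w := back a (Sum.inr (D.line i)) w) ?_).symm) (if_neg hy).symm
      · have h4 := D.R_eq i (back a (Sum.inr (D.line i)) w).1 w.2.2
        have h5 := D.q_eq i (back a (Sum.inr (D.line i)) w).1 w.2.2
        have h6 : (back a (Sum.inr (D.line i)) w).1 =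
          D.c i w.2.2 + w.2.1 * (finParam a (D.line i) - w.1 * w.2.1) := rfl
        have h7 : (back a (Sum.inr (D.line i)) w).2.1 = w.2.1⁻¹ := rfl
        congr 2
        simp only [posMap, posFst, gen, back_time, h.fst_pos i _ h3, h.snd_pos i _ h3,
          h.total_eq i _ _ h3, h7]
        rw [h5, h4, h6]
        refine Prod.ext ?_ (Prod.ext ?_ rfl)
        · simp only
          ring
        · simp only
          generalize D.dq i _ w.2.2 = θ
          generalize D.dR i _ w.2.2 = ρ
          generalize D.R i _ w.2.2 = r
          rw [add_sub_cancel_left]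
          have h8 : w.1 * w.2.1 = finParam a (D.line i) -
            (finParam a (D.line i) - w.1 * w.2.1) := by ring
          generalize finParam a (D.line i) - w.1 * w.2.1 = s at *
          field_simp
          linear_combination -r * h8
      · intro j
        rw [back_time]
        by_cases hj : j = i
        · rw [hj]
          intro e
          have : w.2.1 * (finParam a (D.line i) - w.1 * w.2.1) = 0 := by
            simpa [back, c] using e
          exact mul_ne_zero hy h1 this
        · exact h2 j hj

end Valid

/-! ### Takano's charts and the exceptional lines over a pair of points -/

namespace Valid

theorem base_zeroPt (h : D.Valid a k A A') {w : C3} (hw : w ∈ fullDom) :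
    (S.blowUp k A A').base (D.zeroPt k A A' w) = w.2.2 := by
  rcases h.zeroPt_cases hw with ⟨hf, e⟩ | ⟨i, hi, e⟩
  · rw [e, blowUp_base_offPt]
    exact h.atlas.base (k := D.chart) (z := D.gen w) (by rw [h.dom]; exact hw)
  · rw [e, blowUp_base_excPt]

theorem zeroPt_injOn (h : D.Valid a k A A') : InjOn (D.zeroPt k A A') fullDom := by
  intro w hw w' hw' e
  rcases h.zeroPt_cases hw with ⟨hf, e1⟩ | ⟨i, hi, e1⟩ <;>
    rcases h.zeroPt_cases hw' with ⟨hf', e2⟩ | ⟨i', hi', e2⟩ <;> rw [e1, e2] at e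
  · have e3 := (h.atlas.isPatch D.chart).injOn (by rw [h.dom]; exact hw) (by rw [h.dom]; exact hw')
      (offPt_inj.1 e)
    rw [← h.ungen_gen hw hf, e3, h.ungen_gen hw' hf']
  · exact absurd e offPt_ne_excPt
  · exact absurd e.symm offPt_ne_excPt
  · obtain ⟨e3, e4, e5⟩ := excPt_inj.1 e
    obtain rfl := h.neg_inj e3
    obtain ⟨f, y, t⟩ := w
    obtain ⟨f', y', t'⟩ := w'
    obtain rfl : t = t' := e4
    obtain rfl : f = D.c i t := hi
    obtain rfl : f' = D.c i t := hi'
    have h6 : D.R i (D.c i t) t ≠ 0 := h.R_ne i t hw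
    have h7 := sphereChart_self.1 e5
    simp only [negMap] at h7
    have h8 := mul_left_cancel₀ h6 (add_right_cancel ((div_left_inj' (h.scale_ne t hw)).1 h7))
    rw [h8]

theorem linePt_inj (h : D.Valid a k A A') {i i' : ι} {x x' t t' : ℂ} (ht : t ∈ B)
    (e : D.linePt a k A A' i x t = D.linePt a k A A' i' x' t') : i = i' ∧ x = x' ∧ t = t' := by
  obtain ⟨e1, rfl, e2⟩ := excPt_inj.1 e
  obtain rfl := h.pos_inj e1
  refine ⟨rfl, ?_, rfl⟩
  have h7 := sphereChart_self.1 e2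
  have h8 := h.R_ne i t ht
  have h9 := h.scale_ne t ht
  have h10 := h.param_ne i
  simp only [posFst, mul_zero, zero_mul, add_zero, sub_zero] at h7
  generalize D.R i (D.c i t) t = r at *
  generalize D.dR i (D.c i t) t = ρ at *
  generalize D.dq i (D.c i t) t = θ at *
  field_simp at h7
  refine mul_left_cancel₀ h8 ?_
  linear_combination -h7

theorem zeroPt_ne_linePt (h : D.Valid a k A A') {w : C3} (hw : w ∈ fullDom) (i : ι) (x t : ℂ) :
    D.zeroPt k A A' w ≠ D.linePt a k A A' i x t := by
  rcases h.zeroPt_cases hw with ⟨hf, e1⟩ | ⟨j, hj, e1⟩ <;> rw [e1]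
  · exact offPt_ne_excPt
  · exact fun e => h.neg_ne_pos _ _ (excPt_inj.1 e).1

/-- A point away from the fibres lies in Takano's chart `0`. -/
theorem exists_zeroPt_off (h : D.Valid a k A A') {z : C3} (hz : z ∈ fullDom)
    (hf : ∀ i, z.1 ≠ D.shift z.2.2 + D.scale z.2.2 * D.c i z.2.2) :
    ∃ w ∈ fullDom, (∀ i, w.1 ≠ D.c i w.2.2) ∧ D.gen w = z ∧
      D.zeroPt k A A' w = offPt k A A' ((S.chart D.chart).par z) := by
  obtain ⟨h1, h2⟩ := h.gen_ungen hz hf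
  exact ⟨D.ungen z, hz, h1, h2, by rw [zeroPt_off h1, h2]⟩

/-- A point of the exceptional line over `neg i` either lies in Takano's chart `0` or is the
direction of the fibre. -/
theorem exists_zeroPt_exc (h : D.Valid a k A A') (i : ι) {t : ℂ} (ht : t ∈ B) (u : OnePoint ℂ) :
    u = sphereChart false 0 ∨ ∃ w ∈ fullDom, D.zeroPt k A A' w = excPt k A A' (D.neg i) t u := by
  have h1 := h.R_ne i t ht
  have h2 := h.scale_ne t ht
  rcases exists_sphereChart u with rfl | ⟨U, rfl⟩
  · exact Or.inl rfl
  · refine Or.inr ⟨(D.c i t, (D.scale t * U - D.dq i (D.c i t) t) / D.R i (D.c i t) t, t), ht, ?_⟩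
    rw [h.zeroPt_exc (i := i) ht rfl]
    congr 2
    simp only [negMap]
    rw [mul_div_cancel₀ _ h1, sub_add_cancel, mul_div_cancel_left₀ _ h2]

/-- A point of the exceptional line over `pos i` either lies on the line `i` or is the
direction of the fibre. -/
theorem exists_linePt (h : D.Valid a k A A') (i : ι) {t : ℂ} (ht : t ∈ B) (u : OnePoint ℂ) :
    u = sphereChart false 0 ∨ ∃ x, D.linePt a k A A' i x t = excPt k A A' (D.pos i) t u := by
  have h1 := h.R_ne i t ht
  have h2 := h.scale_ne t ht
  have h3 := h.param_ne i
  rcases exists_sphereChart u with rfl | ⟨U, rfl⟩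
  · exact Or.inl rfl
  · refine Or.inr ⟨finParam a (D.line i) * (D.dR i (D.c i t) t * finParam a (D.line i) +
      D.dq i (D.c i t) t - D.scale t * U) / D.R i (D.c i t) t, ?_⟩
    rw [linePt]
    congr 2
    simp only [posFst, mul_zero, zero_mul, add_zero, sub_zero]
    generalize D.R i (D.c i t) t = r at *
    field_simp
    ring

end Valid

end FibreData

/-! ### Placements given by a chart and five lines -/

section Glue

variable {X : Space}

/-- The placement of the glued surface with the given positions of Takano's chart `0` and of the
lines in the other charts. -/
def glue (z : C3 → X.Pt) (L : Line → ℂ → ℂ → X.Pt) : ModelPt → X.Pt :=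
  Sum.elim z fun q => L q.1 q.2.1 q.2.2

theorem placedPatch_glue_zero {a : Fin 5 → ℂ} {z : C3 → X.Pt} {L : Line → ℂ → ℂ → X.Pt} {l : Line}
    {w : C3} (h : w.2.1 = 0) : (placedPatch a (glue z L) (some l)).par w = L l w.1 w.2.2 :=
  congrArg (glue z L) (modelPatch_zero h)

theorem placedPatch_glue_ne {a : Fin 5 → ℂ} {z : C3 → X.Pt} {L : Line → ℂ → ℂ → X.Pt} {l : Line}
    {w : C3} (h : w.2.1 ≠ 0) : (placedPatch a (glue z L) (some l)).par w = z (back a l w) :=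
  congrArg (glue z L) (modelPatch_ne h)

theorem isPlacement_glue {a : Fin 5 → ℂ} {z : C3 → X.Pt} {L : Line → ℂ → ℂ → X.Pt}
    (hX : X.IsAtlas) (hz : InjOn z fullDom)
    (hL : ∀ l l' x x' t t', t ∈ B → L l x t = L l' x' t' → l = l' ∧ x = x' ∧ t = t')
    (hzL : ∀ w ∈ fullDom, ∀ l x t, z w ≠ L l x t) (hbz : ∀ w ∈ fullDom, X.base (z w) = w.2.2)
    (hbL : ∀ l x, ∀ t ∈ B, X.base (L l x t) = t)
    (h0 : ∀ w ∈ fullDom, X.IsLocalPatch ⟨fullDom, z⟩ w)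
    (h1 : ∀ l x, ∀ t ∈ B, X.IsLocalPatch (placedPatch a (glue z L) (some l)) (x, 0, t)) :
    X.IsPlacement a (glue z L) where
  atlas := hX
  injOn := by
    rintro (w | ⟨l, x, t⟩) hm (w' | ⟨l', x', t'⟩) hm' e
    · exact congrArg Sum.inl (hz hm hm' e)
    · exact absurd e (hzL w hm l' x' t')
    · exact absurd e.symm (hzL w' hm' l x t)
    · obtain ⟨rfl, rfl, rfl⟩ := hL l l' x x' t t' hm e
      rfl
  base := by
    rintro (w | ⟨l, x, t⟩) hm
    · exact hbz w hm
    · exact hbL l x t hm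
  local_zero := h0
  local_line := h1

end Glue

theorem exists_sphereChart' (u : OnePoint ℂ) :
    u = sphereChart true 0 ∨ ∃ U, u = sphereChart false U := by
  induction u with
  | infty => exact Or.inl (by simp [sphereChart, recip])
  | coe x => exact Or.inr ⟨x, rfl⟩

theorem fibre_ne_zero {i : Fin 3} (hi : i ≠ 1) {t : ℂ} (ht : t ∈ B) : fibre i t ≠ 0 := by
  intro e
  exact hi (fibre_inj ht (e.trans (by simp [fibre, fibreConst, fibreSlope])))

/-- A cubic polynomial has its linear coefficient as derivative at `0`. -/
theorem hasDerivAt_cubic (h c b d : ℂ) :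
    HasDerivAt (fun s : ℂ => h + s * c + s ^ 2 * b + s ^ 3 * d) c 0 := by
  have h1 := (((hasDerivAt_id (0 : ℂ)).mul_const c).const_add h).add
    (((hasDerivAt_id (0 : ℂ)).pow 2).mul_const b)
  have h2 := h1.add (((hasDerivAt_id (0 : ℂ)).pow 3).mul_const d)
  exact h2.congr_deriv (by simp)

/-- The partial derivatives of the Hamiltonian in Takano's chart `0`. -/
theorem hamSystem_knyH₀ (a : Fin 5 → ℂ) {x y t : ℂ} (ht : t ∈ B) :
    hamSystem (knyH₀ a) (x, y, t) =
      ((2 * x * (x - 1) * (x - t) * y + (x ^ 2 * (a 1 + 2 * a 2) + x * t * (a 3 + a 4)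
          - x * (a 1 + 2 * a 2 + a 3) - t * a 4)) / (t * (t - 1)),
        -((3 * x ^ 2 - 2 * (1 + t) * x + t) * y ^ 2 + a 2 * (a 1 + a 2)
          + (2 * x * (a 1 + 2 * a 2) + t * (a 3 + a 4) - (a 1 + 2 * a 2 + a 3)) * y)
          / (t * (t - 1)), 1) := by
  have h0 : t ≠ 0 := ht.1
  have h1 : t - 1 ≠ 0 := sub_ne_zero.2 ht.2
  have hd : HasFDerivAt (knyH₀ a) (fderiv ℂ (knyH₀ a) (x, y, t)) (x, y, t) :=
    (analyticAt_modelHam (a := a) none (w := (x, y, t)) ht).differentiableAt.hasFDerivAt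
  have key : ∀ v : C3, ∀ h c b d : ℂ, (∀ s : ℂ, knyH₀ a ((x, y, t) + s • v) =
      h + s * c + s ^ 2 * b + s ^ 3 * d) → fderiv ℂ (knyH₀ a) (x, y, t) v = c := by
    intro v h c b d e
    have h2 : HasDerivAt (fun s : ℂ => ((x, y, t) : C3) + s • v) v 0 := by
      have := ((hasDerivAt_id (0 : ℂ)).smul_const v).const_add ((x, y, t) : C3)
      simpa using this
    have h3 : HasFDerivAt (knyH₀ a) (fderiv ℂ (knyH₀ a) (x, y, t))
        (((x, y, t) : C3) + (0 : ℂ) • v) := by simpa using hd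
    have h4 := h3.comp_hasDerivAt (0 : ℂ) h2
    have h5 : knyH₀ a ∘ (fun s : ℂ => ((x, y, t) : C3) + s • v) =
        fun s : ℂ => h + s * c + s ^ 2 * b + s ^ 3 * d := funext e
    rw [h5] at h4
    exact h4.unique (hasDerivAt_cubic h c b d)
  have k1 := key (1, 0, 0) (knyH₀ a (x, y, t))
    (((3 * x ^ 2 - 2 * (1 + t) * x + t) * y ^ 2 + a 2 * (a 1 + a 2)
          + (2 * x * (a 1 + 2 * a 2) + t * (a 3 + a 4) - (a 1 + 2 * a 2 + a 3)) * y)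
          / (t * (t - 1)))
    (((3 * x - 1 - t) * y ^ 2 + (a 1 + 2 * a 2) * y) / (t * (t - 1))) (y ^ 2 / (t * (t - 1)))
    (fun s => by simp [knyH₀]; field_simp; ring)
  have k2 := key (0, 1, 0) (knyH₀ a (x, y, t))
    ((2 * x * (x - 1) * (x - t) * y + (x ^ 2 * (a 1 + 2 * a 2) + x * t * (a 3 + a 4)
          - x * (a 1 + 2 * a 2 + a 3) - t * a 4)) / (t * (t - 1)))
    (x * (x - 1) * (x - t) / (t * (t - 1))) 0
    (fun s => by simp [knyH₀]; field_simp; ring)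
  rw [hamSystem, k1, k2, neg_div]

/-- The centres of a blow up of `ℙ¹ × ℙ¹` are admissible if they are distinct and depend
holomorphically on `t`. -/
theorem admissible_P1P1 {J : Type} {k : J → P1P1.Ix} {a b : J → ℂ → ℂ}
    (ha : ∀ j, ∀ t ∈ B, AnalyticAt ℂ (a j) t) (hb : ∀ j, ∀ t ∈ B, AnalyticAt ℂ (b j) t)
    (hd : ∀ i j, ∀ t ∈ B, P1P1.center k a b i t = P1P1.center k a b j t → i = j) :
    P1P1.Admissible k a b :=
  ⟨ha, hb, fun _ _ ht => ht, hd, fun j i => isOpen_ne_P1P1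
    (fun t ht => (ha j t ht).continuousAt.continuousWithinAt)
    (fun t ht => (hb j t ht).continuousAt.continuousWithinAt) _ i⟩

theorem admissible_F1 {J : Type} {k : J → F1.Ix} {a b : J → ℂ → ℂ}
    (ha : ∀ j, ∀ t ∈ B, AnalyticAt ℂ (a j) t) (hb : ∀ j, ∀ t ∈ B, AnalyticAt ℂ (b j) t)
    (hd : ∀ i j, ∀ t ∈ B, F1.center k a b i t = F1.center k a b j t → i = j) :
    F1.Admissible k a b :=
  ⟨ha, hb, fun _ _ ht => ht, hd, fun j i => isOpen_ne_F1
    (fun t ht => (ha j t ht).continuousAt.continuousWithinAt)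
    (fun t ht => (hb j t ht).continuousAt.continuousWithinAt) _ i⟩

/-! ### The space `E^KNY` -/

section KNY

variable (a : Fin 5 → ℂ)

/-- The charts that contain the centres of the first blow up. -/
def knyK : Fin 6 → P1P1.Ix :=
  ![(true, false), (true, false), (false, true), (false, false), (false, false), (false, true)]

/-- The first coordinates of the centres of the first blow up. -/
def knyA (j : Fin 6) (t : ℂ) : ℂ := ![0, 0, t, 0, 0, 1] j

/-- The second coordinates of the centres of the first blow up. -/
def knyB (j : Fin 6) (_ : ℂ) : ℂ := ![-a 2, -a 1 - a 2, 0, 0, a 4, 0] j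

/-- The first blow up. -/
abbrev knyY₁ : Space := P1P1.blowUp knyK knyA (knyB a)

/-- The charts that contain the centres of the second blow up. -/
def knyK₂ : Fin 2 → (knyY₁ a).Ix :=
  ![excIx knyK knyA (knyB a) 2 false, excIx knyK knyA (knyB a) 5 false]

/-- The coordinates `u` of the centres of the second blow up; there `v = 0`. -/
def knyA₂ (j : Fin 2) (t : ℂ) : ℂ := ![t * a 0, a 3] j

/-- The second blow up. -/
abbrev knyY₂ : Space := (knyY₁ a).blowUp (knyK₂ a) (knyA₂ a) fun _ _ => 0

/-- The index of the line at which the second blow up takes place. -/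
def knyLine (m : Fin 2) : Fin 3 := ![0, 2] m

/-- The centre of the first blow up, over whose exceptional line the second one takes place. -/
def knyUnder (m : Fin 2) : Fin 6 := ![2, 5] m

theorem knyK₂_eq : knyK₂ a = fun m => excIx knyK knyA (knyB a) (knyUnder m) false := by
  funext m
  fin_cases m <;> rfl

/-- Takano's chart `0` is `(f, g) = (x₀, x₀ y₀)`. The fibre `f = 0` is the only one on which two
points are blown up: `g = 0`, on whose exceptional line the chart `0` continues, and `g = a₄`. -/
def knyData : FibreData P1P1 (Fin 6) Unit where
  chart := (false, false)
  line _ := 1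
  neg _ := 3
  pos _ := 4
  shift _ := 0
  scale _ := 1
  total f _ := f
  q0 _ := 0
  q1 _ := 0
  q2 _ := 0
  r0 _ _ := 1
  r1 _ _ := 0
  r2 _ _ := 0

theorem knyData_c (i : Unit) (t : ℂ) : knyData.c i t = 0 := by
  simp [FibreData.c, knyData, fibre, fibreConst, fibreSlope]

theorem knyData_R (i : Unit) (f t : ℂ) : knyData.R i f t = 1 := by simp [FibreData.R, knyData]

theorem knyData_q (f t : ℂ) : knyData.q f t = 0 := by simp [FibreData.q, knyData]

theorem knyData_gen (w : C3) : knyData.gen w = (w.1, w.1 * w.2.1, w.2.2) := by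
  simp [FibreData.gen, knyData_q]
  simp [knyData]

variable {a}

theorem admissible_kny₁ (h1 : a 1 ≠ 0) (h4 : a 4 ≠ 0) : P1P1.Admissible knyK knyA (knyB a) := by
  refine admissible_P1P1 ?_ (fun _ _ _ => analyticAt_const) ?_
  · intro j t _
    fin_cases j <;> first | exact analyticAt_const | exact analyticAt_id
  · intro i j t ht
    have h0 := ht.1
    have h1' := ht.2
    have h2 : -a 2 ≠ -a 1 - a 2 := fun e => h1 (by linear_combination e)
    fin_cases i <;> fin_cases j <;>
      simp [Space.center, knyK, knyA, knyB, P1P1_par, P1P1pt_inj, sphereChart, recip, h2, h4, h0,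
        h1', h2.symm, Ne.symm h1', Ne.symm h4]

theorem valid_kny (h1 : a 1 ≠ 0) (h4 : a 4 ≠ 0) : knyData.Valid a knyK knyA (knyB a) where
  atlas := isAtlas_P1P1
  admissible := admissible_kny₁ h1 h4
  dom := rfl
  analytic_shift _ _ := analyticAt_const
  analytic_scale _ _ := analyticAt_const
  analytic_q _ _ := ⟨analyticAt_const, analyticAt_const, analyticAt_const⟩
  analytic_r _ _ _ := ⟨analyticAt_const, analyticAt_const, analyticAt_const⟩
  analytic_total _ _ := analyticAt_fst
  scale_ne _ _ := one_ne_zero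
  param_ne _ := h4
  total_eq i f t _ := by rw [knyData_c, knyData_R]; simp [knyData]
  total_ne f t _ h := by
    have h0 := h ()
    rwa [knyData_c] at h0
  R_ne i t _ := by rw [knyData_R]; exact one_ne_zero
  line_inj := Function.injective_of_subsingleton _
  neg_inj := Function.injective_of_subsingleton _
  pos_inj := Function.injective_of_subsingleton _
  neg_ne_pos _ _ := by simp [knyData]
  k_neg _ := rfl
  k_pos _ := rfl
  fst_neg i t _ := by rw [knyData_c]; simp [knyData, knyA]
  fst_pos i t _ := by rw [knyData_c]; simp [knyData, knyA]
  snd_neg i t _ := by rw [knyData_q]; simp [knyData, knyB]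
  snd_pos i t _ := by rw [knyData_q, knyData_R]; simp [knyData, knyB, finParam]
  avoid z _ h j := by
    have h0 : z.1 ≠ 0 := by
      have h0 := h ()
      rw [knyData_c] at h0
      simpa [knyData] using h0
    fin_cases j <;>
      simp [knyData, Space.center, knyK, knyA, knyB, P1P1_par, P1P1pt_inj, sphereChart, recip, h0]

theorem admissible_kny₂ (h1 : a 1 ≠ 0) (h4 : a 4 ≠ 0) :
    (knyY₁ a).Admissible (knyK₂ a) (knyA₂ a) fun _ _ => 0 := by
  rw [knyK₂_eq]
  refine Space.Admissible.exceptional isAtlas_P1P1 (admissible_kny₁ h1 h4) ?_ ?_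
  · intro m t _
    fin_cases m
    · exact analyticAt_id.mul analyticAt_const
    · exact analyticAt_const
  · intro m m' t _ h _
    fin_cases m <;> fin_cases m' <;> simp_all [knyUnder]

theorem center_kny₂ (m : Fin 2) (t : ℂ) :
    (knyY₁ a).center (knyK₂ a) (knyA₂ a) (fun _ _ => 0) m t =
      excPt knyK knyA (knyB a) (knyUnder m) t (sphereChart false (knyA₂ a m t)) := by
  rw [knyK₂_eq]
  exact center_excIx m t

variable (a)

/-- A point of the first blow up which is not a centre of the second one. -/
def knyLift (p : (knyY₁ a).Pt) : (knyY₂ a).Pt := offPt (knyK₂ a) (knyA₂ a) (fun _ _ => 0) p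

/-- The position of Takano's chart `0`. -/
def knyZero (w : C3) : (knyY₂ a).Pt := knyLift a (knyData.zeroPt knyK knyA (knyB a) w)

/-- The lines `y_i = 0` of Takano's charts. Over `f = ∞` and `f = 0` they lie on exceptional lines
of the first blow up, over `f = t` and `f = 1` on those of the second one. -/
def knyLines : Line → ℂ → ℂ → (knyY₂ a).Pt
  | Sum.inl 0, x, t => knyLift a (excPt knyK knyA (knyB a) 0 t (sphereChart true x))
  | Sum.inl 1, x, t => knyLift a (excPt knyK knyA (knyB a) 1 t (sphereChart true x))
  | Sum.inr 0, x, t => excPt (knyK₂ a) (knyA₂ a) (fun _ _ => 0) 0 t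
      (sphereChart false (a 0 ^ 2 * fibre 0 t - x * fibre 0 t ^ 2))
  | Sum.inr 1, x, t => knyLift a (knyData.linePt a knyK knyA (knyB a) () x t)
  | Sum.inr 2, x, t => excPt (knyK₂ a) (knyA₂ a) (fun _ _ => 0) 1 t
      (sphereChart false (a 3 ^ 2 * fibre 2 t - x * fibre 2 t ^ 2))

variable {a}

theorem knyLift_inj {p q : (knyY₁ a).Pt} : knyLift a p = knyLift a q ↔ p = q := offPt_inj

theorem knyLift_ne_exc {p : (knyY₁ a).Pt} {m : Fin 2} {t : ℂ} {u : OnePoint ℂ} :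
    knyLift a p ≠ excPt (knyK₂ a) (knyA₂ a) (fun _ _ => 0) m t u := offPt_ne_excPt

/-- Takano's chart at one of the lines at `f = ∞`. -/
theorem isLocalPatch_kny_inf (h1 : a 1 ≠ 0) (h4 : a 4 ≠ 0) (i : Fin 2) (j : Fin 6)
    (hk : knyK j = (true, false)) (hA : ∀ t, knyA j t = 0)
    (hB : ∀ t, knyB a j t = -infParam a i) (L : Line → ℂ → ℂ → (knyY₂ a).Pt)
    (hL : ∀ x t, L (Sum.inl i) x t = knyLift a (excPt knyK knyA (knyB a) j t (sphereChart true x)))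
    (hj : ∀ m, j ≠ knyUnder m) (x t : ℂ) (ht : t ∈ B) :
    (knyY₂ a).IsLocalPatch (placedPatch a (glue (knyZero a) L) (some (Sum.inl i))) (x, 0, t) := by
  have hX := isAtlas_P1P1.blowUp (admissible_kny₁ h1 h4)
  have hloc : (knyY₁ a).IsLocalPatch ⟨fullDom, ((knyY₁ a).chart
      (excIx knyK knyA (knyB a) j true)).par⟩ (x, 0, t) :=
    ⟨_, _, (LocEquiv.refl ((hX.isOpen _).mem_nhds
      ((admissible_kny₁ h1 h4).mem_dom_exceptional (s := true) ht))).transfer (fullDom_mem_nhds ht)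
      ((hX.isOpen _).mem_nhds ((admissible_kny₁ h1 h4).mem_dom_exceptional ht))
      fun _ _ _ _ e => e⟩
  refine hloc.blowUp hX (admissible_kny₂ h1 h4) (fullDom_mem_nhds ht) ?_ ?_
  · intro w
    by_cases hy : w.2.1 = 0
    · rw [placedPatch_glue_zero hy, hL]
      congr 1
      exact (blowUp_par_exc_zero hy).symm
    · rw [placedPatch_glue_ne hy, knyZero, FibreData.Valid.zeroPt_off]
      · congr 1
        change _ = ((knyY₁ a).chart (excIx knyK knyA (knyB a) j true)).par w
        rw [blowUp_par_exc_ne hy]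
        congr 1
        have : blowDown (knyA j) (knyB a j) true w =
            (w.2.1, w.1 * w.2.1 - infParam a i, w.2.2) := by
          simp [blowDown, hA, hB]; ring
        rw [this, knyData_gen]
        change (P1P1.chart (false, false)).par _ = _
        rw [hk, P1P1_par, P1P1_par, P1P1pt_inj]
        simp [back, sphereChart, recip, hy]
      · intro i'
        rw [knyData_c]
        exact inv_ne_zero hy
  · intro m t' _
    rw [center_kny₂]
    change ((knyY₁ a).chart (excIx knyK knyA (knyB a) j true)).par (x, 0, t) ≠ _
    rw [blowUp_par_exc_zero rfl, Ne, excPt_inj]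
    exact fun e => hj m e.1

/-- Takano's chart at one of the lines over `f = t` and `f = 1`, in the coordinates `(u, v)` at the
corresponding centre of the second blow up. -/
def knyMap (b : ℂ) (i : Fin 3) (w : C3) : C3 :=
  let s := b - w.1 * w.2.1
  let f := fibre i w.2.2 + w.2.1 * s
  (b * s * f - w.1 * f ^ 2, w.2.1 / f, w.2.2)

/-- The inverse of `knyMap b i`. -/
def knyInv (b : ℂ) (i : Fin 3) (z : C3) : C3 :=
  let u := fibre i z.2.2 * b + z.1 * z.2.1
  let f := fibre i z.2.2 + u * z.2.1
  ((b * u - z.1) / f ^ 2, f * z.2.1, z.2.2)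

theorem locInv_knyMap (b : ℂ) {i : Fin 3} (hi : i ≠ 1) {x t : ℂ} (ht : t ∈ B) :
    LocInv (knyMap b i) (knyInv b i) (x, 0, t) := by
  have hc := fibre_ne_zero hi ht
  have e : knyMap b i (x, 0, t) = (b * b * fibre i t - x * fibre i t ^ 2, 0, t) := by
    simp [knyMap]
  have hf : fibre i ((x, 0, t) : C3).2.2 + ((x, 0, t) : C3).2.1 *
      (b - ((x, 0, t) : C3).1 * ((x, 0, t) : C3).2.1) ≠ 0 := by simpa using hc
  have hf' : fibre i (knyMap b i (x, 0, t)).2.2 +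
      (fibre i (knyMap b i (x, 0, t)).2.2 * b + (knyMap b i (x, 0, t)).1 *
        (knyMap b i (x, 0, t)).2.1) * (knyMap b i (x, 0, t)).2.1 ≠ 0 := by
    rw [e]; simpa using hc
  refine ⟨?_, ?_, ?_, ?_⟩
  · unfold knyMap
    dsimp only at hf ⊢
    simp only [fibre] at hf ⊢
    fun_prop (disch := assumption)
  · have hf2 := pow_ne_zero 2 hf'
    unfold knyInv
    dsimp only
    simp only [fibre] at hf2 ⊢
    fun_prop (disch := assumption)
  · rw [e]
    simp only [knyInv, mul_zero, add_zero]
    refine Prod.ext ?_ rfl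
    simp only
    field_simp
    ring
  · have hcont : Continuous fun z : C3 => fibre i z.2.2 +
        (fibre i z.2.2 * b + z.1 * z.2.1) * z.2.1 := by
      simp only [fibre]
      fun_prop
    filter_upwards [hcont.continuousAt.eventually_ne hf'] with z hz
    obtain ⟨u, v, t⟩ := z
    simp only at hz
    simp only [knyMap, knyInv]
    generalize fibre i t = c at *
    obtain ⟨p, hp⟩ : ∃ p, p = c * b + u * v := ⟨_, rfl⟩
    rw [← hp] at hz ⊢
    obtain ⟨f, hf⟩ : ∃ f, f = c + p * v := ⟨_, rfl⟩
    rw [← hf] at hz ⊢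
    have h1 : b - (b * p - u) / f ^ 2 * (f * v) = p / f := by
      field_simp
      linear_combination b * hf - hp
    have h2 : c + f * v * (p / f) = f := by
      field_simp
      linear_combination -hf
    rw [h1, h2]
    refine Prod.ext ?_ (Prod.ext ?_ rfl)
    · simp only
      field_simp
      ring
    · simp only
      field_simp

theorem isLocalPatch_kny_fin (h1 : a 1 ≠ 0) (h4 : a 4 ≠ 0) (m : Fin 2)
    (hb : finParam a (knyLine m) ≠ 0) (L : Line → ℂ → ℂ → (knyY₂ a).Pt)
    (hL : ∀ x t, L (Sum.inr (knyLine m)) x t = excPt (knyK₂ a) (knyA₂ a) (fun _ _ => 0) m t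
      (sphereChart false (knyMap (finParam a (knyLine m)) (knyLine m) (x, 0, t)).1))
    (x t : ℂ) (ht : t ∈ B) :
    (knyY₂ a).IsLocalPatch (placedPatch a (glue (knyZero a) L) (some (Sum.inr (knyLine m))))
      (x, 0, t) := by
  have hX := isAtlas_P1P1.blowUp (admissible_kny₁ h1 h4)
  have hX₂ := hX.blowUp (admissible_kny₂ h1 h4)
  have hi : knyLine m ≠ 1 := by fin_cases m <;> decide
  have hc := fibre_ne_zero hi ht
  have e : knyMap (finParam a (knyLine m)) (knyLine m) (x, 0, t) =
      ((knyMap (finParam a (knyLine m)) (knyLine m) (x, 0, t)).1, 0, t) :=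
    Prod.ext rfl (Prod.ext (by simp [knyMap]) rfl)
  refine ⟨excIx (knyK₂ a) (knyA₂ a) (fun _ _ => 0) m false, _, LocEquiv.of_locInv
    (locInv_knyMap (finParam a (knyLine m)) hi ht) (fullDom_mem_nhds ht)
    ((hX₂.isOpen _).mem_nhds ?_) ?_⟩
  · rw [e]
    exact (admissible_kny₂ h1 h4).mem_dom_exceptional ht
  · have hcont : Continuous fun w : C3 => fibre (knyLine m) w.2.2 +
        w.2.1 * (finParam a (knyLine m) - w.1 * w.2.1) := by
      simp only [fibre]
      fun_prop
    have hcont' : Continuous fun w : C3 => finParam a (knyLine m) - w.1 * w.2.1 := by fun_prop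
    filter_upwards [hcont.continuousAt.eventually_ne (y := 0) (x := (x, 0, t)) (by simpa using hc),
      hcont'.continuousAt.eventually_ne (y := 0) (x := (x, 0, t)) (by simpa using hb)] with w h2 h3
    obtain ⟨x, y, t⟩ := w
    by_cases hy : y = 0
    · subst hy
      rw [blowUp_par_exc_zero (by simp [knyMap]), placedPatch_glue_zero rfl, hL]
      rfl
    · have hv : (knyMap (finParam a (knyLine m)) (knyLine m) (x, y, t)).2.1 ≠ 0 :=
        div_ne_zero hy h2
      rw [blowUp_par_exc_ne hv, placedPatch_glue_ne hy, knyZero, FibreData.Valid.zeroPt_off]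
      · rw [knyLift]
        congr 1
        have hk : ∀ z, ((knyY₁ a).chart (knyK₂ a m)).par z =
            ((knyY₁ a).chart (excIx knyK knyA (knyB a) (knyUnder m) false)).par z := by
          rw [knyK₂_eq]
          exact fun _ => rfl
        rw [hk, blowUp_par_exc_ne (by simpa [blowDown] using hv)]
        congr 1
        have hk' : knyK (knyUnder m) = (false, true) := by fin_cases m <;> rfl
        have hA : knyA (knyUnder m) t = fibre (knyLine m) t := by
          fin_cases m <;> simp [knyUnder, knyLine, knyA, fibre, fibreConst, fibreSlope]
        have hB : knyB a (knyUnder m) t = 0 := by fin_cases m <;> rfl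
        have hA₂ : knyA₂ a m t = fibre (knyLine m) t * finParam a (knyLine m) := by
          fin_cases m <;> simp [knyA₂, knyLine, finParam, fibre, fibreConst, fibreSlope]
        have hg : blowDown (knyA (knyUnder m)) (knyB a (knyUnder m)) false
            (blowDown (knyA₂ a m) (fun _ => 0) false
              (knyMap (finParam a (knyLine m)) (knyLine m) (x, y, t))) =
            (fibre (knyLine m) t + y * (finParam a (knyLine m) - x * y),
              y / (fibre (knyLine m) t + y * (finParam a (knyLine m) - x * y)), t) := by
          simp only [blowDown, knyMap, hA, hB, hA₂, Bool.false_eq_true, if_false, zero_add]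
          simp only at h2
          refine Prod.ext ?_ rfl
          simp only
          generalize fibre (knyLine m) t = c at *
          generalize finParam a (knyLine m) = b at *
          field_simp
          ring
        rw [hg, hk', knyData_gen]
        change _ = (P1P1.chart (false, false)).par _
        rw [P1P1_par, P1P1_par, P1P1pt_inj]
        simp only at h2
        simp [back, sphereChart, recip, hy, h2, div_eq_mul_inv]
      · intro i'
        rw [knyData_c]
        exact h2

end KNY

/-! ### The complement of the glued surface in `X^KNY` -/

section KNY

variable {a : Fin 5 → ℂ}

/-- The position of the glued surface in `E^KNY`. -/
def knyPlace (a : Fin 5 → ℂ) : ModelPt → (knyY₂ a).Pt := glue (knyZero a) (knyLines a)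

theorem isPlacement_kny (h0 : a 0 ≠ 0) (h1 : a 1 ≠ 0) (h3 : a 3 ≠ 0) (h4 : a 4 ≠ 0) :
    (knyY₂ a).IsPlacement a (knyPlace a) := by
  have hv := valid_kny h1 h4
  have hX := isAtlas_P1P1.blowUp (admissible_kny₁ h1 h4)
  refine isPlacement_glue (hX.blowUp (admissible_kny₂ h1 h4)) ?_ ?_ ?_ ?_ ?_ ?_ ?_
  · exact fun w hw w' hw' e => hv.zeroPt_injOn hw hw' (knyLift_inj.1 e)
  · intro l l' x x' t t' ht e
    have hc0 := fibre_ne_zero (i := 0) (by decide) ht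
    have hc2 := fibre_ne_zero (i := 2) (by decide) ht
    rcases l with l | l <;> rcases l' with l' | l' <;> fin_cases l <;> fin_cases l' <;>
      simp only [knyLines, knyLift_inj, excPt_inj,
        FibreData.linePt] at e
    all_goals first
      | exact absurd e knyLift_ne_exc
      | exact absurd e.symm knyLift_ne_exc
      | (exfalso; have e1 := e.1; simp [knyData] at e1)
      | skip
    · exact ⟨rfl, sphereChart_self.1 e.2.2, e.2.1⟩
    · exact ⟨rfl, sphereChart_self.1 e.2.2, e.2.1⟩
    · obtain ⟨-, rfl, e⟩ := e
      have := sphereChart_self.1 e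
      exact ⟨rfl, mul_right_cancel₀ (pow_ne_zero 2 hc0) (by linear_combination -this), rfl⟩
    · have := hv.linePt_inj (i := ()) (i' := ()) ht (excPt_inj.2 ⟨rfl, e.2⟩)
      exact ⟨rfl, this.2.1, this.2.2⟩
    · obtain ⟨-, rfl, e⟩ := e
      have := sphereChart_self.1 e
      exact ⟨rfl, mul_right_cancel₀ (pow_ne_zero 2 hc2) (by linear_combination -this), rfl⟩
  · intro w hw l x t
    rcases l with l | l <;> fin_cases l <;> intro e <;>
      simp only [knyLines, knyZero, knyLift_inj] at e
    · rcases hv.zeroPt_cases hw with ⟨-, h⟩ | ⟨i, -, h⟩ <;> rw [h] at e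
      · exact offPt_ne_excPt e
      · exact absurd (excPt_inj.1 e).1 (by simp [knyData])
    · rcases hv.zeroPt_cases hw with ⟨-, h⟩ | ⟨i, -, h⟩ <;> rw [h] at e
      · exact offPt_ne_excPt e
      · exact absurd (excPt_inj.1 e).1 (by simp [knyData])
    · exact knyLift_ne_exc e
    · exact hv.zeroPt_ne_linePt hw _ _ _ e
    · exact knyLift_ne_exc e
  · exact fun w hw => hv.base_zeroPt hw
  · intro l x t ht
    rcases l with l | l <;> fin_cases l <;> rfl
  · intro w hw
    refine (hv.isLocalPatch_zero hw).blowUp hX (admissible_kny₂ h1 h4) (isOpen_fullDom.mem_nhds hw)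
      (fun _ => rfl) fun m t _ => ?_
    rw [center_kny₂]
    change knyData.zeroPt knyK knyA (knyB a) w ≠ _
    rcases hv.zeroPt_cases hw with ⟨-, h⟩ | ⟨i, -, h⟩ <;> rw [h]
    · exact offPt_ne_excPt
    · rw [Ne, excPt_inj]
      fin_cases m <;> simp [knyData, knyUnder]
  · intro l x t ht
    rcases l with l | l <;> fin_cases l
    · exact isLocalPatch_kny_inf h1 h4 0 0 rfl (fun _ => rfl) (fun _ => rfl) _ (fun _ _ => rfl)
        (fun m => by fin_cases m <;> simp [knyUnder]) x t ht
    · exact isLocalPatch_kny_inf h1 h4 1 1 rfl (fun _ => rfl)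
        (fun _ => by simp [knyB, infParam]; ring) _ (fun _ _ => rfl)
        (fun m => by fin_cases m <;> simp [knyUnder]) x t ht
    · refine isLocalPatch_kny_fin h1 h4 0 h0 _ (fun x t => ?_) x t ht
      change excPt _ _ _ 0 t _ = _
      congr 2
      simp only [knyMap, knyLine, finParam, Matrix.cons_val]
      ring
    · refine (hv.isLocalPatch_line () ht).blowUp hX (admissible_kny₂ h1 h4) (fullDom_mem_nhds ht)
        (fun w => ?_) fun m t' _ => ?_
      · by_cases hy : w.2.1 = 0
        · rw [placedPatch_glue_zero hy]
          exact congrArg (knyLift a) (if_pos hy).symm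
        · rw [placedPatch_glue_ne hy]
          exact congrArg (knyLift a) (if_neg hy).symm
      · rw [center_kny₂]
        have : (knyData.linePatch a knyK knyA (knyB a) ()).par (x, 0, t) =
          knyData.linePt a knyK knyA (knyB a) () x t := if_pos rfl
        rw [this, FibreData.linePt, Ne, excPt_inj]
        fin_cases m <;> simp [knyData, knyUnder]
    · refine isLocalPatch_kny_fin h1 h4 1 h3 _ (fun x t => ?_) x t ht
      change excPt _ _ _ 1 t _ = _
      congr 2
      simp only [knyMap, knyLine, finParam, Matrix.cons_val]
      ring

/-- The points of the glued surface that are not on the exceptional lines of the second blow up. -/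
theorem knyLift_mem_image {p : (knyY₁ a).Pt} (hp : knyLift a p ∈ knyPlace a '' modelCarrier) :
    (∃ w ∈ fullDom, p = knyData.zeroPt knyK knyA (knyB a) w) ∨
      ∃ (j : Fin 6) (t : ℂ) (u : ℂ), (j = 0 ∨ j = 1 ∨ j = 4) ∧
        p = excPt knyK knyA (knyB a) j t (sphereChart true u) := by
  obtain ⟨w | ⟨l | l, x, t⟩, hm, e⟩ := hp
  · exact Or.inl ⟨w, hm, (knyLift_inj.1 e).symm⟩
  · fin_cases l
    · exact Or.inr ⟨0, t, x, by simp, (knyLift_inj.1 e).symm⟩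
    · exact Or.inr ⟨1, t, x, by simp, (knyLift_inj.1 e).symm⟩
  · fin_cases l
    · exact absurd e.symm knyLift_ne_exc
    · exact Or.inr ⟨4, t, _, by simp, (knyLift_inj.1 e).symm⟩
    · exact absurd e.symm knyLift_ne_exc

theorem knyLift_exc_mem_image (h1 : a 1 ≠ 0) (h4 : a 4 ≠ 0) {j : Fin 6} {t : ℂ} {u : OnePoint ℂ}
    (hp : knyLift a (excPt knyK knyA (knyB a) j t u) ∈ knyPlace a '' modelCarrier) :
    j = 0 ∨ j = 1 ∨ j = 3 ∨ j = 4 := by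
  rcases knyLift_mem_image hp with ⟨w, hw, e⟩ | ⟨j', t', u', hj, e⟩
  · rcases (valid_kny h1 h4).zeroPt_cases hw with ⟨-, h⟩ | ⟨i, -, h⟩ <;> rw [h] at e
    · exact absurd e.symm offPt_ne_excPt
    · have : j = 3 := (excPt_inj.1 e).1
      simp [this]
  · rw [(excPt_inj.1 e).1]
    tauto

theorem knyLift_off_mem_image (h1 : a 1 ≠ 0) (h4 : a 4 ≠ 0) {p : P1P1.Pt}
    (hp : knyLift a (offPt knyK knyA (knyB a) p) ∈ knyPlace a '' modelCarrier) :
    ∃ x y t : ℂ, x ≠ 0 ∧ p = P1P1pt x y t := by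
  rcases knyLift_mem_image hp with ⟨w, hw, e⟩ | ⟨j', t', u', hj, e⟩
  · rcases (valid_kny h1 h4).zeroPt_cases hw with ⟨hf, h⟩ | ⟨i, -, h⟩ <;> rw [h] at e
    · have hf := hf ()
      rw [knyData_c] at hf
      refine ⟨w.1, w.1 * w.2.1, w.2.2, hf, ?_⟩
      rw [offPt_inj.1 e, knyData_gen]
      rfl
    · exact absurd e offPt_ne_excPt
  · exact absurd e offPt_ne_excPt

/-- The glued surface is chart-open and avoids the curves themselves, so it avoids their proper
transforms. -/
theorem knyD_disjoint (h0 : a 0 ≠ 0) (h1 : a 1 ≠ 0) (h3 : a 3 ≠ 0) (h4 : a 4 ≠ 0)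
    (hs : a 0 + a 1 + 2 * a 2 + a 3 + a 4 = 1) :
    ∀ q ∈ knyD a, q ∉ knyPlace a '' modelCarrier := by
  have hX := isAtlas_P1P1.blowUp (admissible_kny₁ h1 h4)
  have hP := isPlacement_kny h0 h1 h3 h4
  have hU := hP.isChartOpen hs
  have hU₁ := Space.IsChartOpen.of_blowUp hX hU (hP.image_subset hs)
  have exc : ∀ j, (∀ j', (j' = 0 ∨ j' = 1 ∨ j' = 3 ∨ j' = 4) → j ≠ j') →
      ∀ q ∈ knyProper a (knyExceptional₁ a j), q ∉ knyPlace a '' modelCarrier := by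
    intro j hj q hq
    refine hU.disjoint_properTransform ?_ hq
    rintro _ ⟨t, -, u, rfl⟩ h
    exact hj _ (knyLift_exc_mem_image h1 h4 h) rfl
  have off : ∀ C : Set P1P1.Pt, (∀ x y t : ℂ, x ≠ 0 → P1P1pt x y t ∉ C) →
      ∀ q ∈ knyProper a (knyProper₁ a C), q ∉ knyPlace a '' modelCarrier := by
    intro C hC q hq
    refine hU.disjoint_properTransform (fun p hp => hU₁.disjoint_properTransform ?_ hp) hq
    intro p hp h
    obtain ⟨x, y, t, hx, rfl⟩ := knyLift_off_mem_image h1 h4 h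
    exact hC x y t hx hp
  rintro q ((((hq | hq) | hq) | hq) | hq)
  · exact exc 2 (by rintro j' (rfl | rfl | rfl | rfl) <;> decide) q hq
  · exact off _ (fun x y t _ h => OnePoint.coe_ne_infty x h.2) q hq
  · exact off _ (fun x y t _ h => OnePoint.coe_ne_infty y h.2) q hq
  · exact exc 5 (by rintro j' (rfl | rfl | rfl | rfl) <;> decide) q hq
  · exact off _ (fun x y t hx h => hx (OnePoint.coe_injective h.2)) q hq

/-- Every point of `X^KNY` is on one of the removed curves or in the glued surface: on each
exceptional line that is not removed, all points but one are in the glued surface, and the last one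
is the intersection with a removed curve. -/
theorem knyX_carrier_subset (h1 : a 1 ≠ 0) (h4 : a 4 ≠ 0) :
    (knyY₂ a).carrier ⊆ knyPlace a '' modelCarrier ∪ knyD a := by
  have hv := valid_kny h1 h4
  have hA₁ := admissible_kny₁ h1 h4
  have hA₂ := admissible_kny₂ h1 h4
  have hX := isAtlas_P1P1.blowUp hA₁
  intro q hq
  rcases blowUp_pt_cases q with ⟨p, rfl⟩ | ⟨m, t, u, rfl⟩
  · have hp := offPt_mem_carrier.1 hq
    have hoff : ∀ C : Set (knyY₁ a).Pt, p ∈ C →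
        offPt (knyK₂ a) (knyA₂ a) (fun _ _ => 0) p ∈ knyProper a C :=
      fun C hC => offPt_mem_properTransform hC hq
    rcases blowUp_pt_cases p with ⟨p, rfl⟩ | ⟨j, t, u, rfl⟩
    · have hoff' : ∀ C : Set P1P1.Pt, p ∈ C →
          offPt knyK knyA (knyB a) p ∈ knyProper₁ a C :=
        fun C hC => offPt_mem_properTransform hC hp.1
      obtain ⟨x, y, t⟩ := p
      have ht : t ∈ B := (offPt_mem_carrier.1 hp.1).1
      induction x with
      | infty => exact Or.inr (Or.inl (Or.inl (Or.inl (Or.inr (hoff _ (hoff' _ ⟨ht, rfl⟩))))))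
      | coe x =>
        induction y with
        | infty => exact Or.inr (Or.inl (Or.inl (Or.inr (hoff _ (hoff' _ ⟨ht, rfl⟩)))))
        | coe y =>
          by_cases hx : x = 0
          · subst hx
            exact Or.inr (Or.inr (hoff _ (hoff' _ ⟨ht, rfl⟩)))
          · obtain ⟨w, hw, -, -, e⟩ := hv.exists_zeroPt_off (z := (x, y, t)) ht (fun i => by
              rw [knyData_c]; simpa [knyData] using hx)
            exact Or.inl ⟨Sum.inl w, hw, congrArg (knyLift a) e⟩
    · have ht : t ∈ B := excPt_mem_carrier.1 hp.1
      -- the excluded direction on an exceptional line is that of the fibre through the centre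
      have inf : ∀ j : Fin 6, knyK j = (true, false) → knyA j t = 0 →
          excPt knyK knyA (knyB a) j t (sphereChart false 0) ∈
            knyProper₁ a (firstCoord fun _ => OnePoint.infty) := by
        intro j hk hA
        refine excPt_mem_properTransform isAtlas_P1P1 hA₁ false ht fun v _ _ => ⟨ht, ?_⟩
        rw [hk]
        simp [P1P1_par, P1P1pt, blowDown, hA, sphereChart, recip]
      have zero : ∀ j : Fin 6, knyK j = (false, false) → knyA j t = 0 →
          excPt knyK knyA (knyB a) j t (sphereChart false 0) ∈
            knyProper₁ a (firstCoord fun _ => ((0 : ℂ) : OnePoint ℂ)) := by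
        intro j hk hA
        refine excPt_mem_properTransform isAtlas_P1P1 hA₁ false ht fun v _ _ => ⟨ht, ?_⟩
        rw [hk]
        simp [P1P1_par, P1P1pt, blowDown, hA, sphereChart]
      fin_cases j
      · rcases exists_sphereChart u with rfl | ⟨U, rfl⟩
        · exact Or.inr (Or.inl (Or.inl (Or.inl (Or.inr (hoff _ (inf 0 rfl rfl))))))
        · exact Or.inl ⟨Sum.inr (Sum.inl 0, U, t), ht, rfl⟩
      · rcases exists_sphereChart u with rfl | ⟨U, rfl⟩
        · exact Or.inr (Or.inl (Or.inl (Or.inl (Or.inr (hoff _ (inf 1 rfl rfl))))))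
        · exact Or.inl ⟨Sum.inr (Sum.inl 1, U, t), ht, rfl⟩
      · exact Or.inr (Or.inl (Or.inl (Or.inl (Or.inl (hoff _ ⟨t, ht, u, rfl⟩)))))
      · rcases hv.exists_zeroPt_exc () ht u with rfl | ⟨w, hw, e⟩
        · exact Or.inr (Or.inr (hoff _ (zero 3 rfl rfl)))
        · exact Or.inl ⟨Sum.inl w, hw, congrArg (knyLift a) e⟩
      · rcases hv.exists_linePt () ht u with rfl | ⟨x, e⟩
        · exact Or.inr (Or.inr (hoff _ (zero 4 rfl rfl)))
        · exact Or.inl ⟨Sum.inr (Sum.inr 1, x, t), ht, congrArg (knyLift a) e⟩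
      · exact Or.inr (Or.inl (Or.inr (hoff _ ⟨t, ht, u, rfl⟩)))
  · have ht : t ∈ B := excPt_mem_carrier.1 hq
    -- the excluded direction is that of the exceptional line of the first blow up
    have hdir : ∀ m, excPt (knyK₂ a) (knyA₂ a) (fun _ _ => 0) m t (sphereChart true 0) ∈
        knyProper a (knyExceptional₁ a (knyUnder m)) := by
      intro m
      refine excPt_mem_properTransform hX hA₂ true ht fun v _ _ => ?_
      have hk : ∀ z, ((knyY₁ a).chart (knyK₂ a m)).par z =
          ((knyY₁ a).chart (excIx knyK knyA (knyB a) (knyUnder m) false)).par z := by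
        rw [knyK₂_eq]
        exact fun _ => rfl
      rw [hk, blowUp_par_exc_zero (by simp [blowDown])]
      exact ⟨t, ht, _, rfl⟩
    have hfin : ∀ (i : Fin 3) (b U : ℂ), i ≠ 1 →
        ∃ x, b ^ 2 * fibre i t - x * fibre i t ^ 2 = U := by
      intro i b U hi
      have hc := fibre_ne_zero hi ht
      refine ⟨(b ^ 2 * fibre i t - U) / fibre i t ^ 2, ?_⟩
      field_simp
      ring
    rcases exists_sphereChart' u with rfl | ⟨U, rfl⟩
    · fin_cases m
      · exact Or.inr (Or.inl (Or.inl (Or.inl (Or.inl (hdir 0)))))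
      · exact Or.inr (Or.inl (Or.inr (hdir 1)))
    · fin_cases m
      · obtain ⟨x, rfl⟩ := hfin 0 (a 0) U (by decide)
        exact Or.inl ⟨Sum.inr (Sum.inr 0, x, t), ht, rfl⟩
      · obtain ⟨x, rfl⟩ := hfin 2 (a 3) U (by decide)
        exact Or.inl ⟨Sum.inr (Sum.inr 2, x, t), ht, rfl⟩

end KNY

/-! ### Takano's atlas of `E^KNY` -/

section KNY

variable {a : Fin 5 → ℂ}

theorem isPlacement_knyE (h0 : a 0 ≠ 0) (h1 : a 1 ≠ 0) (h3 : a 3 ≠ 0) (h4 : a 4 ≠ 0)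
    (hs : a 0 + a 1 + 2 * a 2 + a 3 + a 4 = 1) : (knyE a).IsPlacement a (knyPlace a) :=
  (isPlacement_kny h0 h1 h3 h4).remove hs (knyD_disjoint h0 h1 h3 h4 hs)
    (knyX_carrier_subset h1 h4)

theorem knyE_carrier_subset (h1 : a 1 ≠ 0) (h4 : a 4 ≠ 0) :
    (knyE a).carrier ⊆ knyPlace a '' modelCarrier :=
  fun _ hq => (knyX_carrier_subset h1 h4 hq.1).resolve_right hq.2

theorem knyAff_par (z : C3) : ((knyE a).chart (knyAff a)).par z =
    knyLift a (offPt knyK knyA (knyB a) ((P1P1.chart (false, false)).par z)) := rfl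

theorem knyPlace_zero {w : C3} (hw : w.1 ≠ 0) : knyPlace a (Sum.inl w) =
    ((knyE a).chart (knyAff a)).par (w.1, w.1 * w.2.1, w.2.2) := by
  rw [knyAff_par]
  change knyLift a _ = _
  rw [FibreData.Valid.zeroPt_off, knyData_gen]
  · rfl
  · intro i
    rwa [knyData_c]

theorem mem_knyAff_dom (h0 : a 0 ≠ 0) (h1 : a 1 ≠ 0) (h3 : a 3 ≠ 0) (h4 : a 4 ≠ 0)
    (hs : a 0 + a 1 + 2 * a 2 + a 3 + a 4 = 1) {z : C3} :
    z ∈ ((knyE a).chart (knyAff a)).dom ↔ z ∈ fullDom ∧ z.1 ≠ 0 := by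
  constructor
  · intro hz
    have ht : z ∈ fullDom := hz.1.1.1
    refine ⟨ht, fun h => hz.2 (Or.inr ?_)⟩
    have hm := (((isAtlas_P1P1.blowUp (admissible_kny₁ h1 h4)).blowUp
      (admissible_kny₂ h1 h4)).isPatch _).mapsTo hz.1
    refine offPt_mem_properTransform (offPt_mem_properTransform ⟨ht, ?_⟩
      (offPt_mem_carrier.1 hm).1) hm
    exact congrArg ((↑) : ℂ → OnePoint ℂ) h
  · rintro ⟨ht, hz⟩
    have h := knyPlace_zero (a := a) (w := (z.1, z.2.1 / z.1, z.2.2)) hz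
    have e : z.1 * (z.2.1 / z.1) = z.2.1 := mul_div_cancel₀ _ hz
    rw [e] at h
    have hm := (isPlacement_knyE h0 h1 h3 h4 hs).image_subset hs
      ⟨Sum.inl (z.1, z.2.1 / z.1, z.2.2), ht, h⟩
    have h₁ := offPt_mem_carrier.1 hm.1
    have h₂ := offPt_mem_carrier.1 h₁.1
    exact ⟨⟨⟨ht, fun j => h₂.2 j _ ht⟩, fun j => h₁.2 j _ ht⟩, hm.2⟩

/-- In the chart `(f, g)` the system of `knyH₀` is the system `knySystem`, and `dx₀ ∧ dy₀` is
`df ∧ dg / f`. -/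
theorem isAffineForm_kny (h0 : a 0 ≠ 0) (h1 : a 1 ≠ 0) (h3 : a 3 ≠ 0) (h4 : a 4 ≠ 0)
    (hs : a 0 + a 1 + 2 * a 2 + a 3 + a 4 = 1) :
    IsAffineForm (knyE a) a (knyPlace a) (knyAff a) (knySystem a) fun z => 1 / z.1 := by
  intro z hz
  obtain ⟨ht, hz⟩ := (mem_knyAff_dom h0 h1 h3 h4 hs).1 hz
  obtain ⟨f, g, t⟩ := z
  simp only at hz
  have ht0 : t ≠ 0 := ht.1
  have ht1 : t - 1 ≠ 0 := sub_ne_zero.2 ht.2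
  have hd : HasFDerivAt (fun w : C3 => ((w.1, w.1 * w.2.1, w.2.2) : C3)) _ (f, g / f, t) :=
    (hasFDerivAt_fst _).prodMk (((hasFDerivAt_fst _).mul (hasFDerivAt_snd _)).prodMk
      (hasFDerivAt_time _))
  refine ⟨(f, g / f, t), ht, fun w => (w.1, w.1 * w.2.1, w.2.2), ?_, by fun_prop, ?_, ?_, ?_⟩
  · simp only [mul_div_cancel₀ _ hz]
  · filter_upwards [eventually_fst_ne (w := (f, g / f, t)) hz] with w hw
    exact (knyPlace_zero hw).symm
  · rw [relJac, hd.fderiv]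
    simp [dx, dy, dt, hz]
  · rw [hd.fderiv, hamSystem_knyH₀ a ht]
    have e0 : a 0 = 1 - a 1 - 2 * a 2 - a 3 - a 4 := by linear_combination hs
    refine Prod.ext ?_ (Prod.ext ?_ ?_)
    · simp [dx, dy, dt, knySystem, e0]
      field_simp
      ring
    · simp [dx, dy, dt, knySystem]
      field_simp
      ring
    · simp [dx, dy, dt, knySystem]

/-- The chart `0` and the five others, in Takano's order. -/
def takanoIx : Fin 6 → Option Line :=
  ![none, some (Sum.inl 0), some (Sum.inl 1), some (Sum.inr 0), some (Sum.inr 1), some (Sum.inr 2)]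

theorem takanoIx_surjective : Function.Surjective takanoIx := by
  rintro (_ | l | l)
  · exact ⟨0, rfl⟩
  · fin_cases l
    · exact ⟨1, rfl⟩
    · exact ⟨2, rfl⟩
  · fin_cases l
    · exact ⟨3, rfl⟩
    · exact ⟨4, rfl⟩
    · exact ⟨5, rfl⟩

theorem modelPatch_takano (i : Fin 6) {z : C3} (hz : z.1 ≠ 0) (hi : 3 ≤ i → z.2.1 ≠ 0) :
    (modelPatch a (takanoIx i)).par (takano a i z) = Sum.inl (z.1, z.2.1 / z.1, z.2.2) := by
  obtain ⟨f, g, t⟩ := z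
  simp only at hz hi
  have key : ∀ (l : Line) (w : C3), w.2.1 ≠ 0 → back a l w = (f, g / f, t) →
      (modelPatch a (some l)).par w = Sum.inl (f, g / f, t) := by
    intro l w hw e
    rw [modelPatch_ne hw, e]
  fin_cases i
  · rfl
  · refine key (Sum.inl 0) _ (one_div_ne_zero hz) ?_
    simp [takano, back, infParam]
    field_simp
    ring
  · refine key (Sum.inl 1) _ (one_div_ne_zero hz) ?_
    simp [takano, back, infParam]
    field_simp
    ring
  · have hg := hi (by decide)
    refine key (Sum.inr 0) _ (div_ne_zero hz hg) ?_
    simp [takano, back, finParam, fibre, fibreConst, fibreSlope]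
    field_simp
    ring
  · have hg := hi (by decide)
    refine key (Sum.inr 1) _ (div_ne_zero hz hg) ?_
    simp [takano, back, finParam, fibre, fibreConst, fibreSlope]
    field_simp
    ring
  · have hg := hi (by decide)
    refine key (Sum.inr 2) _ (div_ne_zero hz hg) ?_
    simp [takano, back, finParam, fibre, fibreConst, fibreSlope]
    field_simp
    ring

end KNY

/-! ### The space of the first parametrisation -/

section First

variable (p : Params)

/-- The charts that contain `p₁, …, p₇`. -/
def e1K : Fin 7 → P1P1.Ix :=
  ![(false, false), (false, false), (false, false), (false, false), (false, false),
    (false, false), (true, true)]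

/-- The first coordinates of `p₁, …, p₇`. -/
def e1A (j : Fin 7) (t : ℂ) : ℂ := ![0, 0, p.κ / (1 - t), p.κ / (1 - t), p.κ, p.κ, 0] j

/-- The second coordinates of `p₁, …, p₇`. -/
def e1B (j : Fin 7) (t : ℂ) : ℂ :=
  ![p.β * p.κ / (t * (1 - t)), p.β * p.κ / (t * (t - 1)),
    (1 - p.α) * p.κ / (t - 1) ^ 2, (1 + p.α) * p.κ / (t - 1) ^ 2,
    p.γ * p.κ / (1 - t), p.γ * p.κ / (t - 1), 0] j

/-- The first blow up. -/
abbrev e1Y₁ : Space := P1P1.blowUp e1K (e1A p) (e1B p)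

/-- The chart that contains `p₈`. -/
def e1K₂ (_ : Unit) : (e1Y₁ p).Ix := excIx e1K (e1A p) (e1B p) 6 true

/-- The second blow up. -/
abbrev e1Y₂ : Space := (e1Y₁ p).blowUp (e1K₂ p) (fun _ _ => 0) fun _ _ => 0

/-- The chart that contains `p₉` and `p₁₀`. -/
def e1K₃ (_ : Fin 2) : (e1Y₂ p).Ix := excIx (e1K₂ p) (fun _ _ => 0) (fun _ _ => 0) () false

/-- The coordinates `u₈` of `p₉` and `p₁₀`. -/
def e1A₃ (j : Fin 2) (t : ℂ) : ℂ := ![-t, t] j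

/-- The third blow up. -/
abbrev e1Y₃ : Space := (e1Y₂ p).blowUp (e1K₃ p) e1A₃ fun _ _ => 0

/-- The coefficient `c₂` of `-(f - 1)²` in `ỹ / μ`. -/
def e1c2 : ℂ := p.α - p.β - p.γ - 1

/-- The coefficient `c₁` of `f - 1` in `ỹ / μ`. -/
def e1c1 (t : ℂ) : ℂ := 1 - p.α + 2 * p.β + p.γ + (p.α - p.β - 1) * t

/-- The factor `μ` in the formula for `ỹ`. -/
def e1Mu (t : ℂ) : ℂ := p.κ / (t * (t - 1) ^ 2)

/-- The coordinates of the first parametrisation are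
`x̃ = κ (f - 1) / (t - 1)` and
`ỹ = μ (2 f (f - 1) (f - t) y₀ - c₂ (f - 1)² + c₁ (f - 1) - β (t - 1))`. -/
def e1Data : FibreData P1P1 (Fin 7) (Fin 3) where
  chart := (false, false)
  line i := i
  neg := ![5, 2, 0]
  pos := ![4, 3, 1]
  shift t := -(p.κ / (t - 1))
  scale t := p.κ / (t - 1)
  total f t := 2 * e1Mu p t * (f * (f - 1) * (f - t))
  q0 t := e1Mu p t * (-e1c2 p - e1c1 p t - p.β * (t - 1))
  q1 t := e1Mu p t * (2 * e1c2 p + e1c1 p t)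
  q2 t := e1Mu p t * -e1c2 p
  r0 i t := ![0, 2 * e1Mu p t * t, 0] i
  r1 i t := ![-(2 * e1Mu p t), -(2 * e1Mu p t * (1 + t)), -(2 * e1Mu p t * t)] i
  r2 _ t := 2 * e1Mu p t

variable {p}

theorem kappa_div_ne (hκ : p.κ ≠ 0) {t : ℂ} (ht : t ∈ B) :
    p.κ / (1 - t) ≠ 0 ∧ p.κ / (1 - t) ≠ p.κ := by
  have h0 : t ≠ 0 := ht.1
  have h1 : 1 - t ≠ 0 := sub_ne_zero.2 (Ne.symm ht.2)
  refine ⟨div_ne_zero hκ h1, fun e => h0 ?_⟩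
  rw [div_eq_iff h1] at e
  exact mul_left_cancel₀ hκ (by linear_combination e)

theorem admissible_e1₁ (hα : p.α ≠ 0) (hβ : p.β ≠ 0) (hγ : p.γ ≠ 0) (hκ : p.κ ≠ 0) :
    P1P1.Admissible e1K (e1A p) (e1B p) := by
  refine admissible_P1P1 (fun j t ht => ?_) (fun j t ht => ?_) fun i j t ht e => ?_
  · have h1 : 1 - t ≠ 0 := sub_ne_zero.2 (Ne.symm ht.2)
    have : AnalyticAt ℂ (fun t => p.κ / (1 - t)) t := by fun_prop (disch := assumption)
    fin_cases j <;> first | exact analyticAt_const | exact this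
  · have h0 : t ≠ 0 := ht.1
    have h1 : 1 - t ≠ 0 := sub_ne_zero.2 (Ne.symm ht.2)
    have h2 : t - 1 ≠ 0 := sub_ne_zero.2 ht.2
    have h3 := mul_ne_zero h0 h1
    have h4 := mul_ne_zero h0 h2
    have h5 := pow_ne_zero 2 h2
    unfold e1B
    fin_cases j <;> simp only [Fin.zero_eta, Fin.mk_one, Fin.reduceFinMk, Matrix.cons_val] <;>
      fun_prop (disch := assumption)
  · have h0 : t ≠ 0 := ht.1
    have h1 : 1 - t ≠ 0 := sub_ne_zero.2 (Ne.symm ht.2)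
    have h2 : t - 1 ≠ 0 := sub_ne_zero.2 ht.2
    have hx := kappa_div_ne hκ ht
    have hy1 : p.β * p.κ / (t * (1 - t)) ≠ p.β * p.κ / (t * (t - 1)) := by
      intro e
      rw [div_eq_div_iff (mul_ne_zero h0 h1) (mul_ne_zero h0 h2)] at e
      have : 2 * (p.β * p.κ * t * (t - 1)) = 0 := by linear_combination e
      simp [hβ, hκ, h0, h2] at this
    have hy2 : (1 - p.α) * p.κ / (t - 1) ^ 2 ≠ (1 + p.α) * p.κ / (t - 1) ^ 2 := by
      intro e
      rw [div_left_inj' (pow_ne_zero 2 h2)] at e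
      have : 2 * (p.α * p.κ) = 0 := by linear_combination -e
      simp [hα, hκ] at this
    have hy3 : p.γ * p.κ / (1 - t) ≠ p.γ * p.κ / (t - 1) := by
      intro e
      rw [div_eq_div_iff h1 h2] at e
      have : 2 * (p.γ * p.κ * (t - 1)) = 0 := by linear_combination e
      simp [hγ, hκ, h2] at this
    have key1 : ∀ x x', sphereChart false x = sphereChart false x' → x = x' :=
      fun _ _ => sphereChart_self.1
    have key2 : ∀ x, sphereChart false x ≠ sphereChart true 0 :=
      fun x e => by simpa using (sphereChart_ne (by decide)).1 e
    have e := P1P1pt_inj.1 (show P1P1pt (sphereChart (e1K i).1 (e1A p i t))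
      (sphereChart (e1K i).2 (e1B p i t)) t = P1P1pt (sphereChart (e1K j).1 (e1A p j t))
      (sphereChart (e1K j).2 (e1B p j t)) t from e)
    fin_cases i <;> fin_cases j <;> first
      | rfl
      | exact absurd e.1 (key2 _)
      | exact absurd e.1.symm (key2 _)
      | exact absurd (key1 _ _ e.1) hκ
      | exact absurd (key1 _ _ e.1) hκ.symm
      | exact absurd (key1 _ _ e.1) hx.1
      | exact absurd (key1 _ _ e.1) hx.1.symm
      | exact absurd (key1 _ _ e.1) hx.2
      | exact absurd (key1 _ _ e.1) hx.2.symm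
      | exact absurd (key1 _ _ e.2.1) hy1
      | exact absurd (key1 _ _ e.2.1) hy1.symm
      | exact absurd (key1 _ _ e.2.1) hy2
      | exact absurd (key1 _ _ e.2.1) hy2.symm
      | exact absurd (key1 _ _ e.2.1) hy3
      | exact absurd (key1 _ _ e.2.1) hy3.symm

theorem e1Data_c (t : ℂ) : (e1Data p).c 0 t = t ∧ (e1Data p).c 1 t = 0 ∧ (e1Data p).c 2 t = 1 := by
  simp [FibreData.c, e1Data, fibre, fibreConst, fibreSlope]

/-- The values of the first coordinate on the three fibres. -/
theorem e1_fibres {t : ℂ} (ht : t ∈ B) :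
    p.κ = (e1Data p).shift t + (e1Data p).scale t * (e1Data p).c 0 t ∧
    p.κ / (1 - t) = (e1Data p).shift t + (e1Data p).scale t * (e1Data p).c 1 t ∧
    0 = (e1Data p).shift t + (e1Data p).scale t * (e1Data p).c 2 t := by
  have h1 : 1 - t ≠ 0 := sub_ne_zero.2 (Ne.symm ht.2)
  have h2 : t - 1 ≠ 0 := sub_ne_zero.2 ht.2
  rw [(e1Data_c t).1, (e1Data_c t).2.1, (e1Data_c t).2.2]
  simp only [e1Data]
  refine ⟨?_, ?_, ?_⟩
  · field_simp
    ring
  · rw [mul_zero, add_zero, ← div_neg, neg_sub]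
  · ring

theorem valid_e1 (hα : p.α ≠ 0) (hβ : p.β ≠ 0) (hγ : p.γ ≠ 0) (hκ : p.κ ≠ 0) :
    (e1Data p).Valid p.a e1K (e1A p) (e1B p) := by
  have hμ : ∀ t ∈ B, e1Mu p t ≠ 0 := fun t ht => by
    have h0 : t ≠ 0 := ht.1
    have h2 : t - 1 ≠ 0 := sub_ne_zero.2 ht.2
    exact div_ne_zero hκ (mul_ne_zero h0 (pow_ne_zero 2 h2))
  have hμa : ∀ t ∈ B, AnalyticAt ℂ (e1Mu p) t := fun t ht => by
    have h0 : t ≠ 0 := ht.1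
    have h2 : t - 1 ≠ 0 := sub_ne_zero.2 ht.2
    have h3 := mul_ne_zero h0 (pow_ne_zero 2 h2)
    unfold e1Mu
    fun_prop (disch := assumption)
  refine
    { atlas := isAtlas_P1P1
      admissible := admissible_e1₁ hα hβ hγ hκ
      dom := rfl
      analytic_shift := fun t ht => ?_
      analytic_scale := fun t ht => ?_
      analytic_q := fun t ht => ?_
      analytic_r := fun i t ht => ?_
      analytic_total := fun w hw => ?_
      scale_ne := fun t ht => div_ne_zero hκ (sub_ne_zero.2 ht.2)
      param_ne := fun i => ?_
      total_eq := fun i f t ht => ?_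
      total_ne := fun f t ht h => ?_
      R_ne := fun i t ht => ?_
      line_inj := Function.injective_id
      neg_inj := by intro i j; fin_cases i <;> fin_cases j <;> simp [e1Data]
      pos_inj := by intro i j; fin_cases i <;> fin_cases j <;> simp [e1Data]
      neg_ne_pos := fun i j => by fin_cases i <;> fin_cases j <;> simp [e1Data]
      k_neg := fun i => by fin_cases i <;> rfl
      k_pos := fun i => by fin_cases i <;> rfl
      fst_neg := fun i t ht => ?_
      fst_pos := fun i t ht => ?_
      snd_neg := fun i t ht => ?_
      snd_pos := fun i t ht => ?_
      avoid := fun z hz h j => ?_ }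
  · have h2 : t - 1 ≠ 0 := sub_ne_zero.2 ht.2
    simp only [e1Data]
    fun_prop (disch := assumption)
  · have h2 : t - 1 ≠ 0 := sub_ne_zero.2 ht.2
    simp only [e1Data]
    fun_prop (disch := assumption)
  · have h3 := hμa t ht
    simp only [e1Data, e1c1]
    refine ⟨?_, ?_, ?_⟩ <;> fun_prop
  · have h3 := hμa t ht
    fin_cases i <;> simp [e1Data] <;> refine ⟨?_, ?_, ?_⟩ <;> fun_prop
  · have h3 := analyticAt_time (hμa _ hw)
    simp only [e1Data]
    fun_prop
  · fin_cases i
    · exact neg_ne_zero.2 hγ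
    · exact hα
    · exact neg_ne_zero.2 hβ
  · fin_cases i <;> simp [FibreData.R, e1Data, FibreData.c, fibre, fibreConst, fibreSlope] <;> ring
  · have h1 := h 0
    have h2 := h 1
    have h3 := h 2
    rw [(e1Data_c t).1] at h1
    rw [(e1Data_c t).2.1] at h2
    rw [(e1Data_c t).2.2] at h3
    exact mul_ne_zero (mul_ne_zero two_ne_zero (hμ t ht)) (mul_ne_zero (mul_ne_zero h2
      (sub_ne_zero.2 h3)) (sub_ne_zero.2 h1))
  · have h0 : t ≠ 0 := ht.1
    have h1 : t - 1 ≠ 0 := sub_ne_zero.2 ht.2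
    have h2 : 1 - t ≠ 0 := sub_ne_zero.2 (Ne.symm ht.2)
    have h3 := hμ t ht
    have key : ∀ c d : ℂ, c ≠ 0 → d = 2 * e1Mu p t * c → d ≠ 0 := fun c d hc e => by
      rw [e]; exact mul_ne_zero (mul_ne_zero two_ne_zero h3) hc
    fin_cases i
    · refine key (t * (t - 1)) _ (mul_ne_zero h0 h1) ?_
      simp [FibreData.R, e1Data, FibreData.c, fibre, fibreConst, fibreSlope]
      ring
    · refine key t _ h0 ?_
      simp [FibreData.R, e1Data, FibreData.c, fibre, fibreConst, fibreSlope]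
    · refine key (1 - t) _ h2 ?_
      simp [FibreData.R, e1Data, FibreData.c, fibre, fibreConst, fibreSlope]
      ring
  · have hf := e1_fibres (p := p) ht
    fin_cases i
    exacts [hf.1, hf.2.1, hf.2.2]
  · have hf := e1_fibres (p := p) ht
    fin_cases i
    exacts [hf.1, hf.2.1, hf.2.2]
  · have h0 : t ≠ 0 := ht.1
    have h1 : t - 1 ≠ 0 := sub_ne_zero.2 ht.2
    have h2 : 1 - t ≠ 0 := sub_ne_zero.2 (Ne.symm ht.2)
    fin_cases i <;> simp [FibreData.q, e1Data, FibreData.c, fibre, fibreConst, fibreSlope, e1B,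
      e1Mu, e1c1, e1c2] <;> field_simp <;> ring
  · have h0 : t ≠ 0 := ht.1
    have h1 : t - 1 ≠ 0 := sub_ne_zero.2 ht.2
    have h2 : 1 - t ≠ 0 := sub_ne_zero.2 (Ne.symm ht.2)
    fin_cases i <;> simp [FibreData.q, FibreData.R, e1Data, FibreData.c, fibre, fibreConst,
      fibreSlope, e1B, e1Mu, e1c1, e1c2, finParam, Params.a] <;> field_simp <;> ring
  · have hf := e1_fibres (p := p) hz
    have h0 := h 0
    have h1 := h 1
    have h2 := h 2
    rw [← hf.1] at h0
    rw [← hf.2.1] at h1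
    rw [← hf.2.2] at h2
    intro e
    have e := P1P1pt_inj.1 (show P1P1pt (sphereChart false z.1) (sphereChart false z.2.1) z.2.2 =
      P1P1pt (sphereChart (e1K j).1 (e1A p j z.2.2)) (sphereChart (e1K j).2 (e1B p j z.2.2)) z.2.2
      from e)
    fin_cases j <;> first
      | exact h0 (sphereChart_self.1 e.1)
      | exact h1 (sphereChart_self.1 e.1)
      | exact h2 (sphereChart_self.1 e.1)
      | exact absurd ((sphereChart_ne (by decide)).1 e.1) (by change z.1 * 0 ≠ 1; simp)

end First

/-! ### The lines over `f = ∞` in the first parametrisation -/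

section First

variable {p : Params}

theorem admissible_e1₂ (h : P1P1.Admissible e1K (e1A p) (e1B p)) :
    (e1Y₁ p).Admissible (e1K₂ p) (fun _ _ => 0) fun _ _ => 0 :=
  Space.Admissible.exceptional (j := fun _ => 6) (s := fun _ => true) isAtlas_P1P1 h
    (fun _ _ _ => analyticAt_const) fun _ _ _ _ _ _ => rfl

theorem admissible_e1₃ (h : P1P1.Admissible e1K (e1A p) (e1B p)) :
    (e1Y₂ p).Admissible (e1K₃ p) e1A₃ fun _ _ => 0 := by
  refine Space.Admissible.exceptional (j := fun _ => ()) (s := fun _ => false)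
    (isAtlas_P1P1.blowUp h) (admissible_e1₂ h) (fun j t _ => ?_) fun i j t ht _ e => ?_
  · unfold e1A₃
    fin_cases j
    · exact analyticAt_id.neg
    · exact analyticAt_id
  · have e := sphereChart_self.1 e
    have h2 : t ≠ -t := fun h => ht.1 (by linear_combination h / 2)
    fin_cases i <;> fin_cases j <;> first
      | rfl
      | exact absurd e h2
      | exact absurd e h2.symm

theorem center_e1₂ (j : Unit) (t : ℂ) :
    (e1Y₁ p).center (e1K₂ p) (fun _ _ => 0) (fun _ _ => 0) j t =
      excPt e1K (e1A p) (e1B p) 6 t (sphereChart true 0) :=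
  center_excIx (j := fun _ => 6) (s := fun _ => true) j t

theorem center_e1₃ (j : Fin 2) (t : ℂ) :
    (e1Y₂ p).center (e1K₃ p) e1A₃ (fun _ _ => 0) j t =
      excPt (e1K₂ p) (fun _ _ => 0) (fun _ _ => 0) () t (sphereChart false (e1A₃ j t)) :=
  center_excIx (j := fun _ => ()) (s := fun _ => false) j t

variable (p)

/-- A point of the first blow up which is not `p₈`. -/
def e1Lift₂ (q : (e1Y₁ p).Pt) : (e1Y₂ p).Pt := offPt (e1K₂ p) (fun _ _ => 0) (fun _ _ => 0) q

/-- A point of the second blow up which is neither `p₉` nor `p₁₀`. -/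
def e1Lift₃ (q : (e1Y₂ p).Pt) : (e1Y₃ p).Pt := offPt (e1K₃ p) e1A₃ (fun _ _ => 0) q

/-- A point of the first blow up which is not a centre of the later ones. -/
def e1Lift (q : (e1Y₁ p).Pt) : (e1Y₃ p).Pt := e1Lift₃ p (e1Lift₂ p q)

/-- The point `u` of the exceptional line over `p₉` or `p₁₀`. -/
def e1Exc (j : Fin 2) (t : ℂ) (u : OnePoint ℂ) : (e1Y₃ p).Pt :=
  excPt (e1K₃ p) e1A₃ (fun _ _ => 0) j t u

/-- The position of Takano's chart `0`. -/
def e1Zero (w : C3) : (e1Y₃ p).Pt := e1Lift p ((e1Data p).zeroPt e1K (e1A p) (e1B p) w)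

/-- The quantity `ỹ / (f² μ)` in Takano's charts at the lines over `f = ∞`, where
`d = infParam p.a i`. -/
def e1Den (d : ℂ) (w : C3) : ℂ :=
  2 * (1 - w.2.1) * (1 - w.2.2 * w.2.1) * (w.1 * w.2.1 - d) - e1c2 p
    + (2 * e1c2 p + e1c1 p w.2.2) * w.2.1
    + (-e1c2 p - e1c1 p w.2.2 - p.β * (w.2.2 - 1)) * w.2.1 ^ 2

/-- The divided difference of `e1Den` with respect to `y` at `0`. -/
def e1Den' (d : ℂ) (w : C3) : ℂ :=
  2 * ((1 - w.2.1) * (1 - w.2.2 * w.2.1) * w.1 + d * (1 + w.2.2) - d * w.2.2 * w.2.1)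
    + (2 * e1c2 p + e1c1 p w.2.2) + (-e1c2 p - e1c1 p w.2.2 - p.β * (w.2.2 - 1)) * w.2.1

/-- Takano's chart at one of the lines over `f = ∞`, in the coordinates `(u, v)` at the centre
`(s t, 0)` of the third blow up, where `s = ±1`. -/
def e1Map (s d : ℂ) (w : C3) : C3 :=
  (p.κ * w.2.2 * ((w.2.1 - 2) * p.κ - s * e1Den' p d w) * (1 - w.2.1)
      / ((w.2.2 - 1) * e1Den p d w),
    (w.2.2 - 1) * w.2.1 / (p.κ * (1 - w.2.1)), w.2.2)

/-- The coordinate `y` in the coordinates `(u, v)`. -/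
def e1InvSnd (z : C3) : ℂ := p.κ * z.2.1 / (z.2.2 - 1 + p.κ * z.2.1)

/-- The quantity `e1Den` in the coordinates `(u, v)`. -/
def e1InvDen (s : ℂ) (z : C3) : ℂ :=
  p.κ * z.2.2 * (1 - e1InvSnd p z) ^ 2 / (s * z.2.2 + z.1 * z.2.1)

/-- The inverse of `e1Map s d`. -/
def e1Inv (s d : ℂ) (z : C3) : C3 :=
  let y := e1InvSnd p z
  ((s * ((y - 2) * p.κ - z.1 * (z.2.2 - 1) * e1InvDen p s z / (p.κ * z.2.2 * (1 - y)))
      - (2 * e1c2 p + e1c1 p z.2.2) - (-e1c2 p - e1c1 p z.2.2 - p.β * (z.2.2 - 1)) * y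
      - 2 * (d * (1 + z.2.2) - d * z.2.2 * y)) / (2 * ((1 - y) * (1 - z.2.2 * y))), y, z.2.2)

variable {p}

theorem e1Den_eq {s d : ℂ} (hd : -2 * d - e1c2 p = s * p.κ) (w : C3) :
    e1Den p d w = s * p.κ + w.2.1 * e1Den' p d w := by
  rw [← hd]
  simp only [e1Den, e1Den']
  ring

theorem locInv_e1Map (hκ : p.κ ≠ 0) {s d : ℂ} (hs : s ^ 2 = 1)
    (hd : -2 * d - e1c2 p = s * p.κ) {x t : ℂ} (ht : t ∈ B) :
    LocInv (e1Map p s d) (e1Inv p s d) (x, 0, t) := by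
  have h0 : t ≠ 0 := ht.1
  have h1 : t - 1 ≠ 0 := sub_ne_zero.2 ht.2
  have hs0 : s ≠ 0 := by rintro rfl; simp at hs
  have hden := e1Den_eq (p := p) hd (x, 0, t)
  simp only [zero_mul, add_zero] at hden
  have e : e1Map p s d (x, 0, t) = ((e1Map p s d (x, 0, t)).1, 0, t) :=
    Prod.ext rfl (Prod.ext (by simp [e1Map]) rfl)
  have hy : AnalyticAt ℂ (e1InvSnd p) (e1Map p s d (x, 0, t)) := by
    have : (e1Map p s d (x, 0, t)).2.2 - 1 + p.κ * (e1Map p s d (x, 0, t)).2.1 ≠ 0 := by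
      rw [e]; simpa using h1
    unfold e1InvSnd
    fun_prop (disch := assumption)
  have hy0 : e1InvSnd p (e1Map p s d (x, 0, t)) = 0 := by rw [e]; simp [e1InvSnd]
  have hv : s * (e1Map p s d (x, 0, t)).2.2 +
      (e1Map p s d (x, 0, t)).1 * (e1Map p s d (x, 0, t)).2.1 ≠ 0 := by
    rw [e]; simp [hs0, h0]
  have hD : AnalyticAt ℂ (e1InvDen p s) (e1Map p s d (x, 0, t)) := by
    unfold e1InvDen
    fun_prop (disch := assumption)
  have hD0 : e1InvDen p s (e1Map p s d (x, 0, t)) = s * p.κ := by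
    rw [e1InvDen, hy0, e]
    simp only [mul_zero, add_zero, sub_zero]
    field_simp
    linear_combination -hs
  have hn1 : AnalyticAt ℂ (fun z : C3 => 1 - e1InvSnd p z) (e1Map p s d (x, 0, t)) := by fun_prop
  have hn2 : AnalyticAt ℂ (fun z : C3 => 1 - z.2.2 * e1InvSnd p z) (e1Map p s d (x, 0, t)) := by
    fun_prop
  have hn1' : 1 - e1InvSnd p (e1Map p s d (x, 0, t)) ≠ 0 := by rw [hy0]; simp
  have hn2' : 1 - (e1Map p s d (x, 0, t)).2.2 * e1InvSnd p (e1Map p s d (x, 0, t)) ≠ 0 := by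
    rw [hy0]; simp
  refine ⟨?_, ?_, ?_, ?_⟩
  · have h2 : (((x, 0, t) : C3).2.2 - 1) * (2 * (1 - ((x, 0, t) : C3).2.1) *
        (1 - ((x, 0, t) : C3).2.2 * ((x, 0, t) : C3).2.1) *
        (((x, 0, t) : C3).1 * ((x, 0, t) : C3).2.1 - d) - e1c2 p
        + (2 * e1c2 p + e1c1 p ((x, 0, t) : C3).2.2) * ((x, 0, t) : C3).2.1
        + (-e1c2 p - e1c1 p ((x, 0, t) : C3).2.2 - p.β * (((x, 0, t) : C3).2.2 - 1)) *
          ((x, 0, t) : C3).2.1 ^ 2) ≠ 0 := by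
      refine mul_ne_zero h1 ?_
      change e1Den p d (x, 0, t) ≠ 0
      rw [hden]
      exact mul_ne_zero hs0 hκ
    have h3 : p.κ * (1 - ((x, 0, t) : C3).2.1) ≠ 0 := by simpa using hκ
    unfold e1Map e1Den e1Den'
    simp only [e1c1] at h2 ⊢
    fun_prop (disch := assumption)
  · have h2 : 2 * ((1 - e1InvSnd p (e1Map p s d (x, 0, t))) *
        (1 - (e1Map p s d (x, 0, t)).2.2 * e1InvSnd p (e1Map p s d (x, 0, t)))) ≠ 0 :=
      mul_ne_zero two_ne_zero (mul_ne_zero hn1' hn2')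
    have h3 : p.κ * (e1Map p s d (x, 0, t)).2.2 *
        (1 - e1InvSnd p (e1Map p s d (x, 0, t))) ≠ 0 := mul_ne_zero (mul_ne_zero hκ h0) hn1'
    unfold e1Inv
    simp only [e1c1]
    fun_prop (disch := assumption)
  · have e1 : (e1Map p s d (x, 0, t)).1 =
        p.κ * t * (-2 * p.κ - s * e1Den' p d (x, 0, t)) / ((t - 1) * (s * p.κ)) := by
      simp only [e1Map, hden]
      ring
    refine Prod.ext ?_ (Prod.ext hy0 rfl)
    have e2 : (0 - 2) * p.κ - (e1Map p s d (x, 0, t)).1 * (t - 1) * (s * p.κ) /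
        (p.κ * t * (1 - 0)) = s * e1Den' p d (x, 0, t) := by
      rw [e1]
      field_simp
      ring
    have e3 : s * (s * e1Den' p d (x, 0, t)) = e1Den' p d (x, 0, t) := by
      linear_combination e1Den' p d (x, 0, t) * hs
    simp only [e1Inv, hy0, hD0]
    change (s * ((0 - 2) * p.κ - (e1Map p s d (x, 0, t)).1 * (t - 1) * (s * p.κ) /
        (p.κ * t * (1 - 0))) - _ - _ - _) / _ = x
    rw [e2, e3]
    simp only [e1Den', e1Map]
    field_simp
    ring
  · have ht' : ∀ᶠ z : C3 in 𝓝 (e1Map p s d (x, 0, t)), z ∈ fullDom :=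
      isOpen_fullDom.mem_nhds ht
    have hv' : ContinuousAt (fun z : C3 => s * z.2.2 + z.1 * z.2.1) (e1Map p s d (x, 0, t)) := by
      fun_prop
    have hw' : ContinuousAt (fun z : C3 => z.2.2 - 1 + p.κ * z.2.1) (e1Map p s d (x, 0, t)) := by
      fun_prop
    filter_upwards [hn1.continuousAt.eventually_ne hn1', hn2.continuousAt.eventually_ne hn2', ht',
      hv'.eventually_ne hv, hw'.eventually_ne (y := 0) (by rw [e]; simpa using h1)]
      with z h2 h3 h4 h5 h6
    obtain ⟨u, v, t⟩ := z
    simp only at h2 h3 h5 h6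
    have h0 : t ≠ 0 := h4.1
    have h1 : t - 1 ≠ 0 := sub_ne_zero.2 h4.2
    have hyv : e1InvSnd p (u, v, t) * (t - 1) = p.κ * v * (1 - e1InvSnd p (u, v, t)) := by
      simp only [e1InvSnd]
      field_simp
      ring
    have hDv : e1InvDen p s (u, v, t) * (s * t + u * v) =
        p.κ * t * (1 - e1InvSnd p (u, v, t)) ^ 2 := div_mul_cancel₀ _ h5
    have hD0 : e1InvDen p s (u, v, t) ≠ 0 :=
      div_ne_zero (mul_ne_zero (mul_ne_zero hκ h0) (pow_ne_zero 2 h2)) h5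
    have e1 : e1Den' p d (e1Inv p s d (u, v, t)) = s * ((e1InvSnd p (u, v, t) - 2) * p.κ
        - u * (t - 1) * e1InvDen p s (u, v, t) / (p.κ * t * (1 - e1InvSnd p (u, v, t)))) := by
      simp only [e1Den', e1Inv]
      generalize e1InvSnd p (u, v, t) = y at *
      generalize (y - 2) * p.κ - u * (t - 1) * e1InvDen p s (u, v, t) / (p.κ * t * (1 - y)) = N
      have h23 : 2 * ((1 - y) * (1 - t * y)) ≠ 0 :=
        mul_ne_zero two_ne_zero (mul_ne_zero h2 h3)
      have := mul_div_cancel₀ (s * N - (2 * e1c2 p + e1c1 p t)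
        - (-e1c2 p - e1c1 p t - p.β * (t - 1)) * y - 2 * (d * (1 + t) - d * t * y)) h23
      linear_combination this
    have e2 : e1Den p d (e1Inv p s d (u, v, t)) = e1InvDen p s (u, v, t) := by
      rw [e1Den_eq hd, e1]
      simp only [e1Inv]
      generalize e1InvSnd p (u, v, t) = y at *
      generalize e1InvDen p s (u, v, t) = D at *
      have e3 : y * (s * ((y - 2) * p.κ - u * (t - 1) * D / (p.κ * t * (1 - y)))) =
          s * (y * (y - 2) * p.κ) - s * u * v * D / t := by
        have : y * (u * (t - 1) * D / (p.κ * t * (1 - y))) = u * v * D / t := by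
          field_simp
          linear_combination u * hyv
        linear_combination -s * this
      rw [e3]
      field_simp
      linear_combination -s * hDv + t * D * hs
    simp only [e1Map, e2, e1]
    simp only [e1Inv]
    generalize e1InvSnd p (u, v, t) = y at *
    generalize e1InvDen p s (u, v, t) = D at *
    have e3 : (y - 2) * p.κ - s * (s * ((y - 2) * p.κ - u * (t - 1) * D /
        (p.κ * t * (1 - y)))) = u * (t - 1) * D / (p.κ * t * (1 - y)) := by
      linear_combination -((y - 2) * p.κ - u * (t - 1) * D / (p.κ * t * (1 - y))) * hs
    rw [e3]
    refine Prod.ext ?_ (Prod.ext ?_ rfl)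
    · simp only
      field_simp
    · simp only
      field_simp
      linear_combination hyv

end First

section First

variable {p : Params}

theorem e1Data_gen_fst (w : C3) :
    ((e1Data p).gen w).1 = p.κ / (w.2.2 - 1) * (w.1 - 1) := by
  simp only [FibreData.gen, e1Data]
  ring

theorem e1Data_gen_snd (w : C3) : ((e1Data p).gen w).2.1 = e1Mu p w.2.2 *
    (2 * w.1 * (w.1 - 1) * (w.1 - w.2.2) * w.2.1 - e1c2 p * (w.1 - 1) ^ 2
      + e1c1 p w.2.2 * (w.1 - 1) - p.β * (w.2.2 - 1)) := by
  simp only [FibreData.gen, FibreData.q, e1Data]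
  ring

/-- The coordinate `ỹ` near one of the lines over `f = ∞`. -/
theorem e1Data_gen_back {i : Fin 2} {x y t : ℂ} (hy : y ≠ 0) :
    ((e1Data p).gen (back p.a (Sum.inl i) (x, y, t))).2.1 =
      e1Mu p t * (e1Den p (infParam p.a i) (x, y, t) / y ^ 2) := by
  rw [e1Data_gen_snd]
  simp only [back, e1Den]
  congr 1
  field_simp
  ring

/-- The coordinates `(u₈, v₈)` of a point near one of the lines over `f = ∞`. -/
theorem e1Map_blowDown (hκ : p.κ ≠ 0) {s d : ℂ} (hs : s ^ 2 = 1)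
    (hd : -2 * d - e1c2 p = s * p.κ) {x y t : ℂ} (ht : t ∈ B) (h1 : 1 - y ≠ 0)
    (hD : e1Den p d (x, y, t) ≠ 0) :
    s * t + (e1Map p s d (x, y, t)).1 * (e1Map p s d (x, y, t)).2.1 =
      t * p.κ * (1 - y) ^ 2 / e1Den p d (x, y, t) := by
  have ht1 : t - 1 ≠ 0 := sub_ne_zero.2 ht.2
  have e := e1Den_eq (p := p) hd (x, y, t)
  simp only at e
  simp only [e1Map]
  generalize e1Den p d (x, y, t) = D at *
  generalize e1Den' p d (x, y, t) = D' at *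
  field_simp
  linear_combination s * t * e + t * p.κ * hs

/-- Takano's chart at a line over `f = ∞` is a chart `(u, v)` at `p₉` or `p₁₀`. The point `p₉`
belongs to `infParam p.a 1 = a₁ + a₂`, the point `p₁₀` to `infParam p.a 0 = a₂`. -/
theorem isLocalPatch_e1_inf (hv : (e1Data p).Valid p.a e1K (e1A p) (e1B p)) (hκ : p.κ ≠ 0)
    (i m : Fin 2) {s : ℂ} (hs : s ^ 2 = 1) (hd : -2 * infParam p.a i - e1c2 p = s * p.κ)
    (hm : ∀ t, e1A₃ m t = s * t) (L : Line → ℂ → ℂ → (e1Y₃ p).Pt)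
    (hL : ∀ x t, L (Sum.inl i) x t =
      e1Exc p m t (sphereChart false (e1Map p s (infParam p.a i) (x, 0, t)).1))
    (x t : ℂ) (ht : t ∈ B) :
    (e1Y₃ p).IsLocalPatch (placedPatch p.a (glue (e1Zero p) L) (some (Sum.inl i))) (x, 0, t) := by
  have hX := isAtlas_P1P1.blowUp hv.admissible
  have hX₂ := hX.blowUp (admissible_e1₂ hv.admissible)
  have hX₃ := hX₂.blowUp (admissible_e1₃ hv.admissible)
  have hs0 : s ≠ 0 := by rintro rfl; simp at hs
  have e : e1Map p s (infParam p.a i) (x, 0, t) =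
      ((e1Map p s (infParam p.a i) (x, 0, t)).1, 0, t) :=
    Prod.ext rfl (Prod.ext (by simp [e1Map]) rfl)
  refine ⟨excIx (e1K₃ p) e1A₃ (fun _ _ => 0) m false, _, LocEquiv.of_locInv
    (locInv_e1Map hκ hs hd (x := x) ht) (fullDom_mem_nhds ht)
    ((hX₃.isOpen _).mem_nhds ?_) ?_⟩
  · rw [e]
    exact (admissible_e1₃ hv.admissible).mem_dom_exceptional ht
  · have hcD : ContinuousAt (e1Den p (infParam p.a i)) (x, 0, t) := by
      unfold e1Den e1c1
      fun_prop
    have hc1 : ContinuousAt (fun w : C3 => 1 - w.2.1) (x, 0, t) := by fun_prop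
    have hc2 : ContinuousAt (fun w : C3 => 1 - w.2.2 * w.2.1) (x, 0, t) := by fun_prop
    have hD0 : e1Den p (infParam p.a i) (x, 0, t) ≠ 0 := by
      rw [e1Den_eq hd]; simp [hs0, hκ]
    filter_upwards [hcD.eventually_ne hD0, hc1.eventually_ne (y := 0) (by simp),
      hc2.eventually_ne (y := 0) (by simp), isOpen_fullDom.mem_nhds (x := (x, 0, t)) ht]
      with w hD h1 h2 ht'
    obtain ⟨x, y, t⟩ := w
    have ht : t ∈ B := ht'
    have h0 : t ≠ 0 := ht.1
    have ht1 : t - 1 ≠ 0 := sub_ne_zero.2 ht.2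
    simp only at h1 h2
    by_cases hy : y = 0
    · subst hy
      rw [blowUp_par_exc_zero (by simp [e1Map]), placedPatch_glue_zero rfl, hL]
      rfl
    · have hv' : (e1Map p s (infParam p.a i) (x, y, t)).2.1 ≠ 0 :=
        div_ne_zero (mul_ne_zero ht1 hy) (mul_ne_zero hκ h1)
      have hf : ∀ j, (back p.a (Sum.inl i) (x, y, t)).1 ≠ (e1Data p).c j t := by
        have hc := e1Data_c (p := p) t
        have e0 : (back p.a (Sum.inl i) (x, y, t)).1 = y⁻¹ := by simp [back]
        rw [e0]
        intro j
        fin_cases j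
        · intro e
          have e' : y⁻¹ = t := e.trans hc.1
          exact h2 (by rw [← e', inv_mul_cancel₀ hy, sub_self])
        · exact fun e => inv_ne_zero hy (e.trans hc.2.1)
        · exact fun e => h1 (by have := e.trans hc.2.2; field_simp at this; rw [this]; ring)
      rw [blowUp_par_exc_ne hv', placedPatch_glue_ne hy, e1Zero, FibreData.Valid.zeroPt_off hf]
      rw [e1Lift, e1Lift₃]
      congr 1
      change ((e1Y₂ p).chart (excIx (e1K₂ p) (fun _ _ => 0) (fun _ _ => 0) () false)).par _ = _
      rw [blowUp_par_exc_ne (by simpa [blowDown] using hv'), e1Lift₂]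
      congr 1
      change ((e1Y₁ p).chart (excIx e1K (e1A p) (e1B p) 6 true)).par _ = _
      rw [blowUp_par_exc_ne (by simpa [blowDown] using hv')]
      congr 1
      -- the coordinates `(1 / x̃, 1 / ỹ)` after three blow downs
      have hb := e1Map_blowDown hκ hs hd ht h1 hD
      have hg : blowDown (e1A p 6) (e1B p 6) true (blowDown (fun _ => 0) (fun _ => 0) false
          (blowDown (e1A₃ m) (fun _ => 0) false (e1Map p s (infParam p.a i) (x, y, t)))) =
          ((t - 1) * y / (p.κ * (1 - y)),
            t * (t - 1) ^ 2 * y ^ 2 / (p.κ * e1Den p (infParam p.a i) (x, y, t)), t) := by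
        have : (e1Map p s (infParam p.a i) (x, y, t)).2.2 = t := rfl
        simp only [blowDown, Bool.false_eq_true, if_false, if_true, zero_add, hm, this, hb]
        have hA : e1A p 6 t = 0 := rfl
        have hB : e1B p 6 t = 0 := rfl
        rw [hA, hB, zero_add, zero_add]
        refine Prod.ext rfl (Prod.ext ?_ rfl)
        simp only [e1Map]
        generalize e1Den p (infParam p.a i) (x, y, t) = D at *
        field_simp
      rw [hg]
      change (P1P1.chart (true, true)).par _ = (P1P1.chart (false, false)).par _
      rw [P1P1_par, P1P1_par, P1P1pt_inj]
      refine ⟨(sphereChart_ne (by simp)).2 ?_, (sphereChart_ne (by simp)).2 ?_, rfl⟩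
      · rw [e1Data_gen_fst]
        simp only [back]
        field_simp
      · rw [e1Data_gen_back hy, e1Mu]
        generalize e1Den p (infParam p.a i) (x, y, t) = D at *
        field_simp

end First

/-! ### The glued surface in the first parametrisation -/

section First

variable {p : Params}

/-- The signs `s` with `(u₈, v₈) = (s t, 0)` that distinguish the two lines over `f = ∞`. -/
theorem e1_sign (p : Params) : -2 * p.a 2 - e1c2 p = 1 * p.κ ∧
    -2 * (p.a 1 + p.a 2) - e1c2 p = -1 * p.κ := by
  constructor <;> simp [Params.a, e1c2, Params.κ] <;> ring

variable (p) in
/-- The lines `y_i = 0` of Takano's charts. -/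
def e1Lines : Line → ℂ → ℂ → (e1Y₃ p).Pt
  | Sum.inl 0, x, t => e1Exc p 1 t (sphereChart false (e1Map p 1 (infParam p.a 0) (x, 0, t)).1)
  | Sum.inl 1, x, t => e1Exc p 0 t (sphereChart false (e1Map p (-1) (infParam p.a 1) (x, 0, t)).1)
  | Sum.inr i, x, t => e1Lift p ((e1Data p).linePt p.a e1K (e1A p) (e1B p) i x t)

theorem e1Lift_inj {q q' : (e1Y₁ p).Pt} : e1Lift p q = e1Lift p q' ↔ q = q' :=
  offPt_inj.trans offPt_inj

theorem e1Lift_ne_exc {q : (e1Y₁ p).Pt} {m : Fin 2} {t : ℂ} {u : OnePoint ℂ} :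
    e1Lift p q ≠ e1Exc p m t u := offPt_ne_excPt

theorem e1Exc_inj {m m' : Fin 2} {t t' : ℂ} {u u' : OnePoint ℂ} :
    e1Exc p m t u = e1Exc p m' t' u' ↔ m = m' ∧ t = t' ∧ u = u' := excPt_inj

/-- On each of the two lines over `f = ∞`, the coordinate `u` is an affine function of `x`. -/
theorem e1Map_line (hκ : p.κ ≠ 0) {s d : ℂ} (hs : s ^ 2 = 1)
    (hd : -2 * d - e1c2 p = s * p.κ) {x t : ℂ} (ht : t ∈ B) :
    (e1Map p s d (x, 0, t)).1 = -(t / (t - 1)) *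
      (2 * s * p.κ + 2 * (x + d * (1 + t)) + (2 * e1c2 p + e1c1 p t)) := by
  have ht1 : t - 1 ≠ 0 := sub_ne_zero.2 ht.2
  have hs0 : s ≠ 0 := by rintro rfl; simp at hs
  have e := e1Den_eq (p := p) hd (x, 0, t)
  simp only [zero_mul, add_zero] at e
  simp only [e1Map, e, e1Den']
  field_simp
  linear_combination 2 * t * p.κ * hs

theorem e1Map_line_inj (hκ : p.κ ≠ 0) {s d : ℂ} (hs : s ^ 2 = 1)
    (hd : -2 * d - e1c2 p = s * p.κ) {x x' t : ℂ} (ht : t ∈ B)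
    (e : (e1Map p s d (x, 0, t)).1 = (e1Map p s d (x', 0, t)).1) : x = x' := by
  have ht1 : t - 1 ≠ 0 := sub_ne_zero.2 ht.2
  rw [e1Map_line hκ hs hd ht, e1Map_line hκ hs hd ht] at e
  have := mul_left_cancel₀ (neg_ne_zero.2 (div_ne_zero ht.1 ht1)) e
  linear_combination this / 2

theorem exists_e1Map_line (hκ : p.κ ≠ 0) {s d : ℂ} (hs : s ^ 2 = 1)
    (hd : -2 * d - e1c2 p = s * p.κ) {t : ℂ} (ht : t ∈ B) (U : ℂ) :
    ∃ x, (e1Map p s d (x, 0, t)).1 = U := by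
  have ht1 : t - 1 ≠ 0 := sub_ne_zero.2 ht.2
  have ht0 : t ≠ 0 := ht.1
  refine ⟨(-((t - 1) / t * U) - (2 * e1c2 p + e1c1 p t) - 2 * s * p.κ) / 2 - d * (1 + t), ?_⟩
  rw [e1Map_line hκ hs hd ht]
  field_simp
  ring

/-- The position of the glued surface in the blow up of the first parametrisation. -/
def e1Place (p : Params) : ModelPt → (e1Y₃ p).Pt := glue (e1Zero p) (e1Lines p)

theorem e1Lift_ne_center {q : (e1Y₁ p).Pt}
    (hq : ∀ t u, q ≠ excPt e1K (e1A p) (e1B p) 6 t u) :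
    (∀ j t, q ≠ (e1Y₁ p).center (e1K₂ p) (fun _ _ => 0) (fun _ _ => 0) j t) ∧
      ∀ j t, e1Lift₂ p q ≠ (e1Y₂ p).center (e1K₃ p) e1A₃ (fun _ _ => 0) j t := by
  refine ⟨fun j t => ?_, fun j t => ?_⟩
  · rw [center_e1₂]; exact hq _ _
  · rw [center_e1₃]; exact offPt_ne_excPt

/-- Patches of the first blow up away from the line over `p₇` remain patches. -/
theorem isLocalPatch_e1Lift (hv : (e1Data p).Valid p.a e1K (e1A p) (e1B p))
    {Q : Patch (e1Y₁ p).Pt} {Q' : Patch (e1Y₃ p).Pt} {w : C3} (hQ : (e1Y₁ p).IsLocalPatch Q w)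
    (hd : Q.dom ∈ 𝓝 w) (hd' : Q'.dom ∈ 𝓝 w) (hpar : ∀ v, Q'.par v = e1Lift p (Q.par v))
    (hw : ∀ t u, Q.par w ≠ excPt e1K (e1A p) (e1B p) 6 t u) : (e1Y₃ p).IsLocalPatch Q' w := by
  have hX := isAtlas_P1P1.blowUp hv.admissible
  have hX₂ := hX.blowUp (admissible_e1₂ hv.admissible)
  obtain ⟨h2, h3⟩ := e1Lift_ne_center hw
  exact (hQ.blowUp (Q' := ⟨Q.dom, fun v => e1Lift₂ p (Q.par v)⟩) hX
    (admissible_e1₂ hv.admissible) hd (fun _ => rfl) fun j t _ => h2 j t).blowUp hX₂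
    (admissible_e1₃ hv.admissible) hd' hpar fun j t _ => h3 j t

theorem e1_zeroPt_ne (hv : (e1Data p).Valid p.a e1K (e1A p) (e1B p)) {w : C3} (hw : w ∈ fullDom)
    (t : ℂ) (u : OnePoint ℂ) : (e1Data p).zeroPt e1K (e1A p) (e1B p) w ≠
      excPt e1K (e1A p) (e1B p) 6 t u := by
  rcases hv.zeroPt_cases hw with ⟨-, h⟩ | ⟨i, -, h⟩ <;> rw [h]
  · exact offPt_ne_excPt
  · rw [Ne, excPt_inj]
    fin_cases i <;> simp [e1Data]

theorem e1_linePt_ne (i : Fin 3) (x t t' : ℂ) (u : OnePoint ℂ) :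
    (e1Data p).linePt p.a e1K (e1A p) (e1B p) i x t ≠ excPt e1K (e1A p) (e1B p) 6 t' u := by
  rw [FibreData.linePt, Ne, excPt_inj]
  fin_cases i <;> simp [e1Data]

theorem isPlacement_e1 (hv : (e1Data p).Valid p.a e1K (e1A p) (e1B p)) (hκ : p.κ ≠ 0) :
    (e1Y₃ p).IsPlacement p.a (e1Place p) := by
  have hX := isAtlas_P1P1.blowUp hv.admissible
  have hX₂ := hX.blowUp (admissible_e1₂ hv.admissible)
  refine isPlacement_glue (hX₂.blowUp (admissible_e1₃ hv.admissible)) ?_ ?_ ?_ ?_ ?_ ?_ ?_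
  · exact fun w hw w' hw' e => hv.zeroPt_injOn hw hw' (e1Lift_inj.1 e)
  · intro l l' x x' t t' ht e
    rcases l with l | l <;> rcases l' with l' | l'
    · fin_cases l <;> fin_cases l' <;> obtain ⟨h1, rfl, h2⟩ := e1Exc_inj.1 e
      · exact ⟨rfl, e1Map_line_inj hκ (one_pow 2) (e1_sign p).1 ht (sphereChart_self.1 h2), rfl⟩
      · exact absurd h1 (by decide)
      · exact absurd h1 (by decide)
      · exact ⟨rfl, e1Map_line_inj hκ neg_one_sq (e1_sign p).2 ht (sphereChart_self.1 h2), rfl⟩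
    · fin_cases l <;> exact absurd e.symm e1Lift_ne_exc
    · fin_cases l' <;> exact absurd e e1Lift_ne_exc
    · obtain ⟨rfl, h2, h3⟩ := hv.linePt_inj ht (e1Lift_inj.1 e)
      exact ⟨rfl, h2, h3⟩
  · intro w hw l x t
    rcases l with l | l
    · fin_cases l <;> exact e1Lift_ne_exc
    · exact fun e => hv.zeroPt_ne_linePt hw _ _ _ (e1Lift_inj.1 e)
  · exact fun w hw => hv.base_zeroPt hw
  · intro l x t ht
    rcases l with l | l
    · fin_cases l <;> rfl
    · rfl
  · intro w hw
    exact isLocalPatch_e1Lift hv (hv.isLocalPatch_zero hw) (isOpen_fullDom.mem_nhds hw)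
      (isOpen_fullDom.mem_nhds hw) (fun _ => rfl) fun t u => e1_zeroPt_ne hv hw t u
  · intro l x t ht
    rcases l with l | l
    · fin_cases l
      · exact isLocalPatch_e1_inf hv hκ 0 1 (one_pow 2) (e1_sign p).1
          (fun t => by simp [e1A₃]) _ (fun _ _ => rfl) x t ht
      · exact isLocalPatch_e1_inf hv hκ 1 0 neg_one_sq (e1_sign p).2
          (fun t => by simp [e1A₃]) _ (fun _ _ => rfl) x t ht
    · refine isLocalPatch_e1Lift hv (hv.isLocalPatch_line l ht) (fullDom_mem_nhds ht)
        (fullDom_mem_nhds ht) (fun w => ?_) fun t' u => ?_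
      · by_cases hy : w.2.1 = 0
        · rw [placedPatch_glue_zero hy]
          exact congrArg (e1Lift p) (if_pos hy).symm
        · rw [placedPatch_glue_ne hy]
          exact congrArg (e1Lift p) (if_neg hy).symm
      · have : ((e1Data p).linePatch p.a e1K (e1A p) (e1B p) l).par (x, 0, t) =
          (e1Data p).linePt p.a e1K (e1A p) (e1B p) l x t := if_pos rfl
        rw [this]
        exact e1_linePt_ne l x t t' u

/-- The points of the glued surface that are not on the exceptional lines of the last blow up. -/
theorem e1Lift₃_mem_image {q : (e1Y₂ p).Pt} (hq : e1Lift₃ p q ∈ e1Place p '' modelCarrier) :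
    (∃ w ∈ fullDom, q = e1Lift₂ p ((e1Data p).zeroPt e1K (e1A p) (e1B p) w)) ∨
      ∃ i x t, q = e1Lift₂ p ((e1Data p).linePt p.a e1K (e1A p) (e1B p) i x t) := by
  obtain ⟨w | ⟨l | l, x, t⟩, hm, e⟩ := hq
  · exact Or.inl ⟨w, hm, (offPt_inj.1 e).symm⟩
  · fin_cases l <;> exact absurd e.symm offPt_ne_excPt
  · exact Or.inr ⟨l, x, t, (offPt_inj.1 e).symm⟩

theorem e1Lift_off_mem_image (hv : (e1Data p).Valid p.a e1K (e1A p) (e1B p)) {q : P1P1.Pt}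
    (hq : e1Lift p (offPt e1K (e1A p) (e1B p) q) ∈ e1Place p '' modelCarrier) :
    ∃ z : C3, (∀ i, z.1 ≠ (e1Data p).shift z.2.2 + (e1Data p).scale z.2.2 * (e1Data p).c i z.2.2) ∧
      z ∈ fullDom ∧ q = P1P1pt z.1 z.2.1 z.2.2 := by
  rcases e1Lift₃_mem_image hq with ⟨w, hw, e⟩ | ⟨i, x, t, e⟩
  · have e := offPt_inj.1 e
    rcases hv.zeroPt_cases hw with ⟨hf, h⟩ | ⟨i, -, h⟩ <;> rw [h] at e
    · exact ⟨(e1Data p).gen w, hv.gen_fst_ne hw hf, hw, offPt_inj.1 e⟩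
    · exact absurd e offPt_ne_excPt
  · exact absurd (offPt_inj.1 e) offPt_ne_excPt

theorem e1D_disjoint (hv : (e1Data p).Valid p.a e1K (e1A p) (e1B p)) (hκ : p.κ ≠ 0)
    (hs : p.a 0 + p.a 1 + 2 * p.a 2 + p.a 3 + p.a 4 = 1) :
    ∀ q ∈ D₁ p, q ∉ e1Place p '' modelCarrier := by
  have hX := isAtlas_P1P1.blowUp hv.admissible
  have hX₂ := hX.blowUp (admissible_e1₂ hv.admissible)
  have hP := isPlacement_e1 hv hκ
  have hU := hP.isChartOpen hs
  have hc := hP.image_subset hs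
  have hU₂ := Space.IsChartOpen.of_blowUp hX₂ hU hc
  have hU₁ := Space.IsChartOpen.of_blowUp hX hU₂
    fun q hq => (offPt_mem_carrier.1 (hc hq)).1
  have off : ∀ C : Set P1P1.Pt, (∀ z ∈ fullDom, (∀ i, z.1 ≠ (e1Data p).shift z.2.2 +
      (e1Data p).scale z.2.2 * (e1Data p).c i z.2.2) → P1P1pt z.1 z.2.1 z.2.2 ∉ C) →
      ∀ q ∈ proper₁₃ p (proper₁₂ p (proper₁₁ p C)), q ∉ e1Place p '' modelCarrier := by
    intro C hC q hq
    refine hU.disjoint_properTransform (fun q hq => hU₂.disjoint_properTransform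
      (fun q hq => hU₁.disjoint_properTransform ?_ hq) hq) hq
    intro q hq h
    obtain ⟨z, h1, hz, rfl⟩ := e1Lift_off_mem_image hv h
    exact hC z hz h1 hq
  rintro q ((((((hq | hq) | hq) | hq) | hq) | hq) | hq)
  · exact off _ (fun z hz h e => h 2 ((OnePoint.coe_injective e.2).trans (e1_fibres hz).2.2)) q hq
  · exact off _ (fun z hz h e => h 1 ((OnePoint.coe_injective e.2).trans (e1_fibres hz).2.1)) q hq
  · exact off _ (fun z hz h e => h 0 ((OnePoint.coe_injective e.2).trans (e1_fibres hz).1)) q hq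
  · exact off _ (fun z _ _ e => OnePoint.coe_ne_infty z.1 e.2) q hq
  · exact off _ (fun z _ _ e => OnePoint.coe_ne_infty z.2.1 e.2) q hq
  · refine hU.disjoint_properTransform (fun q hq => hU₂.disjoint_properTransform ?_ hq) hq
    rintro _ ⟨t, -, u, rfl⟩ h
    rcases e1Lift₃_mem_image h with ⟨w, hw, e⟩ | ⟨i, x, t', e⟩
    · exact e1_zeroPt_ne hv hw t u (offPt_inj.1 e).symm
    · exact e1_linePt_ne i x t' t u (offPt_inj.1 e).symm
  · refine hU.disjoint_properTransform ?_ hq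
    rintro _ ⟨t, -, u, rfl⟩ h
    rcases e1Lift₃_mem_image h with ⟨w, hw, e⟩ | ⟨i, x, t', e⟩
    · exact absurd e.symm offPt_ne_excPt
    · exact absurd e.symm offPt_ne_excPt

end First

section First

variable {p : Params}

/-- Every point of the blow up is on one of the removed curves or in the glued surface. On each
exceptional line that is not removed, one point belongs to a removed curve: the direction of the
fibre over one of `p₁, …, p₆`, and, at `p₉` and `p₁₀`, that of the exceptional line over `p₈`. -/
theorem e1X_carrier_subset (hv : (e1Data p).Valid p.a e1K (e1A p) (e1B p)) (hκ : p.κ ≠ 0) :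
    (e1Y₃ p).carrier ⊆ e1Place p '' modelCarrier ∪ D₁ p := by
  have hX := isAtlas_P1P1.blowUp hv.admissible
  have hX₂ := hX.blowUp (admissible_e1₂ hv.admissible)
  intro q hq
  rcases blowUp_pt_cases q with ⟨q, rfl⟩ | ⟨m, t, u, rfl⟩
  · have hq₂ := (offPt_mem_carrier.1 hq).1
    have up : ∀ C : Set (e1Y₂ p).Pt, q ∈ C → e1Lift₃ p q ∈ proper₁₃ p C :=
      fun C hC => offPt_mem_properTransform hC hq
    rcases blowUp_pt_cases q with ⟨q, rfl⟩ | ⟨j, t, u, rfl⟩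
    · have hq₁ := (offPt_mem_carrier.1 hq₂).1
      have up₂ : ∀ C : Set (e1Y₁ p).Pt, q ∈ C → e1Lift p q ∈ proper₁₃ p (proper₁₂ p C) :=
        fun C hC => up _ (offPt_mem_properTransform hC hq₂)
      rcases blowUp_pt_cases q with ⟨q, rfl⟩ | ⟨j, t, u, rfl⟩
      · have up₁ : ∀ C : Set P1P1.Pt, q ∈ C → e1Lift p (offPt e1K (e1A p) (e1B p) q) ∈
            proper₁₃ p (proper₁₂ p (proper₁₁ p C)) :=
          fun C hC => up₂ _ (offPt_mem_properTransform hC hq₁)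
        obtain ⟨x, y, t⟩ := q
        have ht : t ∈ B := (offPt_mem_carrier.1 hq₁).1
        have hf := e1_fibres (p := p) ht
        induction x with
        | infty => exact Or.inr (Or.inl (Or.inl (Or.inl (Or.inr (up₁ _ ⟨ht, rfl⟩)))))
        | coe x =>
          induction y with
          | infty => exact Or.inr (Or.inl (Or.inl (Or.inr (up₁ _ ⟨ht, rfl⟩))))
          | coe y =>
            by_cases h0 : x = p.κ
            · subst h0
              exact Or.inr (Or.inl (Or.inl (Or.inl (Or.inl (Or.inr (up₁ _ ⟨ht, rfl⟩))))))
            by_cases h1 : x = p.κ / (1 - t)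
            · subst h1
              exact Or.inr (Or.inl (Or.inl (Or.inl (Or.inl (Or.inl (Or.inr (up₁ _ ⟨ht, rfl⟩)))))))
            by_cases h2 : x = 0
            · subst h2
              exact Or.inr (Or.inl (Or.inl (Or.inl (Or.inl (Or.inl (Or.inl (up₁ _ ⟨ht, rfl⟩)))))))
            obtain ⟨w, hw, -, -, e⟩ := hv.exists_zeroPt_off (z := (x, y, t)) ht (fun i => by
              fin_cases i
              exacts [fun e => h0 (e.trans hf.1.symm), fun e => h1 (e.trans hf.2.1.symm),
                fun e => h2 (e.trans hf.2.2.symm)])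
            exact Or.inl ⟨Sum.inl w, hw, congrArg (e1Lift p) e⟩
      · have ht : t ∈ B := excPt_mem_carrier.1 hq₁
        have dir : ∀ (j : Fin 7) (c : ℂ → OnePoint ℂ), e1K j = (false, false) →
            c t = ((e1A p j t : ℂ) : OnePoint ℂ) →
            excPt e1K (e1A p) (e1B p) j t (sphereChart false 0) ∈ proper₁₁ p (firstCoord c) := by
          intro j c hk hA
          refine excPt_mem_properTransform isAtlas_P1P1 hv.admissible false ht
            fun v _ _ => ⟨ht, ?_⟩
          change _ = c t
          rw [hk, hA]
          simp [P1P1_par, P1P1pt, blowDown, sphereChart]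
        have zero : excPt e1K (e1A p) (e1B p) j t u ∈
            proper₁₁ p (firstCoord (fun _ => ((0 : ℂ) : OnePoint ℂ))) →
            e1Lift p (excPt e1K (e1A p) (e1B p) j t u) ∈ D₁ p := by
          intro h
          exact Or.inl (Or.inl (Or.inl (Or.inl (Or.inl (Or.inl (up₂ _ h))))))
        have one : excPt e1K (e1A p) (e1B p) j t u ∈
            proper₁₁ p (firstCoord (fun t => ((p.κ / (1 - t) : ℂ) : OnePoint ℂ))) →
            e1Lift p (excPt e1K (e1A p) (e1B p) j t u) ∈ D₁ p := by
          intro h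
          exact Or.inl (Or.inl (Or.inl (Or.inl (Or.inl (Or.inr (up₂ _ h))))))
        have two : excPt e1K (e1A p) (e1B p) j t u ∈
            proper₁₁ p (firstCoord (fun _ => ((p.κ : ℂ) : OnePoint ℂ))) →
            e1Lift p (excPt e1K (e1A p) (e1B p) j t u) ∈ D₁ p := by
          intro h
          exact Or.inl (Or.inl (Or.inl (Or.inl (Or.inr (up₂ _ h)))))
        have neg : ∀ i, j = (e1Data p).neg i → u = sphereChart false 0 ∨
            e1Lift p (excPt e1K (e1A p) (e1B p) j t u) ∈ e1Place p '' modelCarrier := by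
          rintro i rfl
          exact (hv.exists_zeroPt_exc i ht u).imp id fun ⟨w, hw, e⟩ =>
            ⟨Sum.inl w, hw, congrArg (e1Lift p) e⟩
        have pos : ∀ i, j = (e1Data p).pos i → u = sphereChart false 0 ∨
            e1Lift p (excPt e1K (e1A p) (e1B p) j t u) ∈ e1Place p '' modelCarrier := by
          rintro i rfl
          exact (hv.exists_linePt i ht u).imp id fun ⟨x, e⟩ =>
            ⟨Sum.inr (Sum.inr i, x, t), ht, congrArg (e1Lift p) e⟩
        fin_cases j
        · rcases neg 2 rfl with rfl | h
          exacts [Or.inr (zero (dir 0 _ rfl rfl)), Or.inl h]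
        · rcases pos 2 rfl with rfl | h
          exacts [Or.inr (zero (dir 1 _ rfl rfl)), Or.inl h]
        · rcases neg 1 rfl with rfl | h
          exacts [Or.inr (one (dir 2 _ rfl rfl)), Or.inl h]
        · rcases pos 1 rfl with rfl | h
          exacts [Or.inr (one (dir 3 _ rfl rfl)), Or.inl h]
        · rcases pos 0 rfl with rfl | h
          exacts [Or.inr (two (dir 4 _ rfl rfl)), Or.inl h]
        · rcases neg 0 rfl with rfl | h
          exacts [Or.inr (two (dir 5 _ rfl rfl)), Or.inl h]
        · exact Or.inr (Or.inl (Or.inr (up₂ _ ⟨t, ht, u, rfl⟩)))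
    · exact Or.inr (Or.inr (up _ ⟨t, excPt_mem_carrier.1 hq₂, u, rfl⟩))
  · have ht : t ∈ B := excPt_mem_carrier.1 hq
    rcases exists_sphereChart' u with rfl | ⟨U, rfl⟩
    · refine Or.inr (Or.inr (excPt_mem_properTransform hX₂ (admissible_e1₃ hv.admissible) true ht
        fun v _ _ => ?_))
      change ((e1Y₂ p).chart (excIx (e1K₂ p) (fun _ _ => 0) (fun _ _ => 0) () false)).par _ ∈ _
      rw [blowUp_par_exc_zero (by simp [blowDown])]
      exact ⟨t, ht, _, rfl⟩
    · fin_cases m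
      · obtain ⟨x, rfl⟩ := exists_e1Map_line hκ neg_one_sq (e1_sign p).2 ht U
        exact Or.inl ⟨Sum.inr (Sum.inl 1, x, t), ht, rfl⟩
      · obtain ⟨x, rfl⟩ := exists_e1Map_line hκ (one_pow 2) (e1_sign p).1 ht U
        exact Or.inl ⟨Sum.inr (Sum.inl 0, x, t), ht, rfl⟩

end First

/-! ### The system in the first parametrisation -/

section First

variable {p : Params}

theorem a_sum (p : Params) : p.a 0 + p.a 1 + 2 * p.a 2 + p.a 3 + p.a 4 = 1 := by
  simp [Params.a, Params.κ]
  ring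

theorem isPlacement_E₁ (hv : (e1Data p).Valid p.a e1K (e1A p) (e1B p)) (hκ : p.κ ≠ 0) :
    (E₁ p).IsPlacement p.a (e1Place p) :=
  (isPlacement_e1 hv hκ).remove (a_sum p) (e1D_disjoint hv hκ (a_sum p)) (e1X_carrier_subset hv hκ)

theorem E₁_carrier_subset (hv : (e1Data p).Valid p.a e1K (e1A p) (e1B p)) (hκ : p.κ ≠ 0) :
    (E₁ p).carrier ⊆ e1Place p '' modelCarrier :=
  fun _ hq => (e1X_carrier_subset hv hκ hq.1).resolve_right hq.2

theorem e1Place_zero {w : C3} (hw : ∀ i, w.1 ≠ (e1Data p).c i w.2.2) :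
    e1Place p (Sum.inl w) = ((E₁ p).chart (aff₁ p)).par ((e1Data p).gen w) := by
  change e1Lift p _ = _
  rw [FibreData.Valid.zeroPt_off hw]
  rfl

/-- Every point of the chart `(x̃, ỹ)` lies in Takano's chart `0`. -/
theorem exists_of_mem_aff₁ (hv : (e1Data p).Valid p.a e1K (e1A p) (e1B p)) {z : C3}
    (hz : z ∈ ((E₁ p).chart (aff₁ p)).dom) :
    ∃ w ∈ fullDom, (∀ i, w.1 ≠ (e1Data p).c i w.2.2) ∧ (e1Data p).gen w = z := by
  have ht : z ∈ fullDom := hz.1.1.1.1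
  have hm := (((((isAtlas_P1P1.blowUp hv.admissible).blowUp
    (admissible_e1₂ hv.admissible)).blowUp (admissible_e1₃ hv.admissible)).isPatch _).mapsTo hz.1)
  have hm₂ := (offPt_mem_carrier.1 hm).1
  have hm₁ := (offPt_mem_carrier.1 hm₂).1
  have up : ∀ c : ℂ → OnePoint ℂ, (z.1 : OnePoint ℂ) = c z.2.2 →
      ((E₁ p).chart (aff₁ p)).par z ∈ proper₁₃ p (proper₁₂ p (proper₁₁ p (firstCoord c))) :=
    fun c hc => offPt_mem_properTransform (offPt_mem_properTransform
      (offPt_mem_properTransform ⟨ht, hc⟩ hm₁) hm₂) hm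
  have hf := e1_fibres (p := p) ht
  obtain ⟨w, hw, h1, h2, -⟩ := hv.exists_zeroPt_off (z := z) ht fun i e => by
    refine hz.2 ?_
    fin_cases i
    · exact Or.inl (Or.inl (Or.inl (Or.inl (Or.inr
        (up _ (congrArg ((↑) : ℂ → OnePoint ℂ) (e.trans hf.1.symm)))))))
    · exact Or.inl (Or.inl (Or.inl (Or.inl (Or.inl (Or.inr
        (up _ (congrArg ((↑) : ℂ → OnePoint ℂ) (e.trans hf.2.1.symm))))))))
    · exact Or.inl (Or.inl (Or.inl (Or.inl (Or.inl (Or.inl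
        (up _ (congrArg ((↑) : ℂ → OnePoint ℂ) (e.trans hf.2.2.symm))))))))
  exact ⟨w, hw, h1, h2⟩

theorem e1_ne {w : C3} (hw : ∀ i, w.1 ≠ (e1Data p).c i w.2.2) :
    w.1 ≠ 0 ∧ w.1 - 1 ≠ 0 ∧ w.1 - w.2.2 ≠ 0 := by
  have hc := e1Data_c (p := p) w.2.2
  refine ⟨fun e => hw 1 (e.trans hc.2.1.symm), sub_ne_zero.2 fun e => hw 2 (e.trans hc.2.2.symm),
    sub_ne_zero.2 fun e => hw 0 (e.trans hc.1.symm)⟩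

/-- The change of coordinates `(f, y₀) ↦ (x̃, ỹ)` is inverse to the map `(x̃, ỹ) ↦ (f, g)`. -/
theorem ident₁_gen (hκ : p.κ ≠ 0) {w : C3} (ht : w ∈ fullDom)
    (hw : ∀ i, w.1 ≠ (e1Data p).c i w.2.2) :
    ident₁ p ((e1Data p).gen w) = (w.1, w.1 * w.2.1, w.2.2) := by
  obtain ⟨h0, h1, h2⟩ := e1_ne hw
  have ht0 : w.2.2 ≠ 0 := ht.1
  have ht1 : w.2.2 - 1 ≠ 0 := sub_ne_zero.2 ht.2
  have ht2 : ((e1Data p).gen w).2.2 = w.2.2 := rfl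
  simp only [ident₁, e1Data_gen_fst, e1Data_gen_snd, ht2, e1Mu]
  obtain ⟨f, y, t⟩ := w
  simp only at *
  have e : p.κ / (t - 1) * (f - 1) - p.κ = p.κ * (f - t) / (t - 1) := by
    field_simp
    ring
  refine Prod.ext ?_ (Prod.ext ?_ rfl)
  · simp only
    field_simp
    ring
  · simp only
    rw [e]
    field_simp
    simp only [e1c2, e1c1]
    ring

/-- The polynomial `phi` in terms of `u = f - 1` and `M`, where `x̃ = κ u / (t - 1)` and
`ỹ = κ M / (t (t - 1)²)`. -/
def phiRed (α β γ n κ u M t : ℂ) : ℂ :=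
  -(u ^ 4 * (6 * κ ^ 2 - β ^ 2 + 4 * n * (t ^ 2 - 6 * t) * (κ - n)
      + t ^ 2 * (α + β + 1) * (α + β + 2 * γ + 1)
      - t * (2 * α * (κ - 2 * n) + 2 * β * (γ + 1) + 2 * γ + 5 * (κ - 2 * n) ^ 2)))
  - u ^ 2 * ((t - 1) * (-κ ^ 2 + 6 * β ^ 2 + 4 * n * t * (κ - n) + t ^ 2 * (β ^ 2 - α ^ 2 + 1)
        + t * (2 * α * (κ - 2 * n) - 5 * β ^ 2 + 2 * β * (γ + 1) + 2 * γ))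
      + 3 * M ^ 2 + 2 * (t ^ 2 - 4 * t + 2) * M)
  + 2 * (t - 1) * u ^ 3 * (M
      - 2 * (β ^ 2 - κ ^ 2 + 2 * n * t * (β + γ + n) + β * γ * t + (κ - 1) * (α + 1) * t))
  - 2 * u * (-((t - 2) * M ^ 2) + (2 * t - 1) * (t - 1) * M + β ^ 2 * (t - 2) * (t - 1) ^ 2)
  - (β ^ 2 * (t - 1) ^ 3 - (t - 1) * M ^ 2) - κ ^ 2 * u ^ 6 + 2 * κ ^ 2 * (t - 2) * u ^ 5

theorem phi_eq_phiRed (α β γ n κ u M : ℂ) {t : ℂ} (h0 : t ≠ 0) (h1 : t - 1 ≠ 0) :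
    phi α β γ n κ (κ * u * (t - 1)⁻¹) (κ * M * (t * (t - 1) ^ 2)⁻¹) t =
      κ ^ 4 * phiRed α β γ n κ u M t / (t - 1) ^ 3 := by
  simp only [phi, phiRed]
  field_simp
  ring

set_option maxHeartbeats 1000000 in
/-- The equation for `ỹ'`, with denominators cleared: `N₁` and `N₂` are the numerators of the system
in Takano's chart `0`, and the left hand side is a multiple of the derivative of `M / (t (t - 1)²)`
along that system. -/
theorem phiRed_eq (α β γ n κ f y t M N₁ N₂ : ℂ) (hκ : κ = α + β + γ + 2 * n + 1)
    (hM : M = 2 * (f * (f - 1) * (f - t) * y) - (α - β - γ - 1) * (f - 1) ^ 2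
      + (1 - α + 2 * β + γ + (α - β - 1) * t) * (f - 1) - β * (t - 1))
    (hN₁ : N₁ = 2 * f * (f - 1) * (f - t) * y + (f ^ 2 * (κ + 2 * (-n - α)) + f * t * (-β + α)
      - f * (κ + 2 * (-n - α) + -β) - t * α))
    (hN₂ : N₂ = -((3 * f ^ 2 - 2 * (1 + t) * f + t) * y ^ 2 + (-n - α) * (κ + (-n - α))
          + (2 * f * (κ + 2 * (-n - α)) + t * (-β + α) - (κ + 2 * (-n - α) + -β)) * y)) :
    2 * f * (f - 1) * (f - t) * (2 * (f * (f - 1) * (f - t)) * N₂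
      + (2 * (3 * f ^ 2 - 2 * (1 + t) * f + t) * y - 2 * (α - β - γ - 1) * (f - 1)
        + (1 - α + 2 * β + γ + (α - β - 1) * t)) * N₁
      + t * (t - 1) * (-(2 * f * (f - 1) * y) + (α - β - 1) * (f - 1) - β)
      - (3 * t - 1) * M) = -phiRed α β γ n κ (f - 1) M t := by
  subst hM hN₁ hN₂ hκ
  simp only [phiRed]
  ring

/-- The chain rule for the reciprocal of a scalar function. -/
theorem hasFDerivAt_inv_comp {f : C3 → ℂ} {f' : C3 →L[ℂ] ℂ} {w : C3} (hf : HasFDerivAt f f' w)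
    (h : f w ≠ 0) : HasFDerivAt (fun z => (f z)⁻¹) (-(f w ^ 2)⁻¹ • f') w :=
  (hasDerivAt_inv h).comp_hasFDerivAt w hf

theorem isAffineForm_E₁ (hv : (e1Data p).Valid p.a e1K (e1A p) (e1B p)) (hκ : p.κ ≠ 0) :
    IsAffineForm (E₁ p) p.a (e1Place p) (aff₁ p) (system₁ p) (area₁ p) := by
  intro z hz
  obtain ⟨⟨f, y, t⟩, ht', hw, rfl⟩ := exists_of_mem_aff₁ hv hz
  have ht : t ∈ B := ht'
  have ht0 : t ≠ 0 := ht.1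
  have ht1 : t - 1 ≠ 0 := sub_ne_zero.2 ht.2
  obtain ⟨h0, h1, h2⟩ := e1_ne hw
  simp only at h0 h1 h2
  have e : p.κ / (t - 1) * (f - 1) - p.κ = p.κ * (f - t) / (t - 1) := by
    field_simp
    ring
  have e' : (1 - t) * (p.κ / (t - 1) * (f - 1)) - p.κ = -(p.κ * f) := by
    field_simp
    ring
  have hgen : (e1Data p).gen = fun w : C3 => (p.κ * (w.1 - 1) * (w.2.2 - 1)⁻¹,
      p.κ * (2 * (w.1 * (w.1 - 1) * (w.1 - w.2.2) * w.2.1) - e1c2 p * (w.1 - 1) ^ 2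
        + e1c1 p w.2.2 * (w.1 - 1) - p.β * (w.2.2 - 1)) * (w.2.2 * (w.2.2 - 1) ^ 2)⁻¹, w.2.2) := by
    funext w
    refine Prod.ext ?_ (Prod.ext ?_ rfl)
    · simp only [e1Data_gen_fst]; ring
    · simp only [e1Data_gen_snd, e1Mu]; ring
  have hf := hasFDerivAt_fst (f, y, t)
  have hy := hasFDerivAt_snd (f, y, t)
  have htt := hasFDerivAt_time (f, y, t)
  have h3 : ((f, y, t) : C3).2.2 * (((f, y, t) : C3).2.2 - 1) ^ 2 ≠ 0 :=
    mul_ne_zero ht0 (pow_ne_zero 2 ht1)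
  have hc1 : HasFDerivAt (fun w : C3 => e1c1 p w.2.2) _ (f, y, t) :=
    (htt.const_mul (p.α - p.β - 1)).const_add (1 - p.α + 2 * p.β + p.γ)
  have hx1 := hf.sub_const 1
  have hs1 := htt.sub_const 1
  have hp := (((hf.mul hx1).mul (hf.sub htt)).mul hy).const_mul 2
  have hM := ((hp.sub ((hx1.pow 2).const_mul (e1c2 p))).add (hc1.mul hx1)).sub
    (hs1.const_mul p.β)
  have hd : HasFDerivAt (fun w : C3 => ((p.κ * (w.1 - 1) * (w.2.2 - 1)⁻¹,
      p.κ * (2 * (w.1 * (w.1 - 1) * (w.1 - w.2.2) * w.2.1) - e1c2 p * (w.1 - 1) ^ 2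
        + e1c1 p w.2.2 * (w.1 - 1) - p.β * (w.2.2 - 1)) * (w.2.2 * (w.2.2 - 1) ^ 2)⁻¹, w.2.2) :
          C3)) _ (f, y, t) :=
    ((hx1.const_mul p.κ).mul (hasFDerivAt_inv_comp hs1 ht1)).prodMk
      (((hM.const_mul p.κ).mul (hasFDerivAt_inv_comp (htt.mul (hs1.pow 2)) h3)).prodMk htt)
  refine ⟨(f, y, t), ht, (e1Data p).gen, rfl, (hv.locInv_gen ht hw).analytic, ?_, ?_, ?_⟩
  · filter_upwards [FibreData.Valid.eventually_ne (D := e1Data p) (w := (f, y, t)) (fun _ => True)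
      fun i _ => hw i] with w' h
    exact (e1Place_zero fun i => h i trivial).symm
  · have ha : area₁ p ((e1Data p).gen (f, y, t)) =
        t * (t - 1) ^ 3 / (2 * p.κ ^ 2 * f * (f - 1) * (f - t)) := by
      have h3 : ((e1Data p).gen (f, y, t)).2.2 = t := rfl
      simp only [area₁, e1Data_gen_fst, h3, e, e']
      field_simp
    rw [ha, hgen, relJac, hd.fderiv]
    simp [dx, dy, dt]
    field_simp
  · obtain ⟨M, hM⟩ : ∃ M, M = 2 * (f * (f - 1) * (f - t) * y) - e1c2 p * (f - 1) ^ 2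
        + e1c1 p t * (f - 1) - p.β * (t - 1) := ⟨_, rfl⟩
    obtain ⟨N₁, hN₁⟩ : ∃ N, N = 2 * f * (f - 1) * (f - t) * y + (f ^ 2 * (p.κ + 2 * (-p.n - p.α))
        + f * t * (-p.β + p.α) - f * (p.κ + 2 * (-p.n - p.α) + -p.β) - t * p.α) := ⟨_, rfl⟩
    obtain ⟨N₂, hN₂⟩ : ∃ N, N = -((3 * f ^ 2 - 2 * (1 + t) * f + t) * y ^ 2
        + (-p.n - p.α) * (p.κ + (-p.n - p.α)) + (2 * f * (p.κ + 2 * (-p.n - p.α))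
        + t * (-p.β + p.α) - (p.κ + 2 * (-p.n - p.α) + -p.β)) * y) := ⟨_, rfl⟩
    have key := phiRed_eq p.α p.β p.γ p.n p.κ f y t M N₁ N₂ rfl hM hN₁ hN₂
    have hH : hamSystem (knyH₀ p.a) (f, y, t) = (N₁ / (t * (t - 1)), N₂ / (t * (t - 1)), 1) := by
      rw [hamSystem_knyH₀ p.a ht, hN₁, hN₂]
      rfl
    rw [hH, hgen, hd.fderiv]
    simp only [system₁, ← hM, phi_eq_phiRed _ _ _ _ _ _ _ ht0 ht1]
    have e1 : p.κ * (f - 1) * (t - 1)⁻¹ - p.κ = p.κ * (f - t) / (t - 1) := by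
      field_simp
      ring
    have e2 : p.κ - p.κ * (f - 1) * (t - 1)⁻¹ = -(p.κ * (f - t) / (t - 1)) := by
      rw [← e1]; ring
    have e3 : p.κ + (t - 1) * (p.κ * (f - 1) * (t - 1)⁻¹) = p.κ * f := by
      field_simp
      ring
    rw [e2, e3]
    refine Prod.ext ?_ (Prod.ext ?_ ?_)
    · simp [dx, dt, dy]
      -- the equation `x̃' = ỹ`
      have : N₁ - t * (f - 1) = M := by
        rw [hN₁, hM, e1c2, e1c1, Params.κ]
        ring
      rw [← this]
      field_simp
      ring
    · simp [dx, dt, dy, ← hM]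
      generalize phiRed p.α p.β p.γ p.n p.κ (f - 1) M t = P at *
      obtain rfl : P = -_ := neg_eq_iff_eq_neg.1 key.symm
      field_simp
      simp only [e1c2, e1c1]
      ring
    · simp [dx, dt, dy]

end First

/-! ### The transport to the first parametrisation -/

theorem a_ne_zero {p : Params} (hα : p.α ≠ 0) (hβ : p.β ≠ 0) (hγ : p.γ ≠ 0) (hκ : p.κ ≠ 0) :
    p.a 0 ≠ 0 ∧ p.a 1 ≠ 0 ∧ p.a 3 ≠ 0 ∧ p.a 4 ≠ 0 :=
  ⟨neg_ne_zero.2 hγ, hκ, neg_ne_zero.2 hβ, hα⟩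

/-- The point with coordinates `(f, f y₀, t)` of `E^KNY`. -/
theorem ident_mem_knyAff {p : Params} (hα : p.α ≠ 0) (hβ : p.β ≠ 0) (hγ : p.γ ≠ 0) (hκ : p.κ ≠ 0)
    {w z : C3} (ht : w ∈ fullDom) (hw : w.1 ≠ 0) (hz : z = (w.1, w.1 * w.2.1, w.2.2)) :
    z ∈ ((knyE p.a).chart (knyAff p.a)).dom ∧
      knyPlace p.a (Sum.inl w) = ((knyE p.a).chart (knyAff p.a)).par z := by
  obtain ⟨h0, h1, h3, h4⟩ := a_ne_zero hα hβ hγ hκ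
  subst hz
  exact ⟨(mem_knyAff_dom h0 h1 h3 h4 (a_sum p)).2 ⟨ht, hw⟩, knyPlace_zero hw⟩

theorem pullsBackAlong_E₁ {p : Params} (hα : p.α ≠ 0) (hβ : p.β ≠ 0) (hγ : p.γ ≠ 0)
    (hκ : p.κ ≠ 0) :
    PullsBackAlong (E₁ p) (knyE p.a) (aff₁ p) (knyAff p.a) (ident₁ p) (system₁ p) (area₁ p)
      (fun i => placedPatch p.a (knyPlace p.a) (takanoIx i)) (fun i => modelHam p.a (takanoIx i))
      (fun k z => areaOf ((knyE p.a).hamTwoForm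
        (fun i => placedPatch p.a (knyPlace p.a) (takanoIx i))
        (fun i => modelHam p.a (takanoIx i)) k z))
      ((knyE p.a).hamTwoForm (fun i => placedPatch p.a (knyPlace p.a) (takanoIx i))
        fun i => modelHam p.a (takanoIx i))
      (fun k z => fieldOf ((knyE p.a).hamTwoForm
        (fun i => placedPatch p.a (knyPlace p.a) (takanoIx i))
        (fun i => modelHam p.a (takanoIx i)) k z)) := by
  obtain ⟨h0, h1, h3, h4⟩ := a_ne_zero hα hβ hγ hκ
  have hv := valid_e1 hα hβ hγ hκ
  refine (isPlacement_E₁ hv hκ).pullsBackAlong (isPlacement_knyE h0 h1 h3 h4 (a_sum p)) (a_sum p)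
    (E₁_carrier_subset hv hκ) (knyE_carrier_subset h1 h4) (isAffineForm_E₁ hv hκ) ?_
    takanoIx_surjective
  intro z hz
  obtain ⟨w, ht, hw, rfl⟩ := exists_of_mem_aff₁ hv hz
  exact ⟨w, ht, e1Place_zero hw,
    ident_mem_knyAff hα hβ hγ hκ ht (e1_ne hw).1 (ident₁_gen hκ ht hw)⟩

/-! ### The space of the second parametrisation -/

section Second

variable (p : Params)

/-- The charts that contain `π₁, …, π₇`. -/
def e2K : Fin 7 → F1.Ix := (![3, 3, 3, 3, 3, 3, 1] : Fin 7 → Fin 4)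

/-- The first coordinates of `π₁, …, π₇`. -/
def e2A (j : Fin 7) (t : ℂ) : ℂ := ![0, 0, p.κ, p.κ, p.κ / (1 - t), p.κ / (1 - t), 0] j

/-- The second coordinates of `π₁, …, π₇`. -/
def e2B (j : Fin 7) (t : ℂ) : ℂ :=
  ![0, p.κ * p.β, -p.κ * t * p.n, -p.κ * t * (p.γ + p.n), 0, p.κ * t * p.α / (1 - t), 0] j

/-- The first blow up. -/
abbrev e2Y₁ : Space := F1.blowUp e2K (e2A p) (e2B p)

/-- The chart that contains `π₈`. -/
def e2K₂ (_ : Unit) : (e2Y₁ p).Ix := excIx e2K (e2A p) (e2B p) 6 false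

/-- The coordinate `u₇` of `π₈`. -/
def e2A₂ (_ : Unit) (t : ℂ) : ℂ := 1 - t

/-- The second blow up. -/
abbrev e2Y₂ : Space := (e2Y₁ p).blowUp (e2K₂ p) e2A₂ fun _ _ => 0

/-- The factor `λ` in the formulas for `ξ₀` and `υ₀`. -/
def e2La (t : ℂ) : ℂ := p.κ / (t - 1)

/-- The coordinates of the second parametrisation are `ξ₀ = λ (f - 1)` and
`1 / υ₀ = λ (f - 1) (f (f - t) y₀ - (α + n) f + α t)`, where `λ = κ / (t - 1)`. -/
def e2Data : FibreData F1 (Fin 7) (Fin 3) where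
  chart := F1ix false true
  line i := i
  neg := ![2, 5, 0]
  pos := ![3, 4, 1]
  shift t := -(e2La p t)
  scale t := e2La p t
  total f t := e2La p t * (f * (f - 1) * (f - t))
  q0 t := -(e2La p t * (p.α * t))
  q1 t := e2La p t * (p.α + p.n + p.α * t)
  q2 t := -(e2La p t * (p.α + p.n))
  r0 i t := ![0, e2La p t * t, 0] i
  r1 i t := ![-(e2La p t), -(e2La p t * (1 + t)), -(e2La p t * t)] i
  r2 _ t := e2La p t

variable {p}

theorem e2_center (j : Fin 7) (t : ℂ) : F1.center e2K (e2A p) (e2B p) j t =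
    F1pt (sphereChart (![false, false, false, false, false, false, true] j) (e2A p j t))
      (sphereChart (![true, true, true, true, true, true, false] j) (e2B p j t)) t := by
  fin_cases j
  exacts [F1_par_false true _, F1_par_false true _, F1_par_false true _, F1_par_false true _,
    F1_par_false true _, F1_par_false true _, F1_par_zero true false rfl]

theorem admissible_e2₁ (hα : p.α ≠ 0) (hβ : p.β ≠ 0) (hγ : p.γ ≠ 0) (hκ : p.κ ≠ 0) :
    F1.Admissible e2K (e2A p) (e2B p) := by
  refine admissible_F1 (fun j t ht => ?_) (fun j t ht => ?_) fun i j t ht e => ?_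
  · have h1 : 1 - t ≠ 0 := sub_ne_zero.2 (Ne.symm ht.2)
    have : AnalyticAt ℂ (fun t => p.κ / (1 - t)) t := by fun_prop (disch := assumption)
    fin_cases j <;> first | exact analyticAt_const | exact this
  · have h1 : 1 - t ≠ 0 := sub_ne_zero.2 (Ne.symm ht.2)
    unfold e2B
    fin_cases j <;> simp only [Fin.zero_eta, Fin.mk_one, Fin.reduceFinMk, Matrix.cons_val] <;>
      fun_prop (disch := assumption)
  · have h0 : t ≠ 0 := ht.1
    have h1 : 1 - t ≠ 0 := sub_ne_zero.2 (Ne.symm ht.2)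
    have hx := kappa_div_ne hκ ht
    have hy1 : 0 ≠ p.κ * p.β := (mul_ne_zero hκ hβ).symm
    have hy2 : -p.κ * t * p.n ≠ -p.κ * t * (p.γ + p.n) := by
      intro e
      have : p.κ * t * p.γ = 0 := by linear_combination e
      simp [hκ, h0, hγ] at this
    have hy3 : 0 ≠ p.κ * t * p.α / (1 - t) :=
      (div_ne_zero (mul_ne_zero (mul_ne_zero hκ h0) hα) h1).symm
    have key1 : ∀ x x', sphereChart false x = sphereChart false x' → x = x' :=
      fun _ _ => sphereChart_self.1
    have key2 : ∀ x x', sphereChart true x = sphereChart true x' → x = x' :=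
      fun _ _ => sphereChart_self.1
    have key3 : ∀ x, sphereChart false x ≠ sphereChart true 0 :=
      fun x e => by simpa using (sphereChart_ne (by decide)).1 e
    rw [e2_center, e2_center, F1pt_inj] at e
    fin_cases i <;> fin_cases j <;> first
      | rfl
      | exact absurd e.1 (key3 _)
      | exact absurd e.1.symm (key3 _)
      | exact absurd (key1 _ _ e.1) hκ
      | exact absurd (key1 _ _ e.1) hκ.symm
      | exact absurd (key1 _ _ e.1) hx.1
      | exact absurd (key1 _ _ e.1) hx.1.symm
      | exact absurd (key1 _ _ e.1) hx.2
      | exact absurd (key1 _ _ e.1) hx.2.symm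
      | exact absurd (key2 _ _ e.2.1) hy1
      | exact absurd (key2 _ _ e.2.1) hy1.symm
      | exact absurd (key2 _ _ e.2.1) hy2
      | exact absurd (key2 _ _ e.2.1) hy2.symm
      | exact absurd (key2 _ _ e.2.1) hy3
      | exact absurd (key2 _ _ e.2.1) hy3.symm

theorem e2Data_c (t : ℂ) : (e2Data p).c 0 t = t ∧ (e2Data p).c 1 t = 0 ∧ (e2Data p).c 2 t = 1 := by
  simp [FibreData.c, e2Data, fibre, fibreConst, fibreSlope]

/-- The values of the first coordinate on the three fibres. -/
theorem e2_fibres {t : ℂ} (ht : t ∈ B) :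
    p.κ = (e2Data p).shift t + (e2Data p).scale t * (e2Data p).c 0 t ∧
    p.κ / (1 - t) = (e2Data p).shift t + (e2Data p).scale t * (e2Data p).c 1 t ∧
    0 = (e2Data p).shift t + (e2Data p).scale t * (e2Data p).c 2 t := by
  have hc := e1Data_c (p := p) t
  have hc' := e2Data_c (p := p) t
  have := e1_fibres (p := p) ht
  rw [hc.1, hc.2.1, hc.2.2] at this
  rw [hc'.1, hc'.2.1, hc'.2.2]
  exact this

theorem valid_e2 (hα : p.α ≠ 0) (hβ : p.β ≠ 0) (hγ : p.γ ≠ 0) (hκ : p.κ ≠ 0) :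
    (e2Data p).Valid p.a e2K (e2A p) (e2B p) := by
  have hl : ∀ t ∈ B, e2La p t ≠ 0 := fun t ht => div_ne_zero hκ (sub_ne_zero.2 ht.2)
  have hla : ∀ t ∈ B, AnalyticAt ℂ (e2La p) t := fun t ht => by
    have h2 : t - 1 ≠ 0 := sub_ne_zero.2 ht.2
    unfold e2La
    fun_prop (disch := assumption)
  refine
    { atlas := isAtlas_F1
      admissible := admissible_e2₁ hα hβ hγ hκ
      dom := rfl
      analytic_shift := fun t ht => (hla t ht).neg
      analytic_scale := fun t ht => hla t ht
      analytic_q := fun t ht => ?_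
      analytic_r := fun i t ht => ?_
      analytic_total := fun w hw => ?_
      scale_ne := hl
      param_ne := fun i => ?_
      total_eq := fun i f t ht => ?_
      total_ne := fun f t ht h => ?_
      R_ne := fun i t ht => ?_
      line_inj := Function.injective_id
      neg_inj := by intro i j; fin_cases i <;> fin_cases j <;> simp [e2Data]
      pos_inj := by intro i j; fin_cases i <;> fin_cases j <;> simp [e2Data]
      neg_ne_pos := fun i j => by fin_cases i <;> fin_cases j <;> simp [e2Data]
      k_neg := fun i => by fin_cases i <;> rfl
      k_pos := fun i => by fin_cases i <;> rfl
      fst_neg := fun i t ht => ?_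
      fst_pos := fun i t ht => ?_
      snd_neg := fun i t ht => ?_
      snd_pos := fun i t ht => ?_
      avoid := fun z hz h j => ?_ }
  · have h3 := hla t ht
    simp only [e2Data]
    refine ⟨?_, ?_, ?_⟩ <;> fun_prop
  · have h3 := hla t ht
    fin_cases i <;> simp [e2Data] <;> refine ⟨?_, ?_, ?_⟩ <;> fun_prop
  · have h3 := analyticAt_time (hla _ hw)
    simp only [e2Data]
    fun_prop
  · fin_cases i
    · exact neg_ne_zero.2 hγ
    · exact hα
    · exact neg_ne_zero.2 hβ
  · fin_cases i <;> simp [FibreData.R, e2Data, FibreData.c, fibre, fibreConst, fibreSlope] <;> ring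
  · have h1 := h 0
    have h2 := h 1
    have h3 := h 2
    rw [(e2Data_c t).1] at h1
    rw [(e2Data_c t).2.1] at h2
    rw [(e2Data_c t).2.2] at h3
    exact mul_ne_zero (hl t ht) (mul_ne_zero (mul_ne_zero h2
      (sub_ne_zero.2 h3)) (sub_ne_zero.2 h1))
  · have h0 : t ≠ 0 := ht.1
    have h1 : t - 1 ≠ 0 := sub_ne_zero.2 ht.2
    have h2 : 1 - t ≠ 0 := sub_ne_zero.2 (Ne.symm ht.2)
    have key : ∀ c d : ℂ, c ≠ 0 → d = e2La p t * c → d ≠ 0 := fun c d hc e => by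
      rw [e]; exact mul_ne_zero (hl t ht) hc
    fin_cases i
    · refine key (t * (t - 1)) _ (mul_ne_zero h0 h1) ?_
      simp [FibreData.R, e2Data, FibreData.c, fibre, fibreConst, fibreSlope]
      ring
    · refine key t _ h0 ?_
      simp [FibreData.R, e2Data, FibreData.c, fibre, fibreConst, fibreSlope]
    · refine key (1 - t) _ h2 ?_
      simp [FibreData.R, e2Data, FibreData.c, fibre, fibreConst, fibreSlope]
      ring
  · have hf := e2_fibres (p := p) ht
    fin_cases i
    exacts [hf.1, hf.2.1, hf.2.2]
  · have hf := e2_fibres (p := p) ht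
    fin_cases i
    exacts [hf.1, hf.2.1, hf.2.2]
  · have h1 : t - 1 ≠ 0 := sub_ne_zero.2 ht.2
    have h2 : 1 - t ≠ 0 := sub_ne_zero.2 (Ne.symm ht.2)
    fin_cases i <;> simp [FibreData.q, e2Data, FibreData.c, fibre, fibreConst, fibreSlope, e2B,
      e2La] <;> field_simp <;> ring
  · have h1 : t - 1 ≠ 0 := sub_ne_zero.2 ht.2
    have h2 : 1 - t ≠ 0 := sub_ne_zero.2 (Ne.symm ht.2)
    fin_cases i <;> simp [FibreData.q, FibreData.R, e2Data, FibreData.c, fibre, fibreConst,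
      fibreSlope, e2B, e2La, finParam, Params.a] <;> field_simp <;> ring
  · have hf := e2_fibres (p := p) hz
    have h0 := h 0
    have h1 := h 1
    have h2 := h 2
    rw [← hf.1] at h0
    rw [← hf.2.1] at h1
    rw [← hf.2.2] at h2
    have e0 : (F1.chart (e2Data p).chart).par z =
        F1pt (sphereChart false z.1) (sphereChart true z.2.1) z.2.2 := F1_par_false true z
    rw [e0, e2_center, Ne, F1pt_inj]
    intro e
    fin_cases j <;> first
      | exact h0 (sphereChart_self.1 e.1)
      | exact h1 (sphereChart_self.1 e.1)
      | exact h2 (sphereChart_self.1 e.1)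
      | exact absurd ((sphereChart_ne (by decide)).1 e.1) (by change z.1 * 0 ≠ 1; simp)

theorem admissible_e2₂ (h : F1.Admissible e2K (e2A p) (e2B p)) :
    (e2Y₁ p).Admissible (e2K₂ p) e2A₂ fun _ _ => 0 :=
  Space.Admissible.exceptional (j := fun _ => 6) (s := fun _ => false) isAtlas_F1 h
    (fun _ _ _ => analyticAt_const.sub analyticAt_id) fun _ _ _ _ _ _ => rfl

theorem center_e2₂ (j : Unit) (t : ℂ) : (e2Y₁ p).center (e2K₂ p) e2A₂ (fun _ _ => 0) j t =
    excPt e2K (e2A p) (e2B p) 6 t (sphereChart false (1 - t)) :=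
  center_excIx (j := fun _ => 6) (s := fun _ => false) j t

end Second

/-! ### The lines over `f = ∞` in the second parametrisation -/

section Second

variable (p : Params)

/-- A point of the first blow up which is not the centre of the second one. -/
def e2Lift (q : (e2Y₁ p).Pt) : (e2Y₂ p).Pt := offPt (e2K₂ p) e2A₂ (fun _ _ => 0) q

/-- The point `u` of the exceptional line over `π₈`. -/
def e2Exc (t : ℂ) (u : OnePoint ℂ) : (e2Y₂ p).Pt := excPt (e2K₂ p) e2A₂ (fun _ _ => 0) () t u

/-- The position of Takano's chart `0`. -/
def e2Zero (w : C3) : (e2Y₂ p).Pt := e2Lift p ((e2Data p).zeroPt e2K (e2A p) (e2B p) w)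

/-- Takano's chart at the first line over `f = ∞`, in the coordinates `(ξ₂, υ₂)`. -/
def e2MapA (w : C3) : C3 :=
  ((w.2.2 - 1) * w.2.1 / (p.κ * (1 - w.2.1)), w.1 * (1 - w.2.2 * w.2.1) - w.2.2 * p.n, w.2.2)

/-- The inverse of `e2MapA`. -/
def e2InvA (z : C3) : C3 :=
  let y := p.κ * z.1 / (z.2.2 - 1 + p.κ * z.1)
  ((z.2.1 + z.2.2 * p.n) / (1 - z.2.2 * y), y, z.2.2)

/-- The quantity `y / υ₁` in Takano's chart at the second line over `f = ∞`. -/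
def e2Den (w : C3) : ℂ :=
  w.1 * w.2.1 * (1 - w.2.2 * w.2.1) - p.κ + (p.κ - p.n) * w.2.2 * w.2.1

/-- Takano's chart at the second line over `f = ∞`, in the coordinates `(u, v)` at the centre of
the second blow up. -/
def e2MapB (w : C3) : C3 :=
  ((w.2.2 - 1) * (w.1 * (1 - w.2.2 * w.2.1) + (p.κ - p.n) * w.2.2 - p.κ) * e2Den p w
      / (p.κ * (1 - w.2.1)), w.2.1 / e2Den p w, w.2.2)

/-- The coordinate `y` in the coordinates `(u, v)`. -/
def e2InvSnd (z : C3) : ℂ :=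
  p.κ * ((1 - z.2.2 + z.1 * z.2.1) * z.2.1) /
    (z.2.2 - 1 + p.κ * ((1 - z.2.2 + z.1 * z.2.1) * z.2.1))

/-- The inverse of `e2MapB`. -/
def e2InvB (z : C3) : C3 :=
  ((z.1 / (1 - z.2.2 + z.1 * z.2.1) - (p.κ - p.n) * z.2.2 + p.κ) / (1 - z.2.2 * e2InvSnd p z),
    e2InvSnd p z, z.2.2)

variable {p}

theorem locInv_e2MapA (hκ : p.κ ≠ 0) {x t : ℂ} (ht : t ∈ B) :
    LocInv (e2MapA p) (e2InvA p) (x, 0, t) := by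
  have h1 : t - 1 ≠ 0 := sub_ne_zero.2 ht.2
  have e : e2MapA p (x, 0, t) = (0, x - t * p.n, t) := by simp [e2MapA]
  have h3 : p.κ * (1 - ((x, 0, t) : C3).2.1) ≠ 0 := by simpa using hκ
  have h4 : (e2MapA p (x, 0, t)).2.2 - 1 + p.κ * (e2MapA p (x, 0, t)).1 ≠ 0 := by
    rw [e]; simpa using h1
  have h5 : 1 - (e2MapA p (x, 0, t)).2.2 * (p.κ * (e2MapA p (x, 0, t)).1 /
      ((e2MapA p (x, 0, t)).2.2 - 1 + p.κ * (e2MapA p (x, 0, t)).1)) ≠ 0 := by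
    rw [e]; simp
  have ha : AnalyticAt ℂ (fun z : C3 => 1 - z.2.2 * (p.κ * z.1 / (z.2.2 - 1 + p.κ * z.1)))
      (e2MapA p (x, 0, t)) := by
    fun_prop (disch := assumption)
  have hb : ContinuousAt (fun z : C3 => z.2.2 - 1 + p.κ * z.1) (e2MapA p (x, 0, t)) := by fun_prop
  refine ⟨?_, ?_, ?_, ?_⟩
  · unfold e2MapA
    fun_prop (disch := assumption)
  · unfold e2InvA
    dsimp only
    fun_prop (disch := assumption)
  · rw [e]
    simp [e2InvA]
  · filter_upwards [ha.continuousAt.eventually_ne h5, hb.eventually_ne h4,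
      isOpen_fullDom.mem_nhds (show e2MapA p (x, 0, t) ∈ fullDom by rw [e]; exact ht)]
      with z h6 h7 h8
    obtain ⟨X, Y, t⟩ := z
    have h1 : t - 1 ≠ 0 := sub_ne_zero.2 h8.2
    simp only at h6 h7
    simp only [e2MapA, e2InvA]
    obtain ⟨y, hy⟩ : ∃ y, y = p.κ * X / (t - 1 + p.κ * X) := ⟨_, rfl⟩
    have hy1 : 1 - y = (t - 1) / (t - 1 + p.κ * X) := by
      rw [hy]
      field_simp
      ring
    have hy2 : 1 - y ≠ 0 := by rw [hy1]; exact div_ne_zero h1 h7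
    rw [← hy] at h6 ⊢
    refine Prod.ext ?_ (Prod.ext ?_ rfl)
    · simp only
      rw [hy1, hy]
      field_simp
    · simp only
      field_simp
      ring

theorem locInv_e2MapB (hκ : p.κ ≠ 0) {x t : ℂ} (ht : t ∈ B) :
    LocInv (e2MapB p) (e2InvB p) (x, 0, t) := by
  have h1 : t - 1 ≠ 0 := sub_ne_zero.2 ht.2
  have h1' : 1 - t ≠ 0 := sub_ne_zero.2 (Ne.symm ht.2)
  have hD : e2Den p (x, 0, t) = -p.κ := by simp [e2Den]
  have e : e2MapB p (x, 0, t) = (-((t - 1) * (x + (p.κ - p.n) * t - p.κ)), 0, t) := by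
    simp only [e2MapB, hD]
    refine Prod.ext ?_ (Prod.ext ?_ rfl)
    · simp only
      field_simp
      ring
    · simp
  have h3 : p.κ * (1 - ((x, 0, t) : C3).2.1) ≠ 0 := by simpa using hκ
  have h4 : (e2MapB p (x, 0, t)).2.2 - 1 + p.κ * ((1 - (e2MapB p (x, 0, t)).2.2 +
      (e2MapB p (x, 0, t)).1 * (e2MapB p (x, 0, t)).2.1) * (e2MapB p (x, 0, t)).2.1) ≠ 0 := by
    rw [e]; simpa using h1
  have h5 : 1 - (e2MapB p (x, 0, t)).2.2 +
      (e2MapB p (x, 0, t)).1 * (e2MapB p (x, 0, t)).2.1 ≠ 0 := by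
    rw [e]; simpa using h1'
  have hy : AnalyticAt ℂ (e2InvSnd p) (e2MapB p (x, 0, t)) := by
    unfold e2InvSnd
    fun_prop (disch := assumption)
  have hy0 : e2InvSnd p (e2MapB p (x, 0, t)) = 0 := by rw [e]; simp [e2InvSnd]
  have h6 : 1 - (e2MapB p (x, 0, t)).2.2 * e2InvSnd p (e2MapB p (x, 0, t)) ≠ 0 := by
    rw [hy0]; simp
  have ha : ContinuousAt (fun z : C3 => 1 - z.2.2 * e2InvSnd p z) (e2MapB p (x, 0, t)) := by
    have : AnalyticAt ℂ (fun z : C3 => 1 - z.2.2 * e2InvSnd p z) (e2MapB p (x, 0, t)) := by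
      fun_prop
    exact this.continuousAt
  have hb : ContinuousAt (fun z : C3 => z.2.2 - 1 + p.κ * ((1 - z.2.2 + z.1 * z.2.1) * z.2.1))
      (e2MapB p (x, 0, t)) := by fun_prop
  have hc : ContinuousAt (fun z : C3 => 1 - z.2.2 + z.1 * z.2.1) (e2MapB p (x, 0, t)) := by
    fun_prop
  refine ⟨?_, ?_, ?_, ?_⟩
  · have hd : e2Den p (x, 0, t) ≠ 0 := by rw [hD]; exact neg_ne_zero.2 hκ
    unfold e2MapB
    unfold e2Den at hd ⊢
    fun_prop (disch := assumption)
  · unfold e2InvB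
    fun_prop (disch := assumption)
  · refine Prod.ext ?_ (Prod.ext hy0 rfl)
    simp only [e2InvB, hy0]
    rw [e]
    simp only [mul_zero, add_zero, sub_zero, div_one]
    field_simp
    ring
  · filter_upwards [ha.eventually_ne h6, hb.eventually_ne h4, hc.eventually_ne h5,
      isOpen_fullDom.mem_nhds (show e2MapB p (x, 0, t) ∈ fullDom by rw [e]; exact ht)]
      with z h6 h7 h8 h9
    obtain ⟨u, v, t⟩ := z
    have h1 : t - 1 ≠ 0 := sub_ne_zero.2 h9.2
    have hy : e2InvSnd p (u, v, t) = p.κ * ((1 - t + u * v) * v) /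
      (t - 1 + p.κ * ((1 - t + u * v) * v)) := rfl
    simp only at h6 h7 h8
    obtain ⟨U, hU⟩ : ∃ U, U = 1 - t + u * v := ⟨_, rfl⟩
    rw [← hU] at h7 h8 hy
    have hy1 : 1 - e2InvSnd p (u, v, t) = (t - 1) / (t - 1 + p.κ * (U * v)) := by
      rw [hy, eq_div_iff h7, sub_mul, div_mul_cancel₀ _ h7]
      ring
    have hy2 : 1 - e2InvSnd p (u, v, t) ≠ 0 := by rw [hy1]; exact div_ne_zero h1 h7
    have hy3 : e2InvSnd p (u, v, t) * (t - 1) = p.κ * (U * v) * (1 - e2InvSnd p (u, v, t)) := by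
      rw [hy1, hy]
      field_simp
    simp only [e2MapB, e2InvB, e2Den, ← hU]
    generalize e2InvSnd p (u, v, t) = y at *
    have hx : (u / U - (p.κ - p.n) * t + p.κ) / (1 - t * y) * (1 - t * y) =
      u / U - (p.κ - p.n) * t + p.κ := div_mul_cancel₀ _ h6
    generalize (u / U - (p.κ - p.n) * t + p.κ) / (1 - t * y) = x' at *
    have hE : x' * y * (1 - t * y) - p.κ + (p.κ - p.n) * t * y = p.κ * (1 - y) * U / (t - 1) := by
      have h2 : y * (u / U) = u * (p.κ * v * (1 - y)) / (t - 1) := by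
        field_simp
        linear_combination u * hy3
      have h3 : p.κ * (1 - y) * U / (t - 1) =
          u * (p.κ * v * (1 - y)) / (t - 1) - p.κ * (1 - y) := by
        field_simp
        linear_combination hU
      rw [h3]
      linear_combination y * hx + h2
    rw [hE, hx]
    refine Prod.ext ?_ (Prod.ext ?_ rfl)
    · simp only
      field_simp
      ring
    · simp only
      field_simp
      linear_combination hy3

theorem e2Data_gen_fst (w : C3) : ((e2Data p).gen w).1 = e2La p w.2.2 * (w.1 - 1) := by
  simp only [FibreData.gen, e2Data]
  ring

theorem e2Data_gen_snd (w : C3) : ((e2Data p).gen w).2.1 = e2La p w.2.2 * (w.1 - 1) *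
    (w.1 * (w.1 - w.2.2) * w.2.1 - ((p.α + p.n) * w.1 - p.α * w.2.2)) := by
  simp only [FibreData.gen, FibreData.q, e2Data]
  ring

theorem e2Data_gen_back_zero {x y t : ℂ} (hy : y ≠ 0) :
    ((e2Data p).gen (back p.a (Sum.inl 0) (x, y, t))).2.1 =
      e2La p t * ((1 - y) / y) * (x * (1 - t * y) - t * p.n) := by
  rw [e2Data_gen_snd]
  simp only [back, infParam, Params.a, Matrix.cons_val]
  field_simp
  ring

theorem e2Data_gen_back_one {x y t : ℂ} (hy : y ≠ 0) :
    ((e2Data p).gen (back p.a (Sum.inl 1) (x, y, t))).2.1 =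
      e2La p t * ((1 - y) / y ^ 2) * e2Den p (x, y, t) := by
  rw [e2Data_gen_snd]
  simp only [back, infParam, Params.a, Matrix.cons_val, e2Den]
  field_simp
  ring

theorem e2_back_ne {i : Fin 2} {x y t : ℂ} (hy : y ≠ 0) (h1 : 1 - y ≠ 0) (h2 : 1 - t * y ≠ 0)
    (j : Fin 3) : (back p.a (Sum.inl i) (x, y, t)).1 ≠ (e2Data p).c j t := by
  have hc := e2Data_c (p := p) t
  have e0 : (back p.a (Sum.inl i) (x, y, t)).1 = y⁻¹ := by simp [back]
  rw [e0]
  fin_cases j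
  · intro e
    have e' : y⁻¹ = t := e.trans hc.1
    exact h2 (by rw [← e', inv_mul_cancel₀ hy, sub_self])
  · exact fun e => inv_ne_zero hy (e.trans hc.2.1)
  · exact fun e => h1 (by have := e.trans hc.2.2; field_simp at this; rw [this]; ring)

end Second

/-! ### The glued surface in the second parametrisation -/

section Second

variable {p : Params}

theorem e2Lift_inj {q q' : (e2Y₁ p).Pt} : e2Lift p q = e2Lift p q' ↔ q = q' := offPt_inj

theorem e2Lift_ne_exc {q : (e2Y₁ p).Pt} {t : ℂ} {u : OnePoint ℂ} : e2Lift p q ≠ e2Exc p t u :=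
  offPt_ne_excPt

theorem e2Exc_inj {t t' : ℂ} {u u' : OnePoint ℂ} : e2Exc p t u = e2Exc p t' u' ↔ t = t' ∧ u = u' :=
  excPt_inj.trans (and_iff_right rfl)

theorem e2_par_gen {z : C3} : (F1.chart (e2Data p).chart).par z =
    F1pt (sphereChart false z.1) (sphereChart true z.2.1) z.2.2 := F1_par_false true z

/-- Patches of the first blow up away from the line over `π₇` remain patches. -/
theorem isLocalPatch_e2Lift (hv : (e2Data p).Valid p.a e2K (e2A p) (e2B p))
    {Q : Patch (e2Y₁ p).Pt} {Q' : Patch (e2Y₂ p).Pt} {w : C3} (hQ : (e2Y₁ p).IsLocalPatch Q w)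
    (hd : Q'.dom ∈ 𝓝 w) (hpar : ∀ v, Q'.par v = e2Lift p (Q.par v))
    (hw : ∀ t u, Q.par w ≠ excPt e2K (e2A p) (e2B p) 6 t u) : (e2Y₂ p).IsLocalPatch Q' w :=
  hQ.blowUp (isAtlas_F1.blowUp hv.admissible) (admissible_e2₂ hv.admissible) hd hpar
    fun j t _ => by rw [center_e2₂]; exact hw _ _

/-- The first line over `f = ∞` is the fibre `ξ₀ = ∞` of `𝔽₁` itself, without the point `υ₁ = 0`. -/
theorem isLocalPatch_e2_infA (hv : (e2Data p).Valid p.a e2K (e2A p) (e2B p)) (hκ : p.κ ≠ 0)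
    (L : Line → ℂ → ℂ → (e2Y₂ p).Pt)
    (hL : ∀ x t, L (Sum.inl 0) x t = e2Lift p (offPt e2K (e2A p) (e2B p)
      (F1pt (sphereChart true 0) (sphereChart true (x - t * p.n)) t)))
    (x t : ℂ) (ht : t ∈ B) :
    (e2Y₂ p).IsLocalPatch (placedPatch p.a (glue (e2Zero p) L) (some (Sum.inl 0))) (x, 0, t) := by
  have hX := isAtlas_F1.blowUp hv.admissible
  have hX₂ := hX.blowUp (admissible_e2₂ hv.admissible)
  have e : e2MapA p (x, 0, t) = (0, x - t * p.n, t) := by simp [e2MapA]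
  have hpar0 : ∀ Y : ℂ, ∀ t, (F1.chart (F1ix true true)).par (0, Y, t) =
      F1pt (sphereChart true 0) (sphereChart true Y) t := fun Y t => F1_par_zero true true rfl
  refine ⟨offIx (e2K₂ p) e2A₂ (fun _ _ => 0) (offIx e2K (e2A p) (e2B p) (F1ix true true)), _,
    LocEquiv.of_locInv (locInv_e2MapA hκ (x := x) ht) (fullDom_mem_nhds ht)
    ((hX₂.isOpen _).mem_nhds ?_) ?_⟩
  · rw [e]
    refine ⟨⟨ht, fun j => ?_⟩, fun j => ?_⟩
    · rw [hpar0, e2_center, Ne, F1pt_inj]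
      intro e
      fin_cases j <;> first
        | exact absurd ((sphereChart_ne (by decide)).1 e.1) (by simp)
        | exact absurd ((sphereChart_ne (by decide)).1 e.2.1)
            (by change (x - t * p.n) * 0 ≠ 1; simp)
    · rw [center_e2₂]
      exact offPt_ne_excPt
  · have hc1 : ContinuousAt (fun w : C3 => 1 - w.2.1) (x, 0, t) := by fun_prop
    have hc2 : ContinuousAt (fun w : C3 => 1 - w.2.2 * w.2.1) (x, 0, t) := by fun_prop
    filter_upwards [hc1.eventually_ne (y := 0) (by simp), hc2.eventually_ne (y := 0) (by simp),
      isOpen_fullDom.mem_nhds (x := (x, 0, t)) ht] with w h1 h2 ht'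
    obtain ⟨x, y, t⟩ := w
    have ht1 : t - 1 ≠ 0 := sub_ne_zero.2 ht'.2
    simp only at h1 h2
    change e2Lift p (offPt e2K (e2A p) (e2B p) ((F1.chart (F1ix true true)).par _)) = _
    by_cases hy : y = 0
    · subst hy
      rw [placedPatch_glue_zero rfl, hL]
      have e : e2MapA p (x, 0, t) = (0, x - t * p.n, t) := by simp [e2MapA]
      rw [e, hpar0]
    · rw [placedPatch_glue_ne hy, e2Zero,
        FibreData.Valid.zeroPt_off (w := back p.a (Sum.inl 0) (x, y, t)) (e2_back_ne hy h1 h2)]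
      have hne : (e2MapA p (x, y, t)).1 ≠ 0 :=
        div_ne_zero (mul_ne_zero ht1 hy) (mul_ne_zero hκ h1)
      rw [e2_par_gen, F1_par_true true hne]
      congr 2
      rw [F1pt_inj]
      refine ⟨(sphereChart_ne (by simp)).2 ?_, sphereChart_self.2 ?_, rfl⟩
      · rw [e2Data_gen_fst]
        simp only [back, e2MapA, e2La]
        field_simp
      · rw [e2Data_gen_back_zero hy]
        simp only [F1twist, if_true, e2MapA, e2La]
        field_simp

/-- The second line over `f = ∞` lies on the exceptional line over `π₈`. -/
theorem isLocalPatch_e2_infB (hv : (e2Data p).Valid p.a e2K (e2A p) (e2B p)) (hκ : p.κ ≠ 0)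
    (L : Line → ℂ → ℂ → (e2Y₂ p).Pt)
    (hL : ∀ x t, L (Sum.inl 1) x t = e2Exc p t (sphereChart false (e2MapB p (x, 0, t)).1))
    (x t : ℂ) (ht : t ∈ B) :
    (e2Y₂ p).IsLocalPatch (placedPatch p.a (glue (e2Zero p) L) (some (Sum.inl 1))) (x, 0, t) := by
  have hX := isAtlas_F1.blowUp hv.admissible
  have hX₂ := hX.blowUp (admissible_e2₂ hv.admissible)
  have e : e2MapB p (x, 0, t) = ((e2MapB p (x, 0, t)).1, 0, t) :=
    Prod.ext rfl (Prod.ext (by simp [e2MapB]) rfl)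
  refine ⟨excIx (e2K₂ p) e2A₂ (fun _ _ => 0) () false, _, LocEquiv.of_locInv
    (locInv_e2MapB hκ (x := x) ht) (fullDom_mem_nhds ht) ((hX₂.isOpen _).mem_nhds ?_) ?_⟩
  · rw [e]
    exact (admissible_e2₂ hv.admissible).mem_dom_exceptional ht
  · have hcD : ContinuousAt (e2Den p) (x, 0, t) := by
      unfold e2Den
      fun_prop
    have hc1 : ContinuousAt (fun w : C3 => 1 - w.2.1) (x, 0, t) := by fun_prop
    have hc2 : ContinuousAt (fun w : C3 => 1 - w.2.2 * w.2.1) (x, 0, t) := by fun_prop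
    filter_upwards [hcD.eventually_ne (y := 0) (by simpa [e2Den] using hκ),
      hc1.eventually_ne (y := 0) (by simp), hc2.eventually_ne (y := 0) (by simp),
      isOpen_fullDom.mem_nhds (x := (x, 0, t)) ht] with w hD h1 h2 ht'
    obtain ⟨x, y, t⟩ := w
    have ht1 : t - 1 ≠ 0 := sub_ne_zero.2 ht'.2
    simp only at h1 h2
    by_cases hy : y = 0
    · subst hy
      rw [blowUp_par_exc_zero (by simp [e2MapB]), placedPatch_glue_zero rfl, hL]
      rfl
    · have hv' : (e2MapB p (x, y, t)).2.1 ≠ 0 := div_ne_zero hy hD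
      rw [blowUp_par_exc_ne hv', placedPatch_glue_ne hy, e2Zero,
        FibreData.Valid.zeroPt_off (w := back p.a (Sum.inl 1) (x, y, t)) (e2_back_ne hy h1 h2),
        e2Lift]
      congr 1
      change ((e2Y₁ p).chart (excIx e2K (e2A p) (e2B p) 6 false)).par _ = _
      rw [blowUp_par_exc_ne (by simpa [blowDown] using hv'), e2_par_gen]
      congr 1
      -- the coordinates `(ξ₁, υ₁)` after both blow downs
      have hg : blowDown (e2A p 6) (e2B p 6) false (blowDown (e2A₂ ()) (fun _ => 0) false
          (e2MapB p (x, y, t))) =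
          ((t - 1) * y / (p.κ * (1 - y)), y / e2Den p (x, y, t), t) := by
        have hA : e2A p 6 t = 0 := rfl
        have hB : e2B p 6 t = 0 := rfl
        have ht2 : (e2MapB p (x, y, t)).2.2 = t := rfl
        simp only [blowDown, Bool.false_eq_true, if_false, zero_add, ht2, hA, hB]
        refine Prod.ext ?_ (Prod.ext rfl rfl)
        have hu : e2Den p (x, y, t) =
            y * (x * (1 - t * y) + (p.κ - p.n) * t - p.κ) - p.κ * (1 - y) := by
          simp only [e2Den]; ring
        simp only [e2MapB, e2A₂]
        generalize x * (1 - t * y) + (p.κ - p.n) * t - p.κ = r at *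
        generalize e2Den p (x, y, t) = D at *
        field_simp
        linear_combination -(t - 1) * hu
      rw [hg]
      have hne : (t - 1) * y / (p.κ * (1 - y)) ≠ 0 :=
        div_ne_zero (mul_ne_zero ht1 hy) (mul_ne_zero hκ h1)
      refine (F1_par_true false hne).trans ?_
      rw [F1pt_inj]
      refine ⟨(sphereChart_ne (by simp)).2 ?_, (sphereChart_ne (by simp)).2 ?_, rfl⟩
      · rw [e2Data_gen_fst]
        simp only [back, e2La]
        field_simp
      · rw [e2Data_gen_back_one hy]
        simp only [F1twist, Bool.false_eq_true, if_false, e2La]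
        generalize e2Den p (x, y, t) = D at *
        field_simp

variable (p) in
/-- The lines `y_i = 0` of Takano's charts. -/
def e2Lines : Line → ℂ → ℂ → (e2Y₂ p).Pt
  | Sum.inl 0, x, t => e2Lift p (offPt e2K (e2A p) (e2B p)
      (F1pt (sphereChart true 0) (sphereChart true (x - t * p.n)) t))
  | Sum.inl 1, x, t => e2Exc p t (sphereChart false (e2MapB p (x, 0, t)).1)
  | Sum.inr i, x, t => e2Lift p ((e2Data p).linePt p.a e2K (e2A p) (e2B p) i x t)

/-- The position of the glued surface in the blow up of the second parametrisation. -/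
def e2Place (p : Params) : ModelPt → (e2Y₂ p).Pt := glue (e2Zero p) (e2Lines p)

theorem e2MapB_line (hκ : p.κ ≠ 0) (x t : ℂ) :
    (e2MapB p (x, 0, t)).1 = -((t - 1) * (x + (p.κ - p.n) * t - p.κ)) := by
  simp only [e2MapB, e2Den]
  simp only [mul_zero, sub_zero, add_zero, zero_sub, mul_one]
  field_simp

theorem e2_zeroPt_ne (hv : (e2Data p).Valid p.a e2K (e2A p) (e2B p)) {w : C3} (hw : w ∈ fullDom)
    (t : ℂ) (u : OnePoint ℂ) : (e2Data p).zeroPt e2K (e2A p) (e2B p) w ≠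
      excPt e2K (e2A p) (e2B p) 6 t u := by
  rcases hv.zeroPt_cases hw with ⟨-, h⟩ | ⟨i, -, h⟩ <;> rw [h]
  · exact offPt_ne_excPt
  · rw [Ne, excPt_inj]
    fin_cases i <;> simp [e2Data]

theorem e2_linePt_ne (i : Fin 3) (x t t' : ℂ) (u : OnePoint ℂ) :
    (e2Data p).linePt p.a e2K (e2A p) (e2B p) i x t ≠ excPt e2K (e2A p) (e2B p) 6 t' u := by
  rw [FibreData.linePt, Ne, excPt_inj]
  fin_cases i <;> simp [e2Data]

theorem e2_zeroPt_ne_inf (hv : (e2Data p).Valid p.a e2K (e2A p) (e2B p)) {w : C3}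
    (hw : w ∈ fullDom) (y : OnePoint ℂ) (t : ℂ) : (e2Data p).zeroPt e2K (e2A p) (e2B p) w ≠
      offPt e2K (e2A p) (e2B p) (F1pt (sphereChart true 0) y t) := by
  rcases hv.zeroPt_cases hw with ⟨-, h⟩ | ⟨i, -, h⟩ <;> rw [h]
  · rw [Ne, offPt_inj, e2_par_gen, F1pt_inj]
    exact fun e => absurd ((sphereChart_ne (by decide)).1 e.1) (by simp)
  · exact fun e => offPt_ne_excPt e.symm

theorem isPlacement_e2 (hv : (e2Data p).Valid p.a e2K (e2A p) (e2B p)) (hκ : p.κ ≠ 0) :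
    (e2Y₂ p).IsPlacement p.a (e2Place p) := by
  have hX := isAtlas_F1.blowUp hv.admissible
  refine isPlacement_glue (hX.blowUp (admissible_e2₂ hv.admissible)) ?_ ?_ ?_ ?_ ?_ ?_ ?_
  · exact fun w hw w' hw' e => hv.zeroPt_injOn hw hw' (e2Lift_inj.1 e)
  · intro l l' x x' t t' ht e
    have ht1 : t - 1 ≠ 0 := sub_ne_zero.2 ht.2
    rcases l with l | l <;> rcases l' with l' | l'
    · fin_cases l <;> fin_cases l'
      · obtain ⟨-, h1, rfl⟩ := F1pt_inj.1 (offPt_inj.1 (e2Lift_inj.1 e))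
        exact ⟨rfl, sub_left_injective (sphereChart_self.1 h1), rfl⟩
      · exact absurd e e2Lift_ne_exc
      · exact absurd e.symm e2Lift_ne_exc
      · obtain ⟨rfl, h2⟩ := e2Exc_inj.1 e
        have h3 := sphereChart_self.1 h2
        rw [e2MapB_line hκ, e2MapB_line hκ] at h3
        exact ⟨rfl, by linear_combination mul_left_cancel₀ ht1 (neg_injective h3), rfl⟩
    · fin_cases l
      · exact absurd (e2Lift_inj.1 e) offPt_ne_excPt
      · exact absurd e.symm e2Lift_ne_exc
    · fin_cases l'
      · exact absurd (e2Lift_inj.1 e).symm offPt_ne_excPt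
      · exact absurd e e2Lift_ne_exc
    · obtain ⟨rfl, h2, h3⟩ := hv.linePt_inj ht (e2Lift_inj.1 e)
      exact ⟨rfl, h2, h3⟩
  · intro w hw l x t
    rcases l with l | l
    · fin_cases l
      · exact fun e => e2_zeroPt_ne_inf hv hw _ _ (e2Lift_inj.1 e)
      · exact e2Lift_ne_exc
    · exact fun e => hv.zeroPt_ne_linePt hw _ _ _ (e2Lift_inj.1 e)
  · exact fun w hw => hv.base_zeroPt hw
  · intro l x t ht
    rcases l with l | l
    · fin_cases l <;> rfl
    · rfl
  · intro w hw
    exact isLocalPatch_e2Lift hv (hv.isLocalPatch_zero hw)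
      (isOpen_fullDom.mem_nhds hw) (fun _ => rfl) fun t u => e2_zeroPt_ne hv hw t u
  · intro l x t ht
    rcases l with l | l
    · fin_cases l
      · exact isLocalPatch_e2_infA hv hκ _ (fun _ _ => rfl) x t ht
      · exact isLocalPatch_e2_infB hv hκ _ (fun _ _ => rfl) x t ht
    · refine isLocalPatch_e2Lift hv (hv.isLocalPatch_line l ht)
        (fullDom_mem_nhds ht) (fun w => ?_) fun t' u => ?_
      · by_cases hy : w.2.1 = 0
        · rw [placedPatch_glue_zero hy]
          exact congrArg (e2Lift p) (if_pos hy).symm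
        · rw [placedPatch_glue_ne hy]
          exact congrArg (e2Lift p) (if_neg hy).symm
      · have : ((e2Data p).linePatch p.a e2K (e2A p) (e2B p) l).par (x, 0, t) =
          (e2Data p).linePt p.a e2K (e2A p) (e2B p) l x t := if_pos rfl
        rw [this]
        exact e2_linePt_ne l x t t' u

end Second

/-! ### The complement of the glued surface in the second parametrisation -/

section Second

variable {p : Params}

/-- The points of the glued surface that are not on the exceptional line of the last blow up. -/
theorem e2Lift_mem_image {q : (e2Y₁ p).Pt} (hq : e2Lift p q ∈ e2Place p '' modelCarrier) :
    (∃ w ∈ fullDom, q = (e2Data p).zeroPt e2K (e2A p) (e2B p) w) ∨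
      (∃ i x t, q = (e2Data p).linePt p.a e2K (e2A p) (e2B p) i x t) ∨
      ∃ y t, q = offPt e2K (e2A p) (e2B p) (F1pt (sphereChart true 0) (sphereChart true y) t) := by
  obtain ⟨w | ⟨l | l, x, t⟩, hm, e⟩ := hq
  · exact Or.inl ⟨w, hm, (e2Lift_inj.1 e).symm⟩
  · fin_cases l
    · exact Or.inr (Or.inr ⟨_, t, (e2Lift_inj.1 e).symm⟩)
    · exact absurd e.symm e2Lift_ne_exc
  · exact Or.inr (Or.inl ⟨l, x, t, (e2Lift_inj.1 e).symm⟩)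

theorem e2Lift_off_mem_image (hv : (e2Data p).Valid p.a e2K (e2A p) (e2B p)) {q : F1.Pt}
    (hq : e2Lift p (offPt e2K (e2A p) (e2B p) q) ∈ e2Place p '' modelCarrier) :
    ∃ y t, q.2.1 = sphereChart true y ∧ q.2.2 = t ∧ (q.1 = OnePoint.infty ∨
      ∃ x : ℂ, q.1 = x ∧ t ∈ B ∧
        ∀ i, x ≠ (e2Data p).shift t + (e2Data p).scale t * (e2Data p).c i t) := by
  rcases e2Lift_mem_image hq with ⟨w, hw, e⟩ | ⟨i, x, t, e⟩ | ⟨y, t, e⟩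
  · rcases hv.zeroPt_cases hw with ⟨hf, h⟩ | ⟨i, -, h⟩ <;> rw [h] at e
    · rw [offPt_inj.1 e, e2_par_gen]
      exact ⟨_, w.2.2, rfl, rfl, Or.inr ⟨_, rfl, hw, hv.gen_fst_ne hw hf⟩⟩
    · exact absurd e offPt_ne_excPt
  · exact absurd e offPt_ne_excPt
  · rw [offPt_inj.1 e]
    exact ⟨y, t, rfl, rfl, Or.inl (by simp [F1pt, sphereChart, recip])⟩

theorem sphereChart_true_ne_zero (y : ℂ) : sphereChart true y ≠ ((0 : ℂ) : OnePoint ℂ) :=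
  fun e => absurd ((sphereChart_ne (s' := false) (by decide)).1 e) (by simp)

theorem e2D_disjoint (hv : (e2Data p).Valid p.a e2K (e2A p) (e2B p)) (hκ : p.κ ≠ 0) :
    ∀ q ∈ D₂ p, q ∉ e2Place p '' modelCarrier := by
  have hX := isAtlas_F1.blowUp hv.admissible
  have hP := isPlacement_e2 hv hκ
  have hU := hP.isChartOpen (a_sum p)
  have hU₁ := Space.IsChartOpen.of_blowUp hX hU (hP.image_subset (a_sum p))
  have off : ∀ C : Set F1.Pt, (∀ q : F1.Pt, q ∈ C → ∀ y t, q.2.1 = sphereChart true y →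
      q.2.2 = t → (q.1 = OnePoint.infty ∨ ∃ x : ℂ, q.1 = x ∧ t ∈ B ∧
        ∀ i, x ≠ (e2Data p).shift t + (e2Data p).scale t * (e2Data p).c i t) → False) →
      ∀ q ∈ proper₂₂ p (proper₂₁ p C), q ∉ e2Place p '' modelCarrier := by
    intro C hC q hq
    refine hU.disjoint_properTransform (fun q hq => hU₁.disjoint_properTransform ?_ hq) hq
    intro q hq h
    obtain ⟨y, t, h1, h2, h3⟩ := e2Lift_off_mem_image hv h
    exact hC q hq y t h1 h2 h3
  have fib : ∀ (c : ℂ → ℂ) (i : Fin 3), (∀ t ∈ B, c t = (e2Data p).shift t +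
      (e2Data p).scale t * (e2Data p).c i t) →
      ∀ q ∈ proper₂₂ p (proper₂₁ p (firstCoord fun t => ((c t : ℂ) : OnePoint ℂ))),
        q ∉ e2Place p '' modelCarrier := by
    intro c i hc
    refine off _ fun q hq y t _ ht h => ?_
    subst ht
    rcases h with h | ⟨x, h, htB, hx⟩
    · exact OnePoint.coe_ne_infty _ (hq.2.symm.trans h)
    · exact hx i ((OnePoint.coe_injective (h.symm.trans hq.2)).trans (hc _ htB))
  rintro q ((((hq | hq) | hq) | hq) | hq)
  · exact fib (fun _ => 0) 2 (fun t ht => (e2_fibres ht).2.2) q hq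
  · exact fib (fun _ => p.κ) 0 (fun t ht => (e2_fibres ht).1) q hq
  · exact fib (fun t => p.κ / (1 - t)) 1 (fun t ht => (e2_fibres ht).2.1) q hq
  · exact off _ (fun q hq y t hy _ _ => sphereChart_true_ne_zero y (hy.symm.trans hq.2)) q hq
  · refine hU.disjoint_properTransform ?_ hq
    rintro _ ⟨t, -, u, rfl⟩ h
    rcases e2Lift_mem_image h with ⟨w, hw, e⟩ | ⟨i, x, t', e⟩ | ⟨y, t', e⟩
    · exact e2_zeroPt_ne hv hw t u e.symm
    · exact e2_linePt_ne i x t' t u e.symm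
    · exact absurd e.symm offPt_ne_excPt

/-- Every point of the blow up is on one of the removed curves or in the glued surface. On each
exceptional line that is not removed, one point belongs to a removed curve: the direction of the
fibre over one of `π₁, …, π₆`, and, at `π₈`, that of the exceptional line over `π₇`. -/
theorem e2X_carrier_subset (hv : (e2Data p).Valid p.a e2K (e2A p) (e2B p)) (hκ : p.κ ≠ 0) :
    (e2Y₂ p).carrier ⊆ e2Place p '' modelCarrier ∪ D₂ p := by
  have hX := isAtlas_F1.blowUp hv.admissible
  intro q hq
  rcases blowUp_pt_cases q with ⟨q, rfl⟩ | ⟨⟨⟩, t, u, rfl⟩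
  · have hq₁ := (offPt_mem_carrier.1 hq).1
    have up₂ : ∀ C : Set (e2Y₁ p).Pt, q ∈ C → e2Lift p q ∈ proper₂₂ p C :=
      fun C hC => offPt_mem_properTransform hC hq
    rcases blowUp_pt_cases q with ⟨q, rfl⟩ | ⟨j, t, u, rfl⟩
    · have up₁ : ∀ C : Set F1.Pt, q ∈ C → e2Lift p (offPt e2K (e2A p) (e2B p) q) ∈
          proper₂₂ p (proper₂₁ p C) :=
        fun C hC => up₂ _ (offPt_mem_properTransform hC hq₁)
      obtain ⟨x, y, t⟩ := q
      have ht : t ∈ B := (offPt_mem_carrier.1 hq₁).1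
      have hf := e2_fibres (p := p) ht
      rcases exists_sphereChart y with rfl | ⟨Y, rfl⟩
      · exact Or.inr (Or.inl (Or.inr (up₁ _ ⟨ht, rfl⟩)))
      induction x with
      | infty =>
        refine Or.inl ⟨Sum.inr (Sum.inl 0, Y + t * p.n, t), ht,
          congrArg (fun q => e2Lift p (offPt e2K (e2A p) (e2B p) q)) ?_⟩
        change F1pt _ _ _ = F1pt _ _ _
        rw [F1pt_inj]
        exact ⟨by simp [sphereChart, recip], by rw [add_sub_cancel_right], rfl⟩
      | coe x =>
        by_cases h0 : x = p.κ
        · subst h0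
          exact Or.inr (Or.inl (Or.inl (Or.inl (Or.inr (up₁ _ ⟨ht, rfl⟩)))))
        by_cases h1 : x = p.κ / (1 - t)
        · subst h1
          exact Or.inr (Or.inl (Or.inl (Or.inr (up₁ _ ⟨ht, rfl⟩))))
        by_cases h2 : x = 0
        · subst h2
          exact Or.inr (Or.inl (Or.inl (Or.inl (Or.inl (up₁ _ ⟨ht, rfl⟩)))))
        obtain ⟨w, hw, -, -, e⟩ := hv.exists_zeroPt_off (z := (x, Y, t)) ht (fun i => by
          fin_cases i
          exacts [fun e => h0 (e.trans hf.1.symm), fun e => h1 (e.trans hf.2.1.symm),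
            fun e => h2 (e.trans hf.2.2.symm)])
        rw [e2_par_gen] at e
        exact Or.inl ⟨Sum.inl w, hw, congrArg (e2Lift p) e⟩
    · have ht : t ∈ B := excPt_mem_carrier.1 hq₁
      have dir : ∀ (j : Fin 7) (c : ℂ → OnePoint ℂ), e2K j = F1ix false true →
          c t = ((e2A p j t : ℂ) : OnePoint ℂ) →
          excPt e2K (e2A p) (e2B p) j t (sphereChart false 0) ∈ proper₂₁ p (firstCoord c) := by
        intro j c hk hA
        refine excPt_mem_properTransform isAtlas_F1 hv.admissible false ht
          fun v _ _ => ⟨ht, ?_⟩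
        change _ = c t
        rw [hk, hA, F1_par_false]
        simp [F1pt, blowDown, sphereChart]
      have zero : excPt e2K (e2A p) (e2B p) j t u ∈
          proper₂₁ p (firstCoord (fun _ => ((0 : ℂ) : OnePoint ℂ))) →
          e2Lift p (excPt e2K (e2A p) (e2B p) j t u) ∈ D₂ p :=
        fun h => Or.inl (Or.inl (Or.inl (Or.inl (up₂ _ h))))
      have one : excPt e2K (e2A p) (e2B p) j t u ∈
          proper₂₁ p (firstCoord (fun t => ((p.κ / (1 - t) : ℂ) : OnePoint ℂ))) →
          e2Lift p (excPt e2K (e2A p) (e2B p) j t u) ∈ D₂ p :=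
        fun h => Or.inl (Or.inl (Or.inr (up₂ _ h)))
      have two : excPt e2K (e2A p) (e2B p) j t u ∈
          proper₂₁ p (firstCoord (fun _ => ((p.κ : ℂ) : OnePoint ℂ))) →
          e2Lift p (excPt e2K (e2A p) (e2B p) j t u) ∈ D₂ p :=
        fun h => Or.inl (Or.inl (Or.inl (Or.inr (up₂ _ h))))
      have neg : ∀ i, j = (e2Data p).neg i → u = sphereChart false 0 ∨
          e2Lift p (excPt e2K (e2A p) (e2B p) j t u) ∈ e2Place p '' modelCarrier := by
        rintro i rfl
        exact (hv.exists_zeroPt_exc i ht u).imp id fun ⟨w, hw, e⟩ =>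
          ⟨Sum.inl w, hw, congrArg (e2Lift p) e⟩
      have pos : ∀ i, j = (e2Data p).pos i → u = sphereChart false 0 ∨
          e2Lift p (excPt e2K (e2A p) (e2B p) j t u) ∈ e2Place p '' modelCarrier := by
        rintro i rfl
        exact (hv.exists_linePt i ht u).imp id fun ⟨x, e⟩ =>
          ⟨Sum.inr (Sum.inr i, x, t), ht, congrArg (e2Lift p) e⟩
      fin_cases j
      · rcases neg 2 rfl with rfl | h
        exacts [Or.inr (zero (dir 0 _ rfl rfl)), Or.inl h]
      · rcases pos 2 rfl with rfl | h
        exacts [Or.inr (zero (dir 1 _ rfl rfl)), Or.inl h]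
      · rcases neg 0 rfl with rfl | h
        exacts [Or.inr (two (dir 2 _ rfl rfl)), Or.inl h]
      · rcases pos 0 rfl with rfl | h
        exacts [Or.inr (two (dir 3 _ rfl rfl)), Or.inl h]
      · rcases pos 1 rfl with rfl | h
        exacts [Or.inr (one (dir 4 _ rfl rfl)), Or.inl h]
      · rcases neg 1 rfl with rfl | h
        exacts [Or.inr (one (dir 5 _ rfl rfl)), Or.inl h]
      · exact Or.inr (Or.inr (up₂ _ ⟨t, ht, u, rfl⟩))
  · have ht : t ∈ B := excPt_mem_carrier.1 hq
    have ht1 : t - 1 ≠ 0 := sub_ne_zero.2 ht.2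
    rcases exists_sphereChart' u with rfl | ⟨U, rfl⟩
    · refine Or.inr (Or.inr (excPt_mem_properTransform hX (admissible_e2₂ hv.admissible) true ht
        fun v _ _ => ?_))
      change ((e2Y₁ p).chart (excIx e2K (e2A p) (e2B p) 6 false)).par _ ∈ _
      rw [blowUp_par_exc_zero (by simp [blowDown])]
      exact ⟨t, ht, _, rfl⟩
    · refine Or.inl ⟨Sum.inr (Sum.inl 1, -(U / (t - 1)) - (p.κ - p.n) * t + p.κ, t), ht, ?_⟩
      change e2Exc p t (sphereChart false (e2MapB p (_, 0, t)).1) = _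
      rw [e2MapB_line hκ]
      refine e2Exc_inj.2 ⟨rfl, sphereChart_self.2 ?_⟩
      field_simp
      ring

theorem isPlacement_E₂ (hv : (e2Data p).Valid p.a e2K (e2A p) (e2B p)) (hκ : p.κ ≠ 0) :
    (E₂ p).IsPlacement p.a (e2Place p) :=
  (isPlacement_e2 hv hκ).remove (a_sum p) (e2D_disjoint hv hκ) (e2X_carrier_subset hv hκ)

theorem E₂_carrier_subset (hv : (e2Data p).Valid p.a e2K (e2A p) (e2B p)) (hκ : p.κ ≠ 0) :
    (E₂ p).carrier ⊆ e2Place p '' modelCarrier :=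
  fun _ hq => (e2X_carrier_subset hv hκ hq.1).resolve_right hq.2

variable (p) in
/-- Takano's chart `0` in the coordinates `(ξ₀, υ₀)`. -/
def e2Gen (w : C3) : C3 := (((e2Data p).gen w).1, ((e2Data p).gen w).2.1⁻¹, w.2.2)

theorem e2Place_zero {w : C3} (hw : ∀ i, w.1 ≠ (e2Data p).c i w.2.2)
    (hY : ((e2Data p).gen w).2.1 ≠ 0) :
    e2Place p (Sum.inl w) = ((E₂ p).chart (aff₂ p)).par (e2Gen p w) := by
  change e2Lift p _ = e2Lift p (offPt e2K (e2A p) (e2B p) ((F1.chart (F1ix false false)).par _))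
  rw [FibreData.Valid.zeroPt_off hw, e2_par_gen, F1_par_false]
  congr 2
  rw [F1pt_inj]
  exact ⟨rfl, (sphereChart_ne (by simp)).2 (mul_inv_cancel₀ hY), rfl⟩

/-- Every point of the chart `(ξ₀, υ₀)` lies in Takano's chart `0`. -/
theorem exists_of_mem_aff₂ (hv : (e2Data p).Valid p.a e2K (e2A p) (e2B p)) {z : C3}
    (hz : z ∈ ((E₂ p).chart (aff₂ p)).dom) :
    ∃ w ∈ fullDom, (∀ i, w.1 ≠ (e2Data p).c i w.2.2) ∧ ((e2Data p).gen w).2.1 ≠ 0 ∧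
      e2Gen p w = z := by
  have ht : z ∈ fullDom := hz.1.1.1
  have hm := ((((isAtlas_F1.blowUp hv.admissible).blowUp
    (admissible_e2₂ hv.admissible)).isPatch _).mapsTo hz.1)
  have hm₁ := (offPt_mem_carrier.1 hm).1
  have up : ∀ C : Set F1.Pt, (F1.chart (F1ix false false)).par z ∈ C →
      ((E₂ p).chart (aff₂ p)).par z ∈ proper₂₂ p (proper₂₁ p C) :=
    fun c hc => offPt_mem_properTransform (offPt_mem_properTransform hc hm₁) hm
  have hf := e2_fibres (p := p) ht
  have hy : z.2.1 ≠ 0 := fun e => hz.2 (Or.inl (Or.inr (up _ ⟨ht, congrArg _ e⟩)))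
  obtain ⟨w, hw, h1, h2, -⟩ := hv.exists_zeroPt_off (z := (z.1, z.2.1⁻¹, z.2.2)) ht fun i e => by
    refine hz.2 ?_
    fin_cases i
    · exact Or.inl (Or.inl (Or.inl (Or.inr
        (up _ ⟨ht, congrArg ((↑) : ℂ → OnePoint ℂ) (e.trans hf.1.symm)⟩))))
    · exact Or.inl (Or.inl (Or.inr
        (up _ ⟨ht, congrArg ((↑) : ℂ → OnePoint ℂ) (e.trans hf.2.1.symm)⟩)))
    · exact Or.inl (Or.inl (Or.inl (Or.inl
        (up _ ⟨ht, congrArg ((↑) : ℂ → OnePoint ℂ) (e.trans hf.2.2.symm)⟩))))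
  refine ⟨w, hw, h1, by rw [h2]; exact inv_ne_zero hy, ?_⟩
  have h3 : ((e2Data p).gen w).2.2 = z.2.2 := by rw [h2]
  change w.2.2 = z.2.2 at h3
  rw [e2Gen, h2, h3, inv_inv]

theorem e2_ne {w : C3} (hw : ∀ i, w.1 ≠ (e2Data p).c i w.2.2) :
    w.1 ≠ 0 ∧ w.1 - 1 ≠ 0 ∧ w.1 - w.2.2 ≠ 0 := by
  have hc := e2Data_c (p := p) w.2.2
  refine ⟨fun e => hw 1 (e.trans hc.2.1.symm), sub_ne_zero.2 fun e => hw 2 (e.trans hc.2.2.symm),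
    sub_ne_zero.2 fun e => hw 0 (e.trans hc.1.symm)⟩

end Second

/-! ### The system in the second parametrisation -/

section Second

variable {p : Params}

/-- The change of coordinates `(f, y₀) ↦ (ξ₀, υ₀)` is inverse to the map `(ξ₀, υ₀) ↦ (f, g)`. -/
theorem ident₂_gen (hκ : p.κ ≠ 0) {w : C3} (ht : w ∈ fullDom)
    (hw : ∀ i, w.1 ≠ (e2Data p).c i w.2.2) (hY : ((e2Data p).gen w).2.1 ≠ 0) :
    ident₂ p (e2Gen p w) = (w.1, w.1 * w.2.1, w.2.2) := by
  obtain ⟨h0, h1, h2⟩ := e2_ne hw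
  have ht1 : w.2.2 - 1 ≠ 0 := sub_ne_zero.2 ht.2
  rw [e2Data_gen_snd] at hY
  simp only [ident₂, e2Gen, e2Data_gen_fst, e2Data_gen_snd]
  obtain ⟨f, y, t⟩ := w
  simp only at *
  obtain ⟨W, hW⟩ : ∃ W, W = f * (f - t) * y - ((p.α + p.n) * f - p.α * t) := ⟨_, rfl⟩
  rw [← hW] at hY ⊢
  have hW0 : W ≠ 0 := right_ne_zero_of_mul hY
  have e : e2La p t * (f - 1) - p.κ = p.κ * (f - t) / (t - 1) := by
    rw [e2La]
    field_simp
    ring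
  have e' : e2La p t * (f - 1) * (t - 1) = p.κ * (f - 1) := by
    rw [e2La]
    field_simp
  refine Prod.ext ?_ (Prod.ext ?_ rfl)
  · simp only
    rw [mul_comm (t - 1), e']
    field_simp
    ring
  · simp only
    rw [e, e', e2La]
    field_simp
    rw [hW]
    ring

/-- The polynomial `υ₀⁻² η` in terms of `f` and `W`, up to the factor `κ⁴ (f - 1) / (t - 1)³`, where
`ξ₀ = κ (f - 1) / (t - 1)` and `υ₀⁻¹ = ξ₀ W`. -/
def etaRed (α β γ n κ f W t : ℂ) : ℂ :=
  (f - 1) * W ^ 2 * ((t - 1) + 2 * (t - 2) * (f - 1) - 3 * (f - 1) ^ 2)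
  - n * t * (γ + n) * f ^ 2 * (f - 1) * (t - 1)
  + W * ((f - 1) ^ 3 * (-2 * (κ + β) + t * (2 * α + 2 * β + 1) - κ * (f - 1))
    - (f - 1) ^ 2 * (5 * β + κ + t * (α * (t - 2) + β * (t - 6) - 1))
    - 2 * β * (t - 2) * (t - 1) * (f - 1) - β * (t - 1) ^ 2)

theorem eta_eq_etaRed (α β γ n κ W : ℂ) {f t : ℂ} (hκ : κ ≠ 0) (hf : f - 1 ≠ 0) (hW : W ≠ 0)
    (ht : t - 1 ≠ 0) :
    eta α β γ n κ (κ * (f - 1) * (t - 1)⁻¹) (κ * (f - 1) * W * (t - 1)⁻¹)⁻¹ t =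
      κ ^ 2 * etaRed α β γ n κ f W t / ((t - 1) * (f - 1) * W ^ 2) := by
  have e : κ + (t - 1) * (κ * (f - 1) * (t - 1)⁻¹) = κ * f := by
    field_simp
    ring
  simp only [eta, etaRed, e]
  field_simp
  ring

set_option maxHeartbeats 1000000 in
/-- The equation for `υ₀'`, with denominators cleared: `N₁` and `N₂` are the numerators of the
system in Takano's chart `0`, and the left hand side is a multiple of the derivative of `υ₀⁻¹ = κ (f
- 1) W / (t - 1)` along that system. -/
theorem etaRed_eq (α β γ n κ f y t W N₁ N₂ : ℂ) (hκ : κ = α + β + γ + 2 * n + 1)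
    (hW : W = f * (f - t) * y - ((α + n) * f - α * t))
    (hN₁ : N₁ = 2 * f * (f - 1) * (f - t) * y + (f ^ 2 * (κ + 2 * (-n - α)) + f * t * (-β + α)
      - f * (κ + 2 * (-n - α) + -β) - t * α))
    (hN₂ : N₂ = -((3 * f ^ 2 - 2 * (1 + t) * f + t) * y ^ 2 + (-n - α) * (κ + (-n - α))
          + (2 * f * (κ + 2 * (-n - α)) + t * (-β + α) - (κ + 2 * (-n - α) + -β)) * y)) :
    f * (f - t) * (N₁ * W + (f - 1) * (((2 * f - t) * y - (α + n)) * N₁ + f * (f - t) * N₂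
      + t * (t - 1) * (α - f * y)) - t * (f - 1) * W) = -etaRed α β γ n κ f W t := by
  subst hW hN₁ hN₂ hκ
  simp only [etaRed]
  ring

end Second

section Second

variable {p : Params}

theorem isAffineForm_E₂ (hv : (e2Data p).Valid p.a e2K (e2A p) (e2B p)) (hκ : p.κ ≠ 0) :
    IsAffineForm (E₂ p) p.a (e2Place p) (aff₂ p) (system₂ p) (area₂ p) := by
  intro z hz
  obtain ⟨⟨f, y, t⟩, ht', hw, hY, rfl⟩ := exists_of_mem_aff₂ hv hz
  have ht : t ∈ B := ht'
  have ht0 : t ≠ 0 := ht.1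
  have ht1 : t - 1 ≠ 0 := sub_ne_zero.2 ht.2
  obtain ⟨h0, h1, h2⟩ := e2_ne hw
  simp only at h0 h1 h2
  obtain ⟨W, hW⟩ : ∃ W, W = f * (f - t) * y - ((p.α + p.n) * f - p.α * t) := ⟨_, rfl⟩
  have hW0 : W ≠ 0 := by
    rw [e2Data_gen_snd] at hY
    rw [hW]
    exact right_ne_zero_of_mul hY
  have h3 : p.κ * (f - 1) * W * (t - 1)⁻¹ ≠ 0 :=
    mul_ne_zero (mul_ne_zero (mul_ne_zero hκ h1) hW0) (inv_ne_zero ht1)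
  have hgen : e2Gen p = fun w : C3 => (p.κ * (w.1 - 1) * (w.2.2 - 1)⁻¹,
      (p.κ * (w.1 - 1) * (w.1 * (w.1 - w.2.2) * w.2.1 - ((p.α + p.n) * w.1 - p.α * w.2.2))
        * (w.2.2 - 1)⁻¹)⁻¹, w.2.2) := by
    funext w
    refine Prod.ext ?_ (Prod.ext (congrArg Inv.inv ?_) rfl)
    · simp only [e2Gen, e2Data_gen_fst, e2La]; ring
    · simp only [e2Data_gen_snd, e2La]; ring
  have hf := hasFDerivAt_fst (f, y, t)
  have hy := hasFDerivAt_snd (f, y, t)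
  have htt := hasFDerivAt_time (f, y, t)
  have hx1 := hf.sub_const 1
  have hs1 := htt.sub_const 1
  have hi := hasFDerivAt_inv_comp hs1 ht1
  have hM := ((hf.mul (hf.sub htt)).mul hy).sub
    ((hf.const_mul (p.α + p.n)).sub (htt.const_mul p.α))
  have hYd := ((hx1.const_mul p.κ).mul hM).mul hi
  have h3' : p.κ * (f - 1) * (f * (f - t) * y - ((p.α + p.n) * f - p.α * t)) * (t - 1)⁻¹ ≠ 0 := by
    rwa [← hW]
  have hd : HasFDerivAt (fun w : C3 => ((p.κ * (w.1 - 1) * (w.2.2 - 1)⁻¹,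
      (p.κ * (w.1 - 1) * (w.1 * (w.1 - w.2.2) * w.2.1 - ((p.α + p.n) * w.1 - p.α * w.2.2))
        * (w.2.2 - 1)⁻¹)⁻¹, w.2.2) : C3)) _ (f, y, t) :=
    ((hx1.const_mul p.κ).mul hi).prodMk ((hasFDerivAt_inv_comp hYd h3').prodMk htt)
  have ha := (hv.locInv_gen ht hw).analytic
  have hYc : AnalyticAt ℂ (fun w => ((e2Data p).gen w).2.1) (f, y, t) :=
    analyticAt_fst.fun_comp (analyticAt_snd.fun_comp ha)
  have e1 : p.κ * (f - 1) * (t - 1)⁻¹ - p.κ = p.κ * (f - t) / (t - 1) := by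
    field_simp
    ring
  have e2 : p.κ - p.κ * (f - 1) * (t - 1)⁻¹ = -(p.κ * (f - t) / (t - 1)) := by
    rw [← e1]; ring
  have e3 : p.κ + (t - 1) * (p.κ * (f - 1) * (t - 1)⁻¹) = p.κ * f := by
    field_simp
    ring
  have e3' : (t - 1) * (p.κ * (f - 1) * (t - 1)⁻¹) + p.κ = p.κ * f := by
    rw [← e3, add_comm]
  have e4 : (1 - t) * (p.κ * (f - 1) * (t - 1)⁻¹) - p.κ = -(p.κ * f) := by
    rw [← e3]; ring
  refine ⟨(f, y, t), ht, e2Gen p, rfl, (analyticAt_fst.fun_comp ha).prod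
    ((hYc.inv hY).prod (analyticAt_snd.fun_comp analyticAt_snd)), ?_, ?_, ?_⟩
  · filter_upwards [FibreData.Valid.eventually_ne (D := e2Data p) (w := (f, y, t)) (fun _ => True)
      fun i _ => hw i, hYc.continuousAt.eventually_ne hY] with w' h h'
    exact (e2Place_zero (fun i => h i trivial) h').symm
  · rw [hgen, relJac, hd.fderiv]
    simp only [area₂, ← hW, e1, e4]
    simp [dx, dy, dt, ← hW]
    field_simp
  · obtain ⟨N₁, hN₁⟩ : ∃ N, N = 2 * f * (f - 1) * (f - t) * y + (f ^ 2 * (p.κ + 2 * (-p.n - p.α))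
        + f * t * (-p.β + p.α) - f * (p.κ + 2 * (-p.n - p.α) + -p.β) - t * p.α) := ⟨_, rfl⟩
    obtain ⟨N₂, hN₂⟩ : ∃ N, N = -((3 * f ^ 2 - 2 * (1 + t) * f + t) * y ^ 2
        + (-p.n - p.α) * (p.κ + (-p.n - p.α)) + (2 * f * (p.κ + 2 * (-p.n - p.α))
        + t * (-p.β + p.α) - (p.κ + 2 * (-p.n - p.α) + -p.β)) * y) := ⟨_, rfl⟩
    have key := etaRed_eq p.α p.β p.γ p.n p.κ f y t W N₁ N₂ rfl hW hN₁ hN₂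
    have hH : hamSystem (knyH₀ p.a) (f, y, t) = (N₁ / (t * (t - 1)), N₂ / (t * (t - 1)), 1) := by
      rw [hamSystem_knyH₀ p.a ht, hN₁, hN₂]
      rfl
    rw [hH, hgen, hd.fderiv]
    simp only [system₂, ← hW, eta_eq_etaRed _ _ _ _ _ _ hκ h1 hW0 ht1, e2, e3, e3']
    refine Prod.ext ?_ (Prod.ext ?_ ?_)
    · simp [dx, dt, dy]
      -- the equation for `ξ₀'`
      have : N₁ - t * (f - 1) = f * (p.κ * (f - 1) - p.β * (t - 1)) - t * (f - 1) * (p.α + 1)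
          + 2 * (f - 1) * W := by
        rw [hN₁, hW, Params.κ]
        ring
      obtain rfl := eq_add_of_sub_eq this
      field_simp
      ring
    · simp [dx, dt, dy, ← hW]
      generalize etaRed p.α p.β p.γ p.n p.κ f W t = P at *
      obtain rfl : P = -_ := neg_eq_iff_eq_neg.1 key.symm
      field_simp
      ring
    · simp [dx, dt, dy]

end Second

theorem pullsBackAlong_E₂ {p : Params} (hα : p.α ≠ 0) (hβ : p.β ≠ 0) (hγ : p.γ ≠ 0)
    (hκ : p.κ ≠ 0) :
    PullsBackAlong (E₂ p) (knyE p.a) (aff₂ p) (knyAff p.a) (ident₂ p) (system₂ p) (area₂ p)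
      (fun i => placedPatch p.a (knyPlace p.a) (takanoIx i)) (fun i => modelHam p.a (takanoIx i))
      (fun k z => areaOf ((knyE p.a).hamTwoForm
        (fun i => placedPatch p.a (knyPlace p.a) (takanoIx i))
        (fun i => modelHam p.a (takanoIx i)) k z))
      ((knyE p.a).hamTwoForm (fun i => placedPatch p.a (knyPlace p.a) (takanoIx i))
        fun i => modelHam p.a (takanoIx i))
      (fun k z => fieldOf ((knyE p.a).hamTwoForm
        (fun i => placedPatch p.a (knyPlace p.a) (takanoIx i))
        (fun i => modelHam p.a (takanoIx i)) k z)) := by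
  obtain ⟨h0, h1, h3, h4⟩ := a_ne_zero hα hβ hγ hκ
  have hv := valid_e2 hα hβ hγ hκ
  refine (isPlacement_E₂ hv hκ).pullsBackAlong (isPlacement_knyE h0 h1 h3 h4 (a_sum p)) (a_sum p)
    (E₂_carrier_subset hv hκ) (knyE_carrier_subset h1 h4) (isAffineForm_E₂ hv hκ) ?_
    takanoIx_surjective
  intro z hz
  obtain ⟨w, ht, hw, hY, rfl⟩ := exists_of_mem_aff₂ hv hz
  exact ⟨w, ht, e2Place_zero hw hY,
    ident_mem_knyAff hα hβ hγ hκ ht (e2_ne hw).1 (ident₂_gen hκ ht hw hY)⟩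

end PVI

end

open PVI in
theorem mainTheorem6 (p : PVI.Params) (hα : p.α ≠ 0) (hβ : p.β ≠ 0) (hγ : p.γ ≠ 0)
    (hκ : p.κ ≠ 0) :
    ∃ (τ : Fin 6 → Patch (knyE p.a).Pt) (H : Fin 6 → C3 → ℂ)
      (ω : (knyE p.a).Ix → C3 → ℂ) (Ω : (knyE p.a).Ix → C3 → Bil)
      (V : (knyE p.a).Ix → C3 → C3),
      -- the patches `U_i`, each a copy of `ℂ² × B`, carry Takano's coordinates
      (∀ i, (τ i).dom = {w | w.2.2 ∈ B}) ∧
      (∀ i, ∀ z ∈ ((knyE p.a).chart (knyAff p.a)).dom, (3 ≤ i → z.2.1 ≠ 0) →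
        (τ i).par (takano p.a i z) = ((knyE p.a).chart (knyAff p.a)).par z) ∧
      -- the symplectic atlas and global Hamiltonian structure on `E^KNY`
      (∀ z ∈ ((knyE p.a).chart (knyAff p.a)).dom, ω (knyAff p.a) z = 1 / z.1) ∧
      (∀ z ∈ ((knyE p.a).chart (knyAff p.a)).dom, V (knyAff p.a) z = knySystem p.a z) ∧
      (∀ w ∈ (τ 0).dom, H 0 w = knyH₀ p.a w) ∧
      (knyE p.a).IsSymplecticAtlas τ ω ∧
      (knyE p.a).IsGlobalHamiltonianStructure τ V H Ω ∧
      -- the pullbacks to the spaces of the two parametrisations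
      PullsBackAlong (E₁ p) (knyE p.a) (aff₁ p) (knyAff p.a) (ident₁ p) (system₁ p) (area₁ p)
        τ H ω Ω V ∧
      PullsBackAlong (E₂ p) (knyE p.a) (aff₂ p) (knyAff p.a) (ident₂ p) (system₂ p) (area₂ p)
        τ H ω Ω V := by
  obtain ⟨h0, h1, h3, h4⟩ := a_ne_zero hα hβ hγ hκ
  have hP := isPlacement_knyE h0 h1 h3 h4 (a_sum p)
  have hH := hP.isHamAtlas (a_sum p) (knyE_carrier_subset h1 h4) takanoIx_surjective
    (P := fun i => placedPatch p.a (knyPlace p.a) (takanoIx i)) (fun _ => rfl) fun _ _ _ => rfl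
  have hA := isAffineForm_kny h0 h1 h3 h4 (a_sum p)
  refine ⟨_, _, _, _, _, fun _ => rfl, fun i z hz hi => ?_,
    fun z hz => (hA.eq (fun _ => rfl) (fun _ _ _ => rfl) hH (i := 0) rfl hz).1,
    fun z hz => (hA.eq (fun _ => rfl) (fun _ _ _ => rfl) hH (i := 0) rfl hz).2,
    fun _ _ => rfl, hH.isSymplecticAtlas, hH.isGlobalHamiltonianStructure,
    pullsBackAlong_E₁ hα hβ hγ hκ, pullsBackAlong_E₂ hα hβ hγ hκ⟩
  obtain ⟨ht, hz⟩ := (mem_knyAff_dom h0 h1 h3 h4 (a_sum p)).1 hz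
  have hp := knyPlace_zero (a := p.a) (w := (z.1, z.2.1 / z.1, z.2.2)) hz
  simp only [mul_div_cancel₀ _ hz] at hp
  exact (congrArg (knyPlace p.a) (modelPatch_takano i hz hi)).trans hp
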